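/- Let $\mathbb T^3=\mathbb R^3/2\pi\mathbb Z^3$ and $\nu>0$. For $s\ge 0$ let $H^s=H^s(\mathbb T^3;\mathbb R^3)$ be the space of $f\in L^2(\mathbb T^3;\mathbb R^3)$ whose Fourier coefficients $\hat f_k$ satisfy $\|f\|_s^2:=(2\pi)^3\sum_{k\in\mathbb Z^3}|k|^{2s}|\hat f_k|^2<\infty$, with norm $(\|f\|_{L^2}^2+\|f\|_s^2)^{1/2}$ up to equivalence, and let $H^{-s}$ be its dual. Consider the vector-valued diffusive Burgers equations $$u_t+(u\cdot\nabla)u-\nu\Delta u=0\qquad\text{on }\mathbb T^3.\tag{1}$$ For $T>0$, a strong solution of (1) on $[0,T]$ is a function $u\in C^0([0,T];H^{1/2})\cap L^2(0,T;H^{3/2})$ with weak time derivative $u_t\in L^2(0,T;H^{-1/2})$ such that for every $\phi\in C^\infty(\mathbb T^3;\mathbb R^3)$ $$\langle u_t,\phi\rangle+((u\cdot\nabla)u,\phi)_{L^2}+\nu(\nabla u,\nabla\phi)_{L^2}=0\qquad\text{for almost every }t\in[0,T],$$ where $\langle\cdot,\cdot\rangle$ is the duality pairing of $H^{-1/2}$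 with $H^{1/2}$. A global strong solution is a function $u:[0,\infty)\to H^{1/2}$ that is a strong solution on $[0,T]$ for every $T>0$; in particular $u\in C^0([0,\infty);H^{1/2})$, and $u\in L^2(0,T;H^{3/2})$ for every $T>0$. **Theorem.** For every $u_0\in H^{1/2}$ there exists a unique global strong solution $u$ of (1) with $u(0)=u_0$. It satisfies $\int_0^\infty\|u(t)\|_{3/2}^2\,dt<\infty$. Moreover, after the initial time (and after modification on null sets of $\mathbb T^3$), $u\in C^1((0,\infty);C^0(\mathbb T^3))\cap C^0((0,\infty);C^2(\mathbb T^3))$, and $u$ is a classical solution: (1) holds at every point of $(0,\infty)\times\mathbb T^3$. -/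

import Mathlib

open MeasureTheory Set Filter Topology
open scoped ENNReal ContDiff

noncomputable section

namespace Burgers

instance factTwoPiPos : Fact ((0 : ℝ) < 2 * Real.pi) := ⟨Real.two_pi_pos⟩

/-- The torus `𝕋³ = ℝ³ / 2πℤ³`, with Lebesgue measure of total mass `(2π)³`. -/
abbrev Torus : Type := Fin 3 → AddCircle (2 * Real.pi)

/-- Euclidean three-space, the space of values of the velocity fields. -/
abbrev E3 : Type := EuclideanSpace ℝ (Fin 3)

/-- `L²(𝕋³; ℝ³)`. -/
abbrev L2Field : Type := Lp E3 2 (volume : Measure Torus)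

/-- The value space of Fourier coefficients. -/
abbrev C3 : Type := EuclideanSpace ℂ (Fin 3)

/-- The exponential `x ↦ exp (i k·x)` on the torus. -/
def expMode (k : Fin 3 → ℤ) (x : Torus) : ℂ := ∏ j, fourier (k j) (x j)

/-- The `k`-th Fourier coefficient `f̂_k = (2π)⁻³ ∫ f(x) exp (-i k·x) dx` of a vector field. -/
def fourierCoef (f : L2Field) (k : Fin 3 → ℤ) : C3 :=
  WithLp.toLp 2 fun i =>
    (((2 * Real.pi) ^ 3 : ℝ) : ℂ)⁻¹ * ∫ x : Torus, expMode (-k) x * ((f x i : ℝ) : ℂ)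

/-- The Euclidean length `|k|` of a wave vector. -/
def modeNorm (k : Fin 3 → ℤ) : ℝ := ‖(WithLp.toLp 2 fun i => (k i : ℝ) : E3)‖

/-- The Fourier coefficients `|k|ˢ f̂_k` of `Λˢ f`. -/
def lambdaCoef (s : ℝ) (f : L2Field) (k : Fin 3 → ℤ) : C3 := modeNorm k ^ s • fourierCoef f k

lemma continuous_expMode (k : Fin 3 → ℤ) : Continuous (expMode k) := by
  unfold expMode
  fun_prop

lemma norm_expMode (k : Fin 3 → ℤ) (x : Torus) : ‖expMode k x‖ = 1 := by
  simp only [expMode, norm_prod, fourier_apply, Circle.norm_coe, Finset.prod_const_one]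

lemma integrable_expMode_mul (f : L2Field) (k : Fin 3 → ℤ) (i : Fin 3) :
    Integrable (fun x : Torus => expMode k x * ((f x i : ℝ) : ℂ)) := by
  have h1 : Integrable (fun x : Torus => f x) := (Lp.memLp f).integrable (by norm_num)
  have h2 : Integrable (fun x : Torus => (f x i : ℝ)) :=
    (EuclideanSpace.proj (𝕜 := ℝ) i).integrable_comp h1
  exact h2.ofReal.bdd_mul (c := 1) (continuous_expMode k).aestronglyMeasurable
    (Eventually.of_forall fun x => (norm_expMode k x).le)

lemma fourierCoef_add (f g : L2Field) (k : Fin 3 → ℤ) :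
    fourierCoef (f + g) k = fourierCoef f k + fourierCoef g k := by
  ext i
  simp only [fourierCoef, PiLp.add_apply]
  rw [← mul_add, ← integral_add (integrable_expMode_mul f _ i) (integrable_expMode_mul g _ i)]
  congr 1
  apply integral_congr_ae
  filter_upwards [Lp.coeFn_add f g] with x hx
  rw [hx]
  simp [mul_add]

lemma fourierCoef_smul (c : ℝ) (f : L2Field) (k : Fin 3 → ℤ) :
    fourierCoef (c • f) k = c • fourierCoef f k := by
  ext i
  simp only [fourierCoef, PiLp.smul_apply]
  rw [Complex.real_smul, mul_left_comm, ← integral_const_mul (c : ℂ)]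
  refine congrArg _ (integral_congr_ae ?_)
  filter_upwards [Lp.coeFn_smul c f] with x hx
  rw [hx]
  simp only [Pi.smul_apply, PiLp.smul_apply, smul_eq_mul, Complex.ofReal_mul]
  ring

lemma lambdaCoef_add (s : ℝ) (f g : L2Field) :
    lambdaCoef s (f + g) = lambdaCoef s f + lambdaCoef s g := by
  funext k
  simp [lambdaCoef, fourierCoef_add]

lemma lambdaCoef_smul (s c : ℝ) (f : L2Field) :
    lambdaCoef s (c • f) = c • lambdaCoef s f := by
  funext k
  simp [lambdaCoef, fourierCoef_smul, smul_comm c]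

/-- The fields `f ∈ L²` with `∑ |k|²ˢ |f̂_k|² < ∞`. -/
def sobolevSubmodule (s : ℝ) : Submodule ℝ L2Field where
  carrier := {f | Memℓp (lambdaCoef s f) 2}
  zero_mem' := by
    have h : lambdaCoef s (0 : L2Field) = 0 := by
      simpa using lambdaCoef_smul s 0 (0 : L2Field)
    simpa [h] using (zero_memℓp : Memℓp (0 : (k : Fin 3 → ℤ) → C3) 2)
  add_mem' := by
    intro f g hf hg
    simp only [mem_ofPred_eq] at *
    rw [lambdaCoef_add]
    exact hf.add hg
  smul_mem' := by
    intro c f hf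
    simp only [mem_ofPred_eq] at *
    rw [lambdaCoef_smul]
    exact hf.const_smul c

/-- The Sobolev space `Hˢ(𝕋³; ℝ³)`, `s ≥ 0`. -/
def Sobolev (s : ℝ) : Type := ↥(sobolevSubmodule s)

namespace Sobolev

instance (s : ℝ) : AddCommGroup (Sobolev s) :=
  inferInstanceAs (AddCommGroup ↥(sobolevSubmodule s))

instance (s : ℝ) : Module ℝ (Sobolev s) :=
  inferInstanceAs (Module ℝ ↥(sobolevSubmodule s))

/-- The inclusion of `Hˢ` in `L²`. -/
def toL2 {s : ℝ} : Sobolev s →ₗ[ℝ] L2Field := (sobolevSubmodule s).subtype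

/-- The linear map `f ↦ (f, Λˢ f)`, with `Λˢ f` given by its Fourier coefficients. -/
def graphMap (s : ℝ) :
    Sobolev s →ₗ[ℝ] WithLp 2 (L2Field × lp (fun _ : Fin 3 → ℤ => C3) 2) where
  toFun f := WithLp.toLp 2 (toL2 f, ⟨lambdaCoef s (toL2 f), f.2⟩)
  map_add' f g := by
    apply (WithLp.ofLp_injective 2)
    refine Prod.ext (by simp) (Subtype.ext ?_)
    exact (congrArg (lambdaCoef s) (map_add toL2 f g)).trans (lambdaCoef_add s _ _)
  map_smul' c f := by
    apply (WithLp.ofLp_injective 2)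
    refine Prod.ext (by simp) (Subtype.ext ?_)
    exact (congrArg (lambdaCoef s) (map_smul toL2 c f)).trans (lambdaCoef_smul s c _)

lemma graphMap_injective (s : ℝ) : Function.Injective (graphMap s) := by
  intro f g h
  have h1 : toL2 f = toL2 g := congrArg (fun p => (WithLp.ofLp p).1) h
  exact Subtype.ext h1

/-- The norm `‖f‖² = ‖f‖²_{L²} + ∑ |k|²ˢ |f̂_k|²`. -/
instance (s : ℝ) : NormedAddCommGroup (Sobolev s) :=
  NormedAddCommGroup.induced _ _ (graphMap s) (graphMap_injective s)

instance (s : ℝ) : NormedSpace ℝ (Sobolev s) :=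
  NormedSpace.induced ℝ (Sobolev s) _ (graphMap s)

end Sobolev

/-- The dual `H⁻ˢ` of `Hˢ`. -/
abbrev SobolevDual (s : ℝ) : Type := StrongDual ℝ (Sobolev s)

/-- The square `∑ |k|²ˢ |f̂_k|²` of the homogeneous seminorm, up to the factor `(2π)³` in
`‖Λˢ f‖²_{L²}`, as an extended real. -/
def seminormSq (s : ℝ) (f : L2Field) : ℝ≥0∞ := ∑' k, ‖lambdaCoef s f k‖ₑ ^ 2

/-- The projection `ℝ³ → 𝕋³`. -/
def proj (y : E3) : Torus := fun i => (y i : AddCircle (2 * Real.pi))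

/-- The periodic function on `ℝ³` which a function on the torus defines. -/
def lift (f : Torus → E3) (y : E3) : E3 := f (proj y)

/-- The classical partial derivative `∂_j f` of a field on the torus. -/
def partialDeriv (j : Fin 3) (f : Torus → E3) (x : Torus) : E3 :=
  deriv (fun h : ℝ => f (x + Pi.single j (h : AddCircle (2 * Real.pi)))) 0

/-- `φ ∈ C^∞(𝕋³; ℝ³)`. -/
def IsSmooth (φ : Torus → E3) : Prop := ContDiff ℝ ∞ (lift φ)

/-- `g ∈ L²` is the weak partial derivative `∂_j f` of `f ∈ L²`. -/
def HasWeakPartial (j : Fin 3) (f g : L2Field) : Prop :=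
  ∀ φ : Torus → E3, IsSmooth φ →
    ∫ x, inner ℝ (f x) (partialDeriv j φ x) = -∫ x, inner ℝ (g x) (φ x)

/-- `u ∈ L²(0, T; Hˢ)` for a curve `u` in `L²`. -/
def MemL2Sobolev (s T : ℝ) (u : ℝ → L2Field) : Prop :=
  ∃ v : ℝ → Sobolev s, MemLp v 2 (volume.restrict (Ioo 0 T)) ∧
    ∀ᵐ t ∂(volume.restrict (Ioo 0 T)), (v t).toL2 = u t

/-- `g` is the weak (distributional) derivative in time of `u` on `(0, T)`, with values in the
dual of `Hˢ`; here `L²` is embedded in the dual by the `L²` inner product. -/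
def HasWeakTimeDeriv (s T : ℝ) (u : ℝ → L2Field) (g : ℝ → SobolevDual s) : Prop :=
  ∀ ψ : ℝ → ℝ, ContDiff ℝ ∞ ψ → HasCompactSupport ψ → tsupport ψ ⊆ Ioo 0 T →
    ∀ φ : Sobolev s,
      ∫ t in Ioo 0 T, deriv ψ t * inner ℝ (u t) φ.toL2 = -∫ t in Ioo 0 T, ψ t * g t φ

/-- Strong solutions on `[0, T]` of `u_t + (u·∇)u - ν Δu = 0`:
`u ∈ C⁰([0,T]; H^{1/2}) ∩ L²(0,T; H^{3/2})` with `u_t ∈ L²(0,T; H^{-1/2})`, and for every smooth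
`φ` one has `⟨u_t, φ⟩ + ((u·∇)u, φ) + ν (∇u, ∇φ) = 0` at almost every time. In the last clause
`Φ` is `φ` as an element of `H^{1/2}` and `D j` is the weak derivative `∂_j u(t)`. -/
def IsStrongSolutionOn (ν T : ℝ) (u : ℝ → Sobolev (1 / 2)) : Prop :=
  ContinuousOn u (Icc 0 T) ∧
  MemL2Sobolev (3 / 2) T (fun t => (u t).toL2) ∧
  ∃ g : ℝ → SobolevDual (1 / 2),
    MemLp g 2 (volume.restrict (Ioo 0 T)) ∧
    HasWeakTimeDeriv (1 / 2) T (fun t => (u t).toL2) g ∧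
    ∀ φ : Torus → E3, IsSmooth φ → ∀ Φ : Sobolev (1 / 2), (Φ.toL2 : Torus → E3) =ᵐ[volume] φ →
      ∀ᵐ t ∂(volume.restrict (Ioo 0 T)),
        ∃ D : Fin 3 → L2Field, (∀ j, HasWeakPartial j (u t).toL2 (D j)) ∧
          g t Φ
            + (∫ x, inner ℝ (∑ j, ((u t).toL2 x j) • (D j x)) (φ x))
            + ν * (∑ j, ∫ x, inner ℝ (D j x) (partialDeriv j φ x)) = 0

/-- Global strong solutions: strong solutions on `[0, T]` for every `T > 0`. Only the values
`u t` with `t ≥ 0` matter. -/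
def IsGlobalStrongSolution (ν : ℝ) (u : ℝ → Sobolev (1 / 2)) : Prop :=
  ∀ T : ℝ, 0 < T → IsStrongSolutionOn ν T u

/-- `U ∈ C⁰((0,∞); C²(𝕋³))`: each `U t` is `C²`, and the derivatives of order at most two depend
continuously on `t > 0` in the supremum norm. -/
def MemC0C2 (U : ℝ → C(Torus, E3)) : Prop :=
  ∀ t : ℝ, 0 < t → ContDiff ℝ 2 (lift (U t)) ∧
    ∀ m : ℕ, m ≤ 2 →
      TendstoUniformly (fun τ y => iteratedFDeriv ℝ m (lift (U τ)) y)
        (iteratedFDeriv ℝ m (lift (U t))) (𝓝 t)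

/-- `U ∈ C¹((0,∞); C⁰) ∩ C⁰((0,∞); C²)` solves `U_t + (U·∇)U - ν ΔU = 0` pointwise on
`(0,∞) × 𝕋³`. -/
def IsClassicalSolution (ν : ℝ) (U : ℝ → C(Torus, E3)) : Prop :=
  ContDiffOn ℝ 1 U (Ioi 0) ∧ MemC0C2 U ∧
    ∀ t : ℝ, 0 < t → ∀ x : Torus,
      deriv U t x + (∑ j, (U t x j) • partialDeriv j (U t) x)
        - ν • (∑ j, partialDeriv j (partialDeriv j (U t)) x) = 0

end Burgers

end

open scoped ComplexConjugate

noncomputable section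

namespace Burgers

/-! On the Fourier side the equation is a quadratic system for the coefficients u_k, with linear
part -ν|k|²u_k and a convolution as nonlinearity. The proof combines a critical local theory for the
mild (Duhamel) form, global bounds from maximum principles, and the equivalence of mild and strong
solutions.

Local theory. H^{1/2} is scaling-critical in three dimensions. The fixed point is sought in
L̃⁴(0,T;H¹), where the time norm of each mode is taken before the ℓ² sum over modes. The product of
an H¹ and an L² function lies in H^{-1/2} (`tsum_conv_sq_le`), so advection maps this space into
L²(0,T;H^{-1/2}); maximal regularity of the heat equation, checked on each mode
(`zNorm_duhamel_le`), maps back. The constants do not shrink with T. Smallness comes from the heat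
flow of the datum, whose norm tends to 0 with T (`tendsto_linNorm_zero`), and `exists_mildSol_local`
is then a contraction argument.

All estimates carry a Gevrey weight e^{σ√t|k|}. It is submultiplicative under convolution
(`gev_le_mul`), and half of the heat kernel absorbs it when σ ≤ 1 (`kernel_le`). The case σ = 0
yields uniqueness (`MildSol.unique`). The case σ = 1 yields exponentially decaying coefficients at
positive times (`MildSol.exists_expDecay`), so the Fourier series may be differentiated termwise and
the solution is classical there (`RegModes.isClassicalSolution`).

Global bounds. There is no pressure, so every component ⟨e,u⟩ solves a scalar drift-diffusion
equation whose drift is u itself (`RegModes.driftHeat`). The maximum principle bounds |u| by its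
supremum K at an earlier positive time. The two-point maximum principle `DriftHeat.sub_le` compares
f(x) - f(y) with c(t)(1 - e^{-μ|x-y|}): for μ large in terms of K and ν, the concavity of this
modulus makes diffusion beat the drift, with room left for c to decay exponentially. Hence u stays
bounded in H¹ and its gradient decays exponentially. H¹ is subcritical, so a bound there fixes a
lifespan (`exists_lifespan`), and restarting with this lifespan gives a solution for all times
(`exists_mildSol`). For the integral of ‖u‖²_{3/2}, local estimates cover bounded times; for large
times ‖u‖²_{3/2} ≤ ‖u‖₁‖u‖₂, where the first factor decays exponentially and the second is bounded
by Gevrey smoothing.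

Equivalence. A mild solution is smooth for t > 0, so it satisfies the weak form there
(`isGlobalStrongSolution_curve`). Conversely, testing a strong solution with single plane waves
gives scalar weak ODEs, which integrate to the Duhamel formula; the L̃⁴ bound follows from maximal
regularity (`IsStrongSolutionOn.mildSol`). Uniqueness of mild solutions is thus uniqueness of strong
ones. -/

/-- The lattice of wave vectors. -/
abbrev Mode : Type := Fin 3 → ℤ

/-! ### Fourier series on the torus -/

lemma expMode_neg (k : Mode) (x : Torus) : expMode (-k) x = conj (expMode k x) := by
  simp only [expMode, Pi.neg_apply, fourier_neg, map_prod]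

lemma expMode_add (k l : Mode) (x : Torus) : expMode (k + l) x = expMode k x * expMode l x := by
  simp only [expMode, Pi.add_apply, fourier_add, Finset.prod_mul_distrib]

lemma expMode_zero (x : Torus) : expMode 0 x = 1 := by
  simp [expMode]

lemma expMode_single (i : Fin 3) (x : Torus) : expMode (Pi.single i 1) x = fourier 1 (x i) := by
  rw [expMode, Finset.prod_eq_single i]
  · simp
  · intro j _ hj
    simp [Pi.single_eq_of_ne hj]
  · simp

/-- `expMode k` as a continuous function. -/
def expModeC (k : Mode) : C(Torus, ℂ) := ⟨expMode k, continuous_expMode k⟩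

@[simp] lemma expModeC_apply (k : Mode) (x : Torus) : expModeC k x = expMode k x := rfl

/-- The star subalgebra of trigonometric polynomials. -/
def trigSubalgebra : StarSubalgebra ℂ C(Torus, ℂ) where
  toSubalgebra := Algebra.adjoin ℂ (range expModeC)
  star_mem' := by
    change Algebra.adjoin ℂ (range expModeC) ≤ star (Algebra.adjoin ℂ (range expModeC))
    refine Algebra.adjoin_le ?_
    rintro _ ⟨n, rfl⟩
    refine Algebra.subset_adjoin ⟨-n, ?_⟩
    ext1 x
    simp only [expModeC_apply, expMode_neg, starRingEnd_apply, ContinuousMap.star_apply]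

lemma trigSubalgebra_coe :
    trigSubalgebra.toSubalgebra.toSubmodule = Submodule.span ℂ (range expModeC) := by
  apply Algebra.adjoin_eq_span_of_subset
  refine .trans (fun x ↦ Submonoid.closure_induction (fun _ ↦ id) ⟨0, ?_⟩ ?_)
    Submodule.subset_span
  · ext z
    simp [expMode_zero]
  · rintro _ _ _ _ ⟨m, rfl⟩ ⟨n, rfl⟩
    refine ⟨m + n, ?_⟩
    ext z
    simp [expMode_add]

lemma trigSubalgebra_separatesPoints : trigSubalgebra.SeparatesPoints := by
  intro x y hxy
  rw [Ne, funext_iff, not_forall] at hxy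
  obtain ⟨i, hi⟩ := hxy
  -- Points that differ in the coordinate `i` are separated by e^{ix_i}, which is injective on the
  -- circle.
  refine ⟨_, ⟨expModeC (Pi.single i 1), Algebra.subset_adjoin ⟨Pi.single i 1, rfl⟩, rfl⟩, ?_⟩
  dsimp only
  rw [expModeC_apply, expModeC_apply, expMode_single, expMode_single, fourier_one, fourier_one]
  intro h
  exact hi (AddCircle.injective_toCircle Real.two_pi_pos.ne' (Circle.ext h))

/-- Stone-Weierstrass: the exponentials are closed under products and conjugation, so their span is
already the star algebra that they generate. -/
lemma span_expModeC_closure_eq_top :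
    (Submodule.span ℂ (range expModeC)).topologicalClosure = ⊤ := by
  rw [← trigSubalgebra_coe]
  exact congr_arg (Subalgebra.toSubmodule <| StarSubalgebra.toSubalgebra ·)
    (ContinuousMap.starSubalgebra_topologicalClosure_eq_top_of_separatesPoints _
      trigSubalgebra_separatesPoints)

lemma volume_torus : (volume : Measure Torus) univ = ENNReal.ofReal ((2 * Real.pi) ^ 3) := by
  rw [volume_pi, ← Set.pi_univ univ, Measure.pi_pi]
  simp [AddCircle.measure_univ, ENNReal.ofReal_pow Real.two_pi_pos.le]

lemma integral_fourier_circle (n : ℤ) :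
    ∫ x : AddCircle (2 * Real.pi), fourier n x = if n = 0 then ((2 * Real.pi : ℝ) : ℂ) else 0 := by
  split_ifs with h
  · subst h
    simp [Measure.real, AddCircle.measure_univ, Real.pi_pos.le]
  -- Translation by half a wavelength changes the sign of the integrand.
  · exact integral_eq_zero_of_add_right_eq_neg (fourier_add_half_inv_index h Real.two_pi_pos)

lemma integral_expMode (k : Mode) :
    ∫ x, expMode k x = if k = 0 then (((2 * Real.pi) ^ 3 : ℝ) : ℂ) else 0 := by
  simp only [expMode]
  rw [MeasureTheory.integral_fintype_prod_volume_eq_prod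
    (f := fun j (y : AddCircle (2 * Real.pi)) => (fourier (k j) y : ℂ))]
  simp only [integral_fourier_circle]
  split_ifs with h
  · subst h; simp
  · obtain ⟨i, hi⟩ := Function.ne_iff.mp h
    exact Finset.prod_eq_zero (Finset.mem_univ i) (if_neg hi)

/-- The complex space `L²(𝕋³; ℂ)`. -/
abbrev L2C : Type := Lp ℂ 2 (volume : Measure Torus)

/-- The square root of `(2π)³`. -/
def volRoot : ℝ := Real.sqrt ((2 * Real.pi) ^ 3)

lemma volRoot_pos : 0 < volRoot := Real.sqrt_pos.2 (pow_pos Real.two_pi_pos 3)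

lemma volRoot_sq : volRoot ^ 2 = (2 * Real.pi) ^ 3 := Real.sq_sqrt (pow_pos Real.two_pi_pos 3).le

/-- The normalised exponentials in `L²`. -/
def expLp (k : Mode) : L2C := ((volRoot⁻¹ : ℝ) : ℂ) • ContinuousMap.toLp 2 volume ℂ (expModeC k)

lemma inner_toLp_expModeC (k l : Mode) :
    inner ℂ (ContinuousMap.toLp (E := ℂ) 2 volume ℂ (expModeC k))
      (ContinuousMap.toLp (E := ℂ) 2 (volume : Measure Torus) ℂ (expModeC l))
      = if k = l then (((2 * Real.pi) ^ 3 : ℝ) : ℂ) else 0 := by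
  rw [ContinuousMap.inner_toLp]
  simp only [expModeC_apply, ← expMode_neg, ← expMode_add]
  rw [integral_expMode]
  congr 1
  rw [eq_iff_iff, add_neg_eq_zero, eq_comm]

lemma orthonormal_expLp : Orthonormal ℂ expLp := by
  rw [orthonormal_iff_ite]
  intro m n
  rw [expLp, expLp, inner_smul_left, inner_smul_right, inner_toLp_expModeC]
  split_ifs
  · rw [← volRoot_sq]
    have := volRoot_pos.ne'
    simp only [Complex.conj_ofReal]
    norm_cast
    field_simp
  · simp

lemma span_expLp_closure_eq_top : (Submodule.span ℂ (range expLp)).topologicalClosure = ⊤ := by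
  have h1 : Submodule.span ℂ (range expLp) = Submodule.span ℂ
      (range fun k => ContinuousMap.toLp (E := ℂ) 2 (volume : Measure Torus) ℂ (expModeC k)) := by
    have hne : ((volRoot⁻¹ : ℝ) : ℂ) ≠ 0 := by
      have := volRoot_pos.ne'
      simpa using this
    apply le_antisymm
    · rw [Submodule.span_le]
      rintro _ ⟨k, rfl⟩
      exact Submodule.smul_mem _ _ (Submodule.subset_span ⟨k, rfl⟩)
    · rw [Submodule.span_le]
      rintro _ ⟨k, rfl⟩
      have : ContinuousMap.toLp (E := ℂ) 2 (volume : Measure Torus) ℂ (expModeC k)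
          = (((volRoot⁻¹ : ℝ) : ℂ))⁻¹ • expLp k := by
        rw [expLp, smul_smul, inv_mul_cancel₀ hne, one_smul]
      simp only [this]
      exact Submodule.smul_mem _ _ (Submodule.subset_span ⟨k, rfl⟩)
  rw [h1]
  simpa only [Submodule.map_span, ContinuousLinearMap.coe_coe, ← range_comp,
    Function.comp_def] using
    (ContinuousMap.toLp_denseRange ℂ (volume : Measure Torus) ℂ
      (by simp : (2 : ℝ≥0∞) ≠ ⊤)).topologicalClosure_map_submodule
      span_expModeC_closure_eq_top

/-- The Fourier basis of `L²(𝕋³; ℂ)`. -/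
def fourierBasis3 : HilbertBasis Mode ℂ L2C :=
  HilbertBasis.mk orthonormal_expLp span_expLp_closure_eq_top.ge

lemma fourierBasis3_apply (k : Mode) : fourierBasis3 k = expLp k := by
  rw [fourierBasis3, HilbertBasis.coe_mk]

/-- The `i`-th component of a field, as a complex function in `L²`. -/
def compC (i : Fin 3) : L2Field →L[ℝ] L2C :=
  (Complex.ofRealCLM.comp (EuclideanSpace.proj (𝕜 := ℝ) i)).compLpL 2 volume

lemma coeFn_compC (i : Fin 3) (f : L2Field) : compC i f =ᵐ[volume] fun x => ((f x i : ℝ) : ℂ) :=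
  ContinuousLinearMap.coeFn_compLpL _ _

lemma inner_expLp (k : Mode) (g : L2C) :
    inner ℂ (expLp k) g = ((volRoot⁻¹ : ℝ) : ℂ) * ∫ x, expMode (-k) x * g x := by
  rw [expLp, inner_smul_left, Complex.conj_ofReal, L2.inner_def]
  congr 1
  apply integral_congr_ae
  filter_upwards [ContinuousMap.coeFn_toLp (𝕜 := ℂ) (E := ℂ) (p := 2) (volume : Measure Torus)
    (expModeC k)] with x hx
  rw [hx, expMode_neg, RCLike.inner_apply, mul_comm]
  rfl

lemma inner_expLp_compC (k : Mode) (i : Fin 3) (f : L2Field) :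
    inner ℂ (expLp k) (compC i f) = (volRoot : ℂ) * fourierCoef f k i := by
  rw [inner_expLp, fourierCoef, ← volRoot_sq]
  have h : ∫ x, expMode (-k) x * (compC i f : Torus → ℂ) x
      = ∫ x, expMode (-k) x * ((f x i : ℝ) : ℂ) := by
    apply integral_congr_ae
    filter_upwards [coeFn_compC i f] with x hx
    rw [hx]
  rw [h]
  have := volRoot_pos.ne'
  have h2 : (volRoot : ℂ) ≠ 0 := by exact_mod_cast this
  simp only [Complex.ofReal_inv, Complex.ofReal_pow]
  field_simp

lemma enorm_sq_eq_tsum (g : L2C) : ‖g‖ₑ ^ 2 = ∑' k, ‖inner ℂ (expLp k) g‖ₑ ^ 2 := by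
  have h := fourierBasis3.hasSum_inner_mul_inner g g
  have h2 : HasSum (fun k => ‖inner ℂ (expLp k) g‖ ^ 2) (‖g‖ ^ 2) := by
    have := (Complex.reCLM.hasSum h)
    simp only [Complex.reCLM_apply, fourierBasis3_apply] at this
    convert this using 1
    · ext k
      rw [← inner_conj_symm g, RCLike.conj_mul]
      norm_cast
    · rw [inner_self_eq_norm_sq_to_K]
      norm_cast
  have h3 := ENNReal.ofReal_tsum_of_nonneg (fun k => sq_nonneg ‖inner ℂ (expLp k) g‖) h2.summable
  rw [h2.tsum_eq, ENNReal.ofReal_pow (norm_nonneg _), ofReal_norm] at h3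
  rw [h3]
  congr 1
  ext k
  rw [ENNReal.ofReal_pow (norm_nonneg _), ofReal_norm]

lemma enorm_sq_euclidean {𝕜 : Type*} [RCLike 𝕜] (v : EuclideanSpace 𝕜 (Fin 3)) :
    ‖v‖ₑ ^ 2 = ∑ i, ‖v i‖ₑ ^ 2 := by
  rw [← ofReal_norm, ← ENNReal.ofReal_pow (norm_nonneg _), EuclideanSpace.norm_sq_eq,
    ENNReal.ofReal_sum_of_nonneg (fun i _ => sq_nonneg _)]
  congr 1
  ext i
  rw [ENNReal.ofReal_pow (norm_nonneg _), ofReal_norm]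

lemma enorm_sq_Lp {F : Type*} [NormedAddCommGroup F] {α : Type*} [MeasurableSpace α]
    {μ : Measure α} (f : Lp F 2 μ) : ‖f‖ₑ ^ 2 = ∫⁻ x, ‖f x‖ₑ ^ 2 ∂μ := by
  rw [Lp.enorm_def, eLpNorm_eq_lintegral_rpow_enorm_toReal (by norm_num) (by norm_num)]
  rw [← ENNReal.rpow_natCast, ← ENNReal.rpow_mul]
  simp

/-- Parseval's identity. -/
lemma parseval (f : L2Field) :
    ‖f‖ₑ ^ 2 = ENNReal.ofReal ((2 * Real.pi) ^ 3) * ∑' k, ‖fourierCoef f k‖ₑ ^ 2 := by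
  have h1 : ‖f‖ₑ ^ 2 = ∑ i, ‖compC i f‖ₑ ^ 2 := by
    rw [enorm_sq_Lp]
    simp only [enorm_sq_Lp]
    rw [← lintegral_finsetSum']
    · apply lintegral_congr_ae
      have : ∀ᵐ x, ∀ i, compC i f x = ((f x i : ℝ) : ℂ) :=
        ae_all_iff.2 fun i => coeFn_compC i f
      filter_upwards [this] with x hx
      simp only [hx, enorm_sq_euclidean]
      congr 1
      ext i
      congr 1
      rw [← ofReal_norm, ← ofReal_norm, Complex.norm_real]
    · intro i _
      exact ((Lp.aestronglyMeasurable _).enorm.pow_const 2)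
  rw [h1]
  simp only [enorm_sq_eq_tsum, inner_expLp_compC, enorm_sq_euclidean]
  rw [← ENNReal.tsum_mul_left, ← Summable.tsum_finsetSum (fun _ _ => ENNReal.summable)]
  congr 1
  ext k
  rw [Finset.mul_sum]
  congr 1
  ext i
  rw [enorm_mul, mul_pow, ← volRoot_sq, ENNReal.ofReal_pow volRoot_pos.le]
  congr 2
  rw [← ofReal_norm, Complex.norm_real, Real.norm_of_nonneg volRoot_pos.le]

lemma fourierCoef_injective : Function.Injective fourierCoef := by
  intro f g h
  have h1 : fourierCoef (f - g) = 0 := by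
    funext k
    have := fourierCoef_add (f - g) g k
    rw [sub_add_cancel, h] at this
    simpa using this
  have h2 := parseval (f - g)
  simp only [h1, Pi.zero_apply, enorm_zero] at h2
  simpa [sub_eq_zero] using h2

/-- The Fourier coefficients of a product are the convolution of the Fourier coefficients. -/
lemma hasSum_fourierCoef_mul (f g : L2Field) (i j : Fin 3) (k : Mode) :
    HasSum (fun l => fourierCoef f l i * fourierCoef g (k - l) j)
      ((((2 * Real.pi) ^ 3 : ℝ) : ℂ)⁻¹ *
        ∫ x : Torus, expMode (-k) x * (((f x i : ℝ) : ℂ) * ((g x j : ℝ) : ℂ))) := by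
  -- The factor e^{-ik·x} is moved onto `g`. The polarised Parseval identity for e^{ik·x}g_j and f_i
  -- is then the convolution, and nothing beyond square integrability is needed.
  have hm : MemLp (fun x => expMode k x * (compC j g : Torus → ℂ) x) 2 volume := by
    refine (Lp.memLp (compC j g)).of_le
      ((continuous_expMode k).aestronglyMeasurable.mul (Lp.aestronglyMeasurable _)) ?_
    refine Eventually.of_forall fun x => ?_
    rw [norm_mul, norm_expMode, one_mul]
  have h1 : ∀ l, inner ℂ (hm.toLp _) (expLp l) = (volRoot : ℂ) * fourierCoef g (k - l) j := by
    intro l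
    rw [← inner_expLp_compC, ← inner_conj_symm, inner_expLp, inner_expLp, map_mul,
      Complex.conj_ofReal, ← integral_conj]
    congr 1
    apply integral_congr_ae
    filter_upwards [hm.coeFn_toLp, coeFn_compC j g] with x hx hx2
    rw [hx, hx2, map_mul, map_mul, Complex.conj_ofReal, ← expMode_neg, ← expMode_neg, neg_sub,
      sub_eq_add_neg, expMode_add, neg_neg, mul_assoc]
  have h2 : inner ℂ (hm.toLp _) (compC i f)
      = ∫ x : Torus, expMode (-k) x * (((f x i : ℝ) : ℂ) * ((g x j : ℝ) : ℂ)) := by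
    rw [L2.inner_def]
    apply integral_congr_ae
    filter_upwards [hm.coeFn_toLp, coeFn_compC j g, coeFn_compC i f] with x hx hx2 hx3
    rw [hx, hx2, hx3, RCLike.inner_apply, map_mul, Complex.conj_ofReal, expMode_neg]
    ring
  have h3 := (fourierBasis3.hasSum_inner_mul_inner (hm.toLp _) (compC i f)).mul_left
    ((((2 * Real.pi) ^ 3 : ℝ) : ℂ)⁻¹)
  rw [h2] at h3
  refine h3.congr_fun ?_
  intro l
  have := volRoot_pos.ne'
  have h4 : (volRoot : ℂ) ≠ 0 := by exact_mod_cast this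
  rw [fourierBasis3_apply, h1, inner_expLp_compC, ← volRoot_sq, Complex.ofReal_pow]
  field_simp

/-! ### Weights and convolution estimates for sequences -/

/-- The weight `(1 + |k|²)^{1/2}`. -/
def bracket (k : Mode) : ℝ := Real.sqrt (1 + modeNorm k ^ 2)

/-- The weight `(1 + |k|²)^{1/2}` as an extended nonnegative real. -/
def wt (k : Mode) : ℝ≥0∞ := ENNReal.ofReal (bracket k)

lemma modeNorm_nonneg (k : Mode) : 0 ≤ modeNorm k := norm_nonneg _

lemma modeNorm_sq (k : Mode) : modeNorm k ^ 2 = ∑ i, (k i : ℝ) ^ 2 := by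
  rw [modeNorm, EuclideanSpace.norm_sq_eq]
  simp

lemma modeNorm_neg (k : Mode) : modeNorm (-k) = modeNorm k := by
  rw [← sq_eq_sq₀ (modeNorm_nonneg _) (modeNorm_nonneg _), modeNorm_sq, modeNorm_sq]
  simp

lemma modeNorm_add_le (k l : Mode) : modeNorm (k + l) ≤ modeNorm k + modeNorm l := by
  unfold modeNorm
  refine le_of_eq_of_le ?_ (norm_add_le _ _)
  congr 1
  ext i
  simp

lemma abs_le_modeNorm (k : Mode) (i : Fin 3) : |(k i : ℝ)| ≤ modeNorm k := by
  exact PiLp.norm_apply_le (WithLp.toLp 2 fun i => (k i : ℝ) : E3) i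

lemma bracket_sq (k : Mode) : bracket k ^ 2 = 1 + modeNorm k ^ 2 :=
  Real.sq_sqrt (by positivity)

lemma one_le_bracket (k : Mode) : 1 ≤ bracket k := by
  rw [bracket, Real.one_le_sqrt]
  nlinarith [sq_nonneg (modeNorm k)]

lemma bracket_pos (k : Mode) : 0 < bracket k := one_pos.trans_le (one_le_bracket k)

lemma modeNorm_le_bracket (k : Mode) : modeNorm k ≤ bracket k :=
  Real.le_sqrt_of_sq_le (by linarith)

lemma bracket_le (k : Mode) : bracket k ≤ 1 + modeNorm k := by
  have := modeNorm_nonneg k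
  rw [bracket, Real.sqrt_le_left (by positivity)]
  nlinarith

lemma bracket_neg (k : Mode) : bracket (-k) = bracket k := by
  rw [bracket, bracket, modeNorm_neg]

lemma one_le_wt (k : Mode) : 1 ≤ wt k := by
  rw [wt, ENNReal.one_le_ofReal]
  exact one_le_bracket k

lemma wt_ne_zero (k : Mode) : wt k ≠ 0 := (one_pos.trans_le (one_le_wt k)).ne'

lemma wt_ne_top (k : Mode) : wt k ≠ ⊤ := ENNReal.ofReal_ne_top

lemma wt_mul_inv (k : Mode) : wt k * (wt k)⁻¹ = 1 := ENNReal.mul_inv_cancel (wt_ne_zero k) (wt_ne_top k)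

lemma wt_inv_mul (k : Mode) : (wt k)⁻¹ * wt k = 1 := ENNReal.inv_mul_cancel (wt_ne_zero k) (wt_ne_top k)

/-! ### Lattice point counts and weighted convolution estimates -/

/-- The wave vectors with `|k_i| ≤ N`. -/
def modeBox (N : ℕ) : Finset Mode := Finset.Icc (fun _ => -(N : ℤ)) (fun _ => (N : ℤ))

lemma mem_modeBox {N : ℕ} {k : Mode} : k ∈ modeBox N ↔ ∀ i, |k i| ≤ N := by
  simp only [modeBox, Finset.mem_Icc, Pi.le_def, abs_le, forall_and]

lemma card_modeBox (N : ℕ) : (modeBox N).card = (2 * N + 1) ^ 3 := by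
  rw [modeBox, Pi.card_Icc]
  simp only [Int.card_Icc, Finset.prod_const, Finset.card_univ, Fintype.card_fin]
  congr 1
  omega

lemma modeBox_subset (N : ℕ) : modeBox N ⊆ modeBox (N + 1) := by
  intro k hk
  rw [mem_modeBox] at *
  intro i
  have := hk i
  push_cast
  omega

/-- The shell at sup-norm distance m has 24m² + 2 points, each with weight at most 1/(1 + m²), so
every shell contributes at most 26. -/
lemma sum_modeBox_le (N : ℕ) : ∑ k ∈ modeBox N, (bracket k ^ 2)⁻¹ ≤ 26 * (N : ℝ) + 1 := by
  induction N with
  | zero =>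
    have h : modeBox 0 = {0} := by
      ext k
      simp [mem_modeBox, funext_iff]
    rw [h]
    simp [bracket_sq, modeNorm_sq]
  | succ n ih =>
    rw [← Finset.sum_sdiff (modeBox_subset n)]
    have h1 : ∑ k ∈ modeBox (n + 1) \ modeBox n, (bracket k ^ 2)⁻¹
        ≤ (modeBox (n + 1) \ modeBox n).card • ((1 + ((n : ℝ) + 1) ^ 2)⁻¹) := by
      apply Finset.sum_le_card_nsmul
      intro k hk
      rw [Finset.mem_sdiff, mem_modeBox, mem_modeBox, not_forall] at hk
      obtain ⟨-, i, hi⟩ := hk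
      have h2 : (n : ℝ) + 1 ≤ |(k i : ℝ)| := by
        have : (n : ℤ) + 1 ≤ |k i| := by omega
        exact_mod_cast this
      have h3 := h2.trans (abs_le_modeNorm k i)
      rw [bracket_sq]
      gcongr
    have h4 : ((modeBox (n + 1) \ modeBox n).card : ℝ) = (2 * (n + 1 : ℝ) + 1) ^ 3 - (2 * n + 1) ^ 3 := by
      rw [Finset.card_sdiff_of_subset (modeBox_subset n), card_modeBox, card_modeBox,
        Nat.cast_sub (by gcongr; omega)]
      push_cast
      ring
    have h5 : (modeBox (n + 1) \ modeBox n).card • ((1 + ((n : ℝ) + 1) ^ 2)⁻¹) ≤ 26 := by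
      rw [nsmul_eq_mul, h4, ← div_eq_mul_inv, div_le_iff₀ (by positivity)]
      nlinarith [sq_nonneg (n : ℝ), Nat.cast_nonneg (α := ℝ) n]
    push_cast
    linarith

/-- The discrete form of ∫_{|k|≤R} |k|^{-2} dk ~ R, which is where dimension three enters. With R =
`bracket l` ≥ 1 the relevant modes lie in the box of size ⌊R⌋, and 26⌊R⌋ + 1 ≤ 27R. -/
lemma tsum_wt_le_sq (l : Mode) :
    ∑' k, (if wt k ≤ wt l then (wt k ^ 2)⁻¹ else 0) ≤ 27 * wt l := by
  set N := ⌊bracket l⌋₊ with hN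
  have h1 : ∀ k ∉ modeBox N, (if wt k ≤ wt l then (wt k ^ 2)⁻¹ else 0) = 0 := by
    intro k hk
    rw [if_neg]
    intro h
    apply hk
    rw [mem_modeBox]
    intro i
    have h2 : bracket k ≤ bracket l := (ENNReal.ofReal_le_ofReal_iff (bracket_pos l).le).1 h
    have h3 := (abs_le_modeNorm k i).trans ((modeNorm_le_bracket k).trans h2)
    have h4 : |k i| ≤ ⌊bracket l⌋ := by
      rw [Int.le_floor]
      exact_mod_cast h3
    rw [← Int.natCast_floor_eq_floor (bracket_pos l).le] at h4
    exact h4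
  rw [tsum_eq_sum h1]
  calc ∑ k ∈ modeBox N, (if wt k ≤ wt l then (wt k ^ 2)⁻¹ else 0)
      ≤ ∑ k ∈ modeBox N, ENNReal.ofReal ((bracket k ^ 2)⁻¹) := by
        gcongr with k hk
        split_ifs
        · rw [wt, ← ENNReal.ofReal_pow (bracket_pos k).le,
            ENNReal.ofReal_inv_of_pos (pow_pos (bracket_pos k) 2)]
        · exact zero_le
    _ = ENNReal.ofReal (∑ k ∈ modeBox N, (bracket k ^ 2)⁻¹) := by
        rw [ENNReal.ofReal_sum_of_nonneg]
        intro k _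
        positivity
    _ ≤ ENNReal.ofReal (27 * bracket l) := by
        apply ENNReal.ofReal_le_ofReal
        have h2 := sum_modeBox_le N
        have h3 := Nat.floor_le (bracket_pos l).le
        have h4 := one_le_bracket l
        rw [← hN] at h3
        linarith
    _ = 27 * wt l := by
        rw [ENNReal.ofReal_mul (by norm_num), wt]
        norm_num

lemma tsum_wt_le (l : Mode) :
    ∑' k, (if wt k ≤ wt l then (wt k)⁻¹ else 0) ≤ 27 * wt l ^ 2 := by
  calc ∑' k, (if wt k ≤ wt l then (wt k)⁻¹ else 0)
      ≤ ∑' k, wt l * (if wt k ≤ wt l then (wt k ^ 2)⁻¹ else 0) := by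
        gcongr with k
        split_ifs with h
        · calc (wt k)⁻¹ = wt k * (wt k ^ 2)⁻¹ := by
                rw [ENNReal.inv_pow, sq, ← mul_assoc, wt_mul_inv, one_mul]
            _ ≤ _ := by gcongr
        · exact zero_le
    _ = wt l * ∑' k, (if wt k ≤ wt l then (wt k ^ 2)⁻¹ else 0) := ENNReal.tsum_mul_left
    _ ≤ wt l * (27 * wt l) := by gcongr; exact tsum_wt_le_sq l
    _ = _ := by ring

lemma lintegral_mul_sq_le {α : Type*} [MeasurableSpace α] {μ : Measure α} {f g : α → ℝ≥0∞}
    (hf : AEMeasurable f μ) (hg : AEMeasurable g μ) :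
    (∫⁻ x, f x * g x ∂μ) ^ 2 ≤ (∫⁻ x, f x ^ 2 ∂μ) * ∫⁻ x, g x ^ 2 ∂μ := by
  have h := ENNReal.lintegral_mul_le_Lp_mul_Lq μ Real.HolderConjugate.two_two hf hg
  simp only [Pi.mul_apply, ENNReal.rpow_two] at h
  refine (pow_le_pow_left' h 2).trans (le_of_eq ?_)
  rw [mul_pow, ← ENNReal.rpow_two, ← ENNReal.rpow_two, ← ENNReal.rpow_mul, ← ENNReal.rpow_mul]
  norm_num

lemma tsum_mul_sq_le {ι : Type*} (f g : ι → ℝ≥0∞) :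
    (∑' i, f i * g i) ^ 2 ≤ (∑' i, f i ^ 2) * ∑' i, g i ^ 2 := by
  let _ : MeasurableSpace ι := ⊤
  have h := lintegral_mul_sq_le (μ := Measure.count) (f := f) (g := g)
    measurable_from_top.aemeasurable measurable_from_top.aemeasurable
  simpa only [lintegral_count] using h

lemma add_sq_le_two_mul (a b : ℝ≥0∞) : (a + b) ^ 2 ≤ 2 * (a ^ 2 + b ^ 2) := by
  wlog h : a ≤ b generalizing a b
  · rw [add_comm a, add_comm (a ^ 2)]
    exact this b a (le_of_not_ge h)
  -- With b = a + c the two sides differ by exactly c²; this replaces (a - b)² ≥ 0, as subtraction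
  -- is truncated here.
  obtain ⟨c, rfl⟩ := exists_add_of_le h
  calc (a + (a + c)) ^ 2 ≤ (a + (a + c)) ^ 2 + c ^ 2 := le_self_add
    _ = _ := by ring

/-- The convolution of two sequences. -/
def conv (f g : Mode → ℝ≥0∞) (k : Mode) : ℝ≥0∞ := ∑' l, f l * g (k - l)

lemma tsum_sub_left (g : Mode → ℝ≥0∞) (k : Mode) : ∑' l, g (k - l) = ∑' l, g l :=
  (Equiv.subLeft k).tsum_eq g

lemma tsum_sub_right (g : Mode → ℝ≥0∞) (k : Mode) : ∑' l, g (l - k) = ∑' l, g l :=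
  (Equiv.subRight k).tsum_eq g

/-- The product of an `H¹` and an `L²` function is in `H^{-1/2}`. -/
lemma tsum_conv_sq_le (a b : Mode → ℝ≥0∞) :
    ∑' k, (wt k)⁻¹ * (conv (fun l => (wt l)⁻¹ * a l) b k) ^ 2
      ≤ 108 * ((∑' k, a k ^ 2) * ∑' k, b k ^ 2) := by
  -- Splitting by the relative size of the frequencies `l` and `k`. For low `l`, Cauchy-Schwarz
  -- isolates (wt l)⁻¹ and produces a factor wt k, which the outer weight cancels. For high `l`, it
  -- isolates `b`, and the sum over `k` is done first, by `tsum_wt_le`. Each half costs 27, and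
  -- squaring the sum doubles: 108 = 2(27 + 27).
  have hsplit : ∀ k, (conv (fun l => (wt l)⁻¹ * a l) b k) ^ 2
      ≤ 2 * ((∑' l, (if wt l ≤ wt k then (wt l)⁻¹ else 0) * (a l * b (k - l))) ^ 2
        + (∑' l, (if wt k ≤ wt l then (wt l)⁻¹ * a l else 0) * b (k - l)) ^ 2) := by
    intro k
    have h1 : conv (fun l => (wt l)⁻¹ * a l) b k
        ≤ (∑' l, (if wt l ≤ wt k then (wt l)⁻¹ else 0) * (a l * b (k - l)))
          + ∑' l, (if wt k ≤ wt l then (wt l)⁻¹ * a l else 0) * b (k - l) := by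
      rw [conv, ← ENNReal.tsum_add]
      gcongr with l
      rcases le_total (wt l) (wt k) with h | h
      · rw [if_pos h, ← mul_assoc]
        exact le_self_add
      · rw [if_pos h]
        exact le_add_self
    calc _ ≤ _ := pow_le_pow_left' h1 2
      _ ≤ _ := add_sq_le_two_mul _ _
  have hA : ∀ k, (∑' l, (if wt l ≤ wt k then (wt l)⁻¹ else 0) * (a l * b (k - l))) ^ 2
      ≤ 27 * wt k * ∑' l, a l ^ 2 * b (k - l) ^ 2 := by
    intro k
    refine (tsum_mul_sq_le _ _).trans ?_
    gcongr
    · refine le_of_eq_of_le ?_ (tsum_wt_le_sq k)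
      congr 1
      ext l
      split_ifs
      · rw [ENNReal.inv_pow]
      · simp
    · rw [mul_pow]
  have hB : ∀ k, (∑' l, (if wt k ≤ wt l then (wt l)⁻¹ * a l else 0) * b (k - l)) ^ 2
      ≤ (∑' l, (if wt k ≤ wt l then (wt l)⁻¹ * a l else 0) ^ 2) * ∑' l, b l ^ 2 := by
    intro k
    refine (tsum_mul_sq_le _ _).trans ?_
    rw [tsum_sub_left (fun l => b l ^ 2)]
  have hA2 : ∑' k, (wt k)⁻¹ * (27 * wt k * ∑' l, a l ^ 2 * b (k - l) ^ 2)
      = 27 * ((∑' k, a k ^ 2) * ∑' k, b k ^ 2) := by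
    calc _ = ∑' k, 27 * ∑' l, a l ^ 2 * b (k - l) ^ 2 := by
          congr 1; ext k
          rw [← mul_assoc, mul_left_comm _ 27, wt_inv_mul, mul_one]
      _ = 27 * ∑' l, ∑' k, a l ^ 2 * b (k - l) ^ 2 := by
          rw [ENNReal.tsum_mul_left, ENNReal.tsum_comm]
      _ = _ := by
          congr 1
          rw [← ENNReal.tsum_mul_right]
          congr 1; ext l
          rw [ENNReal.tsum_mul_left, tsum_sub_right (fun k => b k ^ 2)]
  have hB2 : ∑' k, (wt k)⁻¹ * ((∑' l, (if wt k ≤ wt l then (wt l)⁻¹ * a l else 0) ^ 2)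
        * ∑' l, b l ^ 2) ≤ 27 * ((∑' k, a k ^ 2) * ∑' k, b k ^ 2) := by
    calc _ = (∑' k, ∑' l, (if wt k ≤ wt l then (wt k)⁻¹ else 0) * ((wt l)⁻¹ * a l) ^ 2)
          * ∑' l, b l ^ 2 := by
          rw [← ENNReal.tsum_mul_right]
          congr 1; ext k
          rw [← mul_assoc, ← ENNReal.tsum_mul_left (a := (wt k)⁻¹)]
          congr 1
          refine tsum_congr fun l => ?_
          split_ifs <;> simp
      _ = (∑' l, (∑' k, (if wt k ≤ wt l then (wt k)⁻¹ else 0)) * ((wt l)⁻¹ * a l) ^ 2)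
          * ∑' l, b l ^ 2 := by
          rw [ENNReal.tsum_comm]
          congr 2; ext l
          rw [ENNReal.tsum_mul_right]
      _ ≤ (∑' l, (27 * wt l ^ 2) * ((wt l)⁻¹ * a l) ^ 2) * ∑' l, b l ^ 2 := by
          gcongr with l
          exact tsum_wt_le l
      _ = (∑' l, 27 * a l ^ 2) * ∑' l, b l ^ 2 := by
          congr 2; ext l
          rw [mul_assoc, ← mul_pow, ← mul_assoc, wt_mul_inv, one_mul]
      _ = _ := by rw [ENNReal.tsum_mul_left, mul_assoc]
  calc _ ≤ ∑' k, (2 * ((wt k)⁻¹ * (27 * wt k * ∑' l, a l ^ 2 * b (k - l) ^ 2))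
        + 2 * ((wt k)⁻¹ * ((∑' l, (if wt k ≤ wt l then (wt l)⁻¹ * a l else 0) ^ 2)
        * ∑' l, b l ^ 2))) := by
        gcongr with k
        rw [← mul_add, ← mul_add, mul_left_comm]
        gcongr
        exact (hsplit k).trans (by gcongr; exacts [hA k, hB k])
    _ ≤ _ := by
        rw [ENNReal.tsum_add, ENNReal.tsum_mul_left, ENNReal.tsum_mul_left, hA2]
        refine (add_le_add_right (mul_le_mul_right hB2 2) _).trans (le_of_eq ?_)
        ring

/-! ### Space-time norms and the nonlinearity -/

/-- The Fourier coefficients of `(a·∇)b` for `a` constant and `b` a single mode `m`. -/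
def convTerm (m : Mode) (a b : C3) : C3 := (Complex.I * ∑ j, a j * (m j : ℂ)) • b

/-- The Fourier coefficients of `(u·∇)u`. -/
def burgersNL (x : Mode → C3) (k : Mode) : C3 := ∑' l, convTerm (k - l) (x l) (x (k - l))

/-- `|m|` as an extended nonnegative real. -/
def modeNormE (m : Mode) : ℝ≥0∞ := ENNReal.ofReal (modeNorm m)

lemma modeNormE_le_wt (m : Mode) : modeNormE m ≤ wt m :=
  ENNReal.ofReal_le_ofReal (modeNorm_le_bracket m)

lemma norm_sum_mul_mode_le (m : Mode) (a : C3) : ‖∑ j, a j * (m j : ℂ)‖ ≤ ‖a‖ * modeNorm m := by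
  have h1 : ∑ j, a j * (m j : ℂ) = inner ℂ (WithLp.toLp 2 fun i => (m i : ℂ) : C3) a := by
    rw [PiLp.inner_apply]
    simp
  have h2 : ‖(WithLp.toLp 2 fun i => (m i : ℂ) : C3)‖ = modeNorm m := by
    rw [← sq_eq_sq₀ (norm_nonneg _) (modeNorm_nonneg _), modeNorm_sq, EuclideanSpace.norm_sq_eq]
    simp
  rw [h1, ← h2, mul_comm]
  exact norm_inner_le_norm _ _

lemma norm_convTerm_le (m : Mode) (a b : C3) : ‖convTerm m a b‖ ≤ ‖a‖ * (modeNorm m * ‖b‖) := by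
  rw [convTerm, norm_smul, norm_mul, Complex.norm_I, one_mul, ← mul_assoc]
  gcongr
  exact norm_sum_mul_mode_le m a

lemma enorm_convTerm_le (m : Mode) (a b : C3) :
    ‖convTerm m a b‖ₑ ≤ ‖a‖ₑ * (modeNormE m * ‖b‖ₑ) := by
  have := ENNReal.ofReal_le_ofReal (norm_convTerm_le m a b)
  rwa [ENNReal.ofReal_mul (norm_nonneg _), ENNReal.ofReal_mul (modeNorm_nonneg _), ofReal_norm,
    ofReal_norm, ofReal_norm] at this

lemma convTerm_sub (m : Mode) (a b c d : C3) :
    convTerm m a b - convTerm m c d = convTerm m (a - c) b + convTerm m c (b - d) := by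
  simp only [convTerm, PiLp.sub_apply, sub_mul, Finset.sum_sub_distrib, mul_sub, sub_smul, smul_sub]
  abel

/-- The Gevrey weight `exp (σ √t |k|)`. -/
def gev (σ : ℝ) (k : Mode) (t : ℝ) : ℝ≥0∞ := ENNReal.ofReal (Real.exp (σ * √t * modeNorm k))

lemma measurable_gev (σ : ℝ) (k : Mode) : Measurable (gev σ k) := by
  unfold gev
  fun_prop

lemma gev_ne_top (σ : ℝ) (k : Mode) (t : ℝ) : gev σ k t ≠ ⊤ := ENNReal.ofReal_ne_top

@[simp] lemma gev_zero_left (k : Mode) (t : ℝ) : gev 0 k t = 1 := by simp [gev]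

@[simp] lemma gev_zero_right (σ : ℝ) (k : Mode) : gev σ k 0 = 1 := by simp [gev]

lemma one_le_gev {σ : ℝ} (hσ : 0 ≤ σ) (k : Mode) (t : ℝ) : 1 ≤ gev σ k t := by
  rw [gev, ENNReal.one_le_ofReal, Real.one_le_exp_iff]
  have := modeNorm_nonneg k
  positivity

/-- The triangle inequality for |k| in the exponent. It lets the Gevrey weight be distributed over
the factors of a convolution at no cost. -/
lemma gev_le_mul {σ : ℝ} (hσ : 0 ≤ σ) (k l : Mode) (t : ℝ) :
    gev σ k t ≤ gev σ l t * gev σ (k - l) t := by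
  rw [gev, gev, gev, ← ENNReal.ofReal_mul (Real.exp_pos _).le, ← Real.exp_add, ← mul_add]
  apply ENNReal.ofReal_le_ofReal
  gcongr
  simpa using modeNorm_add_le l (k - l)

/-- The `L⁴(0,T)` norm. -/
def n4 (T : ℝ) (g : ℝ → ℝ≥0∞) : ℝ≥0∞ := (∫⁻ t in Ioc 0 T, g t ^ 4) ^ (1 / 4 : ℝ)

lemma n4_pow_four (T : ℝ) (g : ℝ → ℝ≥0∞) : n4 T g ^ 4 = ∫⁻ t in Ioc 0 T, g t ^ 4 := by
  rw [n4, ← ENNReal.rpow_natCast, ← ENNReal.rpow_mul]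
  norm_num

lemma n4_le_of_pow_le {T : ℝ} {g : ℝ → ℝ≥0∞} {c : ℝ≥0∞} (h : ∫⁻ t in Ioc 0 T, g t ^ 4 ≤ c ^ 4) :
    n4 T g ≤ c := by
  rw [← n4_pow_four] at h
  exact (ENNReal.pow_right_strictMono (by norm_num)).le_iff_le.1 h

/-- The square of the norm of `L̃⁴(0,T;H¹)` with Gevrey weight. -/
def zNorm (T σ : ℝ) (a : Mode → ℝ → C3) : ℝ≥0∞ :=
  ∑' k, (wt k * n4 T fun t => gev σ k t * ‖a k t‖ₑ) ^ 2

/-- The square of the norm of `L²(0,T;H^{-1/2})` with Gevrey weight. -/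
def fNorm (T σ : ℝ) (f : Mode → ℝ → C3) : ℝ≥0∞ :=
  ∑' k, (wt k)⁻¹ * ∫⁻ t in Ioc 0 T, (gev σ k t * ‖f k t‖ₑ) ^ 2

/-- Minkowski's inequality in L² for countable sums: expand the square and apply Cauchy-Schwarz to
every cross term. -/
lemma lintegral_tsum_sq_le {ι α : Type*} [Countable ι] [MeasurableSpace α] {μ : Measure α}
    (g : ι → α → ℝ≥0∞) (hg : ∀ i, AEMeasurable (g i) μ) :
    ∫⁻ x, (∑' i, g i x) ^ 2 ∂μ ≤ (∑' i, (∫⁻ x, g i x ^ 2 ∂μ) ^ (1 / 2 : ℝ)) ^ 2 := by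
  calc ∫⁻ x, (∑' i, g i x) ^ 2 ∂μ = ∫⁻ x, ∑' i, ∑' j, g i x * g j x ∂μ := by
        congr 1; ext x
        rw [sq, ← ENNReal.tsum_mul_right]
        simp_rw [ENNReal.tsum_mul_left]
    _ = ∑' i, ∑' j, ∫⁻ x, g i x * g j x ∂μ := by
        rw [lintegral_tsum]
        · refine tsum_congr fun i => ?_
          rw [lintegral_tsum]
          exact fun j => (hg i).mul (hg j)
        · exact fun i => AEMeasurable.tsum fun j => (hg i).mul (hg j)
    _ ≤ ∑' i, ∑' j, (∫⁻ x, g i x ^ 2 ∂μ) ^ (1 / 2 : ℝ) * (∫⁻ x, g j x ^ 2 ∂μ) ^ (1 / 2 : ℝ) := by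
        gcongr with i j
        have h := ENNReal.lintegral_mul_le_Lp_mul_Lq μ Real.HolderConjugate.two_two (hg i) (hg j)
        simpa only [Pi.mul_apply, ENNReal.rpow_two] using h
    _ = _ := by
        rw [sq, ← ENNReal.tsum_mul_right]
        simp_rw [ENNReal.tsum_mul_left]

lemma lintegral_mul_sq_le_n4 {T : ℝ} {f g : ℝ → ℝ≥0∞}
    (hf : AEMeasurable f (volume.restrict (Ioc 0 T)))
    (hg : AEMeasurable g (volume.restrict (Ioc 0 T))) :
    (∫⁻ t in Ioc 0 T, (f t * g t) ^ 2) ^ (1 / 2 : ℝ) ≤ n4 T f * n4 T g := by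
  have h := lintegral_mul_sq_le (hf.pow_const 2) (hg.pow_const 2)
  simp only [← mul_pow, ← pow_mul] at h
  norm_num at h
  rw [← n4_pow_four, ← n4_pow_four, ← mul_pow, show 4 = 2 * 2 by norm_num, pow_mul,
    (ENNReal.pow_right_strictMono (by norm_num : 2 ≠ 0)).le_iff_le] at h
  calc _ ≤ ((n4 T f * n4 T g) ^ 2) ^ (1 / 2 : ℝ) := ENNReal.rpow_le_rpow h (by norm_num)
    _ = _ := by
      rw [← ENNReal.rpow_natCast, ← ENNReal.rpow_mul]
      norm_num

lemma lintegral_conv_sq_le {T : ℝ} (a b : Mode → ℝ → ℝ≥0∞)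
    (ha : ∀ k, AEMeasurable (a k) (volume.restrict (Ioc 0 T)))
    (hb : ∀ k, AEMeasurable (b k) (volume.restrict (Ioc 0 T))) (k : Mode) :
    ∫⁻ t in Ioc 0 T, (∑' l, a l t * b (k - l) t) ^ 2
      ≤ (conv (fun l => n4 T (a l)) (fun l => n4 T (b l)) k) ^ 2 := by
  refine (lintegral_tsum_sq_le (fun l t => a l t * b (k - l) t)
    fun l => (ha l).mul (hb (k - l))).trans ?_
  rw [conv]
  gcongr with l
  exact lintegral_mul_sq_le_n4 (ha l) (hb (k - l))

/-- The convolution sum that dominates the nonlinearity. -/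
def gradConv (a b : Mode → ℝ → C3) (k : Mode) (t : ℝ) : ℝ≥0∞ :=
  ∑' l, ‖a l t‖ₑ * (modeNormE (k - l) * ‖b (k - l) t‖ₑ)

lemma gev_mul_gradConv_le {σ : ℝ} (hσ : 0 ≤ σ) (a b : Mode → ℝ → C3) (k : Mode) (t : ℝ) :
    gev σ k t * gradConv a b k t
      ≤ ∑' l, (gev σ l t * ‖a l t‖ₑ) *
          (modeNormE (k - l) * (gev σ (k - l) t * ‖b (k - l) t‖ₑ)) := by
  rw [gradConv, ← ENNReal.tsum_mul_left]
  refine ENNReal.tsum_le_tsum fun l => ?_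
  calc _ ≤ (gev σ l t * gev σ (k - l) t) * (‖a l t‖ₑ * (modeNormE (k - l) * ‖b (k - l) t‖ₑ)) := by
        gcongr
        exact gev_le_mul hσ k l t
    _ = _ := by ring

/-- Measurability of all modes on `(0,T)`. -/
def ModesMeas (T : ℝ) (a : Mode → ℝ → C3) : Prop :=
  ∀ k, AEStronglyMeasurable (a k) (volume.restrict (Ioc 0 T))

lemma n4_const_mul {T : ℝ} (c : ℝ≥0∞) (hc : c ≠ ⊤) (g : ℝ → ℝ≥0∞) :
    n4 T (fun t => c * g t) = c * n4 T g := by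
  rw [n4]
  simp only [mul_pow]
  rw [lintegral_const_mul' _ _ (ENNReal.pow_ne_top hc), ENNReal.mul_rpow_of_nonneg _ _ (by norm_num),
    n4, ← ENNReal.rpow_natCast, ← ENNReal.rpow_mul]
  norm_num

/-- The bilinear estimate L̃⁴H¹ × L̃⁴H¹ → L²H^{-1/2}. The weight is distributed over the factors,
Minkowski brings the time norm inside the convolution, Hölder splits L² into L⁴·L⁴, and
`tsum_conv_sq_le` closes; the gradient costs one `wt` on the second factor, which leaves it in L².
-/
lemma tsum_gradConv_le {T σ : ℝ} (hσ : 0 ≤ σ) {a b : Mode → ℝ → C3}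
    (ha : ModesMeas T a) (hb : ModesMeas T b) :
    ∑' k, (wt k)⁻¹ * ∫⁻ t in Ioc 0 T, (gev σ k t * gradConv a b k t) ^ 2
      ≤ 108 * (zNorm T σ a * zNorm T σ b) := by
  have ham : ∀ k, AEMeasurable (fun t => gev σ k t * ‖a k t‖ₑ) (volume.restrict (Ioc 0 T)) :=
    fun k => (measurable_gev σ k).aemeasurable.mul (ha k).enorm
  have hbm : ∀ k, AEMeasurable (fun t => gev σ k t * ‖b k t‖ₑ) (volume.restrict (Ioc 0 T)) :=
    fun k => (measurable_gev σ k).aemeasurable.mul (hb k).enorm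
  refine le_trans ?_ (tsum_conv_sq_le (fun k => wt k * n4 T fun t => gev σ k t * ‖a k t‖ₑ)
    (fun k => wt k * n4 T fun t => gev σ k t * ‖b k t‖ₑ))
  gcongr with k
  calc ∫⁻ t in Ioc 0 T, (gev σ k t * gradConv a b k t) ^ 2
      ≤ ∫⁻ t in Ioc 0 T, (∑' l, (gev σ l t * ‖a l t‖ₑ) *
          (modeNormE (k - l) * (gev σ (k - l) t * ‖b (k - l) t‖ₑ))) ^ 2 := by
        gcongr with t
        exact gev_mul_gradConv_le hσ a b k t
    _ ≤ _ := lintegral_conv_sq_le (fun l t => gev σ l t * ‖a l t‖ₑ)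
        (fun l t => modeNormE l * (gev σ l t * ‖b l t‖ₑ)) ham
        (fun l => (hbm l).const_mul _) k
    _ ≤ _ := by
        gcongr
        rw [conv, conv]
        gcongr with l
        · rw [← mul_assoc, wt_inv_mul, one_mul]
        · rw [n4_const_mul (modeNormE (k - l)) ENNReal.ofReal_ne_top]
          gcongr
          exact modeNormE_le_wt _

/-- Two convolutions are allowed because a difference of two quadratic terms splits into two
bilinear ones. The doubling of 108 comes from squaring the sum. -/
lemma fNorm_le {T σ : ℝ} (hσ : 0 ≤ σ) {f a b c d : Mode → ℝ → C3}
    (ha : ModesMeas T a) (hb : ModesMeas T b) (hc : ModesMeas T c) (hd : ModesMeas T d)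
    (h : ∀ k, ∀ᵐ t ∂volume.restrict (Ioc 0 T),
      ‖f k t‖ₑ ≤ gradConv a b k t + gradConv c d k t) :
    fNorm T σ f ≤ 216 * (zNorm T σ a * zNorm T σ b + zNorm T σ c * zNorm T σ d) := by
  have hm : ∀ k, AEMeasurable (fun t => (gev σ k t * gradConv a b k t) ^ 2)
      (volume.restrict (Ioc 0 T)) := fun k => by
    refine (((measurable_gev σ k).aemeasurable).mul ?_).pow_const 2
    exact AEMeasurable.tsum fun l => (ha l).enorm.mul ((hb (k - l)).enorm.const_mul _)
  calc fNorm T σ f ≤ ∑' k, (wt k)⁻¹ * (2 * ((∫⁻ t in Ioc 0 T, (gev σ k t * gradConv a b k t) ^ 2)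
        + ∫⁻ t in Ioc 0 T, (gev σ k t * gradConv c d k t) ^ 2)) := by
        rw [fNorm]
        gcongr with k
        rw [← lintegral_add_left' (hm k), ← lintegral_const_mul' _ _ (by norm_num)]
        apply lintegral_mono_ae
        filter_upwards [h k] with t ht
        refine le_trans ?_ (add_sq_le_two_mul _ _)
        rw [← mul_add]
        gcongr
    _ = 2 * ((∑' k, (wt k)⁻¹ * ∫⁻ t in Ioc 0 T, (gev σ k t * gradConv a b k t) ^ 2)
        + ∑' k, (wt k)⁻¹ * ∫⁻ t in Ioc 0 T, (gev σ k t * gradConv c d k t) ^ 2) := by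
        rw [← ENNReal.tsum_add, ← ENNReal.tsum_mul_left]
        refine tsum_congr fun k => ?_
        ring
    _ ≤ 2 * (108 * (zNorm T σ a * zNorm T σ b) + 108 * (zNorm T σ c * zNorm T σ d)) := by
        gcongr
        · exact tsum_gradConv_le hσ ha hb
        · exact tsum_gradConv_le hσ hc hd
    _ = _ := by ring

/-! ### The heat kernel on a single mode -/

/-- The kernel `e^{-λx}` on `x ≥ 0`. -/
def expKer (c x : ℝ) : ℝ≥0∞ := if 0 ≤ x then ENNReal.ofReal (Real.exp (-c * x)) else 0

lemma measurable_expKer (c : ℝ) : Measurable (expKer c) := by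
  unfold expKer
  exact Measurable.ite measurableSet_Ici (by fun_prop) measurable_const

lemma lintegral_expKer {c : ℝ} (hc : 0 < c) : ∫⁻ x, expKer c x = ENNReal.ofReal (1 / c) := by
  have h1 : expKer c = (Ici (0 : ℝ)).indicator fun x => ENNReal.ofReal (Real.exp (-c * x)) := by
    ext x
    simp [expKer, indicator_apply]
  rw [h1, lintegral_indicator measurableSet_Ici, setLIntegral_congr Ioi_ae_eq_Ici.symm,
    ← ofReal_integral_eq_lintegral_ofReal]
  · rw [integral_exp_mul_Ioi (by linarith)]
    simp
  · exact integrableOn_exp_mul_Ioi (by linarith) 0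
  · exact Eventually.of_forall fun x => (Real.exp_pos _).le

lemma expKer_le_one {c : ℝ} (hc : 0 < c) (x : ℝ) : expKer c x ≤ 1 := by
  unfold expKer
  split_ifs with h
  · rw [ENNReal.ofReal_le_one, Real.exp_le_one_iff]
    nlinarith
  · exact zero_le

lemma expKer_half_sq (c x : ℝ) : expKer (c / 2) x ^ 2 = expKer c x := by
  unfold expKer
  split_ifs
  · rw [← ENNReal.ofReal_pow (Real.exp_pos _).le, ← Real.exp_nat_mul]
    congr 2
    push_cast
    ring
  · simp

/-- The convolution with `expKer` of a function on `(0,T)`. -/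
def kerConv (T c : ℝ) (g : ℝ → ℝ≥0∞) (t : ℝ) : ℝ≥0∞ := ∫⁻ s in Ioc 0 T, expKer c (t - s) * g s

/-- Cauchy-Schwarz, giving L² → L^∞. The kernel is at most 1, so its square integral is at most its
integral 1/c. -/
lemma kerConv_sq_le {T c : ℝ} (hc : 0 < c) {g : ℝ → ℝ≥0∞}
    (hg : AEMeasurable g (volume.restrict (Ioc 0 T))) (t : ℝ) :
    kerConv T c g t ^ 2 ≤ ENNReal.ofReal (1 / c) * ∫⁻ s in Ioc 0 T, g s ^ 2 := by
  have hm : Measurable fun s => expKer c (t - s) := (measurable_expKer c).comp (by fun_prop)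
  refine (lintegral_mul_sq_le hm.aemeasurable hg).trans ?_
  gcongr
  calc ∫⁻ s in Ioc 0 T, expKer c (t - s) ^ 2 ≤ ∫⁻ s, expKer c (t - s) ^ 2 :=
        setLIntegral_le_lintegral _ _
    _ ≤ ∫⁻ s, expKer c (t - s) := by
        gcongr with s
        exact pow_le_of_le_one zero_le (expKer_le_one hc _) (by norm_num)
    _ = ∫⁻ s, expKer c s := lintegral_sub_left_eq_self _ t
    _ = _ := lintegral_expKer hc

/-- Young's inequality L¹ * L² ⊂ L²: the kernel is written as a product of two square roots, one of
them stays with `g` in Cauchy-Schwarz, and Tonelli finishes. -/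
lemma lintegral_kerConv_sq_le {T c : ℝ} (hc : 0 < c) {g : ℝ → ℝ≥0∞}
    (hg : AEMeasurable g (volume.restrict (Ioc 0 T))) :
    ∫⁻ t, kerConv T c g t ^ 2 ≤ ENNReal.ofReal (1 / c) ^ 2 * ∫⁻ s in Ioc 0 T, g s ^ 2 := by
  have hm : ∀ c' t, Measurable fun s => expKer c' (t - s) :=
    fun c' t => (measurable_expKer c').comp (by fun_prop)
  have h1 : ∀ t, kerConv T c g t ^ 2
      ≤ ENNReal.ofReal (1 / c) * ∫⁻ s in Ioc 0 T, expKer c (t - s) * g s ^ 2 := by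
    intro t
    have h2 : kerConv T c g t
        = ∫⁻ s in Ioc 0 T, expKer (c / 2) (t - s) * (expKer (c / 2) (t - s) * g s) := by
      rw [kerConv]
      congr 1; ext s
      rw [← mul_assoc, ← sq, expKer_half_sq]
    rw [h2]
    refine (lintegral_mul_sq_le (hm _ t).aemeasurable ((hm _ t).aemeasurable.mul hg)).trans ?_
    simp only [Pi.mul_apply, mul_pow, expKer_half_sq]
    gcongr
    calc ∫⁻ s in Ioc 0 T, expKer c (t - s) ≤ ∫⁻ s, expKer c (t - s) :=
          setLIntegral_le_lintegral _ _
      _ = ∫⁻ s, expKer c s := lintegral_sub_left_eq_self _ t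
      _ = _ := lintegral_expKer hc
  calc ∫⁻ t, kerConv T c g t ^ 2
      ≤ ∫⁻ t, ENNReal.ofReal (1 / c) * ∫⁻ s in Ioc 0 T, expKer c (t - s) * g s ^ 2 :=
        lintegral_mono h1
    _ = ENNReal.ofReal (1 / c) * ∫⁻ s in Ioc 0 T, ∫⁻ t, expKer c (t - s) * g s ^ 2 := by
        rw [lintegral_const_mul' _ _ ENNReal.ofReal_ne_top, lintegral_lintegral_swap]
        refine AEMeasurable.mul ?_ ?_
        · exact ((measurable_expKer c).comp (measurable_fst.sub measurable_snd)).aemeasurable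
        · exact (hg.pow_const 2).comp_snd
    _ = ENNReal.ofReal (1 / c) * ∫⁻ s in Ioc 0 T, ENNReal.ofReal (1 / c) * g s ^ 2 := by
        congr 1
        refine lintegral_congr fun s => ?_
        rw [lintegral_mul_const _ (show Measurable fun t => expKer c (t - s) from
          (measurable_expKer c).comp (by fun_prop)),
          lintegral_sub_right_eq_self (expKer c) s, lintegral_expKer hc]
    _ = _ := by rw [lintegral_const_mul' _ _ ENNReal.ofReal_ne_top, sq, mul_assoc]

/-! ### Maximal regularity on Fourier modes -/

/-- The symbol `ν|k|²` of `-νΔ`. -/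
def heatRate (ν : ℝ) (k : Mode) : ℝ := ν * modeNorm k ^ 2

lemma heatRate_nonneg {ν : ℝ} (hν : 0 ≤ ν) (k : Mode) : 0 ≤ heatRate ν k := by
  unfold heatRate; positivity

/-- The constant in the comparison of heat kernels. -/
def kerConst (ν T : ℝ) : ℝ≥0∞ := ENNReal.ofReal (Real.exp (1 / (2 * ν) + ν * T / 2))

lemma kerConst_ne_top (ν T : ℝ) : kerConst ν T ≠ ⊤ := ENNReal.ofReal_ne_top

lemma kerConst_mono {ν S T : ℝ} (hν : 0 < ν) (h : S ≤ T) : kerConst ν S ≤ kerConst ν T := by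
  unfold kerConst
  gcongr

lemma sqrt_sub_sqrt_le {s t : ℝ} (hs : 0 ≤ s) (hst : s ≤ t) : √t - √s ≤ √(t - s) := by
  rw [sub_le_iff_le_add, Real.sqrt_le_left (by positivity)]
  have h1 := Real.sq_sqrt hs
  have h2 := Real.sq_sqrt (sub_nonneg.2 hst)
  have h3 : 0 ≤ √(t - s) * √s := by positivity
  nlinarith

/-- Half of the heat decay pays for the growth of the Gevrey weight between `s` and `t`, since √t -
√s ≤ √(t-s) and Young's inequality applies to √(t-s)|k|. The other half remains, with |k|² replaced
by 1 + |k|² at the price of e^{νT/2}. -/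
lemma kernel_le {ν σ T s t : ℝ} (hν : 0 < ν) (hσ1 : σ ≤ 1) (hs : 0 ≤ s) (hst : s ≤ t)
    (htT : t ≤ T) (k : Mode) :
    gev σ k t * ENNReal.ofReal (Real.exp (-heatRate ν k * (t - s)))
      ≤ kerConst ν T * (expKer (ν / 2 * bracket k ^ 2) (t - s) * gev σ k s) := by
  rw [expKer, if_pos (sub_nonneg.2 hst), gev, gev, kerConst, ← ENNReal.ofReal_mul (Real.exp_pos _).le,
    ← ENNReal.ofReal_mul (Real.exp_pos _).le, ← ENNReal.ofReal_mul (Real.exp_pos _).le,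
    ← Real.exp_add, ← Real.exp_add, ← Real.exp_add]
  refine ENNReal.ofReal_le_ofReal (Real.exp_le_exp.2 ?_)
  simp only [heatRate, bracket_sq]
  have hm := modeNorm_nonneg k
  set m := modeNorm k
  have h1 : σ * √t * m - σ * √s * m ≤ √(t - s) * m := by
    have h2 := sqrt_sub_sqrt_le hs hst
    have h3 : 0 ≤ √t - √s := sub_nonneg.2 (Real.sqrt_le_sqrt hst)
    calc σ * √t * m - σ * √s * m = σ * ((√t - √s) * m) := by ring
      _ ≤ 1 * ((√t - √s) * m) := by gcongr
      _ ≤ _ := by rw [one_mul]; gcongr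
  set r := √(t - s) with hr
  have hr2 : r ^ 2 = t - s := Real.sq_sqrt (sub_nonneg.2 hst)
  -- Completing the square; this is the source of 1/(2ν) in `kerConst`.
  have h4 : r * m ≤ 1 / (2 * ν) + ν / 2 * (r * m) ^ 2 := by
    have : 1 / (2 * ν) + ν / 2 * (r * m) ^ 2 - r * m = (1 - ν * (r * m)) ^ 2 / (2 * ν) := by
      field_simp
      ring
    have h5 : 0 ≤ (1 - ν * (r * m)) ^ 2 / (2 * ν) := by positivity
    linarith
  rw [← hr2]
  have h6 : r ^ 2 ≤ T := by linarith
  have h7 : ν / 2 * r ^ 2 ≤ ν / 2 * T := by gcongr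
  nlinarith

/-- The Duhamel integral of a single mode. -/
def duhamel (ν : ℝ) (f : Mode → ℝ → C3) (k : Mode) (t : ℝ) : C3 :=
  ∫ s in (0 : ℝ)..t, Real.exp (-heatRate ν k * (t - s)) • f k s

/-- The heat flow of a sequence of Fourier coefficients. -/
def heatFlow (ν : ℝ) (x : Mode → C3) (k : Mode) (t : ℝ) : C3 := Real.exp (-heatRate ν k * t) • x k

/-- The rate of decay in the comparison kernel. -/
def cmpRate (ν : ℝ) (k : Mode) : ℝ := ν / 2 * bracket k ^ 2

lemma cmpRate_pos {ν : ℝ} (hν : 0 < ν) (k : Mode) : 0 < cmpRate ν k := by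
  have := bracket_pos k
  unfold cmpRate
  positivity

lemma ofReal_inv_cmpRate {ν : ℝ} (hν : 0 < ν) (k : Mode) :
    ENNReal.ofReal (1 / cmpRate ν k) = ENNReal.ofReal (2 / ν) * (wt k)⁻¹ ^ 2 := by
  have := bracket_pos k
  rw [wt, ← ENNReal.ofReal_inv_of_pos this, ← ENNReal.ofReal_pow (by positivity),
    ← ENNReal.ofReal_mul (by positivity)]
  congr 1
  rw [cmpRate]
  field_simp

lemma gev_mul_duhamel_le {ν σ T t : ℝ} (hν : 0 < ν) (hσ1 : σ ≤ 1)
    (ht : t ∈ Icc 0 T) (f : Mode → ℝ → C3) (k : Mode) :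
    gev σ k t * ‖duhamel ν f k t‖ₑ
      ≤ kerConst ν T * kerConv T (cmpRate ν k) (fun s => gev σ k s * ‖f k s‖ₑ) t := by
  calc gev σ k t * ‖duhamel ν f k t‖ₑ
      ≤ gev σ k t * ∫⁻ s in Ioc 0 t, ‖Real.exp (-heatRate ν k * (t - s)) • f k s‖ₑ := by
        gcongr
        rw [duhamel, intervalIntegral.integral_of_le ht.1]
        exact enorm_integral_le_lintegral_enorm _
    _ = ∫⁻ s in Ioc 0 t,
          gev σ k t * ENNReal.ofReal (Real.exp (-heatRate ν k * (t - s))) * ‖f k s‖ₑ := by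
        rw [← lintegral_const_mul' _ _ (gev_ne_top σ k t)]
        refine lintegral_congr fun s => ?_
        rw [enorm_smul, Real.enorm_of_nonneg (Real.exp_pos _).le, mul_assoc]
    _ ≤ ∫⁻ s in Ioc 0 t,
          kerConst ν T * (expKer (cmpRate ν k) (t - s) * (gev σ k s * ‖f k s‖ₑ)) := by
        apply setLIntegral_mono' measurableSet_Ioc
        intro s hs
        refine (mul_le_mul_left (kernel_le hν hσ1 hs.1.le hs.2 ht.2 k) _).trans (le_of_eq ?_)
        rw [cmpRate]
        ring
    _ ≤ ∫⁻ s in Ioc 0 T,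
          kerConst ν T * (expKer (cmpRate ν k) (t - s) * (gev σ k s * ‖f k s‖ₑ)) :=
        lintegral_mono_set (Ioc_subset_Ioc_right ht.2)
    _ = _ := by rw [lintegral_const_mul' _ _ (kerConst_ne_top ν T), kerConv]

lemma gev_mul_heatFlow_le {ν σ T t : ℝ} (hν : 0 < ν) (hσ1 : σ ≤ 1)
    (ht : t ∈ Icc 0 T) (x : Mode → C3) (k : Mode) :
    gev σ k t * ‖heatFlow ν x k t‖ₑ ≤ kerConst ν T * (expKer (cmpRate ν k) t * ‖x k‖ₑ) := by
  rw [heatFlow, enorm_smul, Real.enorm_of_nonneg (Real.exp_pos _).le, ← mul_assoc, ← mul_assoc]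
  have h := kernel_le hν hσ1 le_rfl ht.1 ht.2 k
  rw [sub_zero, gev_zero_right, mul_one] at h
  exact mul_le_mul_left h _

/-- The square of the norm of `L̃^∞(0,T;H^{1/2})` with Gevrey weight. -/
def sNorm (T σ : ℝ) (a : Mode → ℝ → C3) : ℝ≥0∞ :=
  ∑' k, wt k * (⨆ t ∈ Icc 0 T, gev σ k t * ‖a k t‖ₑ) ^ 2

/-- The square of the norm of `L²(0,T;H^{3/2})` with Gevrey weight. -/
def hNorm (T σ : ℝ) (a : Mode → ℝ → C3) : ℝ≥0∞ :=
  ∑' k, wt k ^ 3 * ∫⁻ t in Ioc 0 T, (gev σ k t * ‖a k t‖ₑ) ^ 2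

/-- The constant of maximal regularity. -/
def regConst (ν T : ℝ) : ℝ≥0∞ := kerConst ν T ^ 2 * (1 + ENNReal.ofReal (2 / ν)) ^ 2

lemma regConst_ne_top (ν T : ℝ) : regConst ν T ≠ ⊤ := by
  unfold regConst
  have := kerConst_ne_top ν T
  finiteness

lemma regConst_mono {ν S T : ℝ} (hν : 0 < ν) (h : S ≤ T) : regConst ν S ≤ regConst ν T := by
  unfold regConst
  gcongr
  exact kerConst_mono hν h

lemma n4_mono {T : ℝ} {f g : ℝ → ℝ≥0∞} (h : ∀ t ∈ Ioc 0 T, f t ≤ g t) : n4 T f ≤ n4 T g := by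
  unfold n4
  gcongr ?_ ^ _
  apply setLIntegral_mono' measurableSet_Ioc
  intro t ht
  have := h t ht
  gcongr

lemma aemeasurable_gev_mul {T σ : ℝ} {f : Mode → ℝ → C3} (hf : ModesMeas T f) (k : Mode) :
    AEMeasurable (fun t => gev σ k t * ‖f k t‖ₑ) (volume.restrict (Ioc 0 T)) :=
  (measurable_gev σ k).aemeasurable.mul (hf k).enorm

lemma wt_mul_inv_pow (k : Mode) (m n : ℕ) (c : ℝ≥0∞) :
    wt k ^ (m + n) * ((wt k)⁻¹ ^ n * c) = wt k ^ m * c := by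
  rw [pow_add, mul_assoc, ← mul_assoc (wt k ^ n), ← mul_pow, wt_mul_inv, one_pow, one_mul]

/-- On each mode the fourth power is bounded by (sup)²·∫(·)². With `c = cmpRate ν k`, the L² → L^∞
and L² → L² bounds give c^{-3}, that is wt^{-6}, so the squared L⁴ norm gains wt^{-3}, which against
the weight wt² leaves the wt^{-1} of H^{-1/2}. -/
lemma zNorm_duhamel_le {ν σ T : ℝ} (hν : 0 < ν) (hσ1 : σ ≤ 1) {f : Mode → ℝ → C3}
    (hf : ModesMeas T f) : zNorm T σ (duhamel ν f) ≤ regConst ν T * fNorm T σ f := by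
  rw [zNorm, fNorm, ← ENNReal.tsum_mul_left]
  refine ENNReal.tsum_le_tsum fun k => ?_
  set g : ℝ → ℝ≥0∞ := fun s => gev σ k s * ‖f k s‖ₑ with hg
  have hgm : AEMeasurable g (volume.restrict (Ioc 0 T)) := aemeasurable_gev_mul hf k
  set I := ∫⁻ t in Ioc 0 T, g t ^ 2 with hI
  set q := 1 + ENNReal.ofReal (2 / ν) with hq
  have hc := cmpRate_pos hν k
  have h1 : n4 T (fun t => gev σ k t * ‖duhamel ν f k t‖ₑ)
      ≤ kerConst ν T * n4 T (kerConv T (cmpRate ν k) g) := by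
    rw [← n4_const_mul _ (kerConst_ne_top ν T)]
    exact n4_mono fun t ht => gev_mul_duhamel_le hν hσ1 ⟨ht.1.le, ht.2⟩ f k
  have h2 : n4 T (kerConv T (cmpRate ν k) g) ^ 4 ≤ ENNReal.ofReal (1 / cmpRate ν k) ^ 3 * I ^ 2 := by
    -- An infinite constant cannot be pulled out of the integral below, but then the bound is
    -- trivial because its coefficient is nonzero.
    by_cases hIt : I = ⊤
    · have : ENNReal.ofReal (1 / cmpRate ν k) ^ 3 ≠ 0 := by
        simpa using hc
      rw [hIt, ENNReal.top_pow (by norm_num), ENNReal.mul_top this]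
      exact le_top
    rw [n4_pow_four]
    calc ∫⁻ t in Ioc 0 T, kerConv T (cmpRate ν k) g t ^ 4
        ≤ ∫⁻ t in Ioc 0 T, (ENNReal.ofReal (1 / cmpRate ν k) * I)
            * kerConv T (cmpRate ν k) g t ^ 2 := by
          gcongr with t
          rw [show 4 = 2 + 2 by norm_num, pow_add]
          gcongr
          exact kerConv_sq_le hc hgm t
      _ ≤ ENNReal.ofReal (1 / cmpRate ν k) * I * ∫⁻ t, kerConv T (cmpRate ν k) g t ^ 2 := by
          rw [lintegral_const_mul' _ _ (ENNReal.mul_ne_top ENNReal.ofReal_ne_top hIt)]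
          gcongr
          exact Measure.restrict_le_self
      _ ≤ ENNReal.ofReal (1 / cmpRate ν k) * I * (ENNReal.ofReal (1 / cmpRate ν k) ^ 2 * I) := by
          gcongr
          exact lintegral_kerConv_sq_le hc hgm
      _ = _ := by ring
  have h3 : n4 T (kerConv T (cmpRate ν k) g) ^ 2 ≤ q ^ 2 * ((wt k)⁻¹ ^ 3 * I) := by
    rw [← ENNReal.pow_le_pow_left_iff (n := 2) (by norm_num), ← pow_mul]
    refine h2.trans ?_
    rw [ofReal_inv_cmpRate hν]
    calc (ENNReal.ofReal (2 / ν) * (wt k)⁻¹ ^ 2) ^ 3 * I ^ 2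
        ≤ (q * (wt k)⁻¹ ^ 2) ^ 3 * I ^ 2 := by gcongr; exact le_add_self
      _ = q ^ 3 * ((wt k)⁻¹ ^ 3 * I) ^ 2 := by ring
      -- The exponent 3 is raised to 4 so that the right side is a perfect square; this is why `q`
      -- contains the summand 1.
      _ ≤ q ^ 4 * ((wt k)⁻¹ ^ 3 * I) ^ 2 := by
          gcongr
          · exact le_self_add
          · norm_num
      _ = _ := by ring
  calc (wt k * n4 T fun t => gev σ k t * ‖duhamel ν f k t‖ₑ) ^ 2
      ≤ (wt k * (kerConst ν T * n4 T (kerConv T (cmpRate ν k) g))) ^ 2 := by gcongr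
    _ = kerConst ν T ^ 2 * (wt k ^ 2 * n4 T (kerConv T (cmpRate ν k) g) ^ 2) := by ring
    _ ≤ kerConst ν T ^ 2 * (wt k ^ 2 * (q ^ 2 * ((wt k)⁻¹ ^ 3 * I))) := by gcongr
    _ = kerConst ν T ^ 2 * q ^ 2 * (wt k ^ (0 + 2) * ((wt k)⁻¹ ^ 2 * ((wt k)⁻¹ * I))) := by ring
    _ = _ := by rw [wt_mul_inv_pow, pow_zero, one_mul, regConst]

/-- The L² → L^∞ bound gains wt^{-2} on each mode, which turns the weight wt of H^{1/2} into the
wt^{-1} of H^{-1/2}. -/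
lemma sNorm_duhamel_le {ν σ T : ℝ} (hν : 0 < ν) (hσ1 : σ ≤ 1) {f : Mode → ℝ → C3}
    (hf : ModesMeas T f) : sNorm T σ (duhamel ν f) ≤ regConst ν T * fNorm T σ f := by
  rw [sNorm, fNorm, ← ENNReal.tsum_mul_left]
  refine ENNReal.tsum_le_tsum fun k => ?_
  set g : ℝ → ℝ≥0∞ := fun s => gev σ k s * ‖f k s‖ₑ with hg
  have hgm : AEMeasurable g (volume.restrict (Ioc 0 T)) := aemeasurable_gev_mul hf k
  set I := ∫⁻ t in Ioc 0 T, g t ^ 2 with hI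
  set q := 1 + ENNReal.ofReal (2 / ν) with hq
  have hc := cmpRate_pos hν k
  have h1 : ∀ t ∈ Icc 0 T, (gev σ k t * ‖duhamel ν f k t‖ₑ) ^ 2
      ≤ regConst ν T * ((wt k)⁻¹ ^ 2 * I) := by
    intro t ht
    calc (gev σ k t * ‖duhamel ν f k t‖ₑ) ^ 2
        ≤ (kerConst ν T * kerConv T (cmpRate ν k) g t) ^ 2 := by
          exact pow_le_pow_left' (gev_mul_duhamel_le hν hσ1 ht f k) 2
      _ = kerConst ν T ^ 2 * kerConv T (cmpRate ν k) g t ^ 2 := by ring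
      _ ≤ kerConst ν T ^ 2 * (ENNReal.ofReal (2 / ν) * (wt k)⁻¹ ^ 2 * I) := by
          gcongr
          rw [← ofReal_inv_cmpRate hν]
          exact kerConv_sq_le hc hgm t
      _ ≤ kerConst ν T ^ 2 * (q ^ 2 * (wt k)⁻¹ ^ 2 * I) := by
          gcongr
          calc ENNReal.ofReal (2 / ν) ≤ q ^ 1 := by rw [pow_one]; exact le_add_self
            _ ≤ q ^ 2 := pow_le_pow_right₀ le_self_add (by norm_num)
      _ = _ := by rw [regConst]; ring
  have h2 : (⨆ t ∈ Icc 0 T, gev σ k t * ‖duhamel ν f k t‖ₑ) ^ 2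
      ≤ regConst ν T * ((wt k)⁻¹ ^ 2 * I) := by
    rw [← ENNReal.rpow_two, ← ENNReal.le_rpow_inv_iff (by norm_num)]
    refine iSup₂_le fun t ht => ?_
    rw [ENNReal.le_rpow_inv_iff (by norm_num), ENNReal.rpow_two]
    exact h1 t ht
  calc _ ≤ wt k * (regConst ν T * ((wt k)⁻¹ ^ 2 * I)) := by gcongr
    _ = regConst ν T * (wt k ^ (0 + 1) * ((wt k)⁻¹ ^ 1 * ((wt k)⁻¹ * I))) := by ring
    _ = _ := by rw [wt_mul_inv_pow, pow_zero, one_mul]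

/-- The L² → L² bound gains wt^{-4} on each mode: a gain of two derivatives, from H^{-1/2} to
H^{3/2}. -/
lemma hNorm_duhamel_le {ν σ T : ℝ} (hν : 0 < ν) (hσ1 : σ ≤ 1) {f : Mode → ℝ → C3}
    (hf : ModesMeas T f) : hNorm T σ (duhamel ν f) ≤ regConst ν T * fNorm T σ f := by
  rw [hNorm, fNorm, ← ENNReal.tsum_mul_left]
  refine ENNReal.tsum_le_tsum fun k => ?_
  set g : ℝ → ℝ≥0∞ := fun s => gev σ k s * ‖f k s‖ₑ with hg
  have hgm : AEMeasurable g (volume.restrict (Ioc 0 T)) := aemeasurable_gev_mul hf k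
  set I := ∫⁻ t in Ioc 0 T, g t ^ 2 with hI
  set q := 1 + ENNReal.ofReal (2 / ν) with hq
  have hc := cmpRate_pos hν k
  have h1 : ∫⁻ t in Ioc 0 T, (gev σ k t * ‖duhamel ν f k t‖ₑ) ^ 2
      ≤ regConst ν T * ((wt k)⁻¹ ^ 4 * I) := by
    calc ∫⁻ t in Ioc 0 T, (gev σ k t * ‖duhamel ν f k t‖ₑ) ^ 2
        ≤ ∫⁻ t in Ioc 0 T, kerConst ν T ^ 2 * kerConv T (cmpRate ν k) g t ^ 2 := by
          apply setLIntegral_mono' measurableSet_Ioc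
          intro t ht
          rw [← mul_pow]
          have := gev_mul_duhamel_le hν hσ1 ⟨ht.1.le, ht.2⟩ f k
          gcongr
      _ ≤ kerConst ν T ^ 2 * ∫⁻ t, kerConv T (cmpRate ν k) g t ^ 2 := by
          rw [lintegral_const_mul' _ _ (ENNReal.pow_ne_top (kerConst_ne_top ν T))]
          gcongr
          exact Measure.restrict_le_self
      _ ≤ kerConst ν T ^ 2 * ((ENNReal.ofReal (2 / ν) * (wt k)⁻¹ ^ 2) ^ 2 * I) := by
          gcongr
          rw [← ofReal_inv_cmpRate hν]
          exact lintegral_kerConv_sq_le hc hgm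
      _ ≤ kerConst ν T ^ 2 * ((q * (wt k)⁻¹ ^ 2) ^ 2 * I) := by
          gcongr; exact le_add_self
      _ = _ := by rw [regConst]; ring
  calc _ ≤ wt k ^ 3 * (regConst ν T * ((wt k)⁻¹ ^ 4 * I)) := by gcongr
    _ = regConst ν T * (wt k ^ (0 + 3) * ((wt k)⁻¹ ^ 3 * ((wt k)⁻¹ * I))) := by ring
    _ = _ := by rw [wt_mul_inv_pow, pow_zero, one_mul]

/-- The square of the norm in `L̃⁴(0,T;H¹)` of the comparison heat flow of a sequence. -/
def linNorm (ν T : ℝ) (M : Mode → ℝ≥0∞) : ℝ≥0∞ :=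
  ∑' k, (wt k * (M k * n4 T (expKer (cmpRate ν k)))) ^ 2

lemma zNorm_heatFlow_le {ν σ T : ℝ} (hν : 0 < ν) (hσ1 : σ ≤ 1) (x : Mode → C3) :
    zNorm T σ (heatFlow ν x) ≤ kerConst ν T ^ 2 * linNorm ν T (fun k => ‖x k‖ₑ) := by
  rw [zNorm, linNorm, ← ENNReal.tsum_mul_left]
  refine ENNReal.tsum_le_tsum fun k => ?_
  rw [← mul_pow]
  gcongr ?_ ^ 2
  rw [mul_left_comm]
  gcongr
  rw [← n4_const_mul _ enorm_ne_top, ← n4_const_mul _ (kerConst_ne_top ν T)]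
  refine n4_mono fun t ht => ?_
  rw [mul_comm ‖x k‖ₑ]
  exact gev_mul_heatFlow_le hν hσ1 ⟨ht.1.le, ht.2⟩ x k

lemma sNorm_heatFlow_le {ν σ T : ℝ} (hν : 0 < ν) (hσ1 : σ ≤ 1) (x : Mode → C3) :
    sNorm T σ (heatFlow ν x) ≤ kerConst ν T ^ 2 * ∑' k, wt k * ‖x k‖ₑ ^ 2 := by
  rw [sNorm, ← ENNReal.tsum_mul_left]
  refine ENNReal.tsum_le_tsum fun k => ?_
  rw [mul_left_comm, ← mul_pow]
  gcongr
  refine iSup₂_le fun t ht => (gev_mul_heatFlow_le hν hσ1 ht x k).trans ?_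
  gcongr
  exact mul_le_of_le_one_left' (expKer_le_one (cmpRate_pos hν k) t)

lemma lintegral_expKer_sq_le {c : ℝ} (hc : 0 < c) (n : ℕ) (hn : n ≠ 0) (s : Set ℝ) :
    ∫⁻ t in s, expKer c t ^ n ≤ ENNReal.ofReal (1 / c) := by
  calc ∫⁻ t in s, expKer c t ^ n ≤ ∫⁻ t, expKer c t ^ n := setLIntegral_le_lintegral _ _
    _ ≤ ∫⁻ t, expKer c t := by
        gcongr with t
        exact pow_le_of_le_one zero_le (expKer_le_one hc _) hn
    _ = _ := lintegral_expKer hc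

lemma hNorm_heatFlow_le {ν σ T : ℝ} (hν : 0 < ν) (hσ1 : σ ≤ 1) (x : Mode → C3) :
    hNorm T σ (heatFlow ν x)
      ≤ kerConst ν T ^ 2 * ENNReal.ofReal (2 / ν) * ∑' k, wt k * ‖x k‖ₑ ^ 2 := by
  rw [hNorm, ← ENNReal.tsum_mul_left]
  refine ENNReal.tsum_le_tsum fun k => ?_
  calc wt k ^ 3 * ∫⁻ t in Ioc 0 T, (gev σ k t * ‖heatFlow ν x k t‖ₑ) ^ 2
      ≤ wt k ^ 3 * ∫⁻ t in Ioc 0 T, (kerConst ν T * ‖x k‖ₑ) ^ 2 * expKer (cmpRate ν k) t ^ 2 := by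
        refine mul_le_mul_right ?_ _
        apply setLIntegral_mono' measurableSet_Ioc
        intro t ht
        rw [← mul_pow, mul_assoc, mul_comm ‖x k‖ₑ]
        have := gev_mul_heatFlow_le hν hσ1 ⟨ht.1.le, ht.2⟩ x k
        gcongr
    _ ≤ wt k ^ 3 * ((kerConst ν T * ‖x k‖ₑ) ^ 2 * (ENNReal.ofReal (2 / ν) * (wt k)⁻¹ ^ 2)) := by
        have := kerConst_ne_top ν T
        rw [lintegral_const_mul' _ _ (by finiteness), ← ofReal_inv_cmpRate hν]
        gcongr
        exact lintegral_expKer_sq_le (cmpRate_pos hν k) 2 (by norm_num) _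
    _ = wt k ^ (1 + 2) * ((wt k)⁻¹ ^ 2 * (kerConst ν T ^ 2 * ENNReal.ofReal (2 / ν) * ‖x k‖ₑ ^ 2)) := by
        ring
    _ = _ := by rw [wt_mul_inv_pow]; ring

lemma sq_le_add_of_pow_four_le {a b c : ℝ≥0∞} (h : a ^ 4 ≤ b * c) : a ^ 2 ≤ b + c := by
  rw [← ENNReal.pow_le_pow_left_iff (n := 2) (by norm_num), ← pow_mul]
  calc a ^ (2 * 2) ≤ b * c := h
    _ ≤ b * c + (b ^ 2 + b * c + c ^ 2) := le_self_add
    _ = _ := by ring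

/-- Interpolation on each mode: wt⁴∫g⁴ is at most the product of wt·(sup g)² and wt³∫g². -/
lemma zNorm_le_sNorm_add_hNorm (T σ : ℝ) (a : Mode → ℝ → C3) :
    zNorm T σ a ≤ sNorm T σ a + hNorm T σ a := by
  rw [zNorm, sNorm, hNorm, ← ENNReal.tsum_add]
  refine ENNReal.tsum_le_tsum fun k => ?_
  set g : ℝ → ℝ≥0∞ := fun t => gev σ k t * ‖a k t‖ₑ
  set S := ⨆ t ∈ Icc 0 T, g t
  by_cases hS : S = ⊤
  · rw [hS, ENNReal.top_pow (by norm_num), ENNReal.mul_top (wt_ne_zero k), top_add]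
    exact le_top
  apply sq_le_add_of_pow_four_le
  rw [mul_pow, n4_pow_four]
  calc wt k ^ 4 * ∫⁻ t in Ioc 0 T, g t ^ 4
      ≤ wt k ^ 4 * ∫⁻ t in Ioc 0 T, S ^ 2 * g t ^ 2 := by
        refine mul_le_mul_right ?_ _
        apply setLIntegral_mono' measurableSet_Ioc
        intro t ht
        rw [show 4 = 2 + 2 by norm_num, pow_add]
        have : g t ≤ S := le_iSup₂ (f := fun t (_ : t ∈ Icc 0 T) => g t) t ⟨ht.1.le, ht.2⟩
        gcongr
    _ = wt k * S ^ 2 * (wt k ^ 3 * ∫⁻ t in Ioc 0 T, g t ^ 2) := by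
        rw [lintegral_const_mul' _ _ (ENNReal.pow_ne_top hS)]
        ring

lemma tendsto_tsum_zero {l : Filter ℝ} [l.IsCountablyGenerated] {F : ℝ → Mode → ℝ≥0∞}
    (B : Mode → ℝ≥0∞) (hB : ∑' k, B k ≠ ⊤) (hF : ∀ᶠ T in l, ∀ k, F T k ≤ B k)
    (h : ∀ k, Tendsto (fun T => F T k) l (𝓝 0)) : Tendsto (fun T => ∑' k, F T k) l (𝓝 0) := by
  let _ : MeasurableSpace Mode := ⊤
  have h1 := tendsto_lintegral_filter_of_dominated_convergence (μ := Measure.count) (l := l)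
    (F := F) (f := fun _ => 0) B (Eventually.of_forall fun T => measurable_from_top)
    (hF.mono fun T hT => Eventually.of_forall hT) (by rwa [lintegral_count])
    (Eventually.of_forall h)
  simpa only [lintegral_count, lintegral_zero] using h1

lemma n4_mono_time {S T : ℝ} (h : S ≤ T) (g : ℝ → ℝ≥0∞) : n4 S g ≤ n4 T g := by
  unfold n4
  gcongr

lemma tendsto_n4_zero {g : ℝ → ℝ≥0∞} {T : ℝ} (hT : 0 < T) (h : n4 T g ≠ ⊤) :
    Tendsto (fun S => n4 S g) (𝓝[>] 0) (𝓝 0) := by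
  have h1 : ∫⁻ t in Ioc 0 T, g t ^ 4 ≠ ⊤ := by
    rw [← n4_pow_four]; exact ENNReal.pow_ne_top h
  have h2 : Tendsto (fun S => ∫⁻ t in Ioc 0 S, g t ^ 4) (𝓝[>] 0) (𝓝 0) := by
    have h3 : Tendsto (fun S : ℝ => (volume.restrict (Ioc 0 T)) (Ioc 0 S)) (𝓝[>] 0) (𝓝 0) := by
      have h4 : Tendsto (fun S : ℝ => ENNReal.ofReal S) (𝓝[>] 0) (𝓝 0) := by
        have := (ENNReal.continuous_ofReal.tendsto 0).mono_left (nhdsWithin_le_nhds (s := Ioi 0))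
        simpa using this
      refine tendsto_of_tendsto_of_tendsto_of_le_of_le tendsto_const_nhds h4
        (fun _ => zero_le) fun S => ?_
      refine (Measure.restrict_le_self _).trans ?_
      simp
    have h5 := tendsto_setLIntegral_zero h1 h3
    refine h5.congr' ?_
    filter_upwards [Ioo_mem_nhdsGT hT] with S hS
    rw [Measure.restrict_restrict measurableSet_Ioc, inter_eq_left.2 (Ioc_subset_Ioc_right hS.2.le)]
  have := (ENNReal.continuous_rpow_const (y := (1 / 4 : ℝ))).tendsto 0 |>.comp h2
  simpa [n4, Function.comp_def] using this

/-- A finite L⁴ norm vanishes on shrinking time intervals, and the terms at time `T` dominate the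
sum over modes. In the uniqueness proof this takes the place of small data. -/
lemma tendsto_zNorm_zero {T : ℝ} (hT : 0 < T) {a : Mode → ℝ → C3} (h : zNorm T 0 a ≠ ⊤) :
    Tendsto (fun S => zNorm S 0 a) (𝓝[>] 0) (𝓝 0) := by
  refine tendsto_tsum_zero _ h ?_ fun k => ?_
  · filter_upwards [Ioo_mem_nhdsGT hT] with S hS k
    gcongr
    exact n4_mono_time hS.2.le _
  · have h1 : n4 T (fun t => gev 0 k t * ‖a k t‖ₑ) ≠ ⊤ := by
      intro h2
      have h3 := ENNReal.ne_top_of_tsum_ne_top h k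
      rw [h2, ENNReal.mul_top (wt_ne_zero k)] at h3
      simp at h3
    have h2 := ENNReal.Tendsto.pow (n := 2)
      (ENNReal.Tendsto.const_mul (a := wt k) (tendsto_n4_zero hT h1) (Or.inr (wt_ne_top k)))
    simpa using h2

lemma n4_expKer_sq_le {ν : ℝ} (hν : 0 < ν) (T : ℝ) (k : Mode) :
    n4 T (expKer (cmpRate ν k)) ^ 2 ≤ (1 + ENNReal.ofReal (2 / ν)) * (wt k)⁻¹ := by
  rw [← ENNReal.pow_le_pow_left_iff (n := 2) (by norm_num), ← pow_mul, n4_pow_four]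
  refine (lintegral_expKer_sq_le (cmpRate_pos hν k) 4 (by norm_num) _).trans ?_
  rw [ofReal_inv_cmpRate hν, mul_pow]
  gcongr
  calc ENNReal.ofReal (2 / ν) ≤ (1 + ENNReal.ofReal (2 / ν)) ^ 1 := by rw [pow_one]; exact le_add_self
    _ ≤ _ := pow_le_pow_right₀ le_self_add (by norm_num)

/-- The squared L⁴ norm of the kernel is O(wt^{-1}), so the terms are dominated by a multiple of
wt·M². Stating it for a majorant `M` gives all data below `M` a common lifespan, although in a
critical space the size of the norm alone would not. -/
lemma tendsto_linNorm_zero {ν : ℝ} (hν : 0 < ν) {M : Mode → ℝ≥0∞} (hM : ∑' k, wt k * M k ^ 2 ≠ ⊤) :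
    Tendsto (fun S => linNorm ν S M) (𝓝[>] 0) (𝓝 0) := by
  refine tendsto_tsum_zero (fun k => (1 + ENNReal.ofReal (2 / ν)) * (wt k * M k ^ 2)) ?_ ?_
    fun k => ?_
  · rw [ENNReal.tsum_mul_left]
    finiteness
  · refine Eventually.of_forall fun S k => ?_
    calc (wt k * (M k * n4 S (expKer (cmpRate ν k)))) ^ 2
        = wt k ^ 2 * (M k ^ 2 * n4 S (expKer (cmpRate ν k)) ^ 2) := by ring
      _ ≤ wt k ^ 2 * (M k ^ 2 * ((1 + ENNReal.ofReal (2 / ν)) * (wt k)⁻¹)) := by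
          gcongr
          exact n4_expKer_sq_le hν S k
      _ = wt k ^ (1 + 1) * ((wt k)⁻¹ ^ 1 * (M k ^ 2 * (1 + ENNReal.ofReal (2 / ν)))) := by ring
      _ = _ := by rw [wt_mul_inv_pow]; ring
  · have hk : n4 1 (expKer (cmpRate ν k)) ≠ ⊤ := by
      have := n4_expKer_sq_le hν 1 k
      intro h
      rw [h] at this
      have h2 : (wt k)⁻¹ ≠ ⊤ := ENNReal.inv_ne_top.2 (wt_ne_zero k)
      have h3 : (1 + ENNReal.ofReal (2 / ν)) * (wt k)⁻¹ ≠ ⊤ := by finiteness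
      exact h3 (top_le_iff.1 (by simpa using this))
    have hMk : M k ≠ ⊤ := by
      intro h
      have := ENNReal.ne_top_of_tsum_ne_top hM k
      rw [h] at this
      simp [wt_ne_zero] at this
    have h2 := ENNReal.Tendsto.pow (n := 2)
      (ENNReal.Tendsto.const_mul (a := wt k) (ENNReal.Tendsto.const_mul (a := M k)
        (tendsto_n4_zero one_pos hk) (Or.inr hMk)) (Or.inr (wt_ne_top k)))
    simpa using h2

lemma linNorm_mono (ν T : ℝ) {M N : Mode → ℝ≥0∞} (h : ∀ k, M k ≤ N k) :
    linNorm ν T M ≤ linNorm ν T N := by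
  unfold linNorm
  gcongr with k
  exact h k

/-! ### The nonlinearity on space-time families -/

/-- The nonlinearity applied at each time. -/
def nonlin (a : Mode → ℝ → C3) (k : Mode) (t : ℝ) : C3 := burgersNL (fun l => a l t) k

lemma continuous_convTerm (m : Mode) : Continuous fun p : C3 × C3 => convTerm m p.1 p.2 := by
  unfold convTerm
  fun_prop

lemma ModesMeas.nonlin {T : ℝ} {a : Mode → ℝ → C3} (ha : ModesMeas T a) :
    ModesMeas T (nonlin a) := by
  intro k
  refine AEMeasurable.aestronglyMeasurable ?_
  refine AEMeasurable.tsum fun l => ?_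
  exact ((continuous_convTerm (k - l)).comp_aestronglyMeasurable
    ((ha l).prodMk (ha (k - l)))).aemeasurable

lemma ModesMeas.sub {T : ℝ} {a b : Mode → ℝ → C3} (ha : ModesMeas T a) (hb : ModesMeas T b) :
    ModesMeas T (a - b) := fun k => (ha k).sub (hb k)

lemma zNorm_zero_le {T σ : ℝ} (hσ : 0 ≤ σ) (a : Mode → ℝ → C3) : zNorm T 0 a ≤ zNorm T σ a := by
  unfold zNorm
  gcongr with k
  refine n4_mono fun t _ => ?_
  gcongr
  rw [gev_zero_left]
  exact one_le_gev hσ k t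

lemma zNorm_mono_time {S T : ℝ} (h : S ≤ T) (σ : ℝ) (a : Mode → ℝ → C3) :
    zNorm S σ a ≤ zNorm T σ a := by
  unfold zNorm
  gcongr with k
  exact n4_mono_time h _

/-- Absolute convergence of the convolution at almost every time. It is needed to subtract two
nonlinearities termwise, since a divergent `tsum` has value 0. -/
lemma ae_gradConv_lt_top {T : ℝ} {a b : Mode → ℝ → C3} (ha : ModesMeas T a)
    (hb : ModesMeas T b) (hza : zNorm T 0 a ≠ ⊤) (hzb : zNorm T 0 b ≠ ⊤) (k : Mode) :
    ∀ᵐ t ∂volume.restrict (Ioc 0 T), gradConv a b k t < ⊤ := by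
  have h1 := tsum_gradConv_le le_rfl ha hb
  have h2 : 108 * (zNorm T 0 a * zNorm T 0 b) ≠ ⊤ := by finiteness
  have h3 := ENNReal.ne_top_of_tsum_ne_top (ne_top_of_le_ne_top h2 h1) k
  have h4 : ∫⁻ t in Ioc 0 T, (gev 0 k t * gradConv a b k t) ^ 2 ≠ ⊤ := by
    intro h
    rw [h, ENNReal.mul_top (ENNReal.inv_ne_zero.2 (wt_ne_top k))] at h3
    exact h3 rfl
  have h5 : AEMeasurable (fun t => (gev 0 k t * gradConv a b k t) ^ 2)
      (volume.restrict (Ioc 0 T)) := by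
    refine (((measurable_gev 0 k).aemeasurable).mul ?_).pow_const 2
    exact AEMeasurable.tsum fun l => (ha l).enorm.mul ((hb (k - l)).enorm.const_mul _)
  filter_upwards [ae_lt_top' h5 h4] with t ht
  simp only [gev_zero_left, one_mul] at ht
  by_contra h
  rw [not_lt, top_le_iff] at h
  rw [h] at ht
  simp at ht

lemma summable_convTerm {a b : Mode → ℝ → C3} {k : Mode} {t : ℝ} (h : gradConv a b k t < ⊤) :
    Summable fun l => convTerm (k - l) (a l t) (b (k - l) t) := by
  apply Summable.of_enorm
  refine ne_top_of_le_ne_top h.ne ?_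
  unfold gradConv
  gcongr with l
  exact enorm_convTerm_le _ _ _

lemma enorm_nonlin_le (a : Mode → ℝ → C3) (k : Mode) (t : ℝ) :
    ‖nonlin a k t‖ₑ ≤ gradConv a a k t := by
  rcases eq_or_ne (gradConv a a k t) ⊤ with h | h
  · rw [h]; exact le_top
  refine enorm_tsum_le_tsum_enorm.trans ?_
  unfold gradConv
  gcongr with l
  exact enorm_convTerm_le _ _ _

lemma enorm_nonlin_sub_le {a b : Mode → ℝ → C3} {k : Mode} {t : ℝ} (ha : gradConv a a k t < ⊤)
    (hb : gradConv b b k t < ⊤) :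
    ‖nonlin a k t - nonlin b k t‖ₑ ≤ gradConv (a - b) a k t + gradConv b (a - b) k t := by
  rw [nonlin, nonlin, burgersNL, burgersNL,
    ← (summable_convTerm ha).tsum_sub (summable_convTerm hb)]
  refine enorm_tsum_le_tsum_enorm.trans ?_
  rw [gradConv, gradConv, ← ENNReal.tsum_add]
  gcongr with l
  rw [convTerm_sub]
  refine (enorm_add_le _ _).trans ?_
  gcongr
  · exact enorm_convTerm_le _ _ _
  · exact enorm_convTerm_le _ _ _

lemma fNorm_nonlin_le {T σ : ℝ} (hσ : 0 ≤ σ) {a : Mode → ℝ → C3} (ha : ModesMeas T a) :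
    fNorm T σ (nonlin a) ≤ 432 * zNorm T σ a ^ 2 := by
  -- One convolution suffices; the second is padding, hence 432 = 2·216.
  refine (fNorm_le hσ ha ha ha ha fun k => Eventually.of_forall fun t =>
    (enorm_nonlin_le a k t).trans le_self_add).trans (le_of_eq ?_)
  ring

lemma fNorm_nonlin_sub_le {T σ : ℝ} (hσ : 0 ≤ σ) {a b : Mode → ℝ → C3} (ha : ModesMeas T a)
    (hb : ModesMeas T b) (hza : zNorm T 0 a ≠ ⊤) (hzb : zNorm T 0 b ≠ ⊤) :
    fNorm T σ (nonlin a - nonlin b)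
      ≤ 216 * ((zNorm T σ a + zNorm T σ b) * zNorm T σ (a - b)) := by
  refine (fNorm_le hσ (ha.sub hb) ha hb (ha.sub hb) fun k => ?_).trans (le_of_eq ?_)
  · filter_upwards [ae_gradConv_lt_top ha ha hza hza k, ae_gradConv_lt_top hb hb hzb hzb k]
      with t h1 h2
    exact enorm_nonlin_sub_le h1 h2
  · ring

lemma lintegral_sq_ne_top_of_fNorm {T : ℝ} {f : Mode → ℝ → C3} (h : fNorm T 0 f ≠ ⊤) (k : Mode) :
    ∫⁻ t in Ioc 0 T, ‖f k t‖ₑ ^ 2 ≠ ⊤ := by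
  have h3 := ENNReal.ne_top_of_tsum_ne_top h k
  intro h4
  simp only [gev_zero_left, one_mul, h4] at h3
  rw [ENNReal.mul_top (ENNReal.inv_ne_zero.2 (wt_ne_top k))] at h3
  exact h3 rfl

lemma integrableOn_of_fNorm {T : ℝ} {f : Mode → ℝ → C3} (hf : ModesMeas T f)
    (h : fNorm T 0 f ≠ ⊤) (k : Mode) : IntegrableOn (f k) (Ioc 0 T) := by
  have h1 : MemLp (f k) 2 (volume.restrict (Ioc 0 T)) := by
    refine ⟨hf k, ?_⟩
    rw [eLpNorm_lt_top_iff_lintegral_rpow_enorm_lt_top (by norm_num) (by norm_num)]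
    have := lintegral_sq_ne_top_of_fNorm h k
    simpa using this.lt_top
  exact h1.integrable (by norm_num)

/-- The integrating-factor form frees the integrand of its dependence on `t`. Continuity,
differentiation, time shifts and concatenation all go through it. -/
lemma duhamel_eq (ν : ℝ) (f : Mode → ℝ → C3) (k : Mode) (t : ℝ) :
    duhamel ν f k t = Real.exp (-heatRate ν k * t) •
      ∫ s in (0 : ℝ)..t, Real.exp (heatRate ν k * s) • f k s := by
  rw [duhamel, ← intervalIntegral.integral_smul]
  congr 1
  ext1 s
  rw [smul_smul, ← Real.exp_add]
  congr 2
  ring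

lemma intervalIntegrable_exp_smul {T t : ℝ} (ht : t ∈ Icc 0 T) {g : ℝ → C3}
    (hg : IntegrableOn g (Ioc 0 T)) (c : ℝ) :
    IntervalIntegrable (fun s => Real.exp (c * s) • g s) volume 0 t := by
  have h1 : IntervalIntegrable g volume 0 t := by
    rw [intervalIntegrable_iff_integrableOn_Ioc_of_le ht.1]
    exact hg.mono_set (Ioc_subset_Ioc_right ht.2)
  exact h1.continuousOn_smul (by fun_prop)

lemma duhamel_sub {ν T t : ℝ} (ht : t ∈ Icc 0 T) {f g : Mode → ℝ → C3} {k : Mode}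
    (hf : IntegrableOn (f k) (Ioc 0 T)) (hg : IntegrableOn (g k) (Ioc 0 T)) :
    duhamel ν f k t - duhamel ν g k t = duhamel ν (f - g) k t := by
  rw [duhamel_eq, duhamel_eq, duhamel_eq, ← smul_sub, ← intervalIntegral.integral_sub
    (intervalIntegrable_exp_smul ht hf _) (intervalIntegrable_exp_smul ht hg _)]
  simp [smul_sub]

lemma continuousOn_duhamel {ν T : ℝ} {f : Mode → ℝ → C3} {k : Mode}
    (hf : IntegrableOn (f k) (Ioc 0 T)) : ContinuousOn (duhamel ν f k) (Icc 0 T) := by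
  rcases lt_or_ge T 0 with hT | hT
  · rw [Icc_eq_empty (not_le.2 hT)]
    exact continuousOn_empty _
  have h1 : ContinuousOn (fun t => ∫ s in (0 : ℝ)..t, Real.exp (heatRate ν k * s) • f k s)
      (Icc 0 T) := by
    have h2 := intervalIntegrable_exp_smul (right_mem_Icc.2 hT) hf (heatRate ν k)
    have h3 := intervalIntegral.continuousOn_primitive_interval (μ := volume) (a := 0) (b := T)
      (f := fun s => Real.exp (heatRate ν k * s) • f k s)
      (by
        rw [uIcc_of_le hT, integrableOn_Icc_iff_integrableOn_Ioc]
        exact (intervalIntegrable_iff_integrableOn_Ioc_of_le hT).1 h2)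
    rwa [uIcc_of_le hT] at h3
  have h4 : duhamel ν f k = fun t => Real.exp (-heatRate ν k * t) •
      ∫ s in (0 : ℝ)..t, Real.exp (heatRate ν k * s) • f k s := funext fun t => duhamel_eq ν f k t
  rw [h4]
  have h5 : Continuous fun t : ℝ => Real.exp (-heatRate ν k * t) := by fun_prop
  exact h5.continuousOn.smul h1

lemma continuous_heatFlow (ν : ℝ) (x : Mode → C3) (k : Mode) : Continuous (heatFlow ν x k) := by
  unfold heatFlow
  fun_prop

/-! ### Mild solutions -/

/-- Mild solutions on `[0,T]` on the Fourier side, in the class `L̃⁴(0,T;H¹)`. -/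
structure MildSol (ν T : ℝ) (x : Mode → C3) (u : Mode → ℝ → C3) : Prop where
  init : ∑' k, wt k * ‖x k‖ₑ ^ 2 ≠ ⊤
  zfin : zNorm T 0 u ≠ ⊤
  meas : ModesMeas T u
  eqn : ∀ k, ∀ t ∈ Icc 0 T, u k t = heatFlow ν x k t - duhamel ν (nonlin u) k t

lemma MildSol.fNorm_ne_top {ν T : ℝ} {x : Mode → C3} {u : Mode → ℝ → C3} (h : MildSol ν T x u) :
    fNorm T 0 (nonlin u) ≠ ⊤ := by
  have := h.zfin
  exact ne_top_of_le_ne_top (by finiteness) (fNorm_nonlin_le le_rfl h.meas)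

lemma MildSol.integrableOn {ν T : ℝ} {x : Mode → C3} {u : Mode → ℝ → C3} (h : MildSol ν T x u)
    (k : Mode) : IntegrableOn (nonlin u k) (Ioc 0 T) :=
  integrableOn_of_fNorm h.meas.nonlin h.fNorm_ne_top k

lemma MildSol.continuousOn {ν T : ℝ} {x : Mode → C3} {u : Mode → ℝ → C3} (h : MildSol ν T x u)
    (k : Mode) : ContinuousOn (u k) (Icc 0 T) :=
  (((continuous_heatFlow ν x k).continuousOn).sub
    (continuousOn_duhamel (h.integrableOn k))).congr (h.eqn k)

lemma MildSol.apply_zero {ν T : ℝ} {x : Mode → C3} {u : Mode → ℝ → C3} (h : MildSol ν T x u)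
    (hT : 0 ≤ T) (k : Mode) : u k 0 = x k := by
  rw [h.eqn k 0 (left_mem_Icc.2 hT)]
  simp [heatFlow, duhamel]

lemma sNorm_le_of_eq {T σ : ℝ} {u a b : Mode → ℝ → C3}
    (h : ∀ k, ∀ t ∈ Icc 0 T, u k t = a k t - b k t) :
    sNorm T σ u ≤ 2 * (sNorm T σ a + sNorm T σ b) := by
  rw [sNorm, sNorm, sNorm, ← ENNReal.tsum_add, ← ENNReal.tsum_mul_left]
  refine ENNReal.tsum_le_tsum fun k => ?_
  rw [← mul_add, mul_left_comm]
  gcongr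
  refine le_trans ?_ (add_sq_le_two_mul _ _)
  gcongr
  refine iSup₂_le fun t ht => ?_
  rw [h k t ht]
  refine (mul_le_mul_right (enorm_sub_le (a := a k t) (b := b k t)) _).trans ?_
  rw [mul_add]
  gcongr
  · exact le_iSup₂ (f := fun t (_ : t ∈ Icc 0 T) => gev σ k t * ‖a k t‖ₑ) t ht
  · exact le_iSup₂ (f := fun t (_ : t ∈ Icc 0 T) => gev σ k t * ‖b k t‖ₑ) t ht

lemma hNorm_le_of_eq {T σ : ℝ} {u a b : Mode → ℝ → C3} (ha : ModesMeas T a)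
    (h : ∀ k, ∀ t ∈ Icc 0 T, u k t = a k t - b k t) :
    hNorm T σ u ≤ 2 * (hNorm T σ a + hNorm T σ b) := by
  rw [hNorm, hNorm, hNorm, ← ENNReal.tsum_add, ← ENNReal.tsum_mul_left]
  refine ENNReal.tsum_le_tsum fun k => ?_
  rw [← mul_add, mul_left_comm, ← lintegral_add_left' ((aemeasurable_gev_mul ha k).pow_const 2),
    ← lintegral_const_mul' 2 _ (by norm_num)]
  refine mul_le_mul_right ?_ _
  apply setLIntegral_mono' measurableSet_Ioc
  intro t ht
  refine le_trans ?_ (add_sq_le_two_mul _ _)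
  rw [h k t ⟨ht.1.le, ht.2⟩, ← mul_add]
  gcongr
  exact enorm_sub_le

lemma n4_add_le {T : ℝ} {f g : ℝ → ℝ≥0∞} (hf : AEMeasurable f (volume.restrict (Ioc 0 T)))
    (hg : AEMeasurable g (volume.restrict (Ioc 0 T))) :
    n4 T (fun t => f t + g t) ≤ n4 T f + n4 T g := by
  have := ENNReal.lintegral_Lp_add_le (p := 4) hf hg (by norm_num)
  unfold n4
  have e : ∀ y : ℝ≥0∞, y ^ (4 : ℝ) = y ^ 4 := fun y => by
    rw [← ENNReal.rpow_natCast]; norm_num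
  simpa only [Pi.add_apply, e] using this

lemma zNorm_le_of_eq {T σ : ℝ} {u a b : Mode → ℝ → C3} (ha : ModesMeas T a) (hb : ModesMeas T b)
    (h : ∀ k, ∀ t ∈ Icc 0 T, u k t = a k t - b k t) :
    zNorm T σ u ≤ 2 * (zNorm T σ a + zNorm T σ b) := by
  rw [zNorm, zNorm, zNorm, ← ENNReal.tsum_add, ← ENNReal.tsum_mul_left]
  refine ENNReal.tsum_le_tsum fun k => ?_
  refine le_trans ?_ (add_sq_le_two_mul _ _)
  rw [← mul_add]
  gcongr
  refine le_trans ?_ (n4_add_le (aemeasurable_gev_mul ha k) (aemeasurable_gev_mul hb k))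
  refine n4_mono fun t ht => ?_
  rw [h k t ⟨ht.1.le, ht.2⟩, ← mul_add]
  gcongr
  exact enorm_sub_le

lemma modesMeas_heatFlow (ν T : ℝ) (x : Mode → C3) : ModesMeas T (heatFlow ν x) :=
  fun k => (continuous_heatFlow ν x k).aestronglyMeasurable

lemma modesMeas_duhamel {ν T : ℝ} {f : Mode → ℝ → C3} (hf : ∀ k, IntegrableOn (f k) (Ioc 0 T)) :
    ModesMeas T (duhamel ν f) := fun k =>
  ((continuousOn_duhamel (hf k)).mono Ioc_subset_Icc_self).aestronglyMeasurable measurableSet_Ioc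

lemma MildSol.sNorm_le {ν T σ : ℝ} (hν : 0 < ν) (hσ : 0 ≤ σ) (hσ1 : σ ≤ 1) {x : Mode → C3}
    {u : Mode → ℝ → C3} (h : MildSol ν T x u) :
    sNorm T σ u ≤ 2 * (kerConst ν T ^ 2 * (∑' k, wt k * ‖x k‖ₑ ^ 2)
      + regConst ν T * (432 * zNorm T σ u ^ 2)) := by
  refine (sNorm_le_of_eq h.eqn).trans ?_
  gcongr
  · exact sNorm_heatFlow_le hν hσ1 x
  · refine (sNorm_duhamel_le hν hσ1 h.meas.nonlin).trans ?_
    gcongr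
    exact fNorm_nonlin_le hσ h.meas

lemma MildSol.sNorm_ne_top {ν T : ℝ} (hν : 0 < ν) {x : Mode → C3} {u : Mode → ℝ → C3}
    (h : MildSol ν T x u) : sNorm T 0 u ≠ ⊤ := by
  have h1 := h.init
  have h2 := h.zfin
  have h3 := kerConst_ne_top ν T
  have h4 := regConst_ne_top ν T
  exact ne_top_of_le_ne_top (by finiteness) (h.sNorm_le hν le_rfl zero_le_one)

lemma MildSol.hNorm_ne_top {ν T : ℝ} (hν : 0 < ν) {x : Mode → C3} {u : Mode → ℝ → C3}
    (h : MildSol ν T x u) : hNorm T 0 u ≠ ⊤ := by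
  have h1 := h.init
  have h2 := h.fNorm_ne_top
  have h3 := kerConst_ne_top ν T
  have h4 := regConst_ne_top ν T
  refine ne_top_of_le_ne_top ?_ ((hNorm_le_of_eq (modesMeas_heatFlow ν T x) h.eqn).trans
    (mul_le_mul_right (add_le_add (hNorm_heatFlow_le hν zero_le_one x)
      (hNorm_duhamel_le hν zero_le_one h.meas.nonlin)) 2))
  finiteness

/-! ### The Banach space of the fixed point argument -/

instance factOneLeFour : Fact ((1 : ℝ≥0∞) ≤ 4) := ⟨by norm_num⟩

/-- Lebesgue measure on `(0,T]`. -/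
abbrev timeMeas (T : ℝ) : Measure ℝ := volume.restrict (Ioc 0 T)

/-- The weighted space `L̃⁴(0,T;H¹)`. -/
abbrev ZSpace (T : ℝ) : Type := lp (fun _ : Mode => Lp C3 4 (timeMeas T)) 2

/-- The weight in `ZSpace`. -/
def zWeight (k : Mode) (t : ℝ) : ℝ := bracket k * Real.exp (1 * √t * modeNorm k)

lemma zWeight_pos (k : Mode) (t : ℝ) : 0 < zWeight k t :=
  mul_pos (bracket_pos k) (Real.exp_pos _)

lemma continuous_zWeight (k : Mode) : Continuous (zWeight k) := by
  unfold zWeight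
  fun_prop

lemma enorm_zWeight (k : Mode) (t : ℝ) : ‖zWeight k t‖ₑ = wt k * gev 1 k t := by
  rw [Real.enorm_of_nonneg (zWeight_pos k t).le, zWeight, ENNReal.ofReal_mul (bracket_pos k).le,
    wt, gev]

/-- The family of functions of an element of `ZSpace`. -/
def zDecode {T : ℝ} (x : ZSpace T) (k : Mode) (t : ℝ) : C3 := (zWeight k t)⁻¹ • (x k) t

lemma enorm_Lp_four {T : ℝ} (f : Lp C3 4 (timeMeas T)) : ‖f‖ₑ = n4 T fun t => ‖f t‖ₑ := by
  rw [Lp.enorm_def, eLpNorm_eq_lintegral_rpow_enorm_toReal (by norm_num) (by norm_num), n4]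
  have e : ∀ y : ℝ≥0∞, y ^ (4 : ℝ) = y ^ 4 := fun y => by
    rw [← ENNReal.rpow_natCast]; norm_num
  simp [e]

lemma n4_congr {T : ℝ} {f g : ℝ → ℝ≥0∞} (h : f =ᵐ[timeMeas T] g) : n4 T f = n4 T g := by
  unfold n4
  congr 1
  apply lintegral_congr_ae
  filter_upwards [h] with t ht
  rw [ht]

lemma zNorm_congr {T σ : ℝ} {a b : Mode → ℝ → C3} (h : ∀ k, a k =ᵐ[timeMeas T] b k) :
    zNorm T σ a = zNorm T σ b := by
  unfold zNorm
  refine tsum_congr fun k => ?_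
  congr 2
  apply n4_congr
  filter_upwards [h k] with t ht
  rw [ht]

lemma wt_mul_n4 {T : ℝ} (a : Mode → ℝ → C3) (k : Mode) :
    wt k * n4 T (fun t => gev 1 k t * ‖a k t‖ₑ) = n4 T fun t => ‖zWeight k t • a k t‖ₑ := by
  rw [← n4_const_mul _ (wt_ne_top k)]
  congr 1
  ext1 t
  rw [enorm_smul, enorm_zWeight, mul_assoc]

lemma ZSpace.enorm_sq {T : ℝ} (x : ZSpace T) : ‖x‖ₑ ^ 2 = ∑' k, ‖x k‖ₑ ^ 2 := by
  have h := lp.norm_rpow_eq_tsum (p := 2) (by norm_num) x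
  have hs := (lp.memℓp x).summable (by norm_num)
  simp only [ENNReal.toReal_ofNat, Real.rpow_two] at h hs
  rw [← ofReal_norm, ← ENNReal.ofReal_pow (norm_nonneg _), h,
    ENNReal.ofReal_tsum_of_nonneg (fun _ => sq_nonneg _) hs]
  refine tsum_congr fun k => ?_
  rw [ENNReal.ofReal_pow (norm_nonneg _), ofReal_norm]

/-- Multiplying each mode by its weight identifies `zNorm` at σ = 1 with the squared norm of a
complete ℓ² sum of L⁴ spaces, so the contraction principle applies there. -/
lemma zNorm_zDecode_sub {T : ℝ} (x y : ZSpace T) :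
    zNorm T 1 (zDecode x - zDecode y) = ‖x - y‖ₑ ^ 2 := by
  rw [ZSpace.enorm_sq, zNorm]
  refine tsum_congr fun k => ?_
  rw [wt_mul_n4, enorm_Lp_four]
  congr 1
  apply n4_congr
  have h : ⇑((x - y) k) =ᵐ[timeMeas T] ⇑(x k) - ⇑(y k) := by
    rw [lp.coeFn_sub, Pi.sub_apply]
    exact Lp.coeFn_sub _ _
  filter_upwards [h] with t ht
  rw [ht, Pi.sub_apply, Pi.sub_apply, Pi.sub_apply, zDecode, zDecode, ← smul_sub, smul_smul,
    mul_inv_cancel₀ (zWeight_pos k t).ne', one_smul]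

lemma zNorm_zDecode {T : ℝ} (x : ZSpace T) : zNorm T 1 (zDecode x) = ‖x‖ₑ ^ 2 := by
  have h := zNorm_zDecode_sub x 0
  rw [sub_zero] at h
  rw [← h]
  apply zNorm_congr
  intro k
  have h2 : ⇑((0 : ZSpace T) k) =ᵐ[timeMeas T] 0 := by
    rw [lp.coeFn_zero, Pi.zero_apply]
    exact Lp.coeFn_zero _ _ _
  filter_upwards [h2] with t ht
  rw [Pi.sub_apply, Pi.sub_apply]
  simp only [zDecode]
  rw [ht]
  simp

lemma modesMeas_zDecode {T : ℝ} (x : ZSpace T) : ModesMeas T (zDecode x) := fun k =>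
  (((continuous_zWeight k).inv₀ fun t => (zWeight_pos k t).ne').aestronglyMeasurable).smul
    (Lp.aestronglyMeasurable _)

/-- Every family of finite norm is coded, up to null sets of times, so the Picard map can be lifted
to `ZSpace`. -/
lemma exists_zDecode_eq {T : ℝ} {a : Mode → ℝ → C3} (ha : ModesMeas T a) (h : zNorm T 1 a ≠ ⊤) :
    ∃ x : ZSpace T, ∀ k, zDecode x k =ᵐ[timeMeas T] a k := by
  have hm : ∀ k, MemLp (fun t => zWeight k t • a k t) 4 (timeMeas T) := by
    intro k
    refine ⟨(continuous_zWeight k).aestronglyMeasurable.smul (ha k), ?_⟩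
    have h1 := ENNReal.ne_top_of_tsum_ne_top h k
    rw [wt_mul_n4] at h1
    have h2 : n4 T (fun t => ‖zWeight k t • a k t‖ₑ) ≠ ⊤ := by
      intro h3
      rw [h3] at h1
      simp at h1
    rw [eLpNorm_lt_top_iff_lintegral_rpow_enorm_lt_top (by norm_num) (by norm_num)]
    have e : ∀ y : ℝ≥0∞, y ^ (4 : ℝ) = y ^ 4 := fun y => by
      rw [← ENNReal.rpow_natCast]; norm_num
    simp only [ENNReal.toReal_ofNat, e]
    rw [← n4_pow_four]
    exact (ENNReal.pow_ne_top h2).lt_top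
  have hn : ∀ k, ‖(hm k).toLp _‖ₑ ^ 2 = (wt k * n4 T fun t => gev 1 k t * ‖a k t‖ₑ) ^ 2 := by
    intro k
    rw [wt_mul_n4, enorm_Lp_four]
    congr 1
    apply n4_congr
    filter_upwards [(hm k).coeFn_toLp] with t ht
    rw [ht]
  have hmem : Memℓp (fun k => (hm k).toLp _) 2 := by
    apply memℓp_gen
    have h1 : ∑' k, ‖(hm k).toLp _‖ₑ ^ 2 ≠ ⊤ := by
      simp only [hn]
      exact h
    have h2 := ENNReal.summable_toReal h1
    refine h2.congr fun k => ?_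
    simp
  refine ⟨⟨_, hmem⟩, fun k => ?_⟩
  filter_upwards [(hm k).coeFn_toLp] with t ht
  change (zWeight k t)⁻¹ • ((hm k).toLp _ : ℝ → C3) t = a k t
  rw [ht, smul_smul, inv_mul_cancel₀ (zWeight_pos k t).ne', one_smul]

/-! ### Local existence and uniqueness of mild solutions -/

lemma zNorm_congr_enorm {T σ : ℝ} {a b : Mode → ℝ → C3}
    (h : ∀ k, ∀ t ∈ Ioc 0 T, ‖a k t‖ₑ = ‖b k t‖ₑ) : zNorm T σ a = zNorm T σ b := by
  unfold zNorm
  refine tsum_congr fun k => ?_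
  congr 2
  apply n4_congr
  filter_upwards [ae_restrict_mem measurableSet_Ioc] with t ht
  rw [h k t ht]

lemma sNorm_congr_enorm {T σ : ℝ} {a b : Mode → ℝ → C3}
    (h : ∀ k, ∀ t ∈ Icc 0 T, ‖a k t‖ₑ = ‖b k t‖ₑ) : sNorm T σ a = sNorm T σ b := by
  unfold sNorm
  refine tsum_congr fun k => ?_
  congr 2
  exact iSup_congr fun t => iSup_congr fun ht => by rw [h k t ht]

/-- The Picard map. -/
def picard (ν : ℝ) (x : Mode → C3) (a : Mode → ℝ → C3) (k : Mode) (t : ℝ) : C3 :=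
  heatFlow ν x k t - duhamel ν (nonlin a) k t

lemma fNorm_nonlin_ne_top {T : ℝ} {a : Mode → ℝ → C3} (ha : ModesMeas T a)
    (hza : zNorm T 0 a ≠ ⊤) : fNorm T 0 (nonlin a) ≠ ⊤ :=
  ne_top_of_le_ne_top (by finiteness) (fNorm_nonlin_le le_rfl ha)

lemma enorm_picard_sub {ν T t : ℝ} {x : Mode → C3} {a b : Mode → ℝ → C3} (ha : ModesMeas T a)
    (hb : ModesMeas T b) (hza : zNorm T 0 a ≠ ⊤) (hzb : zNorm T 0 b ≠ ⊤) (k : Mode)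
    (ht : t ∈ Icc 0 T) :
    ‖picard ν x a k t - picard ν x b k t‖ₑ = ‖duhamel ν (nonlin a - nonlin b) k t‖ₑ := by
  rw [← duhamel_sub ht (integrableOn_of_fNorm ha.nonlin (fNorm_nonlin_ne_top ha hza) k)
    (integrableOn_of_fNorm hb.nonlin (fNorm_nonlin_ne_top hb hzb) k), picard, picard,
    sub_sub_sub_cancel_left, enorm_sub_rev]

lemma zNorm_picard_sub_le {ν T σ : ℝ} (hν : 0 < ν) (hσ : 0 ≤ σ) (hσ1 : σ ≤ 1) (x : Mode → C3)
    {a b : Mode → ℝ → C3} (ha : ModesMeas T a) (hb : ModesMeas T b) (hza : zNorm T 0 a ≠ ⊤)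
    (hzb : zNorm T 0 b ≠ ⊤) :
    zNorm T σ (picard ν x a - picard ν x b)
      ≤ regConst ν T * (216 * ((zNorm T σ a + zNorm T σ b) * zNorm T σ (a - b))) := by
  rw [zNorm_congr_enorm (a := picard ν x a - picard ν x b) (b := duhamel ν (nonlin a - nonlin b))
    (fun k t ht => enorm_picard_sub ha hb hza hzb k ⟨ht.1.le, ht.2⟩)]
  refine (zNorm_duhamel_le hν hσ1 (ha.nonlin.sub hb.nonlin)).trans ?_
  gcongr
  exact fNorm_nonlin_sub_le hσ ha hb hza hzb

lemma modesMeas_picard {ν T : ℝ} {x : Mode → C3} {a : Mode → ℝ → C3} (ha : ModesMeas T a)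
    (hza : zNorm T 0 a ≠ ⊤) : ModesMeas T (picard ν x a) :=
  (modesMeas_heatFlow ν T x).sub
    (modesMeas_duhamel (integrableOn_of_fNorm ha.nonlin (fNorm_nonlin_ne_top ha hza)))

lemma zNorm_picard_le {ν T σ : ℝ} (hν : 0 < ν) (hσ : 0 ≤ σ) (hσ1 : σ ≤ 1) (x : Mode → C3)
    {a : Mode → ℝ → C3} (ha : ModesMeas T a) (hza : zNorm T 0 a ≠ ⊤) :
    zNorm T σ (picard ν x a)
      ≤ 2 * (kerConst ν T ^ 2 * linNorm ν T (fun k => ‖x k‖ₑ)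
        + regConst ν T * (432 * zNorm T σ a ^ 2)) := by
  refine (zNorm_le_of_eq (modesMeas_heatFlow ν T x)
    (modesMeas_duhamel (integrableOn_of_fNorm ha.nonlin (fNorm_nonlin_ne_top ha hza)))
    (fun _ _ _ => rfl)).trans ?_
  gcongr
  · exact zNorm_heatFlow_le hν hσ1 x
  · refine (zNorm_duhamel_le hν hσ1 ha.nonlin).trans ?_
    gcongr
    exact fNorm_nonlin_le hσ ha

/-- The radius (squared) of the ball of the fixed point argument. -/
def ballRadius (ν : ℝ) : ℝ≥0∞ := (1728 * regConst ν 1)⁻¹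

lemma one_le_regConst {ν T : ℝ} (hν : 0 < ν) (hT : 0 ≤ T) : 1 ≤ regConst ν T := by
  have h1 : 1 ≤ kerConst ν T := by
    rw [kerConst, ENNReal.one_le_ofReal, Real.one_le_exp_iff]
    positivity
  rw [regConst]
  exact one_le_mul (one_le_pow₀ h1) (one_le_pow₀ le_self_add)

lemma ballRadius_ne_zero (ν : ℝ) : ballRadius ν ≠ 0 := by
  have := regConst_ne_top ν 1
  rw [ballRadius]
  exact ENNReal.inv_ne_zero.2 (by finiteness)

lemma ballRadius_le_one {ν : ℝ} (hν : 0 < ν) : ballRadius ν ≤ 1 := by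
  rw [ballRadius, ENNReal.inv_le_one]
  exact one_le_mul (by norm_num) (one_le_regConst hν zero_le_one)

lemma ballRadius_ne_top {ν : ℝ} (hν : 0 < ν) : ballRadius ν ≠ ⊤ :=
  ne_top_of_le_ne_top ENNReal.one_ne_top (ballRadius_le_one hν)

/-- The factor 1728 = 4·432 is chosen for this: on the ball the quadratic term is at most a quarter
of the radius, and the squared Lipschitz constant is at most 1/4. -/
lemma regConst_mul_ballRadius {ν : ℝ} (hν : 0 < ν) : 432 * (regConst ν 1 * ballRadius ν) = 4⁻¹ := by
  have h1 : regConst ν 1 ≠ 0 := (one_pos.trans_le (one_le_regConst hν zero_le_one)).ne'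
  have h2 := regConst_ne_top ν 1
  rw [ballRadius, ENNReal.mul_inv (by simp) (by simp), mul_left_comm (regConst ν 1),
    ENNReal.mul_inv_cancel h1 h2, mul_one, show (1728 : ℝ≥0∞) = 432 * 4 by norm_num,
    ENNReal.mul_inv (by simp) (by simp), ← mul_assoc, ENNReal.mul_inv_cancel (by simp) (by simp),
    one_mul]

/-- The smallness threshold for the linear part. -/
def linThreshold (ν : ℝ) : ℝ≥0∞ := (4 * kerConst ν 1 ^ 2)⁻¹ * ballRadius ν

lemma linThreshold_ne_zero (ν : ℝ) : linThreshold ν ≠ 0 := by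
  have h := kerConst_ne_top ν 1
  exact mul_ne_zero (ENNReal.inv_ne_zero.2 (by finiteness)) (ballRadius_ne_zero ν)

/-- The contraction principle in a small ball at σ = 1, so the solution comes with its Gevrey bound.
The smallness condition concerns the heat flow of the datum and not its norm, so large data are
admitted on short intervals. The bound T ≤ 1 only makes the constants uniform. -/
theorem exists_mildSol_local {ν T : ℝ} (hν : 0 < ν) (hT : T ≤ 1) (x : Mode → C3)
    (hx : ∑' k, wt k * ‖x k‖ₑ ^ 2 ≠ ⊤) (hlin : linNorm ν T (fun k => ‖x k‖ₑ) ≤ linThreshold ν) :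
    ∃ u, MildSol ν T x u ∧ zNorm T 1 u ≤ 1 := by
  set ρ := ballRadius ν with hρ
  have hρt := ballRadius_ne_top hν
  have hρ1 := ballRadius_le_one hν
  have hCρ := regConst_mul_ballRadius hν
  rw [← hρ] at hρt hρ1 hCρ
  have hball : ∀ a : Mode → ℝ → C3, ModesMeas T a → zNorm T 1 a ≤ ρ →
      zNorm T 1 (picard ν x a) ≤ ρ := by
    intro a ha hz
    have hz0 : zNorm T 0 a ≠ ⊤ :=
      ne_top_of_le_ne_top hρt ((zNorm_zero_le zero_le_one a).trans hz)
    refine (zNorm_picard_le hν zero_le_one le_rfl x ha hz0).trans ?_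
    have h1 : kerConst ν T ^ 2 * linNorm ν T (fun k => ‖x k‖ₑ) ≤ 4⁻¹ * ρ := by
      have hk0 : kerConst ν 1 ≠ 0 := by
        rw [kerConst, Ne, ENNReal.ofReal_eq_zero, not_le]
        exact Real.exp_pos _
      have hkt := kerConst_ne_top ν 1
      calc kerConst ν T ^ 2 * linNorm ν T (fun k => ‖x k‖ₑ)
          ≤ kerConst ν 1 ^ 2 * linThreshold ν := by
            gcongr
            exact kerConst_mono hν hT
        _ = _ := by
            rw [linThreshold, ENNReal.mul_inv (by simp) (by simp), mul_assoc, mul_left_comm,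
              ← mul_assoc (kerConst ν 1 ^ 2), ENNReal.mul_inv_cancel (by simpa using hk0)
              (by finiteness), one_mul]
    have h2 : regConst ν T * (432 * zNorm T 1 a ^ 2) ≤ 4⁻¹ * ρ := by
      calc regConst ν T * (432 * zNorm T 1 a ^ 2) ≤ regConst ν 1 * (432 * ρ ^ 2) := by
            gcongr
            exact regConst_mono hν hT
        _ = 432 * (regConst ν 1 * ρ) * ρ := by ring
        _ = _ := by rw [hCρ]
    calc _ ≤ 2 * (4⁻¹ * ρ + 4⁻¹ * ρ) := by gcongr
      _ = (4 * 4⁻¹) * ρ := by ring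
      _ = ρ := by rw [ENNReal.mul_inv_cancel (by simp) (by simp), one_mul]
  -- The Picard map acts on representatives, so its lift is obtained by choice; outside the ball its
  -- value is irrelevant.
  have hex : ∀ y : ZSpace T, ∃ z : ZSpace T, ‖y‖ₑ ^ 2 ≤ ρ →
      ∀ k, zDecode z k =ᵐ[timeMeas T] picard ν x (zDecode y) k := by
    intro y
    by_cases hy : ‖y‖ₑ ^ 2 ≤ ρ
    · rw [← zNorm_zDecode] at hy
      have hz0 : zNorm T 0 (zDecode y) ≠ ⊤ :=
        ne_top_of_le_ne_top hρt ((zNorm_zero_le zero_le_one _).trans hy)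
      obtain ⟨z, hz⟩ := exists_zDecode_eq (modesMeas_picard (ν := ν) (x := x)
        (modesMeas_zDecode y) hz0) (ne_top_of_le_ne_top hρt (hball _ (modesMeas_zDecode y) hy))
      exact ⟨z, fun _ => hz⟩
    · exact ⟨0, fun h => absurd h hy⟩
  choose Φ hΦ using hex
  set s : Set (ZSpace T) := {y | ‖y‖ₑ ^ 2 ≤ ρ} with hs
  have hsz : ∀ {y}, y ∈ s → zNorm T 1 (zDecode y) ≤ ρ := fun {y} hy => by rwa [zNorm_zDecode]
  have hsz0 : ∀ {y}, y ∈ s → zNorm T 0 (zDecode y) ≠ ⊤ := fun {y} hy =>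
    ne_top_of_le_ne_top hρt ((zNorm_zero_le zero_le_one _).trans (hsz hy))
  have hmaps : MapsTo Φ s s := by
    intro y hy
    change ‖Φ y‖ₑ ^ 2 ≤ ρ
    rw [← zNorm_zDecode, zNorm_congr (hΦ y hy)]
    exact hball _ (modesMeas_zDecode y) (hsz hy)
  have hclosed : IsComplete s := by
    apply IsClosed.isComplete
    have : s = (fun y : ZSpace T => ‖y‖ₑ) ⁻¹' ((fun r : ℝ≥0∞ => r ^ 2) ⁻¹' Iic ρ) := rfl
    rw [this]
    exact (isClosed_Iic.preimage (ENNReal.continuous_pow 2)).preimage continuous_enorm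
  -- The estimates are for squared norms, so the factor 1/4 there is the factor 1/2 here.
  have hcontr : ContractingWith 2⁻¹ (hmaps.restrict Φ s s) := by
    refine ⟨by norm_num, fun y z => ?_⟩
    change edist (Φ y.1) (Φ z.1) ≤ _ * edist y.1 z.1
    rw [edist_eq_enorm_sub, edist_eq_enorm_sub, ← ENNReal.pow_le_pow_left_iff (n := 2) (by norm_num),
      mul_pow, ← zNorm_zDecode_sub, ← zNorm_zDecode_sub]
    have h1 : zNorm T 1 (zDecode (Φ y.1) - zDecode (Φ z.1))
        = zNorm T 1 (picard ν x (zDecode y.1) - picard ν x (zDecode z.1)) := by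
      apply zNorm_congr
      intro k
      filter_upwards [hΦ y.1 y.2 k, hΦ z.1 z.2 k] with t h2 h3
      rw [Pi.sub_apply, Pi.sub_apply, Pi.sub_apply, Pi.sub_apply, h2, h3]
    rw [h1]
    refine (zNorm_picard_sub_le hν zero_le_one le_rfl x (modesMeas_zDecode _)
      (modesMeas_zDecode _) (hsz0 y.2) (hsz0 z.2)).trans ?_
    calc regConst ν T * (216 * ((zNorm T 1 (zDecode y.1) + zNorm T 1 (zDecode z.1)) *
          zNorm T 1 (zDecode y.1 - zDecode z.1)))
        ≤ regConst ν 1 * (216 * ((ρ + ρ) * zNorm T 1 (zDecode y.1 - zDecode z.1))) := by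
          gcongr
          · exact regConst_mono hν hT
          · exact hsz y.2
          · exact hsz z.2
      _ = 432 * (regConst ν 1 * ρ) * zNorm T 1 (zDecode y.1 - zDecode z.1) := by ring
      _ = _ := by
          rw [hCρ]
          congr 1
          rw [ENNReal.coe_inv (by norm_num), ← ENNReal.inv_pow]
          norm_num
  have h0s : (0 : ZSpace T) ∈ s := by simp [hs]
  obtain ⟨y, hys, hfix, -⟩ := hcontr.exists_fixedPoint' hclosed hmaps h0s (edist_ne_top _ _)
  have hy1 : ∀ k, zDecode y k =ᵐ[timeMeas T] picard ν x (zDecode y) k := by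
    have := hΦ y hys
    rwa [hfix.eq] at this
  have hym := modesMeas_zDecode y
  -- The solution is the Picard image of the fixed point and not the fixed point itself: this
  -- representative satisfies the equation at every time, while the fixed point does so only almost
  -- everywhere.
  set u := picard ν x (zDecode y) with hu
  have hum : ModesMeas T u := modesMeas_picard hym (hsz0 hys)
  have huz : zNorm T 1 u ≤ ρ := hball _ hym (hsz hys)
  refine ⟨u, ⟨hx, ?_, hum, ?_⟩, huz.trans hρ1⟩
  · exact ne_top_of_le_ne_top hρt ((zNorm_zero_le zero_le_one _).trans huz)
  · intro k t ht
    rw [hu, picard]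
    congr 1
    rw [duhamel, duhamel]
    apply intervalIntegral.integral_congr_ae
    have h1 : ∀ᵐ s ∂timeMeas T, ∀ l, zDecode y l s = u l s := ae_all_iff.2 hy1
    rw [ae_restrict_iff' measurableSet_Ioc] at h1
    filter_upwards [h1] with s hs hst
    rw [uIoc_of_le ht.1] at hst
    simp only [nonlin, hs ⟨hst.1, hst.2.trans ht.2⟩]
    rfl

/-! ### Restriction, uniqueness, time shift and concatenation -/

lemma MildSol.restrict {ν S T : ℝ} {x : Mode → C3} {u : Mode → ℝ → C3} (h : MildSol ν T x u)
    (hST : S ≤ T) : MildSol ν S x u where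
  init := h.init
  zfin := ne_top_of_le_ne_top h.zfin (zNorm_mono_time hST 0 u)
  meas k := (h.meas k).mono_set (Ioc_subset_Ioc_right hST)
  eqn k t ht := h.eqn k t ⟨ht.1, ht.2.trans hST⟩

lemma MildSol.exp_smul {ν T t : ℝ} {x : Mode → C3} {u : Mode → ℝ → C3} (h : MildSol ν T x u)
    (k : Mode) (ht : t ∈ Icc 0 T) :
    Real.exp (heatRate ν k * t) • u k t
      = x k - ∫ s in (0 : ℝ)..t, Real.exp (heatRate ν k * s) • nonlin u k s := by
  rw [h.eqn k t ht, heatFlow, duhamel_eq, ← smul_sub, smul_smul, ← Real.exp_add]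
  simp

lemma eq_of_exp_smul {ν t : ℝ} {x v : C3} {u : Mode → ℝ → C3} {k : Mode}
    (h : Real.exp (heatRate ν k * t) • v
      = x - ∫ s in (0 : ℝ)..t, Real.exp (heatRate ν k * s) • nonlin u k s) :
    v = Real.exp (-heatRate ν k * t) • x - duhamel ν (nonlin u) k t := by
  rw [duhamel_eq, ← smul_sub, ← h, smul_smul, ← Real.exp_add]
  simp

/-- On a short interval both norms are so small that the Picard map at least halves the squared norm
of the difference, which must then vanish. -/
lemma MildSol.uniq_small {ν T : ℝ} (hν : 0 < ν) (hT : 0 < T) {x : Mode → C3}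
    {u v : Mode → ℝ → C3} (hu : MildSol ν T x u) (hv : MildSol ν T x v) :
    ∃ S, 0 < S ∧ S ≤ T ∧ ∀ t ∈ Icc 0 S, ∀ k, u k t = v k t := by
  have hlim : Tendsto (fun S => regConst ν T * (216 * (zNorm S 0 u + zNorm S 0 v))) (𝓝[>] 0)
      (𝓝 (regConst ν T * (216 * (0 + 0)))) := by
    have h1 := (tendsto_zNorm_zero hT hu.zfin).add (tendsto_zNorm_zero hT hv.zfin)
    exact ENNReal.Tendsto.const_mul (ENNReal.Tendsto.const_mul h1 (Or.inr (by simp)))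
      (Or.inr (regConst_ne_top ν T))
  rw [add_zero, mul_zero, mul_zero] at hlim
  obtain ⟨S, hS1, hS⟩ := ((hlim.eventually_lt_const (show (0 : ℝ≥0∞) < 2⁻¹ by simp)).and
    (Ioo_mem_nhdsGT hT)).exists
  have hu' := hu.restrict hS.2.le
  have hv' := hv.restrict hS.2.le
  have hpu : ∀ k, ∀ t ∈ Icc 0 S, (u - v) k t = picard ν x u k t - picard ν x v k t := by
    intro k t ht
    rw [Pi.sub_apply, Pi.sub_apply, hu'.eqn k t ht, hv'.eqn k t ht, picard, picard]
  have hz : zNorm S 0 (u - v) ≤ 2⁻¹ * zNorm S 0 (u - v) := by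
    calc zNorm S 0 (u - v) = zNorm S 0 (picard ν x u - picard ν x v) :=
          zNorm_congr_enorm fun k t ht => by rw [hpu k t ⟨ht.1.le, ht.2⟩]; rfl
      _ ≤ _ := zNorm_picard_sub_le hν le_rfl zero_le_one x hu'.meas hv'.meas hu'.zfin hv'.zfin
      _ ≤ regConst ν T * (216 * ((zNorm S 0 u + zNorm S 0 v) * zNorm S 0 (u - v))) := by
          gcongr
          exact regConst_mono hν hS.2.le
      _ = regConst ν T * (216 * (zNorm S 0 u + zNorm S 0 v)) * zNorm S 0 (u - v) := by ring
      _ ≤ _ := by gcongr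
  -- Absorbing half of the difference on the left requires it to be finite.
  have hzt : zNorm S 0 (u - v) ≠ ⊤ := by
    refine ne_top_of_le_ne_top ?_ (zNorm_le_of_eq hu'.meas hv'.meas fun _ _ _ => rfl)
    have h1 := hu'.zfin
    have h2 := hv'.zfin
    finiteness
  have hz0 : zNorm S 0 (u - v) = 0 := by
    by_contra hne
    have h1 : 2⁻¹ * zNorm S 0 (u - v) < 1 * zNorm S 0 (u - v) :=
      ENNReal.mul_lt_mul_left hne hzt (by simp)
    rw [one_mul] at h1
    exact absurd hz (not_le.2 h1)
  -- The L⁴ norms only see almost every time. The supremum norm of the Duhamel term gives equality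
  -- at every time.
  have hs0 : sNorm S 0 (u - v) = 0 := by
    rw [← nonpos_iff_eq_zero]
    calc sNorm S 0 (u - v) = sNorm S 0 (duhamel ν (nonlin u - nonlin v)) :=
          sNorm_congr_enorm fun k t ht => by
            rw [hpu k t ht, enorm_picard_sub hu'.meas hv'.meas hu'.zfin hv'.zfin k ht]
      _ ≤ _ := sNorm_duhamel_le hν zero_le_one (hu'.meas.nonlin.sub hv'.meas.nonlin)
      _ ≤ regConst ν S * (216 * ((zNorm S 0 u + zNorm S 0 v) * zNorm S 0 (u - v))) := by
          gcongr
          exact fNorm_nonlin_sub_le le_rfl hu'.meas hv'.meas hu'.zfin hv'.zfin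
      _ = 0 := by rw [hz0]; simp
  refine ⟨S, hS.1, hS.2.le, fun t ht k => ?_⟩
  rw [sNorm, ENNReal.tsum_eq_zero] at hs0
  have h1 := hs0 k
  rw [mul_eq_zero, or_iff_right (wt_ne_zero k), pow_eq_zero_iff (by norm_num)] at h1
  have h2 : gev 0 k t * ‖(u - v) k t‖ₑ = 0 := by
    rw [← nonpos_iff_eq_zero, ← h1]
    exact le_iSup₂ (f := fun t (_ : t ∈ Icc 0 S) => gev 0 k t * ‖(u - v) k t‖ₑ) t ht
  simpa [sub_eq_zero] using h2

lemma MildSol.enorm_sq_le_sNorm {T t : ℝ} (u : Mode → ℝ → C3) {σ : ℝ} (ht : t ∈ Icc 0 T) :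
    ∑' k, wt k * (gev σ k t * ‖u k t‖ₑ) ^ 2 ≤ sNorm T σ u := by
  rw [sNorm]
  gcongr with k
  exact le_iSup₂ (f := fun t (_ : t ∈ Icc 0 T) => gev σ k t * ‖u k t‖ₑ) t ht

lemma MildSol.wt_sum_ne_top {ν T t : ℝ} (hν : 0 < ν) {x : Mode → C3} {u : Mode → ℝ → C3}
    (h : MildSol ν T x u) (ht : t ∈ Icc 0 T) : ∑' k, wt k * ‖u k t‖ₑ ^ 2 ≠ ⊤ := by
  have h1 := MildSol.enorm_sq_le_sNorm u (σ := 0) ht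
  simp only [gev_zero_left, one_mul] at h1
  exact ne_top_of_le_ne_top (h.sNorm_ne_top hν) h1

lemma setLIntegral_add_right (g : ℝ → ℝ≥0∞) (a b c : ℝ) :
    ∫⁻ t in Ioc a b, g (t + c) = ∫⁻ t in Ioc (a + c) (b + c), g t := by
  have h := (measurePreserving_add_right (volume : Measure ℝ) c).setLIntegral_comp_preimage_emb
    (measurableEmbedding_addRight c) g (Ioc (a + c) (b + c))
  rw [← h]
  simp

/-- With the integrating factor the equation says that e^{λt}u is the datum minus a primitive, λ
being the heat rate of the mode; the restarted equation is the difference of two instances, rescaled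
by e^{-λs}. The new datum is in H^{1/2} by the supremum bound. -/
lemma MildSol.shift {ν T s : ℝ} (hν : 0 < ν) {x : Mode → C3} {u : Mode → ℝ → C3}
    (h : MildSol ν T x u) (hs : s ∈ Icc 0 T) :
    MildSol ν (T - s) (fun k => u k s) (fun k t => u k (t + s)) where
  init := h.wt_sum_ne_top hν hs
  zfin := by
    refine ne_top_of_le_ne_top h.zfin ?_
    unfold zNorm n4
    simp only [gev_zero_left, one_mul]
    refine ENNReal.tsum_le_tsum fun k => pow_le_pow_left'
      (mul_le_mul_right (ENNReal.rpow_le_rpow ?_ (by norm_num)) _) 2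
    rw [setLIntegral_add_right (fun t => ‖u k t‖ₑ ^ 4)]
    apply lintegral_mono_set
    rw [zero_add, sub_add_cancel]
    exact Ioc_subset_Ioc_left hs.1
  meas k := by
    have h1 : ContinuousOn (fun t => u k (t + s)) (Ioc 0 (T - s)) := by
      refine (h.continuousOn k).comp (by fun_prop) ?_
      intro t ht
      exact ⟨by linarith [ht.1, hs.1], by linarith [ht.2]⟩
    exact h1.aestronglyMeasurable measurableSet_Ioc
  eqn k t ht := by
    apply eq_of_exp_smul
    have hts : t + s ∈ Icc 0 T := ⟨by linarith [ht.1, hs.1], by linarith [ht.2]⟩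
    have h1 := h.exp_smul k hts
    have h2 := h.exp_smul k hs
    have hi1 := intervalIntegrable_exp_smul hts (h.integrableOn k) (heatRate ν k)
    have hi2 := intervalIntegrable_exp_smul hs (h.integrableOn k) (heatRate ν k)
    have h3 := intervalIntegral.integral_interval_sub_left hi1 hi2
    have h4 : Real.exp (heatRate ν k * (t + s)) • u k (t + s) =
        Real.exp (heatRate ν k * s) • u k s
          - ∫ r in s..(t + s), Real.exp (heatRate ν k * r) • nonlin u k r := by
      rw [h1, h2, ← h3]
      abel
    have h5 : ∫ r in (0 : ℝ)..t, Real.exp (heatRate ν k * r)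
          • nonlin (fun k t => u k (t + s)) k r
        = Real.exp (-heatRate ν k * s) •
          ∫ r in s..(t + s), Real.exp (heatRate ν k * r) • nonlin u k r := by
      have h6 := intervalIntegral.integral_comp_add_right (a := 0) (b := t)
        (fun r => Real.exp (heatRate ν k * r) • nonlin u k r) s
      rw [zero_add] at h6
      rw [← h6, ← intervalIntegral.integral_smul]
      congr 1
      ext1 r
      change _ • nonlin u k (r + s) = _
      rw [smul_smul, ← Real.exp_add]
      congr 2
      ring
    rw [h5]
    have h7 := congrArg (fun y => Real.exp (-heatRate ν k * s) • y) h4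
    simp only [smul_sub, smul_smul, ← Real.exp_add] at h7
    convert h7 using 3
    · ring_nf
    · simp

/-- The times of agreement form a closed set which contains 0 and, by `uniq_small` after a shift,
extends to the right of each of its points before `T`. -/
lemma MildSol.unique {ν T : ℝ} (hν : 0 < ν) {x : Mode → C3}
    {u v : Mode → ℝ → C3} (hu : MildSol ν T x u) (hv : MildSol ν T x v) :
    ∀ t ∈ Icc 0 T, ∀ k, u k t = v k t := by
  rcases lt_or_ge T 0 with hT | hT
  · intro t ht
    exact absurd (ht.1.trans ht.2) (not_le.2 hT)
  have hclosed : IsClosed ({t | ∀ k, u k t = v k t} ∩ Icc 0 T) := by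
    have h1 : {t | ∀ k, u k t = v k t} ∩ Icc 0 T
        = ⋂ k, (Icc 0 T ∩ (fun t => u k t - v k t) ⁻¹' {0}) := by
      ext t
      simp only [mem_inter_iff, mem_ofPred_eq, mem_iInter, mem_preimage, mem_singleton_iff,
        sub_eq_zero]
      exact ⟨fun h k => ⟨h.2, h.1 k⟩, fun h => ⟨fun k => (h k).2, (h 0).1⟩⟩
    rw [h1]
    exact isClosed_iInter fun k => ((hu.continuousOn k).sub
      (hv.continuousOn k)).preimage_isClosed_of_isClosed isClosed_Icc isClosed_singleton
  refine hclosed.Icc_subset_of_forall_mem_nhdsWithin ?_ ?_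
  · intro k
    rw [hu.apply_zero hT, hv.apply_zero hT]
  · rintro t ⟨ht, ht2⟩
    have htI : t ∈ Icc 0 T := ⟨ht2.1, ht2.2.le⟩
    have h1 := hu.shift hν htI
    have h2 := hv.shift hν htI
    have h3 : (fun k => v k t) = fun k => u k t := funext fun k => (ht k).symm
    rw [h3] at h2
    obtain ⟨S, hS0, hS1, hS⟩ := h1.uniq_small hν (sub_pos.2 ht2.2) h2
    filter_upwards [Ioo_mem_nhdsGT (show t < t + S by linarith)] with r hr k
    have := hS (r - t) ⟨by linarith [hr.1], by linarith [hr.2]⟩ k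
    simpa using this

/-- Concatenation of two families at time `T`. -/
def glue (T : ℝ) (u v : Mode → ℝ → C3) (k : Mode) (t : ℝ) : C3 :=
  if t ≤ T then u k t else v k (t - T)

lemma nonlin_glue (T : ℝ) (u v : Mode → ℝ → C3) : nonlin (glue T u v) = glue T (nonlin u) (nonlin v) := by
  funext k t
  unfold nonlin glue
  split_ifs <;> rfl

lemma MildSol.glue {ν T S : ℝ} (hT : 0 ≤ T) (hS : 0 ≤ S) {x : Mode → C3} {u v : Mode → ℝ → C3}
    (hu : MildSol ν T x u) (hv : MildSol ν S (fun k => u k T) v) :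
    MildSol ν (T + S) x (glue T u v) := by
  have hsplit : Ioc 0 (T + S) = Ioc 0 T ∪ Ioc T (T + S) :=
    (Ioc_union_Ioc_eq_Ioc hT (by linarith)).symm
  have e1 : ∀ (a b : Mode → ℝ → C3) k, EqOn (Burgers.glue T a b k) (a k) (Ioc 0 T) := fun a b k t ht => if_pos ht.2
  have e2 : ∀ (a b : Mode → ℝ → C3) k, EqOn (Burgers.glue T a b k) (fun t => b k (t - T)) (Ioc T (T + S)) :=
    fun a b k t ht => if_neg (not_le.2 ht.1)
  refine ⟨hu.init, ?_, ?_, ?_⟩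
  · have h1 : zNorm (T + S) 0 (Burgers.glue T u v) ≤ 2 * (zNorm T 0 u + zNorm S 0 v) := by
      rw [zNorm, zNorm, zNorm, ← ENNReal.tsum_add, ← ENNReal.tsum_mul_left]
      refine ENNReal.tsum_le_tsum fun k => (le_trans ?_ (add_sq_le_two_mul _ _))
      rw [← mul_add]
      gcongr
      simp only [gev_zero_left, one_mul]
      apply n4_le_of_pow_le
      rw [hsplit, lintegral_union measurableSet_Ioc (Ioc_disjoint_Ioc_of_le le_rfl)]
      -- Fourth powers of L⁴ norms add over adjacent intervals, and a⁴ + b⁴ ≤ (a + b)⁴.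
      calc _ = n4 T (fun t => ‖u k t‖ₑ) ^ 4 + n4 S (fun t => ‖v k t‖ₑ) ^ 4 := by
            rw [n4_pow_four, n4_pow_four]
            congr 1
            · exact setLIntegral_congr_fun measurableSet_Ioc fun t ht => by
                simp only [e1 u v k ht]
            · have h2 := setLIntegral_add_right (fun t => ‖v k (t - T)‖ₑ ^ 4) 0 S T
              simp only [add_sub_cancel_right, zero_add] at h2
              rw [h2, add_comm S]
              exact setLIntegral_congr_fun measurableSet_Ioc fun t ht => by
                simp only [e2 u v k ht]
        _ ≤ _ := by
            set a := n4 T fun t => ‖u k t‖ₑ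
            set b := n4 S fun t => ‖v k t‖ₑ
            calc a ^ 4 + b ^ 4 ≤ a ^ 4 + b ^ 4 + (4 * a ^ 3 * b + 6 * a ^ 2 * b ^ 2 + 4 * a * b ^ 3) :=
                  le_self_add
              _ = _ := by ring
    have h2 := hu.zfin
    have h3 := hv.zfin
    exact ne_top_of_le_ne_top (by finiteness) h1
  · intro k
    rw [hsplit]
    refine (aestronglyMeasurable_union_iff).2 ⟨?_, ?_⟩
    · exact (hu.meas k).congr ((ae_restrict_iff' measurableSet_Ioc).2
        (Eventually.of_forall fun t ht => (e1 u v k ht).symm))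
    · have h1 : ContinuousOn (fun t => v k (t - T)) (Ioc T (T + S)) := by
        refine (hv.continuousOn k).comp (by fun_prop) ?_
        intro t ht
        exact ⟨by linarith [ht.1], by linarith [ht.2]⟩
      exact (h1.aestronglyMeasurable measurableSet_Ioc).congr
        ((ae_restrict_iff' measurableSet_Ioc).2
          (Eventually.of_forall fun t ht => (e2 u v k ht).symm))
  · intro k t ht
    apply eq_of_exp_smul
    rw [nonlin_glue]
    rcases le_or_gt t T with htT | htT
    · have h1 := hu.exp_smul k ⟨ht.1, htT⟩
      rw [Burgers.glue, if_pos htT, h1]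
      congr 1
      apply intervalIntegral.integral_congr_ae
      refine Eventually.of_forall fun r hr => ?_
      rw [uIoc_of_le ht.1] at hr
      rw [e1 _ _ k ⟨hr.1, hr.2.trans htT⟩]
    · have htS : t - T ∈ Icc 0 S := ⟨by linarith, by linarith [ht.2]⟩
      have h1 := hv.exp_smul k htS
      have h2 := hu.exp_smul k (right_mem_Icc.2 hT)
      have h3 : ∫ r in (0 : ℝ)..T, Real.exp (heatRate ν k * r)
          • Burgers.glue T (nonlin u) (nonlin v) k r
          = ∫ r in (0 : ℝ)..T, Real.exp (heatRate ν k * r) • nonlin u k r := by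
        apply intervalIntegral.integral_congr_ae
        refine Eventually.of_forall fun r hr => ?_
        rw [uIoc_of_le hT] at hr
        rw [e1 _ _ k hr]
      have h4 : ∫ r in T..t, Real.exp (heatRate ν k * r)
          • Burgers.glue T (nonlin u) (nonlin v) k r
          = Real.exp (heatRate ν k * T) •
            ∫ r in (0 : ℝ)..(t - T), Real.exp (heatRate ν k * r) • nonlin v k r := by
        have h6 := intervalIntegral.integral_comp_sub_right (a := T) (b := t)
          (fun r => Real.exp (heatRate ν k * r) • nonlin v k r) T
        rw [sub_self] at h6
        rw [← h6, ← intervalIntegral.integral_smul]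
        apply intervalIntegral.integral_congr_ae
        refine Eventually.of_forall fun r hr => ?_
        rw [uIoc_of_le htT.le] at hr
        rw [e2 _ _ k ⟨hr.1, hr.2.trans ht.2⟩, smul_smul, ← Real.exp_add]
        congr 2
        ring
      have hi1 : IntervalIntegrable (fun r => Real.exp (heatRate ν k * r)
          • Burgers.glue T (nonlin u) (nonlin v) k r) volume 0 T := by
        refine (intervalIntegrable_exp_smul (right_mem_Icc.2 hT) (hu.integrableOn k)
          (heatRate ν k)).congr ?_
        intro r hr
        rw [uIoc_of_le hT] at hr
        simp only [e1 _ _ k hr]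
      have hi2 : IntervalIntegrable (fun r => Real.exp (heatRate ν k * r)
          • Burgers.glue T (nonlin u) (nonlin v) k r) volume T t := by
        have h7 := ((intervalIntegrable_exp_smul htS (hv.integrableOn k)
          (heatRate ν k)).comp_sub_right T).smul (Real.exp (heatRate ν k * T))
        rw [zero_add, sub_add_cancel] at h7
        refine h7.congr ?_
        intro r hr
        rw [uIoc_of_le htT.le] at hr
        simp only [e2 _ _ k ⟨hr.1, hr.2.trans ht.2⟩, Pi.smul_apply, smul_smul, ← Real.exp_add]
        congr 2
        ring
      rw [← intervalIntegral.integral_add_adjacent_intervals hi1 hi2, h3, h4, Burgers.glue,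
        if_neg (not_le.2 htT), ← sub_sub, ← h2]
      have h8 := congrArg (fun y => Real.exp (heatRate ν k * T) • y) h1
      simp only [smul_sub, smul_smul, ← Real.exp_add] at h8
      rw [← h8]
      congr 2
      ring

/-! ### Smoothing of mild solutions -/

/-- A telescoping bound: the shell at distance m contributes at most (24m² + 2)/(1 + m²)², which is
below 52/m - 52/(m+1). -/
lemma sum_modeBox_four_le (N : ℕ) :
    ∑ k ∈ modeBox N, (bracket k ^ 4)⁻¹ ≤ 53 - 52 / ((N : ℝ) + 1) := by
  induction N with
  | zero =>
    have h : modeBox 0 = {0} := by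
      ext k
      simp [mem_modeBox, funext_iff]
    rw [h]
    simp only [Finset.sum_singleton, show 4 = 2 * 2 by norm_num, pow_mul, bracket_sq, modeNorm_sq]
    norm_num
  | succ n ih =>
    rw [← Finset.sum_sdiff (modeBox_subset n)]
    have h1 : ∑ k ∈ modeBox (n + 1) \ modeBox n, (bracket k ^ 4)⁻¹
        ≤ (modeBox (n + 1) \ modeBox n).card • (((1 + ((n : ℝ) + 1) ^ 2) ^ 2)⁻¹) := by
      apply Finset.sum_le_card_nsmul
      intro k hk
      rw [Finset.mem_sdiff, mem_modeBox, mem_modeBox, not_forall] at hk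
      obtain ⟨-, i, hi⟩ := hk
      have h2 : (n : ℝ) + 1 ≤ |(k i : ℝ)| := by
        have : (n : ℤ) + 1 ≤ |k i| := by omega
        exact_mod_cast this
      have h3 := h2.trans (abs_le_modeNorm k i)
      rw [show 4 = 2 * 2 by norm_num, pow_mul, bracket_sq]
      gcongr
    have h4 : ((modeBox (n + 1) \ modeBox n).card : ℝ)
        = (2 * (n + 1 : ℝ) + 1) ^ 3 - (2 * n + 1) ^ 3 := by
      rw [Finset.card_sdiff_of_subset (modeBox_subset n), card_modeBox, card_modeBox,
        Nat.cast_sub (by gcongr; omega)]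
      push_cast
      ring
    have hn : (0 : ℝ) ≤ n := Nat.cast_nonneg n
    have h5 : (modeBox (n + 1) \ modeBox n).card • (((1 + ((n : ℝ) + 1) ^ 2) ^ 2)⁻¹)
        ≤ 52 / ((n : ℝ) + 1) - 52 / ((n : ℝ) + 1 + 1) := by
      rw [nsmul_eq_mul, h4, ← div_eq_mul_inv, div_sub_div _ _ (by positivity) (by positivity),
        div_le_div_iff₀ (by positivity) (by positivity)]
      nlinarith [pow_nonneg hn 2, pow_nonneg hn 3, pow_nonneg hn 4]
    push_cast
    linarith

lemma summable_bracket : Summable fun k : Mode => (bracket k ^ 4)⁻¹ := by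
  refine summable_of_sum_le (c := 53) (fun k => by have := bracket_pos k; positivity) fun s => ?_
  obtain ⟨N, hN⟩ : ∃ N : ℕ, s ⊆ modeBox N := by
    refine ⟨∑ k ∈ s, ∑ i, (k i).natAbs, fun k hk => mem_modeBox.2 fun i => ?_⟩
    rw [Int.abs_eq_natAbs, Int.ofNat_le]
    have h1 : (k i).natAbs ≤ ∑ i, (k i).natAbs :=
      Finset.single_le_sum (f := fun i => (k i).natAbs) (fun _ _ => Nat.zero_le _) (Finset.mem_univ i)
    have h2 : ∑ i, (k i).natAbs ≤ ∑ k ∈ s, ∑ i, (k i).natAbs :=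
      Finset.single_le_sum (f := fun k : Mode => ∑ i, (k i).natAbs) (fun _ _ => Nat.zero_le _) hk
    exact h1.trans h2
  calc ∑ k ∈ s, (bracket k ^ 4)⁻¹ ≤ ∑ k ∈ modeBox N, (bracket k ^ 4)⁻¹ :=
        Finset.sum_le_sum_of_subset_of_nonneg hN fun k _ _ => by
          have := bracket_pos k; positivity
    _ ≤ _ := sum_modeBox_four_le N
    _ ≤ 53 := by
        have : (0 : ℝ) ≤ 52 / ((N : ℝ) + 1) := by positivity
        linarith

/-- A single Taylor term of the exponential, of degree n + 4, is enough: n powers cancel the growth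
and four leave a summable `bracket` weight. -/
lemma summable_pow_mul_exp {c : ℝ} (hc : 0 < c) (n : ℕ) :
    Summable fun k : Mode => modeNorm k ^ n * Real.exp (-c * modeNorm k) := by
  refine Summable.of_nonneg_of_le (fun k => by have := modeNorm_nonneg k; positivity) (fun k => ?_)
    (summable_bracket.mul_left (((n + 4).factorial : ℝ) / c ^ (n + 4) * Real.exp c))
  have h0 := modeNorm_nonneg k
  have hb := bracket_pos k
  have h1 := Real.pow_div_factorial_le_exp (c * (1 + modeNorm k)) (by positivity) (n + 4)
  rw [div_le_iff₀ (by positivity), mul_pow] at h1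
  rw [← div_eq_mul_inv, le_div_iff₀ (by positivity)]
  calc modeNorm k ^ n * Real.exp (-c * modeNorm k) * bracket k ^ 4
      ≤ (1 + modeNorm k) ^ n * Real.exp (-c * modeNorm k) * (1 + modeNorm k) ^ 4 := by
        gcongr
        · linarith
        · exact bracket_le k
    _ = Real.exp (-c * modeNorm k) * (c ^ (n + 4) * (1 + modeNorm k) ^ (n + 4)) / c ^ (n + 4) := by
        field_simp
        ring
    _ ≤ Real.exp (-c * modeNorm k) * (Real.exp (c * (1 + modeNorm k)) * (n + 4).factorial)
          / c ^ (n + 4) := by gcongr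
    _ = (Real.exp (-c * modeNorm k) * Real.exp (c * (1 + modeNorm k)))
          * ((n + 4).factorial / c ^ (n + 4)) := by ring
    _ = _ := by
        rw [← Real.exp_add, mul_comm]
        congr 2
        ring

/-- Exponential decay of Fourier coefficients. -/
def ExpDecay (B c : ℝ) (x : Mode → C3) : Prop := ∀ k, ‖x k‖ ≤ B * Real.exp (-c * modeNorm k)

lemma ExpDecay.summable {B c : ℝ} (hc : 0 < c) {x : Mode → C3} (h : ExpDecay B c x) (n : ℕ) :
    Summable fun k => modeNorm k ^ n * ‖x k‖ := by
  refine Summable.of_nonneg_of_le (fun k => by have := modeNorm_nonneg k; positivity) (fun k => ?_)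
    ((summable_pow_mul_exp hc n).mul_left B)
  have := modeNorm_nonneg k
  calc modeNorm k ^ n * ‖x k‖ ≤ modeNorm k ^ n * (B * Real.exp (-c * modeNorm k)) := by
        gcongr; exact h k
    _ = _ := by ring

lemma ExpDecay.nonneg {B c : ℝ} {x : Mode → C3} (h : ExpDecay B c x) : 0 ≤ B := by
  have h1 := (norm_nonneg _).trans (h 0)
  exact nonneg_of_mul_nonneg_left h1 (Real.exp_pos _)

lemma mul_exp_le {c r : ℝ} (hc : 0 < c) : r * Real.exp (-c * r) ≤ 2 / c * Real.exp (-(c / 2) * r) := by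
  have h1 : c / 2 * r ≤ Real.exp (c / 2 * r) := by linarith [Real.add_one_le_exp (c / 2 * r)]
  have h2 : Real.exp (-(c / 2) * r) = Real.exp (c / 2 * r) * Real.exp (-c * r) := by
    rw [← Real.exp_add]; congr 1; ring
  rw [h2, ← mul_assoc]
  gcongr
  rw [div_mul_eq_mul_div, le_div_iff₀ hc]
  linarith

/-- The constant in the decay of the nonlinearity. -/
def nlConst (B c : ℝ) : ℝ := ∑' l : Mode, B ^ 2 * (2 / c) * Real.exp (-(c / 2) * modeNorm l)

lemma summable_nlConst (B : ℝ) {c : ℝ} (hc : 0 < c) :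
    Summable fun l : Mode => B ^ 2 * (2 / c) * Real.exp (-(c / 2) * modeNorm l) := by
  have := summable_pow_mul_exp (half_pos hc) 0
  simp only [pow_zero, one_mul] at this
  exact this.mul_left _

lemma ExpDecay.norm_convTerm_le {B c : ℝ} (hc : 0 < c) {x : Mode → C3} (h : ExpDecay B c x)
    (k l : Mode) : ‖convTerm (k - l) (x l) (x (k - l))‖
      ≤ B ^ 2 * (2 / c) * Real.exp (-(c / 2) * modeNorm l) * Real.exp (-(c / 2) * modeNorm k) := by
  have hB := h.nonneg
  have hm := modeNorm_nonneg (k - l)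
  calc ‖convTerm (k - l) (x l) (x (k - l))‖
      ≤ ‖x l‖ * (modeNorm (k - l) * ‖x (k - l)‖) := Burgers.norm_convTerm_le _ _ _
    _ ≤ (B * Real.exp (-c * modeNorm l)) *
          (modeNorm (k - l) * (B * Real.exp (-c * modeNorm (k - l)))) := by
        gcongr
        · exact h l
        · exact h (k - l)
    _ = B ^ 2 * Real.exp (-c * modeNorm l) *
          (modeNorm (k - l) * Real.exp (-c * modeNorm (k - l))) := by ring
    _ ≤ B ^ 2 * Real.exp (-c * modeNorm l) * (2 / c * Real.exp (-(c / 2) * modeNorm (k - l))) := by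
        exact mul_le_mul_of_nonneg_left (mul_exp_le hc) (by positivity)
    _ = B ^ 2 * (2 / c) * Real.exp (-c * modeNorm l + -(c / 2) * modeNorm (k - l)) := by
        rw [Real.exp_add]; ring
    -- Half of the decay in `l` is kept for the sum over `l`; the other half joins the decay in `k -
    -- l` to give decay in `k` by the triangle inequality.
    _ ≤ B ^ 2 * (2 / c) * Real.exp (-(c / 2) * modeNorm l + -(c / 2) * modeNorm k) := by
        refine mul_le_mul_of_nonneg_left (Real.exp_le_exp.2 ?_) (by positivity)
        have h1 := modeNorm_add_le l (k - l)
        rw [add_sub_cancel] at h1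
        have h2 := modeNorm_nonneg l
        nlinarith
    _ = _ := by rw [Real.exp_add]; ring

lemma ExpDecay.summable_convTerm {B c : ℝ} (hc : 0 < c) {x : Mode → C3} (h : ExpDecay B c x)
    (k : Mode) : Summable fun l => convTerm (k - l) (x l) (x (k - l)) :=
  Summable.of_norm_bounded ((summable_nlConst B hc).mul_right _) (h.norm_convTerm_le hc k)

lemma ExpDecay.expDecay_burgersNL {B c : ℝ} (hc : 0 < c) {x : Mode → C3} (h : ExpDecay B c x) :
    ExpDecay (nlConst B c) (c / 2) (burgersNL x) := by
  intro k
  have h1 := ((summable_nlConst B hc).mul_right (Real.exp (-(c / 2) * modeNorm k))).hasSum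
  rw [tsum_mul_right] at h1
  exact tsum_of_norm_bounded h1 (h.norm_convTerm_le hc k)

lemma continuousOn_nonlin {B c : ℝ} (hc : 0 < c) {u : Mode → ℝ → C3} {s : Set ℝ}
    (h : ∀ t ∈ s, ExpDecay B c fun k => u k t) (hu : ∀ k, ContinuousOn (u k) s) (k : Mode) :
    ContinuousOn (nonlin u k) s := by
  unfold nonlin Burgers.burgersNL
  refine continuousOn_tsum (u := fun l => B ^ 2 * (2 / c) * Real.exp (-(c / 2) * modeNorm l)
    * Real.exp (-(c / 2) * modeNorm k)) (fun l => ?_) ((summable_nlConst B hc).mul_right _)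
    fun l t ht => (h t ht).norm_convTerm_le hc k l
  have h1 : ContinuousOn (fun t => (u l t, u (k - l) t)) s := (hu l).prodMk (hu (k - l))
  have h2 := (continuous_convTerm (k - l)).comp_continuousOn h1
  simpa only [Function.comp_def] using h2

/-! ### Gevrey smoothing after a restart -/

/-- The bound on the Gevrey norm which the local existence theorem gives. -/
def gevBound (ν : ℝ) (S : ℝ≥0∞) : ℝ≥0∞ := 2 * (kerConst ν 1 ^ 2 * S + regConst ν 1 * 432)

lemma gevBound_ne_top (ν : ℝ) {S : ℝ≥0∞} (hS : S ≠ ⊤) : gevBound ν S ≠ ⊤ := by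
  have h1 := kerConst_ne_top ν 1
  have h2 := regConst_ne_top ν 1
  unfold gevBound
  finiteness

lemma MildSol.sNorm_one_le {ν T : ℝ} (hν : 0 < ν) (hT : T ≤ 1) {x : Mode → C3} {u : Mode → ℝ → C3}
    (h : MildSol ν T x u) (hz : zNorm T 1 u ≤ 1) :
    sNorm T 1 u ≤ gevBound ν (∑' k, wt k * ‖x k‖ₑ ^ 2) := by
  refine (h.sNorm_le hν zero_le_one le_rfl).trans ?_
  rw [gevBound]
  gcongr
  · exact kerConst_mono hν hT
  · exact regConst_mono hν hT
  · calc 432 * zNorm T 1 u ^ 2 ≤ 432 * 1 ^ 2 := by gcongr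
      _ = 432 := by norm_num

/-- The solution restarted at `s` coincides, by uniqueness, with the one that the local theorem
constructs, and the latter carries the weight e^{√τ|k|} at elapsed time `τ`. -/
lemma MildSol.gevrey {ν T s τ : ℝ} (hν : 0 < ν) {x : Mode → C3} {u : Mode → ℝ → C3}
    (h : MildSol ν T x u) (hs : 0 ≤ s) (hτ : 0 ≤ τ) (hτ1 : τ ≤ 1) (hsT : s + τ ≤ T)
    (hlin : linNorm ν τ (fun k => ‖u k s‖ₑ) ≤ linThreshold ν) :
    ∑' k, wt k * (gev 1 k τ * ‖u k (s + τ)‖ₑ) ^ 2 ≤ gevBound ν (∑' k, wt k * ‖u k s‖ₑ ^ 2) := by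
  have hsI : s ∈ Icc 0 T := ⟨hs, by linarith⟩
  obtain ⟨v, hv, hz⟩ := exists_mildSol_local hν hτ1 (fun k => u k s) (h.wt_sum_ne_top hν hsI) hlin
  have h1 := ((h.shift hν hsI).restrict (by linarith : τ ≤ T - s)).unique hν hv τ
    (right_mem_Icc.2 hτ)
  have h2 : ∀ k, u k (s + τ) = v k τ := fun k => by rw [add_comm s]; exact h1 k
  simp only [h2]
  exact (MildSol.enorm_sq_le_sNorm v (right_mem_Icc.2 hτ)).trans (hv.sNorm_one_le hν hτ1 hz)

lemma expDecay_of_gevrey {τ : ℝ} {x : Mode → C3} {D : ℝ≥0∞} (hD : D ≠ ⊤)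
    (h : ∑' k, wt k * (gev 1 k τ * ‖x k‖ₑ) ^ 2 ≤ D) : ExpDecay (√D.toReal) (√τ) x := by
  intro k
  have h1 : (gev 1 k τ * ‖x k‖ₑ) ^ 2 ≤ D := by
    calc (gev 1 k τ * ‖x k‖ₑ) ^ 2 = 1 * (gev 1 k τ * ‖x k‖ₑ) ^ 2 := (one_mul _).symm
      _ ≤ wt k * (gev 1 k τ * ‖x k‖ₑ) ^ 2 := by gcongr; exact one_le_wt k
      _ ≤ _ := ENNReal.le_tsum k
      _ ≤ D := h
  rw [gev, ← ofReal_norm, ← ENNReal.ofReal_mul (Real.exp_pos _).le,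
    ← ENNReal.ofReal_pow (by positivity), ENNReal.ofReal_le_iff_le_toReal hD] at h1
  have h2 := Real.le_sqrt_of_sq_le h1
  rw [one_mul] at h2
  calc ‖x k‖ = Real.exp (√τ * modeNorm k) * ‖x k‖ * Real.exp (-√τ * modeNorm k) := by
        rw [mul_right_comm, ← Real.exp_add]
        simp
    _ ≤ _ := by gcongr

/-- Mild solutions have exponentially decaying Fourier coefficients after the initial time. -/
theorem MildSol.exists_expDecay {ν T t₁ : ℝ} (hν : 0 < ν) {x : Mode → C3} {u : Mode → ℝ → C3}
    (h : MildSol ν T x u) (ht₁ : 0 < t₁) :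
    ∃ B c, 0 < c ∧ ∀ t ∈ Icc t₁ T, ExpDecay B c fun k => u k t := by
  -- This majorant of all the states u(t) is in the weighted ℓ² space because `sNorm` takes the
  -- supremum inside the sum. Hence one `τ` serves every restart time t - τ, and the constants are
  -- uniform on [t₁, T].
  set M : Mode → ℝ≥0∞ := fun k => ⨆ t ∈ Icc 0 T, gev 0 k t * ‖u k t‖ₑ with hM
  have hMle : ∀ t ∈ Icc 0 T, ∀ k, ‖u k t‖ₑ ≤ M k := by
    intro t ht k
    have := le_iSup₂ (f := fun t (_ : t ∈ Icc 0 T) => gev 0 k t * ‖u k t‖ₑ) t ht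
    rwa [gev_zero_left, one_mul] at this
  have hMs : ∑' k, wt k * M k ^ 2 ≠ ⊤ := h.sNorm_ne_top hν
  obtain ⟨τ, hτ, hτ0, hτ1⟩ := (((tendsto_linNorm_zero hν hMs).eventually_le_const
    (pos_iff_ne_zero.2 (linThreshold_ne_zero ν))).and
    (Ioo_mem_nhdsGT (lt_min ht₁ one_pos))).exists
  refine ⟨√(gevBound ν (∑' k, wt k * M k ^ 2)).toReal, √τ, Real.sqrt_pos.2 hτ0, fun t ht => ?_⟩
  have hts : t - τ ∈ Icc 0 T := by
    have := hτ1.trans_le (min_le_left _ _)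
    exact ⟨by linarith [ht.1], by linarith [ht.2]⟩
  have h1 := h.gevrey hν hts.1 hτ0.le (hτ1.le.trans (min_le_right _ _)) (by linarith [ht.2])
    ((linNorm_mono ν τ (hMle _ hts)).trans hτ)
  rw [sub_add_cancel] at h1
  refine expDecay_of_gevrey (gevBound_ne_top ν hMs) (h1.trans ?_)
  unfold gevBound
  gcongr with k
  exact hMle _ hts k

lemma MildSol.continuousOn_nonlin {ν T : ℝ} (hν : 0 < ν) {x : Mode → C3} {u : Mode → ℝ → C3}
    (h : MildSol ν T x u) (k : Mode) : ContinuousOn (nonlin u k) (Ioc 0 T) := by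
  intro t ht
  obtain ⟨B, c, hc, hB⟩ := h.exists_expDecay hν (half_pos ht.1)
  have h1 : ContinuousOn (nonlin u k) (Icc (t / 2) T) :=
    Burgers.continuousOn_nonlin hc hB
      (fun k => (h.continuousOn k).mono (Icc_subset_Icc_left (by linarith [ht.1]))) k
  refine (h1 t ⟨by linarith [ht.1], ht.2⟩).mono_of_mem_nhdsWithin ?_
  filter_upwards [self_mem_nhdsWithin, mem_nhdsWithin_of_mem_nhds (Ioi_mem_nhds (half_lt_self ht.1))]
    with r hr hr2
  exact ⟨le_of_lt hr2, hr.2⟩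

/-- The fundamental theorem of calculus in the integrating-factor form; it applies because smoothing
has made the nonlinear term continuous at positive times. -/
lemma MildSol.hasDerivAt {ν T t : ℝ} (hν : 0 < ν) {x : Mode → C3} {u : Mode → ℝ → C3}
    (h : MildSol ν T x u) (ht : t ∈ Ioo 0 T) (k : Mode) :
    HasDerivAt (u k) (-(heatRate ν k • u k t) - nonlin u k t) t := by
  have hT : 0 ≤ T := (ht.1.trans ht.2).le
  have hn : Icc 0 T ∈ 𝓝 t := Icc_mem_nhds ht.1 ht.2
  have hn2 : Ioc 0 T ∈ 𝓝 t := Ioc_mem_nhds ht.1 ht.2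
  have hcont : ContinuousAt (fun s => Real.exp (heatRate ν k * s) • nonlin u k s) t := by
    have h0 : Continuous fun s : ℝ => Real.exp (heatRate ν k * s) := by fun_prop
    refine h0.continuousAt.smul ?_
    exact (h.continuousOn_nonlin hν k).continuousAt hn2
  have hint := intervalIntegrable_exp_smul (⟨ht.1.le, ht.2.le⟩ : t ∈ Icc 0 T) (h.integrableOn k)
    (heatRate ν k)
  have hmeas : StronglyMeasurableAtFilter
      (fun s => Real.exp (heatRate ν k * s) • nonlin u k s) (𝓝 t) := by
    refine ⟨Ioc 0 T, hn2, ?_⟩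
    have h1 : Continuous fun s : ℝ => Real.exp (heatRate ν k * s) := by fun_prop
    exact h1.aestronglyMeasurable.smul (h.meas.nonlin k)
  have h1 := intervalIntegral.integral_hasDerivAt_right hint hmeas hcont
  have h2 : HasDerivAt (fun s => Real.exp (-heatRate ν k * s))
      (Real.exp (-heatRate ν k * t) * (-heatRate ν k)) t := by
    have := ((hasDerivAt_id t).const_mul (-heatRate ν k)).exp
    simpa using this
  have h3 := h2.smul ((hasDerivAt_const t (x k)).sub h1)
  have h4 : u k =ᶠ[𝓝 t] fun s => Real.exp (-heatRate ν k * s) •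
      (x k - ∫ r in (0 : ℝ)..s, Real.exp (heatRate ν k * r) • nonlin u k r) := by
    filter_upwards [hn] with s hs
    rw [← h.exp_smul k hs, smul_smul, ← Real.exp_add]
    simp
  refine (h3.congr_of_eventuallyEq h4).congr_deriv ?_
  simp only [Pi.sub_apply]
  rw [← h.exp_smul k ⟨ht.1.le, ht.2.le⟩, zero_sub, smul_neg, smul_smul, smul_smul, ← Real.exp_add,
    mul_right_comm, ← Real.exp_add]
  simp only [neg_mul, neg_add_cancel, Real.exp_zero, one_smul, one_mul, neg_smul]
  abel

/-! ### Synthesis of fields from Fourier coefficients -/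

/-- The function `s ↦ Re (a e^{is})`. -/
def reWave (a : C3) (s : ℝ) : E3 :=
  WithLp.toLp 2 fun i => (a i * Complex.exp (s * Complex.I)).re

/-- The phase `y ↦ k·y`. -/
def phase (k : Mode) : E3 →L[ℝ] ℝ := innerSL ℝ (WithLp.toLp 2 fun i => (k i : ℝ) : E3)

lemma phase_apply (k : Mode) (y : E3) : phase k y = ∑ i, (k i : ℝ) * y i := by
  rw [phase, innerSL_apply_apply, PiLp.inner_apply]
  simp [mul_comm]

lemma norm_phase (k : Mode) : ‖phase k‖ = modeNorm k := by
  rw [phase, innerSL_apply_norm, modeNorm]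

lemma expMode_proj (k : Mode) (y : E3) : expMode k (proj y) = Complex.exp (phase k y * Complex.I) := by
  rw [expMode, phase_apply]
  simp only [proj, fourier_coe_apply]
  rw [← Complex.exp_sum]
  congr 1
  push_cast
  rw [Finset.sum_mul]
  refine Finset.sum_congr rfl fun i _ => ?_
  have : (Real.pi : ℂ) ≠ 0 := by exact_mod_cast Real.pi_pos.ne'
  field_simp

/-- The real part of a complex vector times an exponential. -/
def reModeFun (k : Mode) (a : C3) : C(Torus, E3) where
  toFun x := WithLp.toLp 2 fun i => (a i * expMode k x).re
  continuous_toFun := by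
    have := continuous_expMode k
    refine (PiLp.continuous_toLp 2 _).comp (continuous_pi fun i => ?_)
    exact Complex.continuous_re.comp (continuous_const.mul this)

lemma norm_re_le (a : C3) (z : ℂ) (hz : ‖z‖ = 1) :
    ‖(WithLp.toLp 2 fun i => (a i * z).re : E3)‖ ≤ ‖a‖ := by
  rw [← sq_le_sq₀ (norm_nonneg _) (norm_nonneg _), EuclideanSpace.norm_sq_eq,
    EuclideanSpace.norm_sq_eq]
  refine Finset.sum_le_sum fun i _ => ?_
  refine pow_le_pow_left₀ (norm_nonneg _) ?_ 2
  refine (Complex.abs_re_le_norm _).trans (le_of_eq ?_)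
  rw [norm_mul, hz, mul_one]

/-- `a ↦ Re (a e^{ik·x})` as a continuous linear map. -/
def reMode (k : Mode) : C3 →L[ℝ] C(Torus, E3) :=
  LinearMap.mkContinuous
    { toFun := reModeFun k
      map_add' := fun a b => by
        ext x i
        simp [reModeFun, add_mul]
      map_smul' := fun c a => by
        ext x i
        simp [reModeFun, mul_assoc] } 1 (fun a => by
      rw [one_mul, ContinuousMap.norm_le _ (norm_nonneg _)]
      exact fun x => norm_re_le a _ (norm_expMode k x))

lemma reMode_apply (k : Mode) (a : C3) (x : Torus) (i : Fin 3) :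
    reMode k a x i = (a i * expMode k x).re := rfl

lemma norm_reMode_le (k : Mode) (a : C3) : ‖reMode k a‖ ≤ ‖a‖ := by
  have := (reMode k).le_of_opNorm_le (LinearMap.mkContinuous_norm_le _ zero_le_one _) a
  simpa using this

lemma reMode_proj (k : Mode) (a : C3) (y : E3) : reMode k a (proj y) = reWave a (phase k y) := by
  ext i
  rw [reMode_apply, expMode_proj, reWave]

/-- The field with the given Fourier coefficients. -/
def synth (x : Mode → C3) : C(Torus, E3) := ∑' k, reMode k (x k)

lemma summable_reMode {x : Mode → C3} (hx : Summable fun k => ‖x k‖) :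
    Summable fun k => reMode k (x k) :=
  Summable.of_norm_bounded hx fun k => norm_reMode_le k (x k)

lemma synth_apply {x : Mode → C3} (hx : Summable fun k => ‖x k‖) (p : Torus) :
    synth x p = ∑' k, reMode k (x k) p :=
  (ContinuousMap.tsum_apply (summable_reMode hx) p).symm

lemma hasSum_synth {x : Mode → C3} (hx : Summable fun k => ‖x k‖) (p : Torus) :
    HasSum (fun k => reMode k (x k) p) (synth x p) :=
  ContinuousMap.hasSum_apply (summable_reMode hx).hasSum p

lemma synth_sub {x y : Mode → C3} (hx : Summable fun k => ‖x k‖) (hy : Summable fun k => ‖y k‖) :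
    synth (fun k => x k - y k) = synth x - synth y := by
  rw [synth, synth, synth, ← (summable_reMode hx).tsum_sub (summable_reMode hy)]
  simp

lemma synth_smul (c : ℝ) (x : Mode → C3) : synth (fun k => c • x k) = c • synth x := by
  rw [synth, synth, ← tsum_const_smul'' c]
  simp

/-- Reality of a sequence of Fourier coefficients. -/
def IsRealSeq (x : Mode → C3) : Prop := ∀ k i, x (-k) i = conj (x k i)

lemma norm_coord_le (a : C3) (i : Fin 3) : ‖a i‖ ≤ ‖a‖ := PiLp.norm_apply_le a i

/-- The substitution k ↦ -k shows that the complex series equals its conjugate, so the real parts in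
the definition of `synth` lose nothing. -/
lemma hasSum_synth_complex {x : Mode → C3} (hx : Summable fun k => ‖x k‖) (hr : IsRealSeq x)
    (p : Torus) (i : Fin 3) : HasSum (fun k => x k i * expMode k p) ((synth x p i : ℝ) : ℂ) := by
  have hs : Summable fun k => x k i * expMode k p := by
    refine Summable.of_norm_bounded hx fun k => ?_
    rw [norm_mul, norm_expMode, mul_one]
    exact norm_coord_le _ _
  have h1 : HasSum (fun k => (x k i * expMode k p).re) (synth x p i) := by
    have := (EuclideanSpace.proj (𝕜 := ℝ) i : E3 →L[ℝ] ℝ).hasSum (hasSum_synth hx p)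
    exact this
  have h2 : conj (∑' k, x k i * expMode k p) = ∑' k, x k i * expMode k p := by
    rw [Complex.conj_tsum, ← (Equiv.neg Mode).tsum_eq]
    refine tsum_congr fun k => ?_
    rw [Equiv.neg_apply, hr, expMode_neg, map_mul, Complex.conj_conj, Complex.conj_conj]
  have h3 : ((synth x p i : ℝ) : ℂ) = ∑' k, x k i * expMode k p := by
    rw [← Complex.conj_eq_iff_re.1 h2, Complex.re_tsum hs, h1.tsum_eq]
  rw [h3]
  exact hs.hasSum

lemma hasDerivAt_reWave (a : C3) (s : ℝ) :
    HasDerivAt (reWave a) (reWave (Complex.I • a) s) s := by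
  have h : ∀ i, HasDerivAt (fun s : ℝ => (a i * Complex.exp (s * Complex.I)).re)
      (((Complex.I • a) i * Complex.exp (s * Complex.I)).re) s := by
    intro i
    have h1 : HasDerivAt (fun s : ℝ => (s : ℂ) * Complex.I) Complex.I s := by
      simpa using (Complex.ofRealCLM.hasDerivAt (x := s)).mul_const Complex.I
    have h2 := (h1.cexp.const_mul (a i))
    have h3 := Complex.reCLM.hasFDerivAt.comp_hasDerivAt s h2
    refine h3.congr_deriv ?_
    simp only [Complex.reCLM_apply, PiLp.smul_apply, smul_eq_mul]
    congr 1
    ring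
  have h4 := (hasDerivAt_pi.2 h)
  exact (PiLp.continuousLinearEquiv 2 ℝ (fun _ : Fin 3 => ℝ)).symm.hasFDerivAt.comp_hasDerivAt s h4

lemma deriv_reWave (a : C3) : deriv (reWave a) = reWave (Complex.I • a) :=
  funext fun s => (hasDerivAt_reWave a s).deriv

lemma iteratedDeriv_reWave (m : ℕ) (a : C3) :
    iteratedDeriv m (reWave a) = reWave (Complex.I ^ m • a) := by
  induction m generalizing a with
  | zero => simp
  | succ m ih => rw [iteratedDeriv_succ', deriv_reWave, ih, smul_smul, pow_succ]

lemma contDiff_reWave (a : C3) : ContDiff ℝ ∞ (reWave a) := by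
  apply contDiff_of_differentiable_iteratedDeriv
  intro m _
  rw [iteratedDeriv_reWave]
  exact fun s => (hasDerivAt_reWave _ s).differentiableAt

lemma norm_reWave_le (a : C3) (s : ℝ) : ‖reWave a s‖ ≤ ‖a‖ := by
  exact norm_re_le a _ (Complex.norm_exp_ofReal_mul_I s)

lemma contDiff_reMode_proj (k : Mode) (a : C3) : ContDiff ℝ ∞ fun y => reMode k a (proj y) := by
  simp only [reMode_proj]
  exact (contDiff_reWave a).comp (phase k).contDiff

/-- A plane wave is a function of one variable composed with a linear phase of norm |k|, and each
derivative of the profile only multiplies `a` by i. -/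
lemma norm_iteratedFDeriv_reMode_le (m : ℕ) (k : Mode) (a : C3) (y : E3) :
    ‖iteratedFDeriv ℝ m (fun y => reMode k a (proj y)) y‖ ≤ modeNorm k ^ m * ‖a‖ := by
  have h0 : (fun y => reMode k a (proj y)) = reWave a ∘ phase k := funext fun y => reMode_proj k a y
  rw [h0, ContinuousLinearMap.iteratedFDeriv_comp_right (phase k) (contDiff_reWave a) y
    (by exact_mod_cast le_top)]
  refine (ContinuousMultilinearMap.norm_compContinuousLinearMap_le _ _).trans ?_
  rw [norm_iteratedFDeriv_eq_norm_iteratedDeriv, iteratedDeriv_reWave]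
  simp only [Finset.prod_const, Finset.card_univ, Fintype.card_fin, norm_phase]
  rw [mul_comm]
  gcongr
  · exact pow_nonneg (modeNorm_nonneg k) m
  · refine (norm_reWave_le _ _).trans (le_of_eq ?_)
    rw [norm_smul, norm_pow, Complex.norm_I, one_pow, one_mul]

lemma lift_synth {x : Mode → C3} (hx : Summable fun k => ‖x k‖) :
    lift (synth x) = fun y => ∑' k, reMode k (x k) (proj y) :=
  funext fun y => synth_apply hx (proj y)

lemma contDiff_lift_synth {x : Mode → C3} (hx : ∀ n, Summable fun k => modeNorm k ^ n * ‖x k‖)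
    : ContDiff ℝ ∞ (lift (synth x)) := by
  rw [lift_synth (by simpa using hx 0)]
  exact contDiff_tsum (v := fun m k => modeNorm k ^ m * ‖x k‖)
    (fun k => contDiff_reMode_proj k (x k)) (fun m _ => hx m)
    (fun m k y _ => norm_iteratedFDeriv_reMode_le m k (x k) y)

lemma norm_iteratedFDeriv_lift_synth_le {x : Mode → C3}
    (hx : ∀ n, Summable fun k => modeNorm k ^ n * ‖x k‖) (m : ℕ) (y : E3) :
    ‖iteratedFDeriv ℝ m (lift (synth x)) y‖ ≤ ∑' k, modeNorm k ^ m * ‖x k‖ := by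
  rw [lift_synth (by simpa using hx 0), iteratedFDeriv_tsum_apply (N := ⊤)
    (v := fun m k => modeNorm k ^ m * ‖x k‖)
    (fun k => contDiff_reMode_proj k (x k)) (fun m _ => hx m)
    (fun m k y _ => norm_iteratedFDeriv_reMode_le m k (x k) y) le_top]
  exact tsum_of_norm_bounded (hx m).hasSum fun k => norm_iteratedFDeriv_reMode_le m k (x k) y

lemma expMode_add_single (k : Mode) (p : Torus) (j : Fin 3) (h : ℝ) :
    expMode k (p + Pi.single j (h : AddCircle (2 * Real.pi)))
      = expMode k p * Complex.exp ((k j * h : ℝ) * Complex.I) := by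
  have h1 : ∀ q r : Torus, expMode k (q + r) = expMode k q * expMode k r := by
    intro q r
    simp only [expMode, Pi.add_apply, ← Finset.prod_mul_distrib]
    refine Finset.prod_congr rfl fun i _ => ?_
    rw [fourier_apply, fourier_apply, fourier_apply, smul_add, AddCircle.toCircle_add,
      Circle.coe_mul]
  have h2 : Pi.single j (h : AddCircle (2 * Real.pi)) = proj (EuclideanSpace.single j h) := by
    funext i
    rcases eq_or_ne i j with rfl | hij
    · simp [proj]
    · simp [proj, hij]
  rw [h1, h2, expMode_proj, phase_apply]
  congr 4
  simp

/-- The Fourier coefficients of `∂_j`. -/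
def derivSeq (j : Fin 3) (x : Mode → C3) (k : Mode) : C3 := (Complex.I * (k j : ℂ)) • x k

lemma norm_derivSeq_le (j : Fin 3) (x : Mode → C3) (k : Mode) :
    ‖derivSeq j x k‖ ≤ modeNorm k * ‖x k‖ := by
  rw [derivSeq, norm_smul, norm_mul, Complex.norm_I, one_mul]
  gcongr
  have := abs_le_modeNorm k j
  simpa using this

lemma summable_derivSeq {x : Mode → C3} (hx : ∀ n, Summable fun k => modeNorm k ^ n * ‖x k‖)
    (j : Fin 3) (n : ℕ) : Summable fun k => modeNorm k ^ n * ‖derivSeq j x k‖ := by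
  refine Summable.of_nonneg_of_le (fun k => by have := modeNorm_nonneg k; positivity) (fun k => ?_)
    (hx (n + 1))
  rw [pow_succ, mul_assoc]
  have := modeNorm_nonneg k
  gcongr
  exact norm_derivSeq_le j x k

lemma IsRealSeq.derivSeq {x : Mode → C3} (hr : IsRealSeq x) (j : Fin 3) :
    IsRealSeq (derivSeq j x) := by
  intro k i
  simp only [Burgers.derivSeq, PiLp.smul_apply, smul_eq_mul, hr k i, map_mul, Complex.conj_I,
    Pi.neg_apply, Int.cast_neg, map_intCast]
  ring

lemma reMode_add_single (k : Mode) (a : C3) (p : Torus) (j : Fin 3) (h : ℝ) :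
    reMode k a (p + Pi.single j (h : AddCircle (2 * Real.pi)))
      = reWave (expMode k p • a) (k j * h) := by
  ext i
  rw [reMode_apply, expMode_add_single, reWave]
  simp only [PiLp.smul_apply, smul_eq_mul]
  congr 1
  ring

lemma hasDerivAt_reMode_add_single (k : Mode) (x : Mode → C3) (j : Fin 3) (p : Torus) (y : ℝ) :
    HasDerivAt (fun h : ℝ => reMode k (x k) (p + Pi.single j (h : AddCircle (2 * Real.pi))))
      (reMode k (derivSeq j x k) (p + Pi.single j (y : AddCircle (2 * Real.pi)))) y := by
  have h0 : HasDerivAt (fun y : ℝ => (k j : ℝ) * y) ((k j : ℝ) * 1) y :=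
    (hasDerivAt_id y).const_mul (k j : ℝ)
  have h1 : HasDerivAt (reWave (expMode k p • x k) ∘ fun y : ℝ => (k j : ℝ) * y)
      (((k j : ℝ) * 1) • reWave (Complex.I • expMode k p • x k) (k j * y)) y :=
    HasDerivAt.scomp y (hasDerivAt_reWave (expMode k p • x k) (k j * y)) h0
  have h2 : (fun h : ℝ => reMode k (x k) (p + Pi.single j (h : AddCircle (2 * Real.pi))))
      = reWave (expMode k p • x k) ∘ fun y : ℝ => (k j : ℝ) * y :=
    funext fun h => reMode_add_single k (x k) p j h
  rw [h2, reMode_add_single]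
  refine h1.congr_deriv ?_
  ext i
  simp only [PiLp.smul_apply, smul_eq_mul, mul_one, reWave, derivSeq]
  rw [← Complex.re_ofReal_mul]
  congr 1
  push_cast
  ring

lemma hasDerivAt_synth_single {x : Mode → C3}
    (hx : ∀ n, Summable fun k => modeNorm k ^ n * ‖x k‖) (j : Fin 3) (p : Torus) (r : ℝ) :
    HasDerivAt (fun h : ℝ => synth x (p + Pi.single j (h : AddCircle (2 * Real.pi))))
      (synth (derivSeq j x) (p + Pi.single j (r : AddCircle (2 * Real.pi)))) r := by
  have hx0 : Summable fun k => ‖x k‖ := by simpa using hx 0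
  have hd0 : Summable fun k => ‖derivSeq j x k‖ := by simpa using summable_derivSeq hx j 0
  have hb : ∀ (k : Mode) (y : ℝ),
      ‖reMode k (derivSeq j x k) (p + Pi.single j (y : AddCircle (2 * Real.pi)))‖
        ≤ modeNorm k ^ 1 * ‖x k‖ := by
    intro k y
    refine (ContinuousMap.norm_coe_le_norm _ _).trans ((norm_reMode_le _ _).trans ?_)
    rw [pow_one]
    exact norm_derivSeq_le j x k
  have h := hasDerivAt_tsum (hx 1) (hasDerivAt_reMode_add_single · x j p ·) hb
    (y₀ := (0 : ℝ)) (hasSum_synth hx0 _).summable r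
  rw [synth_apply hd0]
  exact h.congr_of_eventuallyEq (Eventually.of_forall fun y => synth_apply hx0 _)

lemma partialDeriv_synth {x : Mode → C3}
    (hx : ∀ n, Summable fun k => modeNorm k ^ n * ‖x k‖) (j : Fin 3) :
    partialDeriv j (synth x) = synth (derivSeq j x) := by
  funext p
  have := (hasDerivAt_synth_single hx j p 0).deriv
  simpa [partialDeriv] using this

lemma sum_partialDeriv_partialDeriv_synth {x : Mode → C3}
    (hx : ∀ n, Summable fun k => modeNorm k ^ n * ‖x k‖) (p : Torus) :
    ∑ j, partialDeriv j (partialDeriv j (synth x)) p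
      = -synth (fun k => modeNorm k ^ 2 • x k) p := by
  have h1 : ∀ j, Summable fun k => ‖derivSeq j (derivSeq j x) k‖ := fun j => by
    simpa using summable_derivSeq (summable_derivSeq hx j) j 0
  have h2 : Summable fun k => ‖modeNorm k ^ 2 • x k‖ := by
    refine (hx 2).congr fun k => ?_
    rw [norm_smul, Real.norm_of_nonneg (sq_nonneg _)]
  simp only [partialDeriv_synth hx, partialDeriv_synth (summable_derivSeq hx _)]
  simp only [synth_apply (h1 _), synth_apply h2]
  rw [← Summable.tsum_finsetSum fun j _ => (hasSum_synth (h1 j) p).summable, ← tsum_neg]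
  refine tsum_congr fun k => ?_
  ext i
  have h3 : ∀ j, reMode k (derivSeq j (derivSeq j x) k) p i = -((k j : ℝ) ^ 2) * reMode k (x k) p i := by
    intro j
    rw [reMode_apply, reMode_apply, ← Complex.re_ofReal_mul]
    congr 1
    simp only [derivSeq, PiLp.smul_apply, smul_eq_mul]
    push_cast
    linear_combination (k j : ℂ) ^ 2 * x k i * expMode k p * Complex.I_sq
  rw [modeNorm_sq, map_smul]
  simp only [WithLp.ofLp_sum, Finset.sum_apply, h3, ContinuousMap.smul_apply, PiLp.neg_apply, PiLp.smul_apply,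
    smul_eq_mul, Finset.sum_mul, ← Finset.sum_neg_distrib, neg_mul]

/-- The double series of the product, reindexed by (k, l) ↦ (l, k - l) and summed along the fibres
over `k`. -/
lemma hasSum_mul_conv {f g : Mode → ℂ} (hf : Summable fun k => ‖f k‖) (hg : Summable fun k => ‖g k‖) :
    HasSum (fun k => ∑' l, f l * g (k - l)) ((∑' k, f k) * ∑' k, g k) := by
  let e : Mode × Mode ≃ Mode × Mode :=
    { toFun := fun q => (q.2, q.1 - q.2)
      invFun := fun q => (q.1 + q.2, q.1)
      left_inv := fun q => by simp
      right_inv := fun q => by simp }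
  have h1 : Summable fun q : Mode × Mode => f q.1 * g q.2 := summable_mul_of_summable_norm hf hg
  have h2 : HasSum (fun q : Mode × Mode => f q.2 * g (q.1 - q.2)) ((∑' k, f k) * ∑' k, g k) := by
    rw [tsum_mul_tsum_of_summable_norm hf hg]
    exact (e.hasSum_iff (f := fun q : Mode × Mode => f q.1 * g q.2)).2 h1.hasSum
  exact h2.prod_fiberwise fun k => (h2.summable.prod_factor k).hasSum

lemma ExpDecay.summable_norm {B c : ℝ} (hc : 0 < c) {x : Mode → C3} (h : ExpDecay B c x) :
    Summable fun k => ‖x k‖ := by simpa using h.summable hc 0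

lemma IsRealSeq.burgersNL {x : Mode → C3} (hr : IsRealSeq x) {B c : ℝ} (hc : 0 < c)
    (h : ExpDecay B c x) : IsRealSeq (burgersNL x) := by
  have hs : ∀ k i, (Burgers.burgersNL x k) i = ∑' l, (convTerm (k - l) (x l) (x (k - l))) i := by
    intro k i
    exact (EuclideanSpace.proj (𝕜 := ℂ) i : C3 →L[ℂ] ℂ).map_tsum (h.summable_convTerm hc k)
  intro k i
  rw [hs, hs, Complex.conj_tsum, ← (Equiv.neg Mode).tsum_eq]
  refine tsum_congr fun l => ?_
  have e : -k - -l = -(k - l) := by abel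
  simp only [Equiv.neg_apply, convTerm, PiLp.smul_apply, smul_eq_mul, e, hr _ _, map_mul, map_sum,
    Complex.conj_I, Pi.neg_apply, Int.cast_neg, map_intCast, mul_neg,
    Finset.sum_neg_distrib, neg_mul]

/-- This identifies the abstract convolution with the advection term in physical space. Reality is
needed because a product of real parts is not the real part of the product. -/
lemma synth_burgersNL {x : Mode → C3} (hr : IsRealSeq x) {B c : ℝ} (hc : 0 < c)
    (h : ExpDecay B c x) (p : Torus) :
    ∑ j, (synth x p j) • partialDeriv j (synth x) p = synth (burgersNL x) p := by
  have hx := h.summable hc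
  have hx0 := h.summable_norm hc
  have hd0 : ∀ j, Summable fun k => ‖derivSeq j x k‖ := fun j => by
    simpa using summable_derivSeq hx j 0
  have hN := h.expDecay_burgersNL hc
  ext i
  rw [← Complex.ofReal_inj]
  have h1 := (hasSum_synth_complex (hN.summable_norm (half_pos hc)) (hr.burgersNL hc h) p i)
  rw [← h1.tsum_eq]
  simp only [WithLp.ofLp_sum, Finset.sum_apply, PiLp.smul_apply, smul_eq_mul, Complex.ofReal_sum,
    Complex.ofReal_mul, partialDeriv_synth hx]
  have hsn : ∀ (y : Mode → C3) (j : Fin 3), (Summable fun k => ‖y k‖) →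
      Summable fun k => ‖y k j * expMode k p‖ := by
    intro y j hy
    refine Summable.of_nonneg_of_le (fun _ => norm_nonneg _) (fun k => ?_) hy
    rw [norm_mul, norm_expMode, mul_one]
    exact norm_coord_le _ _
  have h2 : ∀ j, HasSum (fun k => ∑' l, (x l j * expMode l p) *
      (derivSeq j x (k - l) i * expMode (k - l) p))
      ((synth x p j : ℂ) * (synth (derivSeq j x) p i : ℂ)) := by
    intro j
    have := hasSum_mul_conv (hsn x j hx0) (hsn _ i (hd0 j))
    rwa [(hasSum_synth_complex hx0 hr p j).tsum_eq,
      (hasSum_synth_complex (hd0 j) (hr.derivSeq j) p i).tsum_eq] at this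
  have h3 := hasSum_sum fun j (_ : j ∈ Finset.univ) => h2 j
  rw [← h3.tsum_eq]
  refine tsum_congr fun k => ?_
  have h4 : (Burgers.burgersNL x k) i = ∑' l, (convTerm (k - l) (x l) (x (k - l))) i :=
    (EuclideanSpace.proj (𝕜 := ℂ) i : C3 →L[ℂ] ℂ).map_tsum (h.summable_convTerm hc k)
  have h5 : ∀ j, Summable fun l => (x l j * expMode l p) *
      (derivSeq j x (k - l) i * expMode (k - l) p) := by
    intro j
    have hsum := (hsn x j hx0)
    obtain ⟨C, hC⟩ : ∃ C, ∀ m, ‖derivSeq j x m i * expMode m p‖ ≤ C :=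
      ⟨_, fun m => (hsn _ i (hd0 j)).le_tsum m (fun _ _ => norm_nonneg _)⟩
    refine Summable.of_norm_bounded (hsum.mul_right C) fun l => ?_
    rw [norm_mul]
    gcongr
    exact hC _
  rw [h4, ← tsum_mul_right, ← Summable.tsum_finsetSum fun j _ => h5 j]
  refine tsum_congr fun l => ?_
  have h6 : expMode k p = expMode l p * expMode (k - l) p := by
    rw [← expMode_add, add_sub_cancel]
  simp only [convTerm, derivSeq, PiLp.smul_apply, smul_eq_mul, h6, Finset.mul_sum, Finset.sum_mul]
  refine Finset.sum_congr rfl fun j _ => ?_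
  ring

/-! ### Classical regularity of families of Fourier coefficients -/

/-- The right-hand side of the Burgers equations on the Fourier side. -/
def timeSeq (ν : ℝ) (x : Mode → C3) (k : Mode) : C3 := -(heatRate ν k • x k) - burgersNL x k

/-- Real solutions of the Burgers equations on the Fourier side with locally uniform exponential
decay, on an open set of times. -/
structure RegModes (ν : ℝ) (s : Set ℝ) (u : Mode → ℝ → C3) : Prop where
  decay : ∀ t ∈ s, ∃ B c, 0 < c ∧ ∀ᶠ τ in 𝓝 t, ExpDecay B c fun k => u k τ
  deriv : ∀ t ∈ s, ∀ k, HasDerivAt (u k) (timeSeq ν (fun l => u l t) k) t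
  real : ∀ t ∈ s, IsRealSeq fun k => u k t

/-- The bound for `timeSeq`. -/
def timeBound (ν B c : ℝ) (k : Mode) : ℝ :=
  ν * (modeNorm k ^ 2 * (B * Real.exp (-c * modeNorm k))) + nlConst B c * Real.exp (-(c / 2) * modeNorm k)

lemma summable_timeBound (ν B : ℝ) {c : ℝ} (hc : 0 < c) (n : ℕ) :
    Summable fun k => modeNorm k ^ n * timeBound ν B c k := by
  have h1 := ((summable_pow_mul_exp hc (n + 2)).mul_left (ν * B)).add
    ((summable_pow_mul_exp (half_pos hc) n).mul_left (nlConst B c))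
  refine h1.congr fun k => ?_
  unfold timeBound
  ring

lemma ExpDecay.norm_timeSeq_le {ν B c : ℝ} (hν : 0 ≤ ν) (hc : 0 < c) {x : Mode → C3}
    (h : ExpDecay B c x) (k : Mode) : ‖timeSeq ν x k‖ ≤ timeBound ν B c k := by
  refine (norm_sub_le _ _).trans (add_le_add ?_ (h.expDecay_burgersNL hc k))
  rw [norm_neg, norm_smul, Real.norm_of_nonneg (heatRate_nonneg hν k), heatRate, mul_assoc]
  have := h k
  gcongr

lemma continuousAt_synth {v : Mode → ℝ → C3} {t : ℝ} {b : Mode → ℝ} (hb : Summable b)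
    (hv : ∀ k, ContinuousAt (v k) t) (h : ∀ᶠ τ in 𝓝 t, ∀ k, ‖v k τ‖ ≤ b k) :
    ContinuousAt (fun τ => synth fun k => v k τ) t := by
  refine tendsto_tsum_of_dominated_convergence hb
    (fun k => ((reMode k).continuous.continuousAt.tendsto.comp (hv k))) ?_
  filter_upwards [h] with τ hτ k
  exact (norm_reMode_le _ _).trans (hτ k)

lemma tendsto_tsum_norm_sub {v : Mode → ℝ → C3} {t : ℝ} {b : Mode → ℝ} (m : ℕ)
    (hb : Summable fun k => modeNorm k ^ m * b k)
    (hv : ∀ k, ContinuousAt (v k) t) (h : ∀ᶠ τ in 𝓝 t, ∀ k, ‖v k τ‖ ≤ b k) :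
    Tendsto (fun τ => ∑' k, modeNorm k ^ m * ‖v k τ - v k t‖) (𝓝 t) (𝓝 0) := by
  have h0 : (0 : ℝ) = ∑' k : Mode, modeNorm k ^ m * ‖v k t - v k t‖ := by simp
  rw [h0]
  refine tendsto_tsum_of_dominated_convergence (bound := fun k => 2 * (modeNorm k ^ m * b k))
    (hb.mul_left 2) (fun k => ?_) ?_
  · exact (((hv k).sub continuousAt_const).norm.const_mul _ :)
  · have ht := h.self_of_nhds
    filter_upwards [h] with τ hτ k
    have h1 := pow_nonneg (modeNorm_nonneg k) m
    rw [norm_mul, norm_norm, Real.norm_of_nonneg h1]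
    calc modeNorm k ^ m * ‖v k τ - v k t‖ ≤ modeNorm k ^ m * (b k + b k) := by
          gcongr
          exact (norm_sub_le _ _).trans (add_le_add (hτ k) (ht k))
      _ = _ := by ring

namespace RegModes

variable {ν : ℝ} {s : Set ℝ} {u : Mode → ℝ → C3}

lemma summable (h : RegModes ν s u) {t : ℝ} (ht : t ∈ s) (n : ℕ) :
    Summable fun k => modeNorm k ^ n * ‖u k t‖ := by
  obtain ⟨B, c, hc, hB⟩ := h.decay t ht
  exact hB.self_of_nhds.summable hc n

lemma summable_norm (h : RegModes ν s u) {t : ℝ} (ht : t ∈ s) : Summable fun k => ‖u k t‖ := by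
  simpa using h.summable ht 0

lemma hasDerivAt_synth (hν : 0 ≤ ν) (hs : IsOpen s) (h : RegModes ν s u) {t : ℝ} (ht : t ∈ s) :
    HasDerivAt (fun τ => synth fun k => u k τ) (synth (timeSeq ν fun k => u k t)) t := by
  obtain ⟨B, c, hc, hB⟩ := h.decay t ht
  obtain ⟨r, hr, hball⟩ := Metric.eventually_nhds_iff_ball.1 (hB.and (hs.mem_nhds ht))
  have hsum : Summable fun k => timeBound ν B c k := by simpa using summable_timeBound ν B hc 0
  have htb : t ∈ Metric.ball t r := Metric.mem_ball_self hr
  refine hasDerivAt_tsum_of_isPreconnected (g := fun k τ => reMode k (u k τ))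
    (g' := fun k τ => reMode k (timeSeq ν (fun l => u l τ) k)) hsum Metric.isOpen_ball
    (convex_ball t r).isPreconnected (fun k τ hτ => ?_) (fun k τ hτ => ?_) htb
    (summable_reMode (h.summable_norm ht)) htb
  · exact (reMode k).hasFDerivAt.comp_hasDerivAt τ (h.deriv τ (hball τ hτ).2 k)
  · exact (norm_reMode_le _ _).trans ((hball τ hτ).1.norm_timeSeq_le hν hc k)

lemma continuousAt (h : RegModes ν s u) {t : ℝ} (ht : t ∈ s) (k : Mode) : ContinuousAt (u k) t :=
  (h.deriv t ht k).continuousAt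

lemma continuousAt_synth (h : RegModes ν s u) {t : ℝ} (ht : t ∈ s) :
    ContinuousAt (fun τ => synth fun k => u k τ) t := by
  obtain ⟨B, c, hc, hB⟩ := h.decay t ht
  exact Burgers.continuousAt_synth (b := fun k => B * Real.exp (-c * modeNorm k))
    (by simpa using (summable_pow_mul_exp hc 0).mul_left B) (h.continuousAt ht) hB

lemma continuousAt_nonlin (hs : IsOpen s) (h : RegModes ν s u) {t : ℝ} (ht : t ∈ s) (k : Mode) :
    ContinuousAt (nonlin u k) t := by
  obtain ⟨B, c, hc, hB⟩ := h.decay t ht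
  obtain ⟨r, hr, hball⟩ := Metric.eventually_nhds_iff_ball.1 (hB.and (hs.mem_nhds ht))
  exact (Burgers.continuousOn_nonlin hc (fun τ hτ => (hball τ hτ).1)
    (fun l τ hτ => (h.continuousAt (hball τ hτ).2 l).continuousWithinAt) k).continuousAt
    (Metric.ball_mem_nhds t hr)

lemma continuousAt_timeSeq (hs : IsOpen s) (h : RegModes ν s u) {t : ℝ} (ht : t ∈ s) (k : Mode) :
    ContinuousAt (fun τ => timeSeq ν (fun l => u l τ) k) t := by
  have h0 : ContinuousAt (fun τ => heatRate ν k • u k τ) t :=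
    Filter.Tendsto.const_smul (h.continuousAt ht k) (heatRate ν k)
  have h1 : ContinuousAt (fun τ => -(heatRate ν k • u k τ)) t := h0.neg
  have h2 : ContinuousAt (fun τ => burgersNL (fun l => u l τ) k) t := h.continuousAt_nonlin hs ht k
  unfold timeSeq
  exact h1.sub h2

lemma continuousAt_synth_timeSeq (hν : 0 ≤ ν) (hs : IsOpen s) (h : RegModes ν s u) {t : ℝ}
    (ht : t ∈ s) : ContinuousAt (fun τ => synth (timeSeq ν fun k => u k τ)) t := by
  obtain ⟨B, c, hc, hB⟩ := h.decay t ht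
  have hsum : Summable fun k => timeBound ν B c k := by simpa using summable_timeBound ν B hc 0
  refine Burgers.continuousAt_synth hsum (h.continuousAt_timeSeq hs ht) ?_
  filter_upwards [hB] with τ hτ k
  exact hτ.norm_timeSeq_le hν hc k

lemma contDiffOn_synth (hν : 0 ≤ ν) (hs : IsOpen s) (h : RegModes ν s u) :
    ContDiffOn ℝ 1 (fun τ => synth fun k => u k τ) s := by
  rw [contDiffOn_one_iff_derivWithin hs.uniqueDiffOn]
  refine ⟨fun t ht => (h.hasDerivAt_synth hν hs ht).differentiableAt.differentiableWithinAt, ?_⟩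
  refine ContinuousOn.congr (f := fun τ => synth (timeSeq ν fun k => u k τ))
    (fun t ht => (h.continuousAt_synth_timeSeq hν hs ht).continuousWithinAt) fun t ht => ?_
  exact (h.hasDerivAt_synth hν hs ht).hasDerivWithinAt.derivWithin (hs.uniqueDiffOn t ht)

/-- The difference of the m-th derivatives is bounded, uniformly in space, by ∑|k|^m‖u_k(τ) -
u_k(t)‖, which tends to 0 by dominated convergence. -/
lemma tendstoUniformly (hs : IsOpen s) (h : RegModes ν s u) {t : ℝ} (ht : t ∈ s) (m : ℕ) :
    TendstoUniformly (fun τ y => iteratedFDeriv ℝ m (lift (synth fun k => u k τ)) y)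
        (iteratedFDeriv ℝ m (lift (synth fun k => u k t))) (𝓝 t) := by
  obtain ⟨B, c, hc, hB⟩ := h.decay t ht
  have h1 : Summable fun k => modeNorm k ^ m * (B * Real.exp (-c * modeNorm k)) :=
    ((summable_pow_mul_exp hc m).mul_left B).congr fun k => by ring
  have h2 := tendsto_tsum_norm_sub m h1 (h.continuousAt ht) hB
  rw [Metric.tendstoUniformly_iff]
  intro ε hε
  filter_upwards [h2.eventually_lt_const hε, hs.mem_nhds ht] with τ hτ hτs y
  refine lt_of_le_of_lt ?_ hτ
  have h3 : ∀ n, Summable fun k => modeNorm k ^ n * ‖u k τ - u k t‖ := fun n => by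
    refine Summable.of_nonneg_of_le
      (fun k => mul_nonneg (pow_nonneg (modeNorm_nonneg k) n) (norm_nonneg _)) (fun k => ?_)
      ((h.summable hτs n).add (h.summable ht n))
    rw [← mul_add]
    exact mul_le_mul_of_nonneg_left (norm_sub_le _ _) (pow_nonneg (modeNorm_nonneg k) n)
  have h4 : lift (synth fun k => u k τ - u k t)
      = lift (synth fun k => u k τ) - lift (synth fun k => u k t) := by
    rw [synth_sub (h.summable_norm hτs) (h.summable_norm ht)]
    rfl
  have h5 := norm_iteratedFDeriv_lift_synth_le h3 m y
  rw [h4, iteratedFDeriv_sub_apply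
    ((contDiff_lift_synth (h.summable hτs)).of_le (by exact_mod_cast le_top)).contDiffAt
    ((contDiff_lift_synth (h.summable ht)).of_le (by exact_mod_cast le_top)).contDiffAt] at h5
  rwa [dist_comm, dist_eq_norm]

lemma synth_timeSeq (h : RegModes ν s u) {t : ℝ} (ht : t ∈ s) (p : Torus) :
    synth (timeSeq ν fun k => u k t) p
      = ν • (∑ j, partialDeriv j (partialDeriv j (synth fun k => u k t)) p)
        - ∑ j, (synth (fun k => u k t) p j) • partialDeriv j (synth fun k => u k t) p := by
  obtain ⟨B, c, hc, hB⟩ := h.decay t ht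
  have hB := hB.self_of_nhds
  rw [sum_partialDeriv_partialDeriv_synth (h.summable ht), synth_burgersNL (h.real t ht) hc hB]
  have h2 : Summable fun k => ‖modeNorm k ^ 2 • u k t‖ := (h.summable ht 2).congr fun k => by
    rw [norm_smul, Real.norm_of_nonneg (pow_nonneg (modeNorm_nonneg k) 2)]
  have h3 : Summable fun k => ‖(-ν) • modeNorm k ^ 2 • u k t‖ := by
    simp only [norm_smul _ (modeNorm _ ^ 2 • _)]
    exact h2.mul_left _
  have h4 := (hB.expDecay_burgersNL hc).summable_norm (half_pos hc)
  have h5 : timeSeq ν (fun k => u k t)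
      = fun k => (-ν) • modeNorm k ^ 2 • u k t - burgersNL (fun k => u k t) k := by
    funext k
    rw [timeSeq, heatRate, smul_smul, neg_mul, neg_smul]
  rw [h5, synth_sub h3 h4, synth_smul]
  simp

lemma isClassicalSolution (hν : 0 ≤ ν) (h : RegModes ν (Ioi 0) u) :
    IsClassicalSolution ν fun t => synth fun k => u k t := by
  refine ⟨h.contDiffOn_synth hν isOpen_Ioi, fun t ht => ⟨?_, fun m _ =>
    h.tendstoUniformly isOpen_Ioi ht m⟩, fun t ht p => ?_⟩
  · exact_mod_cast contDiff_infty.1 (contDiff_lift_synth (h.summable ht)) 2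
  · rw [(h.hasDerivAt_synth hν isOpen_Ioi ht).deriv, h.synth_timeSeq ht]
    abel

end RegModes

/-! ### Fourier coefficients of synthesized fields -/

/-- A synthesized field as an element of `L²`. -/
def synthLp (x : Mode → C3) : L2Field := ContinuousMap.toLp 2 volume ℝ (synth x)

lemma coeFn_synthLp (x : Mode → C3) : synthLp x =ᵐ[volume] synth x :=
  ContinuousMap.coeFn_toLp volume (synth x)

lemma fourierCoef_synthLp {x : Mode → C3} (hx : Summable fun k => ‖x k‖) (hr : IsRealSeq x) :
    fourierCoef (synthLp x) = x := by
  funext k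
  ext i
  have h1 : ∫ p, expMode (-k) p * ((synthLp x p i : ℝ) : ℂ)
      = ∫ p, ∑' l, x l i * expMode (l - k) p := by
    refine integral_congr_ae ?_
    filter_upwards [coeFn_synthLp x] with p hp
    rw [hp, ← (hasSum_synth_complex hx hr p i).tsum_eq, ← tsum_mul_left]
    refine tsum_congr fun l => ?_
    rw [sub_eq_add_neg, expMode_add]
    ring
  have hint : ∀ l, Integrable (fun p => x l i * expMode (l - k) p) (volume : Measure Torus) := by
    intro l
    refine Integrable.const_mul ?_ _
    exact (continuous_expMode _).integrable_of_hasCompactSupport (HasCompactSupport.of_compactSpace _)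
  have h2 := hasSum_integral_of_summable_integral_norm hint (by
    simp only [norm_mul, norm_expMode, mul_one, integral_const, smul_eq_mul]
    exact (Summable.of_nonneg_of_le (fun l => norm_nonneg _) (fun l => norm_coord_le (x l) i) hx).mul_left _)
  have h3 : ∀ l, l ≠ k → ∫ p, x l i * expMode (l - k) p = 0 := by
    intro l hl
    rw [integral_const_mul, integral_expMode, if_neg (sub_ne_zero.2 hl), mul_zero]
  have h4 := h2.unique (hasSum_single k h3)
  change _ * ∫ p, expMode (-k) p * ((synthLp x p i : ℝ) : ℂ) = _
  rw [h1, h4, integral_const_mul, integral_expMode, if_pos (sub_self k), mul_left_comm,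
    inv_mul_cancel₀, mul_one]
  exact_mod_cast (pow_pos Real.two_pi_pos 3).ne'

/-! ### Reality of solutions -/

/-- Complex conjugation of vectors. -/
def conjC3 : C3 ≃ₗᵢ[ℝ] C3 := LinearIsometryEquiv.piLpCongrRight 2 fun _ => Complex.conjLIE

lemma conjC3_apply (a : C3) (i : Fin 3) : conjC3 a i = conj (a i) := rfl

lemma isRealSeq_iff {x : Mode → C3} : IsRealSeq x ↔ ∀ k, conjC3 (x (-k)) = x k := by
  constructor
  · intro h k
    ext i
    rw [conjC3_apply, h, Complex.conj_conj]
  · intro h k i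
    rw [← h k, conjC3_apply, Complex.conj_conj]

lemma conjC3_convTerm (m : Mode) (a b : C3) :
    conjC3 (convTerm m a b) = convTerm (-m) (conjC3 a) (conjC3 b) := by
  ext i
  simp only [convTerm, conjC3_apply, PiLp.smul_apply, smul_eq_mul, map_mul, map_sum,
    Complex.conj_I, map_intCast, Pi.neg_apply, Int.cast_neg, mul_neg, Finset.sum_neg_distrib,
    neg_mul]

lemma burgersNL_conj (x : Mode → C3) (k : Mode) :
    burgersNL (fun l => conjC3 (x (-l))) k = conjC3 (burgersNL x (-k)) := by
  have h := conjC3.toContinuousLinearEquiv.map_tsum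
    (f := fun l => convTerm (-k - l) (x l) (x (-k - l))) (L := .unconditional Mode)
  refine Eq.trans ?_ h.symm
  rw [burgersNL, ← (Equiv.neg Mode).tsum_eq]
  refine tsum_congr fun l => ?_
  have e : -(k - -l) = -k - l := by abel
  change convTerm (k - -l) (conjC3 (x (- -l))) (conjC3 (x (-(k - -l))))
    = conjC3 (convTerm (-k - l) (x l) (x (-k - l)))
  rw [conjC3_convTerm, e, neg_neg]
  congr 1
  abel

lemma wt_neg (k : Mode) : wt (-k) = wt k := by rw [wt, wt, bracket_neg]

lemma heatRate_neg (ν : ℝ) (k : Mode) : heatRate ν (-k) = heatRate ν k := by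
  rw [heatRate, heatRate, modeNorm_neg]

lemma enorm_conjC3 (a : C3) : ‖conjC3 a‖ₑ = ‖a‖ₑ := conjC3.enorm_map a

lemma MildSol.conj {ν T : ℝ} {x : Mode → C3} {u : Mode → ℝ → C3} (h : MildSol ν T x u) :
    MildSol ν T (fun k => conjC3 (x (-k))) (fun k t => conjC3 (u (-k) t)) where
  init := by
    have := h.init
    rw [← (Equiv.neg Mode).tsum_eq] at this
    simpa only [Equiv.neg_apply, wt_neg, enorm_conjC3] using this
  zfin := by
    have := h.zfin
    rw [zNorm, ← (Equiv.neg Mode).tsum_eq] at this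
    simpa only [zNorm, Equiv.neg_apply, wt_neg, enorm_conjC3, gev_zero_left] using this
  meas := fun k => conjC3.continuous.comp_aestronglyMeasurable (h.meas (-k))
  eqn := by
    intro k t ht
    rw [h.eqn (-k) t ht, map_sub]
    congr 1
    · rw [heatFlow, heatFlow, map_smul, heatRate_neg]
    · have h1 : nonlin (fun k t => conjC3 (u (-k) t)) k = fun t => conjC3 (nonlin u (-k) t) :=
        funext fun t => burgersNL_conj (fun l => u l t) k
      rw [duhamel, duhamel, h1]
      have h2 := conjC3.toContinuousLinearEquiv.toContinuousLinearMap
      have h3 := conjC3.toContinuousLinearEquiv.integral_comp_comm (μ := volume.restrict (Ioc 0 t))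
        (fun s => Real.exp (-heatRate ν (-k) * (t - s)) • nonlin u (-k) s)
      rw [intervalIntegral.integral_of_le ht.1, intervalIntegral.integral_of_le ht.1]
      refine h3.symm.trans (integral_congr_ae (Eventually.of_forall fun s => ?_))
      change conjC3 _ = _
      rw [map_smul, heatRate_neg]

/-- The reflected conjugate of a solution is again a solution, with the same datum when the datum is
real, so the two agree by uniqueness. -/
lemma MildSol.isRealSeq {ν T : ℝ} (hν : 0 < ν) {x : Mode → C3} {u : Mode → ℝ → C3}
    (h : MildSol ν T x u) (hx : IsRealSeq x) {t : ℝ} (ht : t ∈ Icc 0 T) :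
    IsRealSeq fun k => u k t := by
  have h1 := h.conj
  have h2 : (fun k => conjC3 (x (-k))) = x := funext (isRealSeq_iff.1 hx)
  rw [h2] at h1
  exact isRealSeq_iff.2 fun k => h1.unique hν h t ht k

lemma MildSol.regModes {ν T : ℝ} (hν : 0 < ν) {x : Mode → C3} {u : Mode → ℝ → C3}
    (h : MildSol ν T x u) (hx : IsRealSeq x) : RegModes ν (Ioo 0 T) u := by
  refine ⟨fun t ht => ?_, fun t ht k => h.hasDerivAt hν ht k,
    fun t ht => h.isRealSeq hν hx ⟨ht.1.le, ht.2.le⟩⟩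
  obtain ⟨B, c, hc, hB⟩ := h.exists_expDecay hν (half_pos ht.1)
  refine ⟨B, c, hc, ?_⟩
  filter_upwards [Ioo_mem_nhds (half_lt_self ht.1) ht.2] with τ hτ
  exact hB τ ⟨hτ.1.le, hτ.2.le⟩

lemma isRealSeq_fourierCoef (f : L2Field) : IsRealSeq (fourierCoef f) := by
  intro k i
  change _ * _ = conj (_ * _)
  rw [map_mul, map_inv₀, Complex.conj_ofReal, ← integral_conj]
  congr 2
  funext p
  rw [map_mul, Complex.conj_ofReal, ← expMode_neg]

/-! ### Maximum principles -/

lemma deriv_nonpos_of_le_right {h : ℝ → ℝ} {h' a : ℝ} (hd : HasDerivAt h h' a)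
    (hm : ∀ᶠ s in 𝓝[>] a, h s ≤ h a) : h' ≤ 0 := by
  have h1 := (hasDerivWithinAt_iff_tendsto_slope' (by simp)).1 (hd.hasDerivWithinAt (s := Ioi a))
  refine le_of_tendsto h1 ?_
  filter_upwards [hm, self_mem_nhdsWithin] with s hs has
  rw [slope_def_field]
  exact div_nonpos_of_nonpos_of_nonneg (sub_nonpos.2 hs) (sub_nonneg.2 (le_of_lt has))

lemma deriv_nonneg_of_le_left {h : ℝ → ℝ} {h' a : ℝ} (hd : HasDerivAt h h' a)
    (hm : ∀ᶠ s in 𝓝[<] a, h s ≤ h a) : 0 ≤ h' := by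
  have h1 := (hasDerivWithinAt_iff_tendsto_slope' (by simp)).1 (hd.hasDerivWithinAt (s := Iio a))
  refine ge_of_tendsto h1 ?_
  filter_upwards [hm, self_mem_nhdsWithin] with s hs has
  rw [slope_def_field]
  exact div_nonneg_of_nonpos (sub_nonpos.2 hs) (sub_nonpos.2 (le_of_lt has))

/-- A positive second derivative would make the maximum a local minimum too; the function would be
locally constant, with second derivative 0. -/
lemma second_deriv_nonpos {h h₁ : ℝ → ℝ} {a c : ℝ} (hd : ∀ s, HasDerivAt h (h₁ s) s)
    (hd₁ : HasDerivAt h₁ c a) (hm : IsLocalMax h a) : c ≤ 0 := by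
  by_contra! hc
  have e1 : deriv h = h₁ := funext fun s => (hd s).deriv
  have hmin : IsLocalMin h a := by
    refine isLocalMin_of_deriv_deriv_pos ?_ hm.deriv_eq_zero (hd a).continuousAt
    rwa [e1, hd₁.deriv]
  have e2 : h =ᶠ[𝓝 a] fun _ => h a := by
    filter_upwards [hm, hmin] with s h1 h2
    exact le_antisymm h1 h2
  have e3 := e2.deriv.deriv_eq
  rw [e1, hd₁.deriv] at e3
  simp at e3
  exact hc.ne' e3

section Line

variable {f : E3 → ℝ} (hf : ContDiff ℝ 2 f) (x v : E3)
include hf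

lemma hasDerivAt_line (s : ℝ) :
    HasDerivAt (fun s : ℝ => f (x + s • v)) (fderiv ℝ f (x + s • v) v) s := by
  have h1 : HasDerivAt (fun s : ℝ => x + s • v) v s := by
    simpa using ((hasDerivAt_id s).smul_const v).const_add x
  exact ((hf.differentiable (by norm_num)) _).hasFDerivAt.comp_hasDerivAt s h1

lemma hasDerivAt_line_two (s : ℝ) :
    HasDerivAt (fun s : ℝ => fderiv ℝ f (x + s • v) v)
      (iteratedFDeriv ℝ 2 f (x + s • v) ![v, v]) s := by
  have h1 : HasDerivAt (fun s : ℝ => x + s • v) v s := by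
    simpa using ((hasDerivAt_id s).smul_const v).const_add x
  have h2 : Differentiable ℝ (fderiv ℝ f) :=
    (hf.fderiv_right (m := 1) (by norm_num)).differentiable (by norm_num)
  have h3 := (h2 (x + s • v)).hasFDerivAt.comp_hasDerivAt s h1
  have h4 := h3.clm_apply (hasDerivAt_const s v)
  rw [iteratedFDeriv_two_apply]
  simpa using h4

end Line

/-- The modulus in the two-point maximum principle. -/
def barrier (μ r : ℝ) : ℝ := 1 - Real.exp (-μ * r)

lemma barrier_mono {μ : ℝ} (hμ : 0 < μ) {r r' : ℝ} (h : r ≤ r') : barrier μ r ≤ barrier μ r' := by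
  unfold barrier
  have : Real.exp (-μ * r') ≤ Real.exp (-μ * r) := Real.exp_le_exp.2 (by nlinarith)
  linarith

lemma hasDerivAt_barrier (μ p q s : ℝ) :
    HasDerivAt (fun s => barrier μ (p + q * s)) (μ * q * Real.exp (-μ * (p + q * s))) s := by
  have h1 : HasDerivAt (fun s => -μ * (p + q * s)) (-μ * (q * 1)) s :=
    (((hasDerivAt_id s).const_mul q).const_add p).const_mul (-μ)
  refine (h1.exp.const_sub 1).congr_deriv ?_
  ring

lemma hasDerivAt_barrier_two (μ p q s : ℝ) :
    HasDerivAt (fun s => μ * q * Real.exp (-μ * (p + q * s)))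
      (-(μ * q) ^ 2 * Real.exp (-μ * (p + q * s))) s := by
  have h1 : HasDerivAt (fun s => -μ * (p + q * s)) (-μ * (q * 1)) s :=
    (((hasDerivAt_id s).const_mul q).const_add p).const_mul (-μ)
  refine (h1.exp.const_mul (μ * q)).congr_deriv ?_
  ring

/-- First-order condition along x + sv for s > 0. The norm need not be differentiated: the barrier
increases, so |x + sv - y| may be replaced by its linear upper bound. -/
lemma fderiv_le_of_barrier {f : E3 → ℝ} (hf : ContDiff ℝ 2 f) {μ c : ℝ} (hμ : 0 < μ) (hc : 0 ≤ c)
    {x y : E3} (hm : ∀ z, f z - c * barrier μ ‖z - y‖ ≤ f x - c * barrier μ ‖x - y‖) (v : E3) :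
    fderiv ℝ f x v ≤ c * (μ * Real.exp (-μ * ‖x - y‖)) * ‖v‖ := by
  have h1 := (hasDerivAt_line hf x v 0).sub ((hasDerivAt_barrier μ ‖x - y‖ ‖v‖ 0).const_mul c)
  have h2 := deriv_nonpos_of_le_right h1 (by
    filter_upwards [self_mem_nhdsWithin] with s hs
    simp only [Pi.sub_apply, zero_smul, add_zero, mul_zero]
    refine le_trans ?_ (hm (x + s • v))
    have h3 : ‖x + s • v - y‖ ≤ ‖x - y‖ + ‖v‖ * s := by
      rw [add_sub_right_comm]
      refine (norm_add_le _ _).trans (add_le_add le_rfl (le_of_eq ?_))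
      rw [norm_smul, Real.norm_of_nonneg (le_of_lt hs), mul_comm]
    have h4 := mul_le_mul_of_nonneg_left (barrier_mono hμ h3) hc
    linarith)
  simp only [zero_smul, add_zero, mul_zero] at h2
  linarith

/-- Second-order conditions at a maximum of the two-point function, in an orthonormal basis that
contains the direction `e` from `y` to `x`. All of the gain comes from `e`, through the concavity of
the barrier. -/
lemma laplacian_sub_le_of_barrier {f : E3 → ℝ} (hf : ContDiff ℝ 2 f) {μ c : ℝ}
    {x y : E3} (hxy : x ≠ y)
    (hm : ∀ x' y', f x' - f y' - c * barrier μ ‖x' - y'‖ ≤ f x - f y - c * barrier μ ‖x - y‖) :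
    Laplacian.laplacian f x - Laplacian.laplacian f y
      ≤ -4 * c * μ ^ 2 * Real.exp (-μ * ‖x - y‖) := by
  set r := ‖x - y‖ with hr
  have hr0 : 0 < r := norm_pos_iff.2 (sub_ne_zero.2 hxy)
  set e : E3 := r⁻¹ • (x - y) with he
  have hxe : x - y = r • e := by rw [he, smul_smul, mul_inv_cancel₀ hr0.ne', one_smul]
  have hne : ‖e‖ = 1 := by
    rw [he, norm_smul, norm_inv, Real.norm_of_nonneg hr0.le, ← hr, inv_mul_cancel₀ hr0.ne']
  obtain ⟨w, b, hw, hb⟩ := (orthonormal_subtype_iff_ite.2 (by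
    intro a ha a' ha'
    rw [mem_singleton_iff] at ha ha'
    subst ha; subst ha'
    simp [hne]) : Orthonormal ℝ ((↑) : ({e} : Set E3) → E3)).exists_orthonormalBasis_extension
  have hew : e ∈ w := hw rfl
  have hd : ∀ v : E3, ∀ s : ℝ, HasDerivAt (fun s : ℝ => f (x + s • v)) (fderiv ℝ f (x + s • v) v) s :=
    fun v s => hasDerivAt_line hf x v s
  have hpar : ∀ i : w, iteratedFDeriv ℝ 2 f x ![b i, b i] - iteratedFDeriv ℝ 2 f y ![b i, b i]
      ≤ if i = ⟨e, hew⟩ then -4 * c * μ ^ 2 * Real.exp (-μ * r) else 0 := by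
    intro i
    split_ifs with hi
    -- The two points move in opposite directions, so their distance is r + 2s; the factor 2 is
    -- squared to the 4 in the bound.
    · have hbi : b i = e := by rw [hb, hi]
      have h1 : ∀ s : ℝ, HasDerivAt (fun s : ℝ => f (x + s • e) - f (y + s • -e)
          - c * barrier μ (r + 2 * s)) (fderiv ℝ f (x + s • e) e - fderiv ℝ f (y + s • -e) (-e)
          - c * (μ * 2 * Real.exp (-μ * (r + 2 * s)))) s := fun s =>
        ((hasDerivAt_line hf x e s).sub (hasDerivAt_line hf y (-e) s)).sub
          ((hasDerivAt_barrier μ r 2 s).const_mul c)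
      have h2 := ((hasDerivAt_line_two hf x e 0).sub (hasDerivAt_line_two hf y (-e) 0)).sub
          ((hasDerivAt_barrier_two μ r 2 0).const_mul c)
      have h3 := second_deriv_nonpos h1 h2 (by
        filter_upwards [Ioi_mem_nhds (show -(r / 2) < 0 by linarith)] with s hs
        have hs : -(r / 2) < s := hs
        have h4 := hm (x + s • e) (y + s • -e)
        have h5 : x + s • e - (y + s • -e) = (r + 2 * s) • e := by
          rw [add_sub_add_comm, hxe, smul_neg, sub_neg_eq_add]
          module
        rw [h5, norm_smul, hne, mul_one, Real.norm_of_nonneg (by linarith)] at h4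
        simpa using h4)
      have h6 : iteratedFDeriv ℝ 2 f y ![-e, -e] = iteratedFDeriv ℝ 2 f y ![e, e] := by
        rw [iteratedFDeriv_two_apply, iteratedFDeriv_two_apply]
        simp
      rw [hbi]
      simp only [zero_smul, add_zero, mul_zero, h6] at h3
      linarith
    -- The two points move together, so the barrier term is constant.
    · have h1 : ∀ s : ℝ, HasDerivAt (fun s : ℝ => f (x + s • b i) - f (y + s • b i))
          (fderiv ℝ f (x + s • b i) (b i) - fderiv ℝ f (y + s • b i) (b i)) s := fun s =>
        (hasDerivAt_line hf x (b i) s).sub (hasDerivAt_line hf y (b i) s)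
      have h2 := (hasDerivAt_line_two hf x (b i) 0).sub (hasDerivAt_line_two hf y (b i) 0)
      have h3 := second_deriv_nonpos h1 h2 (by
        refine Eventually.of_forall fun s => ?_
        have h4 := hm (x + s • b i) (y + s • b i)
        rw [add_sub_add_right_eq_sub] at h4
        simp only [zero_smul, add_zero]
        linarith)
      simpa using h3
  rw [InnerProductSpace.laplacian_eq_iteratedFDeriv_orthonormalBasis f b, ← Finset.sum_sub_distrib]
  refine (Finset.sum_le_sum fun i _ => hpar i).trans ?_
  rw [Finset.sum_ite_eq' Finset.univ]
  simp

/-! ### Maximum principles for periodic drift-diffusion equations -/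

/-- The periods. -/
def period (n : Fin 3 → ℤ) : E3 := WithLp.toLp 2 fun i => 2 * Real.pi * n i

lemma proj_add_period (y : E3) (n : Fin 3 → ℤ) : proj (y + period n) = proj y := by
  funext i
  simp only [proj, period, PiLp.add_apply]
  rw [AddCircle.coe_add, mul_comm (2 * Real.pi), ← zsmul_eq_mul, AddCircle.coe_zsmul, AddCircle.coe_period]
  simp

/-- Rounding brings each coordinate into [-π, π], and √3·π ≤ 2π. -/
lemma exists_norm_add_period_le (y : E3) : ∃ n, ‖y + period n‖ ≤ 2 * Real.pi := by
  have hπ := Real.pi_pos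
  refine ⟨fun i => -round (y i / (2 * Real.pi)), ?_⟩
  rw [← sq_le_sq₀ (norm_nonneg _) (by positivity), EuclideanSpace.norm_sq_eq]
  have h1 : ∀ i, ‖(y + period fun i => -round (y i / (2 * Real.pi))) i‖ ^ 2 ≤ Real.pi ^ 2 := by
    intro i
    refine pow_le_pow_left₀ (norm_nonneg _) ?_ 2
    have h2 : (y + period fun i => -round (y i / (2 * Real.pi))) i
        = 2 * Real.pi * (y i / (2 * Real.pi) - round (y i / (2 * Real.pi))) := by
      simp only [period, PiLp.add_apply]
      push_cast
      field_simp
      ring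
    rw [h2, norm_mul, Real.norm_of_nonneg (by positivity : 0 ≤ 2 * Real.pi)]
    have h3 := abs_sub_round (y i / (2 * Real.pi))
    rw [Real.norm_eq_abs]
    nlinarith
  refine (Finset.sum_le_sum fun i _ => h1 i).trans ?_
  simp only [Finset.sum_const, Finset.card_univ, Fintype.card_fin, nsmul_eq_mul]
  push_cast
  nlinarith [sq_nonneg Real.pi]

/-- Periodic solutions of a scalar drift-diffusion equation on `[a,b]`. -/
structure DriftHeat (ν a b : ℝ) (w : ℝ → E3 → E3) (f : ℝ → E3 → ℝ) : Prop where
  cont : ContinuousOn (fun q : ℝ × E3 => f q.1 q.2) (Icc a b ×ˢ univ)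
  per : ∀ t y n, f t (y + period n) = f t y
  smooth : ∀ t ∈ Icc a b, ContDiff ℝ 2 (f t)
  eqn : ∀ t ∈ Ioc a b, ∀ y, HasDerivAt (fun τ => f τ y)
    (ν * Laplacian.laplacian (f t) y - fderiv ℝ (f t) y (w t y)) t

lemma eventually_mem_Icc_left {a b t : ℝ} (ht : t ∈ Ioc a b) : ∀ᶠ s in 𝓝[<] t, s ∈ Icc a b := by
  filter_upwards [Ioo_mem_nhdsLT ht.1] with s hs
  exact ⟨hs.1.le, hs.2.le.trans ht.2⟩

lemma laplacian_nonpos_of_max {f : E3 → ℝ} (hf : ContDiff ℝ 2 f) {x : E3} (hm : ∀ y, f y ≤ f x) :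
    Laplacian.laplacian f x ≤ 0 := by
  rw [InnerProductSpace.laplacian_eq_iteratedFDeriv_stdOrthonormalBasis f]
  refine Finset.sum_nonpos fun i _ => ?_
  have h := second_deriv_nonpos (hasDerivAt_line hf x (stdOrthonormalBasis ℝ E3 i))
    (hasDerivAt_line_two hf x (stdOrthonormalBasis ℝ E3 i) 0)
    (Eventually.of_forall fun s => by simpa using hm _)
  simpa using h

/-- The maximum principle. -/
theorem DriftHeat.le {ν a b M : ℝ} (hν : 0 ≤ ν) {w : ℝ → E3 → E3} {f : ℝ → E3 → ℝ}
    (h : DriftHeat ν a b w f) (h0 : ∀ y, f a y ≤ M) {t : ℝ} (ht : t ∈ Icc a b) (y : E3) :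
    f t y ≤ M := by
  -- The penalty ε(t - a) makes the inequality strict: at an interior maximum the equation gives a
  -- time derivative at most 0, while the penalised function needs at least ε. The maximum is
  -- therefore at time `a`.
  have hmain : ∀ ε > 0, f t y ≤ M + ε * (t - a) := by
    intro ε hε
    have hcomp : IsCompact (Icc a b ×ˢ Metric.closedBall (0 : E3) (2 * Real.pi)) :=
      isCompact_Icc.prod (isCompact_closedBall _ _)
    have hcont : ContinuousOn (fun q : ℝ × E3 => f q.1 q.2 - ε * (q.1 - a))
        (Icc a b ×ˢ Metric.closedBall (0 : E3) (2 * Real.pi)) :=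
      (h.cont.mono (prod_mono_right (subset_univ _))).sub (by fun_prop)
    obtain ⟨⟨t₀, y₀⟩, ⟨ht₀, -⟩, hmax⟩ := hcomp.exists_isMaxOn
      ⟨(t, 0), ht, Metric.mem_closedBall_self (by positivity)⟩ hcont
    have hglob : ∀ s ∈ Icc a b, ∀ z, f s z - ε * (s - a) ≤ f t₀ y₀ - ε * (t₀ - a) := by
      intro s hs z
      obtain ⟨n, hn⟩ := exists_norm_add_period_le z
      have := hmax (show (s, z + period n) ∈ _ from ⟨hs, by simpa using hn⟩)
      simpa [h.per] using this
    rcases eq_or_lt_of_le ht₀.1 with h1 | h1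
    · have h2 := hglob t ht y
      have h3 := h0 y₀
      simp only at h1
      rw [← h1] at h2
      linarith
    · exfalso
      have h1 : t₀ ∈ Ioc a b := ⟨h1, ht₀.2⟩
      have h2 : HasDerivAt (fun s => f s y₀ - ε * (s - a)) _ t₀ :=
        (h.eqn t₀ h1 y₀).sub (((hasDerivAt_id t₀).sub_const a).const_mul ε)
      have h3 := deriv_nonneg_of_le_left h2 (by
        filter_upwards [eventually_mem_Icc_left h1] with s hs
        exact hglob s hs y₀)
      have h4 : ∀ z, f t₀ z ≤ f t₀ y₀ := fun z => by linarith [hglob t₀ ht₀ z]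
      have h5 := laplacian_nonpos_of_max (h.smooth t₀ ht₀) h4
      have h6 : fderiv ℝ (f t₀) y₀ = 0 :=
        IsLocalMax.fderiv_eq_zero (Eventually.of_forall h4)
      rw [h6, zero_apply] at h3
      nlinarith [mul_nonpos_of_nonneg_of_nonpos hν h5]
  have h1 : Tendsto (fun ε : ℝ => M + ε * (t - a)) (𝓝[>] 0) (𝓝 (M + 0 * (t - a))) :=
    (Continuous.tendsto (by fun_prop) 0).mono_left nhdsWithin_le_nhds
  rw [zero_mul, add_zero] at h1
  exact ge_of_tendsto h1 (by filter_upwards [self_mem_nhdsWithin] with ε hε using hmain ε hε)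

/-- The exponent of the modulus in the two-point maximum principle. -/
def barrierRate (ν K : ℝ) : ℝ := (2 * K + 1) / (4 * ν)

/-- The rate of decay in the two-point maximum principle. -/
def decayRate (ν K : ℝ) : ℝ := barrierRate ν K * Real.exp (-barrierRate ν K * (2 * Real.pi)) / 2

lemma barrierRate_pos {ν K : ℝ} (hν : 0 < ν) (hK : 0 ≤ K) : 0 < barrierRate ν K := by
  unfold barrierRate
  positivity

lemma decayRate_pos {ν K : ℝ} (hν : 0 < ν) (hK : 0 ≤ K) : 0 < decayRate ν K := by
  have := barrierRate_pos hν hK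
  unfold decayRate
  positivity

/-- The factor in the two-point maximum principle. -/
def lipFactor (ν K : ℝ) : ℝ := Real.exp (barrierRate ν K * (2 * Real.pi))

/-- From e^{μr} - 1 ≥ μr. On bounded distances the barrier is comparable to `r`, so the Lipschitz
bound at the initial time yields a barrier bound; `barrier_le` is the way back. -/
lemma mul_le_barrier {μ r : ℝ} (hμ : 0 < μ) (hr : 0 ≤ r) (hr' : r ≤ 2 * Real.pi) :
    r ≤ Real.exp (μ * (2 * Real.pi)) / μ * barrier μ r := by
  have h1 := Real.add_one_le_exp (μ * r)
  have h2 : Real.exp (μ * r) ≤ Real.exp (μ * (2 * Real.pi)) := by gcongr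
  have h3 : Real.exp (μ * r) * barrier μ r = Real.exp (μ * r) - 1 := by
    rw [barrier, mul_sub, ← Real.exp_add]
    simp
  have h4 : 0 ≤ barrier μ r := by
    rw [barrier, sub_nonneg, Real.exp_le_one_iff]
    nlinarith
  rw [div_mul_eq_mul_div, le_div_iff₀ hμ]
  nlinarith

lemma barrier_le {μ r : ℝ} : barrier μ r ≤ μ * r := by
  have := Real.add_one_le_exp (-μ * r)
  unfold barrier
  linarith

/-- The two-point maximum principle. -/
theorem DriftHeat.sub_le {ν a b K Λ : ℝ} (hν : 0 < ν) (hK : 0 ≤ K) (hΛ : 0 < Λ)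
    {w : ℝ → E3 → E3} {f : ℝ → E3 → ℝ} (h : DriftHeat ν a b w f)
    (hw : ∀ t ∈ Icc a b, ∀ y, ‖w t y‖ ≤ K) (h0 : ∀ x y, f a x - f a y ≤ Λ * ‖x - y‖) {t : ℝ}
    (ht : t ∈ Icc a b) (x y : E3) :
    f t x - f t y ≤ Λ * lipFactor ν K * Real.exp (-decayRate ν K * (t - a)) * ‖x - y‖ := by
  set μ := barrierRate ν K with hμ
  set l := decayRate ν K with hl
  have hμ0 : 0 < μ := barrierRate_pos hν hK
  have hl0 : 0 < l := decayRate_pos hν hK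
  -- The smallest constant with which `mul_le_barrier` makes the barrier dominate the initial
  -- Lipschitz bound.
  set A := Λ * (lipFactor ν K / μ) with hA
  have hA0 : 0 < A := mul_pos hΛ (div_pos (Real.exp_pos _) hμ0)
  set c : ℝ → ℝ := fun s => A * Real.exp (-l * (s - a)) with hc
  have hc0 : ∀ s, 0 < c s := fun s => mul_pos hA0 (Real.exp_pos _)
  suffices hS : f t x - f t y - c t * barrier μ ‖x - y‖ ≤ 0 by
    have h1 := mul_le_mul_of_nonneg_left (barrier_le (μ := μ) (r := ‖x - y‖)) (hc0 t).le
    have h2 : c t * (μ * ‖x - y‖)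
        = Λ * lipFactor ν K * Real.exp (-l * (t - a)) * ‖x - y‖ := by
      simp only [hc, hA]
      field_simp
    linarith
  by_contra! hpos
  have hcomp : IsCompact (Icc a b ×ˢ (Metric.closedBall (0 : E3) (2 * Real.pi) ×ˢ
      Metric.closedBall (0 : E3) (2 * Real.pi))) :=
    isCompact_Icc.prod ((isCompact_closedBall _ _).prod (isCompact_closedBall _ _))
  -- The variables are x and the difference z = x - y. Periodicity confines x to a ball, and the
  -- monotonicity of the barrier confines z, so a maximum exists.
  have hcont : ContinuousOn (fun q : ℝ × E3 × E3 => f q.1 q.2.1 - f q.1 (q.2.1 - q.2.2)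
      - c q.1 * barrier μ ‖q.2.2‖) (Icc a b ×ˢ (Metric.closedBall (0 : E3) (2 * Real.pi) ×ˢ
      Metric.closedBall (0 : E3) (2 * Real.pi))) := by
    refine ContinuousOn.sub (ContinuousOn.sub ?_ ?_) ?_
    · exact h.cont.comp (f := fun q : ℝ × E3 × E3 => (q.1, q.2.1)) (by fun_prop)
        fun q hq => ⟨hq.1, mem_univ _⟩
    · exact h.cont.comp (f := fun q : ℝ × E3 × E3 => (q.1, q.2.1 - q.2.2)) (by fun_prop)
        fun q hq => ⟨hq.1, mem_univ _⟩
    · simp only [hc, barrier]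
      fun_prop
  have h2π : (0 : ℝ) ≤ 2 * Real.pi := by positivity
  obtain ⟨⟨t₀, x₀, z₀⟩, ⟨ht₀, -, hz₀⟩, hmax⟩ := hcomp.exists_isMaxOn
    ⟨(t, 0, 0), ht, Metric.mem_closedBall_self h2π, Metric.mem_closedBall_self h2π⟩ hcont
  set y₀ := x₀ - z₀ with hy₀
  have hxy₀ : x₀ - y₀ = z₀ := by rw [hy₀, sub_sub_cancel]
  have hz₀ : ‖x₀ - y₀‖ ≤ 2 * Real.pi := by rw [hxy₀]; simpa using hz₀
  have hglob : ∀ s ∈ Icc a b, ∀ x y, f s x - f s y - c s * barrier μ ‖x - y‖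
      ≤ f t₀ x₀ - f t₀ y₀ - c t₀ * barrier μ ‖x₀ - y₀‖ := by
    intro s hs x y
    obtain ⟨n, hn⟩ := exists_norm_add_period_le x
    have key : ∀ z : E3, ‖z‖ ≤ 2 * Real.pi → f s (x - z) = f s y → ‖z‖ ≤ ‖x - y‖ →
        f s x - f s y - c s * barrier μ ‖x - y‖
          ≤ f t₀ x₀ - f t₀ y₀ - c t₀ * barrier μ ‖x₀ - y₀‖ := by
      intro z hz hzy hzx
      have h1 := hmax (show (s, x + period n, z) ∈ _ from
        ⟨hs, by simpa using hn, by simpa using hz⟩)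
      have h2 := mul_le_mul_of_nonneg_left (barrier_mono hμ0 hzx) (hc0 s).le
      have h3 : x + period n - z = x - z + period n := by abel
      simp only [h.per, h3, hzy, mem_ofPred_eq] at h1
      rw [hxy₀]
      linarith
    rcases le_total ‖x - y‖ (2 * Real.pi) with h1 | h1
    · exact key (x - y) h1 (by rw [sub_sub_cancel]) le_rfl
    -- Points further apart than 2π: a periodic image of `y` is closer, with the same value of `f`
    -- and a smaller barrier.
    · obtain ⟨m, hm⟩ := exists_norm_add_period_le (x - y)
      refine key (x - y + period m) hm ?_ (hm.trans h1)
      rw [← h.per s _ m]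
      congr 1
      abel
  have hpos₀ : 0 < f t₀ x₀ - f t₀ y₀ - c t₀ * barrier μ ‖x₀ - y₀‖ :=
    hpos.trans_le (hglob t ht x y)
  have hne : x₀ ≠ y₀ := by
    intro hxy
    rw [hxy] at hpos₀
    simp [barrier] at hpos₀
  have hta : a < t₀ := by
    -- A positive maximum cannot occur at the initial time, by the choice of `A`.
    refine lt_of_le_of_ne ht₀.1 fun hta => ?_
    have h1 := h0 x₀ y₀
    have h2 := mul_le_mul_of_nonneg_left (mul_le_barrier hμ0 (norm_nonneg (x₀ - y₀)) hz₀) hΛ.le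
    have h3 : c t₀ = A := by simp [hc, ← hta]
    rw [← hta] at hpos₀ h3
    rw [h3, hA, lipFactor] at hpos₀
    rw [← mul_assoc] at h2
    linarith
  have ht₀' : t₀ ∈ Ioc a b := ⟨hta, ht₀.2⟩
  have hsm := h.smooth t₀ ht₀
  have htime : 0 ≤ (ν * Laplacian.laplacian (f t₀) x₀ - fderiv ℝ (f t₀) x₀ (w t₀ x₀))
      - (ν * Laplacian.laplacian (f t₀) y₀ - fderiv ℝ (f t₀) y₀ (w t₀ y₀))
      + l * c t₀ * barrier μ ‖x₀ - y₀‖ := by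
    have h1 : HasDerivAt c (-l * c t₀) t₀ := by
      have h2 : HasDerivAt (fun s => -l * (s - a)) (-l * 1) t₀ :=
        ((hasDerivAt_id t₀).sub_const a).const_mul (-l)
      refine (h2.exp.const_mul A).congr_deriv ?_
      simp only [hc]
      ring
    have h2 : HasDerivAt (fun s => f s x₀ - f s y₀ - c s * barrier μ ‖x₀ - y₀‖) _ t₀ :=
      ((h.eqn t₀ ht₀' x₀).sub (h.eqn t₀ ht₀' y₀)).sub (h1.mul_const _)
    have h3 := deriv_nonneg_of_le_left h2 (by
      filter_upwards [eventually_mem_Icc_left ht₀'] with s hs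
      exact hglob s hs x₀ y₀)
    linarith
  have hg := hglob t₀ ht₀
  have hlap := laplacian_sub_le_of_barrier hsm hne hg
  set E := Real.exp (-μ * ‖x₀ - y₀‖) with hE
  have hE0 : 0 < E := Real.exp_pos _
  have hgx := fderiv_le_of_barrier hsm hμ0 (hc0 t₀).le (x := x₀) (y := y₀)
    (fun z => by linarith [hg z y₀]) (-w t₀ x₀)
  have hgy := fderiv_le_of_barrier (f := fun z => -f t₀ z) hsm.neg hμ0 (hc0 t₀).le
    (x := y₀) (y := x₀) (fun z => by
      have := hg x₀ z
      rw [norm_sub_rev z, norm_sub_rev y₀]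
      linarith) (-w t₀ y₀)
  rw [norm_neg, map_neg] at hgx
  rw [norm_neg, norm_sub_rev, fderiv_fun_neg, neg_apply, map_neg, neg_neg] at hgy
  rw [← hE] at hgx hgy
  have hcE : 0 ≤ c t₀ * (μ * E) := mul_nonneg (hc0 t₀).le (mul_pos hμ0 hE0).le
  have hgx' := hgx.trans (mul_le_mul_of_nonneg_left (hw t₀ ht₀ x₀) hcE)
  have hgy' := hgy.trans (mul_le_mul_of_nonneg_left (hw t₀ ht₀ y₀) hcE)
  have hlap' := mul_le_mul_of_nonneg_left hlap hν.le
  -- The choice of `μ`: diffusion contributes -4νμ² and the drift at most 2Kμ, both times cE, so a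
  -- surplus -μcE remains.
  have hμν : 4 * ν * μ = 2 * K + 1 := by
    rw [hμ, barrierRate]
    field_simp
  -- The decay rate is tuned to the largest distance 2π, so the surplus also beats the term l·c·(1 -
  -- E) from the decay of `c`.
  have hEl : 2 * l ≤ μ * E := by
    have h1 : Real.exp (-μ * (2 * Real.pi)) ≤ E := by
      rw [hE]
      exact Real.exp_le_exp.2 (by nlinarith)
    have h2 : 2 * l = μ * Real.exp (-μ * (2 * Real.pi)) := by
      rw [hl, decayRate, ← hμ]
      ring
    rw [h2]
    gcongr
  have hfin : ν * (-4 * c t₀ * μ ^ 2 * E) + 2 * (c t₀ * (μ * E) * K) + l * c t₀ * (1 - E)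
      = c t₀ * (l * (1 - E) - μ * E) := by
    linear_combination (-(c t₀ * μ * E)) * hμν
  have hneg : c t₀ * (l * (1 - E) - μ * E) < 0 :=
    mul_neg_of_pos_of_neg (hc0 t₀) (by nlinarith)
  have hb : barrier μ ‖x₀ - y₀‖ = 1 - E := rfl
  rw [hb] at htime
  nlinarith

/-! ### A priori bounds -/

lemma proj_surjective (p : Torus) : ∃ y, proj y = p := by
  choose y hy using fun i => QuotientAddGroup.mk_surjective (p i)
  exact ⟨WithLp.toLp 2 y, funext hy⟩

lemma continuous_proj : Continuous proj := by
  refine continuous_pi fun i => ?_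
  have h : Continuous fun y : E3 => y i := (EuclideanSpace.proj (𝕜 := ℝ) i).continuous
  exact (AddCircle.continuous_mk' (2 * Real.pi)).comp h

lemma proj_add_smul_single (y : E3) (j : Fin 3) (h : ℝ) :
    proj (y + h • EuclideanSpace.single j (1 : ℝ))
      = proj y + Pi.single j (h : AddCircle (2 * Real.pi)) := by
  funext i
  rcases eq_or_ne i j with rfl | hij
  · simp [proj]
  · simp [proj, hij]

lemma partialDeriv_proj {F : Torus → E3} (hF : Differentiable ℝ (lift F)) (j : Fin 3) (y : E3) :
    partialDeriv j F (proj y) = fderiv ℝ (lift F) y (EuclideanSpace.single j 1) := by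
  rw [← (hF y).lineDeriv_eq_fderiv, lineDeriv, partialDeriv]
  simp only [lift, proj_add_smul_single]

lemma laplacian_lift {F : Torus → E3} (hF : ContDiff ℝ 2 (lift F)) (y : E3) :
    ∑ j, partialDeriv j (partialDeriv j F) (proj y) = Laplacian.laplacian (lift F) y := by
  have hd : Differentiable ℝ (lift F) := hF.differentiable (by norm_num)
  have hd2 : Differentiable ℝ (fderiv ℝ (lift F)) :=
    (hF.fderiv_right (m := 1) (by norm_num)).differentiable (by norm_num)
  rw [InnerProductSpace.laplacian_eq_iteratedFDeriv_orthonormalBasis (lift F)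
    (EuclideanSpace.basisFun (Fin 3) ℝ)]
  refine Finset.sum_congr rfl fun j _ => ?_
  have h1 : lift (partialDeriv j F)
      = fun y => fderiv ℝ (lift F) y (EuclideanSpace.single j 1) :=
    funext fun y => partialDeriv_proj hd j y
  have h2 : Differentiable ℝ (lift (partialDeriv j F)) := by
    rw [h1]
    exact hd2.clm_apply (differentiable_const _)
  rw [partialDeriv_proj h2, h1, fderiv_clm_apply (hd2 y) (differentiableAt_const _),
    iteratedFDeriv_two_apply]
  simp

lemma sum_smul_partialDeriv {F : Torus → E3} (hF : Differentiable ℝ (lift F)) (y v : E3) :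
    ∑ j, v j • partialDeriv j F (proj y) = fderiv ℝ (lift F) y v := by
  simp only [partialDeriv_proj hF, ← map_smul, ← map_sum]
  congr 1
  ext i
  simp [Finset.sum_apply, Pi.single_apply]

section APriori

variable {ν a b : ℝ} {s : Set ℝ} {u : Mode → ℝ → C3}

/-- Pairing the equations with a constant vector leaves a scalar equation, because nothing other
than transport by u couples the components. -/
lemma RegModes.driftHeat (hν : 0 ≤ ν) (hs : IsOpen s) (h : RegModes ν s u) (hab : Icc a b ⊆ s)
    (e : E3) : DriftHeat ν a b (fun t => lift (synth fun k => u k t))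
      (fun t y => inner ℝ e (lift (synth fun k => u k t) y)) where
  cont := by
    refine ContinuousOn.inner continuousOn_const ?_
    have h1 : ContinuousOn (fun t => synth fun k => u k t) (Icc a b) := fun t ht =>
      (h.continuousAt_synth (hab ht)).continuousWithinAt
    have h2 : ContinuousOn (fun q : ℝ × E3 => ((synth fun k => u k q.1), proj q.2))
        (Icc a b ×ˢ univ) :=
      (h1.comp continuousOn_fst fun q hq => hq.1).prodMk
        (continuous_proj.comp continuous_snd).continuousOn
    exact continuous_eval.comp_continuousOn h2
  per := fun t y n => by simp only [lift, proj_add_period]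
  smooth := fun t ht => contDiff_const.inner ℝ
    (by exact_mod_cast contDiff_infty.1 (contDiff_lift_synth (h.summable (hab ht))) 2)
  eqn := by
    intro t ht y
    have hts : t ∈ s := hab ⟨ht.1.le, ht.2⟩
    set F : C(Torus, E3) := synth fun k => u k t with hF
    have hC : ContDiff ℝ 2 (lift F) := by
      exact_mod_cast contDiff_infty.1 (contDiff_lift_synth (h.summable hts)) 2
    have hd : Differentiable ℝ (lift F) := hC.differentiable (by norm_num)
    have h1 := ((innerSL ℝ e).comp (ContinuousMap.evalCLM ℝ (proj y))).hasFDerivAt.comp_hasDerivAt t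
      (h.hasDerivAt_synth hν hs hts)
    refine h1.congr_deriv ?_
    have h2 : Laplacian.laplacian (fun y => inner ℝ e (lift F y)) y
        = inner ℝ e (Laplacian.laplacian (lift F) y) :=
      hC.contDiffAt.laplacian_CLM_comp_left (l := innerSL ℝ e)
    have h3 : fderiv ℝ (fun y => inner ℝ e (lift F y)) y
        = (innerSL ℝ e).comp (fderiv ℝ (lift F) y) :=
      ((innerSL ℝ e).hasFDerivAt.comp y (hd y).hasFDerivAt).fderiv
    rw [h2, h3]
    change inner ℝ e (synth (timeSeq ν fun k => u k t) (proj y)) = _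
    rw [h.synth_timeSeq hts, laplacian_lift hC, sum_smul_partialDeriv hd, inner_sub_right,
      real_inner_smul_right]
    rfl

/-- The scalar maximum principle in the direction `e` = u(t,y), which turns |u|² ≤ |u|·sup|u(a)|
into a bound for the Euclidean norm. -/
lemma RegModes.norm_le (hν : 0 ≤ ν) (hs : IsOpen s) (h : RegModes ν s u) (hab : Icc a b ⊆ s)
    {t : ℝ} (ht : t ∈ Icc a b) (y : E3) :
    ‖lift (synth fun k => u k t) y‖ ≤ ‖synth fun k => u k a‖ := by
  set e := lift (synth fun k => u k t) y with he
  have h1 := (h.driftHeat hν hs hab e).le hν (M := ‖e‖ * ‖synth fun k => u k a‖)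
    (fun z => (real_inner_le_norm _ _).trans
      (mul_le_mul_of_nonneg_left (ContinuousMap.norm_coe_le_norm _ _) (norm_nonneg _))) ht y
  rw [← he, real_inner_self_eq_norm_sq, sq] at h1
  rcases eq_or_lt_of_le (norm_nonneg e) with h2 | h2
  · rw [← h2]; exact norm_nonneg _
  · exact le_of_mul_le_mul_left h1 h2

lemma lipschitz_lift_synth {x : Mode → C3} (hx : ∀ n, Summable fun k => modeNorm k ^ n * ‖x k‖)
    (y z : E3) : ‖lift (synth x) y - lift (synth x) z‖ ≤ (∑' k, modeNorm k * ‖x k‖) * ‖y - z‖ := by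
  have h1 : Differentiable ℝ (lift (synth x)) := (contDiff_lift_synth hx).differentiable (by simp)
  refine Convex.norm_image_sub_le_of_norm_fderiv_le (s := univ) (fun w _ => h1 w) (fun w _ => ?_)
    convex_univ (mem_univ z) (mem_univ y)
  have h2 := norm_iteratedFDeriv_lift_synth_le hx 1 w
  simpa only [norm_iteratedFDeriv_one, pow_one] using h2

/-- The Lipschitz bound given by the two-point maximum principle. -/
def lipBound (x : Mode → C3) : ℝ := ∑' k, modeNorm k * ‖x k‖ + 1

lemma lipBound_pos (x : Mode → C3) : 0 < lipBound x :=
  add_pos_of_nonneg_of_pos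
    (tsum_nonneg fun k => mul_nonneg (modeNorm_nonneg k) (norm_nonneg _)) one_pos

/-- The two-point principle in the direction `d` = u(t,y) - u(t,z), with the previous supremum bound
for the drift. The summand 1 in `lipBound` supplies the strictly positive constant that
`DriftHeat.sub_le` asks for. -/
lemma RegModes.lipschitz (hν : 0 < ν) (hs : IsOpen s) (h : RegModes ν s u) (hab : Icc a b ⊆ s)
    {t : ℝ} (ht : t ∈ Icc a b) (y z : E3) :
    ‖lift (synth fun k => u k t) y - lift (synth fun k => u k t) z‖
      ≤ lipBound (fun k => u k a) * lipFactor ν ‖synth fun k => u k a‖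
        * Real.exp (-decayRate ν ‖synth fun k => u k a‖ * (t - a)) * ‖y - z‖ := by
  set K := ‖synth fun k => u k a‖ with hK
  set Λ := lipBound (fun k => u k a) with hΛ
  have hΛ0 : 0 < Λ := lipBound_pos _
  have has : a ∈ s := hab ⟨le_rfl, ht.1.trans ht.2⟩
  set d := lift (synth fun k => u k t) y - lift (synth fun k => u k t) z with hd
  rcases eq_or_lt_of_le (norm_nonneg d) with h2 | h2
  · rw [← h2]
    unfold lipFactor
    positivity
  have h1 := (h.driftHeat hν.le hs hab d).sub_le hν (norm_nonneg _) (mul_pos h2 hΛ0)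
    (fun t ht y => h.norm_le hν.le hs hab ht y) (fun y z => by
      rw [← inner_sub_right]
      refine (real_inner_le_norm _ _).trans ?_
      rw [mul_assoc]
      refine mul_le_mul_of_nonneg_left ?_ (norm_nonneg _)
      refine (lipschitz_lift_synth (h.summable has) y z).trans ?_
      refine mul_le_mul_of_nonneg_right ?_ (norm_nonneg _)
      rw [hΛ, lipBound]
      linarith) ht y z
  rw [← inner_sub_right, ← hd, real_inner_self_eq_norm_sq, sq] at h1
  refine le_of_mul_le_mul_left (h1.trans (le_of_eq ?_)) h2
  ring

lemma tsum_enorm_sq_le_of_norm_le {x : Mode → C3} (hx : Summable fun k => ‖x k‖)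
    (hr : IsRealSeq x) {M : ℝ} (hM : ∀ p, ‖synth x p‖ ≤ M) :
    ∑' k, ‖x k‖ₑ ^ 2 ≤ ENNReal.ofReal (M ^ 2) := by
  have h1 := parseval (synthLp x)
  rw [fourierCoef_synthLp hx hr, enorm_sq_Lp] at h1
  have h2 : ∫⁻ p, ‖synthLp x p‖ₑ ^ 2 ≤ ENNReal.ofReal ((2 * Real.pi) ^ 3) * ENNReal.ofReal (M ^ 2) := by
    calc ∫⁻ p, ‖synthLp x p‖ₑ ^ 2 ≤ ∫⁻ p : Torus, ENNReal.ofReal (M ^ 2) := by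
          refine lintegral_mono_ae ?_
          filter_upwards [coeFn_synthLp x] with p hp
          have hM0 : 0 ≤ M := (norm_nonneg _).trans (hM p)
          rw [hp, ENNReal.ofReal_pow hM0, ← ofReal_norm]
          gcongr
          exact hM p
      _ = _ := by rw [lintegral_const, volume_torus, mul_comm]
  rw [h1] at h2
  have h3 : ENNReal.ofReal ((2 * Real.pi) ^ 3) ≠ 0 := by
    simpa using pow_pos Real.two_pi_pos 3
  exact (ENNReal.mul_le_mul_iff_right h3 ENNReal.ofReal_ne_top).1 h2

lemma enorm_derivSeq_sq (j : Fin 3) (x : Mode → C3) (k : Mode) :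
    ‖derivSeq j x k‖ₑ ^ 2 = ENNReal.ofReal ((k j : ℝ) ^ 2) * ‖x k‖ₑ ^ 2 := by
  rw [← ofReal_norm, ← ofReal_norm, ← ENNReal.ofReal_pow (norm_nonneg _),
    ← ENNReal.ofReal_pow (norm_nonneg _), ← ENNReal.ofReal_mul (sq_nonneg _), derivSeq, norm_smul,
    norm_mul, Complex.norm_I, one_mul, mul_pow, Complex.norm_intCast, sq_abs]

lemma tsum_modeNorm_sq_le_of_lipschitz {x : Mode → C3}
    (hx : ∀ n, Summable fun k => modeNorm k ^ n * ‖x k‖) (hr : IsRealSeq x) {L : ℝ} (hL0 : 0 ≤ L)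
    (hL : ∀ y z, ‖lift (synth x) y - lift (synth x) z‖ ≤ L * ‖y - z‖) :
    ∑' k, ENNReal.ofReal (modeNorm k ^ 2) * ‖x k‖ₑ ^ 2 ≤ ENNReal.ofReal (3 * L ^ 2) := by
  have h1 : ∀ j, ∑' k, ‖derivSeq j x k‖ₑ ^ 2 ≤ ENNReal.ofReal (L ^ 2) := by
    intro j
    refine tsum_enorm_sq_le_of_norm_le (by simpa using summable_derivSeq hx j 0)
      (hr.derivSeq j) fun p => ?_
    obtain ⟨y, rfl⟩ := proj_surjective p
    have hd : Differentiable ℝ (lift (synth x)) := (contDiff_lift_synth hx).differentiable (by simp)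
    rw [← partialDeriv_synth hx, partialDeriv_proj hd]
    have h2 : ‖fderiv ℝ (lift (synth x)) y‖ ≤ L :=
      norm_fderiv_le_of_lipschitz ℝ (C := ⟨L, hL0⟩) (LipschitzWith.of_dist_le_mul fun y z => by
        rw [dist_eq_norm, dist_eq_norm]
        exact hL y z)
    refine ((fderiv ℝ (lift (synth x)) y).le_of_opNorm_le h2 _).trans ?_
    simp
  calc _ = ∑' k, ∑ j, ‖derivSeq j x k‖ₑ ^ 2 := by
        refine tsum_congr fun k => ?_
        rw [modeNorm_sq, ENNReal.ofReal_sum_of_nonneg (fun i _ => sq_nonneg _), Finset.sum_mul]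
        simp only [enorm_derivSeq_sq]
    _ = ∑ j, ∑' k, ‖derivSeq j x k‖ₑ ^ 2 :=
        Summable.tsum_finsetSum fun j _ => ENNReal.summable
    _ ≤ ∑ j : Fin 3, ENNReal.ofReal (L ^ 2) := Finset.sum_le_sum fun j _ => h1 j
    _ = _ := by
        rw [Finset.sum_const, Finset.card_univ, Fintype.card_fin, nsmul_eq_mul,
          ENNReal.ofReal_mul (by norm_num)]
        norm_num

lemma RegModes.gradient_decay (hν : 0 < ν) (hs : IsOpen s) (h : RegModes ν s u)
    (hab : Icc a b ⊆ s) {t : ℝ} (ht : t ∈ Icc a b) :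
    ∑' k, ENNReal.ofReal (modeNorm k ^ 2) * ‖u k t‖ₑ ^ 2
      ≤ ENNReal.ofReal (3 * (lipBound (fun k => u k a) * lipFactor ν ‖synth fun k => u k a‖
        * Real.exp (-decayRate ν ‖synth fun k => u k a‖ * (t - a))) ^ 2) := by
  have h0 := lipBound_pos fun k => u k a
  refine tsum_modeNorm_sq_le_of_lipschitz (h.summable (hab ht)) (h.real t (hab ht)) ?_
    (h.lipschitz hν hs hab ht)
  unfold lipFactor
  positivity

/-- The square of the norm of `H¹`. -/
def h1Sum (x : Mode → C3) : ℝ≥0∞ := ∑' k, wt k ^ 2 * ‖x k‖ₑ ^ 2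

/-- The a priori bound in `H¹`. -/
def h1Bound (ν : ℝ) (x : Mode → C3) : ℝ≥0∞ :=
  ENNReal.ofReal (‖synth x‖ ^ 2) + ENNReal.ofReal (3 * (lipBound x * lipFactor ν ‖synth x‖) ^ 2)

lemma h1Bound_ne_top (ν : ℝ) (x : Mode → C3) : h1Bound ν x ≠ ⊤ := by
  unfold h1Bound
  finiteness

lemma wt_sq (k : Mode) : wt k ^ 2 = 1 + ENNReal.ofReal (modeNorm k ^ 2) := by
  rw [wt, ← ENNReal.ofReal_pow (bracket_pos k).le, bracket_sq,
    ENNReal.ofReal_add zero_le_one (sq_nonneg _), ENNReal.ofReal_one]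

/-- Parseval turns the supremum bounds of u and of its gradient into an H¹ bound that depends on the
state at time `a` only, however large `t` is. Global continuation rests on this. -/
lemma RegModes.h1Sum_le (hν : 0 < ν) (hs : IsOpen s) (h : RegModes ν s u)
    (hab : Icc a b ⊆ s) {t : ℝ} (ht : t ∈ Icc a b) :
    h1Sum (fun k => u k t) ≤ h1Bound ν fun k => u k a := by
  have h1 : h1Sum (fun k => u k t)
      = ∑' k, ‖u k t‖ₑ ^ 2 + ∑' k, ENNReal.ofReal (modeNorm k ^ 2) * ‖u k t‖ₑ ^ 2 := by
    rw [h1Sum, ← ENNReal.tsum_add]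
    simp only [wt_sq, add_mul, one_mul]
  rw [h1, h1Bound]
  refine add_le_add ?_ ((h.gradient_decay hν hs hab ht).trans (ENNReal.ofReal_le_ofReal ?_))
  · refine tsum_enorm_sq_le_of_norm_le (h.summable_norm (hab ht)) (h.real t (hab ht)) fun p => ?_
    obtain ⟨y, rfl⟩ := proj_surjective p
    exact h.norm_le hν.le hs hab ht y
  · have h0 := lipBound_pos fun k => u k a
    have h2 : 0 < lipFactor ν ‖synth fun k => u k a‖ := Real.exp_pos _
    have h3 := decayRate_pos hν (norm_nonneg (synth fun k => u k a))
    have h4 : Real.exp (-decayRate ν ‖synth fun k => u k a‖ * (t - a)) ≤ 1 :=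
      Real.exp_le_one_iff.2 (by nlinarith [ht.1])
    refine mul_le_mul_of_nonneg_left (pow_le_pow_left₀ (by positivity) ?_ 2) (by norm_num)
    exact mul_le_of_le_one_right (by positivity) h4

end APriori

/-! ### Global existence -/

/-- H¹ is subcritical: bounding the kernel by 1 gains a power of `T` with a factor depending only on
the H¹ norm. -/
lemma linNorm_le {ν T : ℝ} (hν : 0 < ν) (x : Mode → C3) :
    linNorm ν T (fun k => ‖x k‖ₑ) ≤ ENNReal.ofReal T ^ (1 / 2 : ℝ) * h1Sum x := by
  rw [linNorm, h1Sum, ← ENNReal.tsum_mul_left]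
  refine ENNReal.tsum_le_tsum fun k => ?_
  have h1 : n4 T (expKer (cmpRate ν k)) ≤ ENNReal.ofReal T ^ (1 / 4 : ℝ) := by
    unfold n4
    gcongr
    calc ∫⁻ t in Ioc 0 T, expKer (cmpRate ν k) t ^ 4 ≤ ∫⁻ t in Ioc 0 T, 1 :=
          lintegral_mono fun t => pow_le_one₀ zero_le (expKer_le_one (cmpRate_pos hν k) t)
      _ = ENNReal.ofReal T := by simp
  calc (wt k * (‖x k‖ₑ * n4 T (expKer (cmpRate ν k)))) ^ 2
      ≤ (wt k * (‖x k‖ₑ * ENNReal.ofReal T ^ (1 / 4 : ℝ))) ^ 2 := by gcongr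
    _ = (ENNReal.ofReal T ^ (1 / 4 : ℝ)) ^ 2 * (wt k ^ 2 * ‖x k‖ₑ ^ 2) := by ring
    _ = _ := by
        rw [← ENNReal.rpow_natCast (ENNReal.ofReal T ^ (1 / 4 : ℝ)), ← ENNReal.rpow_mul]
        norm_num

lemma exists_lifespan {ν : ℝ} (hν : 0 < ν) {M : ℝ≥0∞} (hM : M ≠ ⊤) {T : ℝ} (hT : 0 < T) :
    ∃ τ, 0 < τ ∧ τ ≤ 1 ∧ τ ≤ T ∧ ∀ x : Mode → C3, h1Sum x ≤ M →
      linNorm ν τ (fun k => ‖x k‖ₑ) ≤ linThreshold ν := by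
  have h1 : Tendsto (fun τ : ℝ => ENNReal.ofReal τ ^ (1 / 2 : ℝ) * M) (𝓝[>] 0) (𝓝 0) := by
    have h2 : Tendsto (fun τ : ℝ => ENNReal.ofReal τ) (𝓝[>] 0) (𝓝 0) := by
      have := ENNReal.continuous_ofReal.tendsto 0
      rw [ENNReal.ofReal_zero] at this
      exact this.mono_left nhdsWithin_le_nhds
    have h3 := (ENNReal.continuous_rpow_const (y := 1 / 2)).tendsto 0
    rw [ENNReal.zero_rpow_of_pos (by norm_num)] at h3
    simpa using ENNReal.Tendsto.mul_const (h3.comp h2) (Or.inr hM)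
  obtain ⟨τ, h2, h3, h4⟩ := ((h1.eventually_le_const
    (pos_iff_ne_zero.2 (linThreshold_ne_zero ν))).and
    (Ioo_mem_nhdsGT (lt_min hT one_pos))).exists
  refine ⟨τ, h3, h4.le.trans (min_le_right _ _), h4.le.trans (min_le_left _ _), fun x hx => ?_⟩
  refine (linNorm_le hν x).trans (le_trans ?_ h2)
  gcongr

lemma MildSol.congr {ν T : ℝ} {x : Mode → C3} {u v : Mode → ℝ → C3} (h : MildSol ν T x u)
    (huv : ∀ t ∈ Icc 0 T, ∀ k, v k t = u k t) : MildSol ν T x v where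
  init := h.init
  zfin := by
    rw [zNorm_congr_enorm (b := u) fun k t ht => by rw [huv t ⟨ht.1.le, ht.2⟩ k]]
    exact h.zfin
  meas := fun k => (h.meas k).congr (by
    filter_upwards [ae_restrict_mem measurableSet_Ioc] with t ht
    exact (huv t ⟨ht.1.le, ht.2⟩ k).symm)
  eqn := by
    intro k t ht
    rw [huv t ht k, h.eqn k t ht]
    congr 1
    rw [duhamel, duhamel]
    refine intervalIntegral.integral_congr fun s hs => ?_
    rw [uIcc_of_le ht.1] at hs
    have h1 : (fun l => v l s) = fun l => u l s := funext (huv s ⟨hs.1, hs.2.trans ht.2⟩)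
    simp only [nonlin, h1]

/-- The H¹ bound is computed from the first local solution at the fixed time T₁/2. By uniqueness
every extension has the same state there, so the same bound and the same lifespan `τ` serve all
restarts, each of which gains τ/2. -/
theorem exists_mildSol {ν : ℝ} (hν : 0 < ν) {x : Mode → C3}
    (hx : ∑' k, wt k * ‖x k‖ₑ ^ 2 ≠ ⊤) (hr : IsRealSeq x) :
    ∃ u, ∀ T, MildSol ν T x u := by
  obtain ⟨T₁, hlin, hT₁, hT₁'⟩ := (((tendsto_linNorm_zero hν (M := fun k => ‖x k‖ₑ)
    hx).eventually_le_const (pos_iff_ne_zero.2 (linThreshold_ne_zero ν))).and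
    (Ioo_mem_nhdsGT one_pos)).exists
  obtain ⟨u₁, hu₁, -⟩ := exists_mildSol_local hν hT₁'.le x hx hlin
  obtain ⟨τ, hτ0, hτ1, hτT, hτ⟩ := exists_lifespan hν (h1Bound_ne_top ν fun k => u₁ k (T₁ / 2)) hT₁
  have step : ∀ n : ℕ, ∃ u, MildSol ν (T₁ + n * (τ / 2)) x u := by
    intro n
    induction n with
    | zero => exact ⟨u₁, by simpa using hu₁⟩
    | succ n ih =>
      obtain ⟨u, hu⟩ := ih
      set T := T₁ + n * (τ / 2) with hT
      have hnn : 0 ≤ n * (τ / 2) := by positivity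
      have h1 : (fun k => u k (T₁ / 2)) = fun k => u₁ k (T₁ / 2) := funext fun k =>
        (hu.restrict (S := T₁) (by linarith)).unique hν hu₁ _ ⟨by linarith, by linarith⟩ k
      -- Regularity is known on the open interval (0, T) only, so the restart is at T - τ/2 and not
      -- at T.
      have h2 := (hu.regModes hν hr).h1Sum_le hν isOpen_Ioo (a := T₁ / 2) (b := T - τ / 2)
        (fun t ht => ⟨by linarith [ht.1], by linarith [ht.2]⟩)
        (right_mem_Icc.2 (by linarith))
      rw [h1] at h2
      have hI : T - τ / 2 ∈ Icc 0 T := ⟨by linarith, by linarith⟩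
      obtain ⟨v, hv, -⟩ := exists_mildSol_local hν hτ1 _ (hu.wt_sum_ne_top hν hI) (hτ _ h2)
      refine ⟨_, (?_ : MildSol ν _ x (glue (T - τ / 2) u v))⟩
      have h3 := (hu.restrict (S := T - τ / 2) (by linarith)).glue hI.1 hτ0.le hv
      convert h3 using 1
      push_cast
      rw [hT]
      ring
  have hex : ∀ n : ℕ, ∃ u, MildSol ν n x u := by
    intro n
    obtain ⟨m, hm⟩ := exists_nat_gt (n / (τ / 2))
    obtain ⟨u, hu⟩ := step m
    refine ⟨u, hu.restrict ?_⟩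
    rw [div_lt_iff₀ (by positivity)] at hm
    linarith
  choose w hw using hex
  -- At time t any solution living past t may be used; uniqueness makes the choices consistent.
  refine ⟨fun k t => w ⌈t⌉₊ k t, fun T => ?_⟩
  refine ((hw ⌈T⌉₊).restrict (Nat.le_ceil T)).congr fun t ht k => ?_
  have h1 : (⌈t⌉₊ : ℝ) ≤ ⌈T⌉₊ := by exact_mod_cast Nat.ceil_mono ht.2
  exact (hw ⌈t⌉₊).unique hν ((hw ⌈T⌉₊).restrict h1) t ⟨ht.1, Nat.le_ceil t⟩ k

/-! ### Decay -/

lemma pow_four_le_gev {τ : ℝ} (hτ : 0 < τ) (k : Mode) :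
    ENNReal.ofReal (modeNorm k ^ 4) ≤ ENNReal.ofReal (2 / τ ^ 2) * gev 1 k τ ^ 2 := by
  have h0 := modeNorm_nonneg k
  have h1 := Real.pow_div_factorial_le_exp (2 * √τ * modeNorm k) (by positivity) 4
  have h2 : √τ ^ 4 = τ ^ 2 := by
    rw [show √τ ^ 4 = (√τ ^ 2) ^ 2 by ring, Real.sq_sqrt hτ.le]
  rw [gev, ← ENNReal.ofReal_pow (Real.exp_pos _).le, ← ENNReal.ofReal_mul (by positivity)]
  refine ENNReal.ofReal_le_ofReal ?_
  rw [← Real.exp_nat_mul]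
  have h3 : ((2 : ℕ) : ℝ) * (1 * √τ * modeNorm k) = 2 * √τ * modeNorm k := by push_cast; ring
  rw [h3]
  rw [mul_pow, mul_pow, h2, Nat.factorial] at h1
  norm_num [Nat.factorial] at h1
  rw [div_mul_eq_mul_div, le_div_iff₀ (by positivity)]
  nlinarith [pow_nonneg h0 4]

lemma regModes_Ioi {ν : ℝ} (hν : 0 < ν) {x : Mode → C3} {u : Mode → ℝ → C3}
    (hu : ∀ T, MildSol ν T x u) (hr : IsRealSeq x) : RegModes ν (Ioi 0) u :=
  ⟨fun t ht => ((hu (t + 1)).regModes hν hr).decay t ⟨ht, by linarith⟩,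
   fun t ht => ((hu (t + 1)).regModes hν hr).deriv t ⟨ht, by linarith⟩,
   fun t ht => ((hu (t + 1)).regModes hν hr).real t ⟨ht, by linarith⟩⟩

/-- Up to time 1 + τ the local H^{3/2} bound applies. Afterwards the gradient decays exponentially
from the reference time 1, and a restart by `τ` bounds the fourth-order sum uniformly in time. -/
theorem lintegral_modeNorm_cube_lt_top {ν : ℝ} (hν : 0 < ν) {x : Mode → C3} {u : Mode → ℝ → C3}
    (hu : ∀ T, MildSol ν T x u) (hr : IsRealSeq x) :
    ∫⁻ t in Ioi (0 : ℝ), ∑' k, ENNReal.ofReal (modeNorm k ^ 3) * ‖u k t‖ₑ ^ 2 < ⊤ := by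
  have hreg := regModes_Ioi hν hu hr
  set y : Mode → C3 := fun k => u k 1 with hy
  obtain ⟨τ, hτ0, hτ1, -, hτ⟩ := exists_lifespan hν (h1Bound_ne_top ν y) one_pos
  set D := gevBound ν (h1Bound ν y) with hD
  have hDtop : D ≠ ⊤ := gevBound_ne_top ν (h1Bound_ne_top ν y)
  set l := decayRate ν ‖synth y‖ with hl
  have hl0 : 0 < l := decayRate_pos hν (norm_nonneg _)
  set A := 3 * (lipBound y * lipFactor ν ‖synth y‖) ^ 2 with hA
  have hA0 : 0 ≤ A := by positivity
  have hsub : ∀ t, Icc 1 t ⊆ Ioi (0 : ℝ) := fun t s hs => one_pos.trans_le hs.1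
  have hgrad : ∀ t, 1 ≤ t → ∑' k, ENNReal.ofReal (modeNorm k ^ 2) * ‖u k t‖ₑ ^ 2
      ≤ ENNReal.ofReal (A * Real.exp (-l * (t - 1)) ^ 2) := by
    intro t ht
    refine (hreg.gradient_decay hν isOpen_Ioi (hsub t) (right_mem_Icc.2 ht)).trans (le_of_eq ?_)
    rw [hA, mul_pow _ (Real.exp _), ← mul_assoc]
  have hfour : ∀ t, 1 + τ ≤ t → ∑' k, ENNReal.ofReal (modeNorm k ^ 4) * ‖u k t‖ₑ ^ 2
      ≤ ENNReal.ofReal (2 / τ ^ 2) * D := by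
    intro t ht
    have h1 := hreg.h1Sum_le hν isOpen_Ioi (hsub (t - τ)) (right_mem_Icc.2 (by linarith))
    have h2 := (hu t).gevrey hν (s := t - τ) (by linarith) hτ0.le hτ1 (by linarith) (hτ _ h1)
    rw [sub_add_cancel] at h2
    calc ∑' k, ENNReal.ofReal (modeNorm k ^ 4) * ‖u k t‖ₑ ^ 2
        ≤ ∑' k, ENNReal.ofReal (2 / τ ^ 2) * (wt k * (gev 1 k τ * ‖u k t‖ₑ) ^ 2) := by
          refine ENNReal.tsum_le_tsum fun k => ?_
          calc _ ≤ ENNReal.ofReal (2 / τ ^ 2) * gev 1 k τ ^ 2 * ‖u k t‖ₑ ^ 2 := by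
                gcongr
                exact pow_four_le_gev hτ0 k
            _ = ENNReal.ofReal (2 / τ ^ 2) * (1 * (gev 1 k τ * ‖u k t‖ₑ) ^ 2) := by ring
            _ ≤ _ := by
                gcongr
                exact one_le_wt k
      _ ≤ ENNReal.ofReal (2 / τ ^ 2) * D := by
          rw [ENNReal.tsum_mul_left]
          refine mul_le_mul_right (h2.trans ?_) _
          rw [hD]
          unfold gevBound
          gcongr
          refine le_trans (ENNReal.tsum_le_tsum fun k => ?_) h1
          gcongr
          exact le_self_pow (one_le_wt k) two_ne_zero
  have hcube : ∀ t, 1 + τ ≤ t → ∑' k, ENNReal.ofReal (modeNorm k ^ 3) * ‖u k t‖ₑ ^ 2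
      ≤ ENNReal.ofReal (Real.exp (-l * (t - 1))) * (ENNReal.ofReal A + ENNReal.ofReal (2 / τ ^ 2) * D) := by
    intro t ht
    set E := ENNReal.ofReal (Real.exp (-l * (t - 1))) with hE
    -- Interpolation through |k|³ = |k|·|k|²: the geometric mean of the decaying and the bounded
    -- sum.
    have h1 := tsum_mul_sq_le (fun k => ENNReal.ofReal (modeNorm k) * ‖u k t‖ₑ)
      (fun k => ENNReal.ofReal (modeNorm k ^ 2) * ‖u k t‖ₑ)
    have e1 : ∀ k, ENNReal.ofReal (modeNorm k) * ‖u k t‖ₑ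
        * (ENNReal.ofReal (modeNorm k ^ 2) * ‖u k t‖ₑ)
        = ENNReal.ofReal (modeNorm k ^ 3) * ‖u k t‖ₑ ^ 2 := fun k => by
      rw [pow_succ' (modeNorm k) 2, ENNReal.ofReal_mul (modeNorm_nonneg k)]
      ring
    have e2 : ∀ k, (ENNReal.ofReal (modeNorm k) * ‖u k t‖ₑ) ^ 2
        = ENNReal.ofReal (modeNorm k ^ 2) * ‖u k t‖ₑ ^ 2 := fun k => by
      rw [mul_pow, ENNReal.ofReal_pow (modeNorm_nonneg k)]
    have e3 : ∀ k, (ENNReal.ofReal (modeNorm k ^ 2) * ‖u k t‖ₑ) ^ 2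
        = ENNReal.ofReal (modeNorm k ^ 4) * ‖u k t‖ₑ ^ 2 := fun k => by
      rw [mul_pow, ← ENNReal.ofReal_pow (sq_nonneg _), ← pow_mul]
    simp only [e1, e2, e3] at h1
    have h2 : (∑' k, ENNReal.ofReal (modeNorm k ^ 3) * ‖u k t‖ₑ ^ 2) ^ 2
        ≤ (E * (ENNReal.ofReal A + ENNReal.ofReal (2 / τ ^ 2) * D)) ^ 2 := by
      calc _ ≤ ENNReal.ofReal (A * Real.exp (-l * (t - 1)) ^ 2) * (ENNReal.ofReal (2 / τ ^ 2) * D) :=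
            h1.trans (mul_le_mul' (hgrad t (by linarith)) (hfour t ht))
        _ = E ^ 2 * (ENNReal.ofReal A * (ENNReal.ofReal (2 / τ ^ 2) * D)) := by
            rw [ENNReal.ofReal_mul hA0, ENNReal.ofReal_pow (Real.exp_pos _).le, ← hE]
            ring
        _ ≤ E ^ 2 * ((ENNReal.ofReal A + ENNReal.ofReal (2 / τ ^ 2) * D)
              * (ENNReal.ofReal A + ENNReal.ofReal (2 / τ ^ 2) * D)) := by
            gcongr
            · exact le_self_add
            · exact le_add_self
        _ = _ := by ring
    exact (ENNReal.pow_right_strictMono two_ne_zero).le_iff_le.1 h2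
  have hsplit : Ioi (0 : ℝ) = Ioc 0 (1 + τ) ∪ Ioi (1 + τ) :=
    (Ioc_union_Ioi_eq_Ioi (by linarith)).symm
  rw [hsplit]
  refine (lintegral_union_le _ _ _).trans_lt (ENNReal.add_lt_top.2 ⟨?_, ?_⟩)
  · have h1 := (hu (1 + τ)).hNorm_ne_top hν
    refine lt_of_le_of_lt ?_ (lt_top_iff_ne_top.2 h1)
    rw [lintegral_tsum fun k => ?_, hNorm]
    · refine ENNReal.tsum_le_tsum fun k => ?_
      rw [lintegral_const_mul' _ _ ENNReal.ofReal_ne_top]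
      simp only [gev_zero_left, one_mul]
      gcongr
      rw [wt, ← ENNReal.ofReal_pow (bracket_pos k).le]
      have := modeNorm_nonneg k
      have := modeNorm_le_bracket k
      exact ENNReal.ofReal_le_ofReal (by gcongr)
    · exact (((hu (1 + τ)).meas k).enorm.pow_const 2).const_mul _
  · refine lt_of_le_of_lt (setLIntegral_mono' measurableSet_Ioi fun t ht => hcube t (le_of_lt ht)) ?_
    rw [lintegral_mul_const' _ _ (by finiteness)]
    refine ENNReal.mul_lt_top ?_ (by finiteness)
    have h1 : IntegrableOn (fun t => Real.exp (-l * (t - 1))) (Ioi (1 + τ)) := by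
      have h2 := (integrableOn_exp_mul_Ioi (neg_lt_zero.2 hl0) (1 + τ)).const_mul (Real.exp l)
      refine IntegrableOn.congr_fun h2 (fun t _ => ?_) measurableSet_Ioi
      rw [← Real.exp_add]
      ring_nf
    exact (hasFiniteIntegral_iff_ofReal (Eventually.of_forall fun t => (Real.exp_pos _).le)).1 h1.2

/-! ### Integration by parts on the torus -/

lemma continuous_of_continuous_lift {F : Torus → E3} (h : Continuous (lift F)) : Continuous F := by
  have h1 : IsOpenMap (fun y : Fin 3 → ℝ => fun i => ((y i : ℝ) : AddCircle (2 * Real.pi))) :=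
    IsOpenMap.piMap (fun _ => QuotientAddGroup.isOpenMap_coe) (by simp)
  have h2 : IsOpenMap proj :=
    h1.comp (PiLp.homeomorph 2 fun _ : Fin 3 => ℝ).isOpenMap
  exact (IsOpenQuotientMap.mk proj_surjective continuous_proj h2).isQuotientMap.continuous_iff.2 h

lemma hasDerivAt_add_single {F : Torus → E3} (hF : Differentiable ℝ (lift F)) (j : Fin 3)
    (p : Torus) (r : ℝ) :
    HasDerivAt (fun h : ℝ => F (p + Pi.single j (h : AddCircle (2 * Real.pi))))
      (partialDeriv j F (p + Pi.single j (r : AddCircle (2 * Real.pi)))) r := by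
  obtain ⟨y, rfl⟩ := proj_surjective p
  have h1 : HasDerivAt (fun h : ℝ => y + h • EuclideanSpace.single j (1 : ℝ))
      (EuclideanSpace.single j (1 : ℝ)) r := by
    simpa using ((hasDerivAt_id r).smul_const (EuclideanSpace.single j (1 : ℝ))).const_add y
  have h2 := (hF _).hasFDerivAt.comp_hasDerivAt r h1
  rw [← partialDeriv_proj hF, proj_add_smul_single] at h2
  simp only [← proj_add_smul_single] at h2 ⊢
  exact h2

lemma continuous_partialDeriv {F : Torus → E3} (hF : ContDiff ℝ 1 (lift F)) (j : Fin 3) :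
    Continuous (partialDeriv j F) := by
  refine continuous_of_continuous_lift ?_
  have h1 : lift (partialDeriv j F) = fun y => fderiv ℝ (lift F) y (EuclideanSpace.single j 1) :=
    funext fun y => partialDeriv_proj (hF.differentiable (by norm_num)) j y
  rw [h1]
  exact (hF.continuous_fderiv (by norm_num)).clm_apply continuous_const

lemma integrable_of_continuous {E : Type*} [NormedAddCommGroup E] {G : Torus → E}
    (hG : Continuous G) : Integrable G :=
  hG.integrable_of_hasCompactSupport (HasCompactSupport.of_compactSpace G)

/-- The integral of a translate of `G` does not depend on the translation; differentiate it under
the integral sign. -/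
lemma integral_eq_zero_of_hasDerivAt_single {G G' : Torus → ℝ} (hG : Continuous G)
    (hG' : Continuous G') (j : Fin 3)
    (h : ∀ (p : Torus) (r : ℝ), HasDerivAt (fun h : ℝ => G (p + Pi.single j (h : AddCircle (2 * Real.pi))))
      (G' (p + Pi.single j (r : AddCircle (2 * Real.pi)))) r) : ∫ p, G' p = 0 := by
  obtain ⟨C, hC⟩ := isCompact_univ.exists_bound_of_continuousOn hG'.continuousOn
  have hs : ∀ r : ℝ, Continuous fun p : Torus => p + Pi.single j (r : AddCircle (2 * Real.pi)) :=
    fun r => continuous_id.add continuous_const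
  let F : ℝ → Torus → ℝ := fun r p => G (p + Pi.single j (r : AddCircle (2 * Real.pi)))
  let F' : ℝ → Torus → ℝ := fun r p => G' (p + Pi.single j (r : AddCircle (2 * Real.pi)))
  have cF : ∀ r, Continuous (F r) := fun r => hG.comp (hs r)
  have cF' : ∀ r, Continuous (F' r) := fun r => hG'.comp (hs r)
  have h1 : HasDerivAt (fun r => ∫ p, F r p) (∫ p, F' 0 p) 0 :=
    (hasDerivAt_integral_of_dominated_loc_of_deriv_le (μ := (volume : Measure Torus))
      (s := univ) (bound := fun _ => C) univ_mem
      (Eventually.of_forall fun r => (cF r).aestronglyMeasurable)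
      (integrable_of_continuous (cF 0)) (cF' 0).aestronglyMeasurable
      (Eventually.of_forall fun p r _ => hC _ (mem_univ _)) (integrable_const C)
      (Eventually.of_forall fun p r _ => h p r)).2
  have e1 : ∀ r, ∫ p, F r p = ∫ p, G p := fun r => integral_add_right_eq_self G _
  have e2 : ∫ p, F' 0 p = ∫ p, G' p := integral_add_right_eq_self G' _
  simp only [e1, e2] at h1
  exact ((hasDerivAt_const (0 : ℝ) (∫ p, G p)).unique h1).symm

lemma integral_inner_partialDeriv {F G : Torus → E3} (hF : ContDiff ℝ 1 (lift F))
    (hG : ContDiff ℝ 1 (lift G)) (j : Fin 3) :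
    ∫ p, inner ℝ (F p) (partialDeriv j G p) = -∫ p, inner ℝ (partialDeriv j F p) (G p) := by
  have cF := continuous_of_continuous_lift hF.continuous
  have cG := continuous_of_continuous_lift hG.continuous
  have cF' := continuous_partialDeriv hF j
  have cG' := continuous_partialDeriv hG j
  have h1 := integral_eq_zero_of_hasDerivAt_single (G := fun p => inner ℝ (F p) (G p))
    (G' := fun p => inner ℝ (F p) (partialDeriv j G p) + inner ℝ (partialDeriv j F p) (G p))
    (cF.inner cG) ((cF.inner cG').add (cF'.inner cG)) j fun p r =>
      (hasDerivAt_add_single (hF.differentiable (by norm_num)) j p r).inner ℝ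
        (hasDerivAt_add_single (hG.differentiable (by norm_num)) j p r)
  rw [integral_add (integrable_of_continuous (cF.inner cG'))
    (integrable_of_continuous (cF'.inner cG))] at h1
  linarith

lemma contDiff_one_lift_synth {x : Mode → C3} (hx : ∀ n, Summable fun k => modeNorm k ^ n * ‖x k‖) :
    ContDiff ℝ 1 (lift (synth x)) := by
  exact_mod_cast contDiff_infty.1 (contDiff_lift_synth hx) 1

lemma integral_inner_synthLp (x : Mode → C3) (φ : Torus → E3) :
    ∫ p, inner ℝ (synthLp x p) (φ p) = ∫ p, inner ℝ (synth x p) (φ p) := by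
  refine integral_congr_ae ?_
  filter_upwards [coeFn_synthLp x] with p hp
  rw [hp]

lemma hasWeakPartial_synthLp {x : Mode → C3} (hx : ∀ n, Summable fun k => modeNorm k ^ n * ‖x k‖)
    (j : Fin 3) : HasWeakPartial j (synthLp x) (synthLp (derivSeq j x)) := by
  intro φ hφ
  have hφ1 : ContDiff ℝ 1 (lift φ) := by exact_mod_cast contDiff_infty.1 hφ 1
  rw [integral_inner_synthLp, integral_inner_synthLp,
    integral_inner_partialDeriv (contDiff_one_lift_synth hx) hφ1, partialDeriv_synth hx]

/-! ### Pairing with a single mode -/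

lemma isSmooth_reMode (k : Mode) (c : C3) : IsSmooth (reMode k c) := contDiff_reMode_proj k c

lemma partialDeriv_reMode (j : Fin 3) (k : Mode) (c : C3) :
    partialDeriv j (reMode k c) = reMode k ((Complex.I * (k j : ℂ)) • c) := by
  funext p
  have := (hasDerivAt_reMode_add_single k (fun _ => c) j p 0).deriv
  simpa [partialDeriv, derivSeq] using this

lemma integral_inner_reMode {g : Torus → E3} (hg : Integrable g) (k : Mode) (c : C3) :
    ∫ p, inner ℝ (g p) (reMode k c p)
      = (∑ i, c i * ∫ p, expMode k p * ((g p i : ℝ) : ℂ)).re := by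
  have hi : ∀ i, Integrable fun p => expMode k p * ((g p i : ℝ) : ℂ) := fun i =>
    (((EuclideanSpace.proj (𝕜 := ℝ) i).integrable_comp hg).ofReal (𝕜 := ℂ)).bdd_mul (c := 1)
      (continuous_expMode k).aestronglyMeasurable
      (Eventually.of_forall fun x => (norm_expMode k x).le)
  have h1 : ∀ p, inner ℝ (g p) (reMode k c p)
      = (∑ i, c i * (expMode k p * ((g p i : ℝ) : ℂ))).re := by
    intro p
    rw [PiLp.inner_apply, Complex.re_sum]
    refine Finset.sum_congr rfl fun i _ => ?_
    rw [reMode_apply, ← mul_assoc, Complex.re_mul_ofReal]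
    simp
  simp only [h1]
  have h2 : Integrable fun p => ∑ i, c i * (expMode k p * ((g p i : ℝ) : ℂ)) :=
    integrable_finsetSum _ fun i _ => (hi i).const_mul _
  have h3 := integral_re h2
  simp only [RCLike.re_eq_complex_re] at h3
  rw [h3, integral_finsetSum _ fun i _ => (hi i).const_mul _]
  simp only [integral_const_mul]

lemma integral_expMode_mul (f : L2Field) (k : Mode) (i : Fin 3) :
    ∫ p, expMode k p * ((f p i : ℝ) : ℂ)
      = (((2 * Real.pi) ^ 3 : ℝ) : ℂ) * conj (fourierCoef f k i) := by
  have h1 := isRealSeq_fourierCoef f k i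
  have h2 : (((2 * Real.pi) ^ 3 : ℝ) : ℂ) ≠ 0 := by
    exact_mod_cast (pow_pos Real.two_pi_pos 3).ne'
  rw [← h1, fourierCoef]
  simp only [neg_neg]
  rw [mul_inv_cancel_left₀ h2]

lemma integral_inner_reMode_L2 (f : L2Field) (k : Mode) (c : C3) :
    ∫ p, inner ℝ (f p) (reMode k c p)
      = (2 * Real.pi) ^ 3 * (inner ℂ (fourierCoef f k) c).re := by
  rw [integral_inner_reMode ((Lp.memLp f).integrable (by norm_num)), PiLp.inner_apply,
    ← Complex.re_ofReal_mul, Finset.mul_sum]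
  congr 1
  refine Finset.sum_congr rfl fun i _ => ?_
  rw [integral_expMode_mul, RCLike.inner_apply]
  ring

lemma hasSum_inner_synthLp {x : Mode → C3} (hx : Summable fun k => ‖x k‖) (f : L2Field) :
    HasSum (fun k => (2 * Real.pi) ^ 3 * (inner ℂ (fourierCoef f k) (x k)).re)
      (inner ℝ f (synthLp x)) := by
  have h1 := (innerSL ℝ f).hasSum
    ((ContinuousMap.toLp (E := E3) 2 (volume : Measure Torus) ℝ).hasSum (summable_reMode hx).hasSum)
  refine h1.congr_fun fun k => ?_
  rw [← integral_inner_reMode_L2, innerSL_apply_apply, L2.inner_def]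
  refine integral_congr_ae ?_
  filter_upwards [ContinuousMap.coeFn_toLp (p := 2) (𝕜 := ℝ) (volume : Measure Torus)
    (reMode k (x k))] with p hp
  rw [hp]

lemma enorm_inner_synthLp_le {x : Mode → C3} (hx : Summable fun k => ‖x k‖) (f : L2Field) :
    ‖inner ℝ (synthLp x) f‖ₑ ^ 2 ≤ ENNReal.ofReal ((2 * Real.pi) ^ 3) ^ 2 *
      ((∑' k, (wt k)⁻¹ * ‖x k‖ₑ ^ 2) * ∑' k, wt k * ‖fourierCoef f k‖ₑ ^ 2) := by
  have h0 : (0 : ℝ) ≤ (2 * Real.pi) ^ 3 := by positivity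
  have hw : ∀ k, (wt k ^ (1 / 2 : ℝ)) ^ 2 = wt k := fun k => by
    rw [← ENNReal.rpow_natCast, ← ENNReal.rpow_mul]
    norm_num
  have hw' : ∀ k, wt k ^ (-(1 / 2) : ℝ) * wt k ^ (1 / 2 : ℝ) = 1 := fun k => by
    rw [← ENNReal.rpow_add _ _ (wt_ne_zero k) (wt_ne_top k)]
    norm_num
  have hw'' : ∀ k, (wt k ^ (-(1 / 2) : ℝ)) ^ 2 = (wt k)⁻¹ := fun k => by
    rw [← ENNReal.rpow_natCast, ← ENNReal.rpow_mul, ← ENNReal.rpow_neg_one]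
    norm_num
  have h1 : ‖inner ℝ (synthLp x) f‖ₑ ≤ ENNReal.ofReal ((2 * Real.pi) ^ 3) *
      ∑' k, (wt k ^ (-(1 / 2) : ℝ) * ‖x k‖ₑ) * (wt k ^ (1 / 2 : ℝ) * ‖fourierCoef f k‖ₑ) := by
    rw [real_inner_comm, ← (hasSum_inner_synthLp hx f).tsum_eq, ← ENNReal.tsum_mul_left]
    refine enorm_tsum_le_tsum_enorm.trans (ENNReal.tsum_le_tsum fun k => ?_)
    rw [mul_mul_mul_comm, hw', one_mul, enorm_mul, Real.enorm_of_nonneg h0]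
    gcongr
    rw [← ofReal_norm, ← ofReal_norm, ← ofReal_norm, ← ENNReal.ofReal_mul (norm_nonneg _)]
    refine ENNReal.ofReal_le_ofReal ?_
    rw [mul_comm]
    exact (Complex.abs_re_le_norm _).trans (norm_inner_le_norm _ _)
  calc ‖inner ℝ (synthLp x) f‖ₑ ^ 2 ≤ _ := pow_le_pow_left' h1 2
    _ ≤ _ := by
      rw [mul_pow]
      gcongr
      refine (tsum_mul_sq_le _ _).trans (le_of_eq ?_)
      simp only [mul_pow, hw, hw'']

/-! ### Sobolev spaces -/

lemma lp_enorm_sq (x : lp (fun _ : Mode => C3) 2) : ‖x‖ₑ ^ 2 = ∑' k, ‖x k‖ₑ ^ 2 := by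
  have h := lp.norm_rpow_eq_tsum (p := 2) (by norm_num) x
  have hs := (lp.memℓp x).summable (by norm_num)
  simp only [ENNReal.toReal_ofNat, Real.rpow_two] at h hs
  rw [← ofReal_norm, ← ENNReal.ofReal_pow (norm_nonneg _), h,
    ENNReal.ofReal_tsum_of_nonneg (fun _ => sq_nonneg _) hs]
  refine tsum_congr fun k => ?_
  rw [ENNReal.ofReal_pow (norm_nonneg _), ofReal_norm]

lemma memℓp_two_of_tsum {x : Mode → C3} (h : ∑' k, ‖x k‖ₑ ^ 2 ≠ ⊤) : Memℓp x 2 := by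
  rw [memℓp_gen_iff (by norm_num)]
  have h1 : ∑' k, ((‖x k‖₊ ^ 2 : NNReal) : ℝ≥0∞) ≠ ⊤ := by
    simpa [enorm_eq_nnnorm] using h
  have h2 := NNReal.summable_coe.2 (ENNReal.tsum_coe_ne_top_iff_summable.1 h1)
  simpa using h2

lemma seminormSq_eq {s : ℝ} {n : ℕ} (hs : s = n / 2) (f : L2Field) :
    seminormSq s f = ∑' k, ENNReal.ofReal (modeNorm k ^ n) * ‖fourierCoef f k‖ₑ ^ 2 := by
  refine tsum_congr fun k => ?_
  have h0 := modeNorm_nonneg k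
  have h1 : (modeNorm k ^ s) ^ 2 = modeNorm k ^ n := by
    rw [← Real.rpow_natCast (modeNorm k ^ s), ← Real.rpow_mul h0, ← Real.rpow_natCast, hs]
    congr 1
    push_cast
    ring
  rw [lambdaCoef, enorm_smul, mul_pow, Real.enorm_of_nonneg (Real.rpow_nonneg h0 s),
    ← ENNReal.ofReal_pow (Real.rpow_nonneg h0 s), h1]

namespace Sobolev

lemma enorm_sq {s : ℝ} (f : Sobolev s) : ‖f‖ₑ ^ 2 = ‖toL2 f‖ₑ ^ 2 + seminormSq s (toL2 f) := by
  set w : lp (fun _ : Mode => C3) 2 := ⟨lambdaCoef s (toL2 f), f.2⟩ with hw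
  have h0 : ‖f‖ = ‖WithLp.toLp 2 (toL2 f, w)‖ := rfl
  have h1 : ‖f‖ ^ 2 = ‖toL2 f‖ ^ 2 + ‖w‖ ^ 2 := by
    rw [h0, WithLp.prod_norm_sq_eq_of_L2]
    rfl
  have h2 : seminormSq s (toL2 f) = ‖w‖ₑ ^ 2 := (lp_enorm_sq w).symm
  rw [h2, ← ofReal_norm, ← ofReal_norm, ← ofReal_norm, ← ENNReal.ofReal_pow (norm_nonneg _),
    ← ENNReal.ofReal_pow (norm_nonneg _), ← ENNReal.ofReal_pow (norm_nonneg _),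
    ← ENNReal.ofReal_add (sq_nonneg _) (sq_nonneg _), h1]

lemma enorm_sq_le {s : ℝ} {n : ℕ} (hs : s = n / 2) (f : Sobolev s) :
    ‖f‖ₑ ^ 2 ≤ ENNReal.ofReal ((2 * Real.pi) ^ 3 + 1) * ∑' k, wt k ^ n * ‖fourierCoef (toL2 f) k‖ₑ ^ 2 := by
  rw [enorm_sq, parseval, seminormSq_eq hs, ENNReal.ofReal_add (by positivity) zero_le_one,
    ENNReal.ofReal_one, add_mul, one_mul]
  gcongr with k k
  · exact le_mul_of_one_le_left zero_le (one_le_pow₀ (one_le_wt k))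
  · rw [wt, ← ENNReal.ofReal_pow (bracket_pos k).le]
    exact ENNReal.ofReal_le_ofReal
      (pow_le_pow_left₀ (modeNorm_nonneg k) (modeNorm_le_bracket k) n)

lemma tsum_wt_le {s : ℝ} {n : ℕ} (hs : s = n / 2) (f : Sobolev s) :
    ∑' k, wt k ^ n * ‖fourierCoef (toL2 f) k‖ₑ ^ 2 ≤ 2 ^ (n - 1) * ‖f‖ₑ ^ 2 := by
  have hπ : 1 ≤ ENNReal.ofReal ((2 * Real.pi) ^ 3) := by
    rw [ENNReal.one_le_ofReal]
    exact one_le_pow₀ (by linarith [Real.pi_gt_three])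
  rw [enorm_sq, parseval, seminormSq_eq hs]
  calc ∑' k, wt k ^ n * ‖fourierCoef (toL2 f) k‖ₑ ^ 2
      ≤ ∑' k, 2 ^ (n - 1) * (‖fourierCoef (toL2 f) k‖ₑ ^ 2
          + ENNReal.ofReal (modeNorm k ^ n) * ‖fourierCoef (toL2 f) k‖ₑ ^ 2) := by
        refine ENNReal.tsum_le_tsum fun k => ?_
        have h0 := modeNorm_nonneg k
        have h1 : wt k ^ n ≤ 2 ^ (n - 1) * (1 + ENNReal.ofReal (modeNorm k ^ n)) := by
          have h2 : bracket k ^ n ≤ 2 ^ (n - 1) * (1 ^ n + modeNorm k ^ n) :=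
            (pow_le_pow_left₀ (bracket_pos k).le (bracket_le k) n).trans
              (add_pow_le zero_le_one h0 n)
          rw [wt, ← ENNReal.ofReal_pow (bracket_pos k).le]
          refine (ENNReal.ofReal_le_ofReal h2).trans (le_of_eq ?_)
          rw [ENNReal.ofReal_mul (by positivity), one_pow,
            ENNReal.ofReal_add zero_le_one (by positivity), ENNReal.ofReal_one,
            ENNReal.ofReal_pow (by norm_num), ENNReal.ofReal_ofNat]
        calc _ ≤ 2 ^ (n - 1) * (1 + ENNReal.ofReal (modeNorm k ^ n)) * ‖fourierCoef (toL2 f) k‖ₑ ^ 2 := by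
              gcongr
          _ = _ := by ring
    _ = 2 ^ (n - 1) * (1 * ∑' k, ‖fourierCoef (toL2 f) k‖ₑ ^ 2
          + ∑' k, ENNReal.ofReal (modeNorm k ^ n) * ‖fourierCoef (toL2 f) k‖ₑ ^ 2) := by
        rw [ENNReal.tsum_mul_left, ENNReal.tsum_add, one_mul]
    _ ≤ _ := by gcongr

lemma mem_sobolevSubmodule {s : ℝ} {f : L2Field} (h : seminormSq s f ≠ ⊤) :
    f ∈ sobolevSubmodule s := memℓp_two_of_tsum h

/-- An element of `L²` as an element of `Hˢ`, when it has finite norm. -/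
def ofL2 (s : ℝ) (f : L2Field) : Sobolev s :=
  open Classical in if h : seminormSq s f ≠ ⊤ then
    (⟨f, mem_sobolevSubmodule h⟩ : ↥(sobolevSubmodule s)) else 0

lemma toL2_ofL2 {s : ℝ} {f : L2Field} (h : seminormSq s f ≠ ⊤) : toL2 (ofL2 s f) = f := by
  have h1 : ofL2 s f = (⟨f, mem_sobolevSubmodule h⟩ : ↥(sobolevSubmodule s)) := dif_pos h
  rw [h1]
  rfl

lemma toL2_injective {s : ℝ} : Function.Injective (toL2 : Sobolev s → L2Field) :=
  Subtype.val_injective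

/-- The inclusion of `Hˢ` in `L²` as a continuous linear map. -/
def toL2CLM (s : ℝ) : Sobolev s →L[ℝ] L2Field :=
  LinearMap.mkContinuous toL2 1 fun f => by
    rw [one_mul, ← enorm_le_iff_norm_le]
    refine (ENNReal.pow_right_strictMono two_ne_zero).le_iff_le.1 ?_
    change ‖toL2 f‖ₑ ^ 2 ≤ ‖f‖ₑ ^ 2
    rw [enorm_sq f]
    exact le_self_add

/-- Continuity of each mode and a common majorant in the weighted ℓ² space give continuity in norm
by dominated convergence. A time-uniform majorant is exactly what the supremum inside `sNorm`
provides. -/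
lemma continuousOn_of_modes {s : ℝ} {n : ℕ} (hs : s = n / 2) {v : ℝ → Sobolev s}
    {u : Mode → ℝ → C3} {S : Set ℝ} (hv : ∀ t ∈ S, fourierCoef (toL2 (v t)) = fun k => u k t)
    {M : Mode → ℝ≥0∞} (hM : ∑' k, wt k ^ n * M k ^ 2 ≠ ⊤) (hb : ∀ t ∈ S, ∀ k, ‖u k t‖ₑ ≤ M k)
    (hc : ∀ k, ContinuousOn (u k) S) : ContinuousOn v S := by
  intro t ht
  have h1 : Tendsto (fun τ => ∑' k, wt k ^ n * ‖u k τ - u k t‖ₑ ^ 2) (𝓝[S] t) (𝓝 0) := by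
    refine tendsto_tsum_zero (fun k => wt k ^ n * (2 * M k) ^ 2) ?_ ?_ fun k => ?_
    · simp only [mul_pow, mul_left_comm _ ((2 : ℝ≥0∞) ^ 2)]
      rw [ENNReal.tsum_mul_left]
      finiteness
    · filter_upwards [self_mem_nhdsWithin] with τ hτ k
      gcongr
      rw [two_mul]
      exact enorm_sub_le.trans (add_le_add (hb τ hτ k) (hb t ht k))
    · have h2 : Tendsto (fun τ => u k τ - u k t) (𝓝[S] t) (𝓝 (u k t - u k t)) :=
        (hc k t ht).sub tendsto_const_nhds
      rw [sub_self] at h2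
      have h3 := ENNReal.Tendsto.pow (n := 2) h2.enorm
      rw [enorm_zero] at h3
      have h4 := ENNReal.Tendsto.const_mul (a := wt k ^ n) h3
        (Or.inr (ENNReal.pow_ne_top (wt_ne_top k)))
      simpa using h4
  have h2 : Tendsto (fun τ => ‖v τ - v t‖ₑ ^ 2) (𝓝[S] t) (𝓝 0) := by
    have h3 := ENNReal.Tendsto.const_mul (a := ENNReal.ofReal ((2 * Real.pi) ^ 3 + 1)) h1
      (Or.inr ENNReal.ofReal_ne_top)
    rw [mul_zero] at h3
    refine tendsto_of_tendsto_of_tendsto_of_le_of_le' tendsto_const_nhds h3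
      (Eventually.of_forall fun _ => zero_le) ?_
    filter_upwards [self_mem_nhdsWithin] with τ hτ
    refine (enorm_sq_le hs _).trans (le_of_eq ?_)
    congr 2
    funext k
    have h4 := fourierCoef_add (toL2 (v τ - v t)) (toL2 (v t)) k
    rw [← map_add, sub_add_cancel, hv τ hτ, hv t ht] at h4
    simp only at h4
    rw [h4, add_sub_cancel_right]
  rw [ContinuousWithinAt, tendsto_iff_edist_tendsto_0]
  have h3 := ((ENNReal.continuous_rpow_const (y := 1 / 2)).tendsto 0).comp h2
  rw [ENNReal.zero_rpow_of_pos (by norm_num)] at h3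
  refine h3.congr fun τ => ?_
  rw [Function.comp_apply, edist_eq_enorm_sub, ← ENNReal.rpow_natCast, ← ENNReal.rpow_mul]
  norm_num

end Sobolev

/-! ### Mild solutions are strong solutions -/

lemma tsum_wt_exp_ne_top (n : ℕ) (B : ℝ) {c : ℝ} (hc : 0 < c) :
    ∑' k, wt k ^ n * ENNReal.ofReal (B * Real.exp (-c * modeNorm k)) ^ 2 ≠ ⊤ := by
  have h1 : Summable fun k => 2 ^ (n - 1) * B ^ 2 *
      (Real.exp (-(2 * c) * modeNorm k) + modeNorm k ^ n * Real.exp (-(2 * c) * modeNorm k)) :=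
    ((by simpa using summable_pow_mul_exp (by linarith : 0 < 2 * c) 0 :
      Summable fun k => Real.exp (-(2 * c) * modeNorm k)).add
      (summable_pow_mul_exp (by linarith : 0 < 2 * c) n)).mul_left _
  have h0 : ∀ k, 0 ≤ 2 ^ (n - 1) * B ^ 2 *
      (Real.exp (-(2 * c) * modeNorm k) + modeNorm k ^ n * Real.exp (-(2 * c) * modeNorm k)) := by
    intro k
    have := modeNorm_nonneg k
    positivity
  refine ne_top_of_le_ne_top (ENNReal.ofReal_ne_top (r := ∑' k, _))
    ((ENNReal.tsum_le_tsum fun k => ?_).trans (ENNReal.ofReal_tsum_of_nonneg h0 h1).ge)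
  have hm := modeNorm_nonneg k
  rcases le_or_gt B 0 with hB | hB
  · rw [ENNReal.ofReal_eq_zero.2 (mul_nonpos_of_nonpos_of_nonneg hB (Real.exp_pos _).le)]
    simp
  rw [wt, ← ENNReal.ofReal_pow (bracket_pos k).le, ← ENNReal.ofReal_pow (by positivity),
    ← ENNReal.ofReal_mul (pow_nonneg (bracket_pos k).le n)]
  refine ENNReal.ofReal_le_ofReal ?_
  have h2 : bracket k ^ n ≤ 2 ^ (n - 1) * (1 ^ n + modeNorm k ^ n) :=
    (pow_le_pow_left₀ (bracket_pos k).le (bracket_le k) n).trans (add_pow_le zero_le_one hm n)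
  have h3 : (B * Real.exp (-c * modeNorm k)) ^ 2 = B ^ 2 * Real.exp (-(2 * c) * modeNorm k) := by
    rw [mul_pow, ← Real.exp_nat_mul]
    congr 2
    push_cast
    ring
  rw [h3]
  calc _ ≤ 2 ^ (n - 1) * (1 ^ n + modeNorm k ^ n) * (B ^ 2 * Real.exp (-(2 * c) * modeNorm k)) := by
        gcongr
    _ = _ := by rw [one_pow]; ring

lemma ExpDecay.enorm_le {B c : ℝ} {x : Mode → C3} (h : ExpDecay B c x) (k : Mode) :
    ‖x k‖ₑ ≤ ENNReal.ofReal (B * Real.exp (-c * modeNorm k)) := by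
  rw [← ofReal_norm]
  exact ENNReal.ofReal_le_ofReal (h k)

lemma ExpDecay.seminormSq_ne_top {B c : ℝ} (hc : 0 < c) {x : Mode → C3} (h : ExpDecay B c x)
    (hr : IsRealSeq x) {s : ℝ} {n : ℕ} (hs : s = n / 2) : seminormSq s (synthLp x) ≠ ⊤ := by
  rw [seminormSq_eq hs, fourierCoef_synthLp (h.summable_norm hc) hr]
  refine ne_top_of_le_ne_top (tsum_wt_exp_ne_top n B hc) (ENNReal.tsum_le_tsum fun k => ?_)
  gcongr
  · rw [wt, ← ENNReal.ofReal_pow (bracket_pos k).le]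
    exact ENNReal.ofReal_le_ofReal
      (pow_le_pow_left₀ (modeNorm_nonneg k) (modeNorm_le_bracket k) n)
  · exact h.enorm_le k

/-- The curve in `H^{1/2}` with given initial value and Fourier coefficients. -/
def curve (u₀ : Sobolev (1 / 2)) (u : Mode → ℝ → C3) (t : ℝ) : Sobolev (1 / 2) :=
  -- The series for an H^{1/2} datum need not converge absolutely, so `synth` is used at positive
  -- times only.
  if 0 < t then Sobolev.ofL2 (1 / 2) (synthLp fun k => u k t) else u₀

/-- Since ψ vanishes near the endpoints, ψf is differentiable on the whole line with compact
support, whatever `f` does outside (0, T). -/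
lemma integral_deriv_mul_eq {T : ℝ} {f f' : ℝ → ℝ} (hf : ∀ t ∈ Ioo 0 T, HasDerivAt f (f' t) t)
    (hf' : ContinuousOn f' (Ioo 0 T)) {ψ : ℝ → ℝ} (hψ : ContDiff ℝ ∞ ψ) (hc : HasCompactSupport ψ)
    (hs : tsupport ψ ⊆ Ioo 0 T) :
    ∫ t in Ioo 0 T, deriv ψ t * f t = -∫ t in Ioo 0 T, ψ t * f' t := by
  have hψ' : Continuous (deriv ψ) := hψ.continuous_deriv (by simp)
  have hout : ∀ t ∉ tsupport ψ, ψ =ᶠ[𝓝 t] 0 := fun t ht => notMem_tsupport_iff_eventuallyEq.1 ht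
  have hs' : tsupport (deriv ψ) ⊆ tsupport ψ := tsupport_deriv_subset
  have hd : ∀ t, HasDerivAt (fun t => ψ t * f t) (deriv ψ t * f t + ψ t * f' t) t := by
    intro t
    by_cases ht : t ∈ tsupport ψ
    · exact ((hψ.differentiable (by simp)) t).hasDerivAt.mul (hf t (hs ht))
    · have h1 : (fun t => ψ t * f t) =ᶠ[𝓝 t] fun _ => 0 := by
        filter_upwards [hout t ht] with r hr
        rw [hr]
        simp
      have h2 : deriv ψ t = 0 := by
        rw [(hout t ht).deriv_eq]
        simp
      rw [h2, (hout t ht).self_of_nhds]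
      simpa using (hasDerivAt_const t (0 : ℝ)).congr_of_eventuallyEq h1
  have c1 : Continuous fun t => deriv ψ t * f t := by
    refine continuous_of_tsupport fun t ht => ?_
    have ht1 : t ∈ tsupport ψ := hs' (tsupport_mul_subset_left ht)
    exact hψ'.continuousAt.mul (hf t (hs ht1)).continuousAt
  have c2 : Continuous fun t => ψ t * f' t := by
    refine continuous_of_tsupport fun t ht => ?_
    have ht1 : t ∈ tsupport ψ := tsupport_mul_subset_left ht
    exact hψ.continuous.continuousAt.mul (hf'.continuousAt (isOpen_Ioo.mem_nhds (hs ht1)))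
  have c3 : Continuous fun t => ψ t * f t := continuous_iff_continuousAt.2 fun t => (hd t).continuousAt
  have i1 : Integrable fun t => deriv ψ t * f t :=
    c1.integrable_of_hasCompactSupport hc.deriv.mul_right
  have i2 : Integrable fun t => ψ t * f' t := c2.integrable_of_hasCompactSupport hc.mul_right
  have i3 : Integrable fun t => ψ t * f t := c3.integrable_of_hasCompactSupport hc.mul_right
  have h1 := integral_eq_zero_of_hasDerivAt_of_integrable hd (i1.add i2) i3
  have h2 : ∫ t, (deriv ψ t * f t + ψ t * f' t) = 0 := h1
  rw [integral_add i1 i2] at h2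
  have hz : ∀ t ∉ Ioo 0 T, ψ t = 0 := fun t ht => image_eq_zero_of_notMem_tsupport fun h => ht (hs h)
  have hz' : ∀ t ∉ Ioo 0 T, deriv ψ t = 0 := fun t ht =>
    image_eq_zero_of_notMem_tsupport fun h => ht (hs (hs' h))
  rw [setIntegral_eq_integral_of_forall_compl_eq_zero (fun t ht => by rw [hz' t ht, zero_mul]),
    setIntegral_eq_integral_of_forall_compl_eq_zero (fun t ht => by rw [hz t ht, zero_mul])]
  linarith

section

variable {ν : ℝ} {u₀ : Sobolev (1 / 2)} {u : Mode → ℝ → C3}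

lemma toL2_curve_of_regModes (h : RegModes ν (Ioi 0) u) {t : ℝ} (ht : 0 < t) :
    (curve u₀ u t).toL2 = synthLp fun k => u k t := by
  obtain ⟨B, c, hc, hB⟩ := h.decay t ht
  rw [curve, if_pos ht, Sobolev.toL2_ofL2
    (hB.self_of_nhds.seminormSq_ne_top hc (h.real t ht) (n := 1) (by norm_num))]

lemma fourierCoef_curve (hν : 0 < ν) (hu : ∀ T, MildSol ν T (fourierCoef u₀.toL2) u) {t : ℝ}
    (ht : 0 ≤ t) : fourierCoef (curve u₀ u t).toL2 = fun k => u k t := by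
  have h := regModes_Ioi hν hu (isRealSeq_fourierCoef _)
  rcases eq_or_lt_of_le ht with rfl | ht
  · rw [curve, if_neg (lt_irrefl _)]
    exact funext fun k => ((hu 0).apply_zero le_rfl k).symm
  · rw [toL2_curve_of_regModes h ht, fourierCoef_synthLp (h.summable_norm ht) (h.real t ht)]

lemma continuousOn_curve (hν : 0 < ν) (hu : ∀ T, MildSol ν T (fourierCoef u₀.toL2) u) (T : ℝ) :
    ContinuousOn (curve u₀ u) (Icc 0 T) := by
  refine Sobolev.continuousOn_of_modes (n := 1) (by norm_num)
    (fun t ht => fourierCoef_curve hν hu ht.1) (M := fun k => ⨆ t ∈ Icc 0 T, gev 0 k t * ‖u k t‖ₑ)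
    ?_ (fun t ht k => ?_) fun k => (hu T).continuousOn k
  · simp only [pow_one]
    exact (hu T).sNorm_ne_top hν
  · have := le_iSup₂ (f := fun t (_ : t ∈ Icc 0 T) => gev 0 k t * ‖u k t‖ₑ) t ht
    rwa [gev_zero_left, one_mul] at this

lemma memLp_two_of_lintegral {E : Type*} [NormedAddCommGroup E] {T : ℝ} {v : ℝ → E}
    (hv : ContinuousOn v (Ioo 0 T)) (h : ∫⁻ t in Ioo 0 T, ‖v t‖ₑ ^ 2 < ⊤) :
    MemLp v 2 (volume.restrict (Ioo 0 T)) := by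
  refine ⟨hv.aestronglyMeasurable measurableSet_Ioo, ?_⟩
  rw [eLpNorm_lt_top_iff_lintegral_rpow_enorm_lt_top (by norm_num) (by norm_num)]
  simpa using h

lemma lintegral_wt_cube (hν : 0 < ν) {x : Mode → C3} {T : ℝ} (hu : MildSol ν T x u) :
    ∫⁻ t in Ioo 0 T, ∑' k, wt k ^ 3 * ‖u k t‖ₑ ^ 2 ≠ ⊤ := by
  have h1 := hu.hNorm_ne_top hν
  refine ne_top_of_le_ne_top h1 ((lintegral_mono_set Ioo_subset_Ioc_self).trans ?_)
  rw [lintegral_tsum fun k => ((hu.meas k).enorm.pow_const 2).const_mul _, hNorm]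
  refine ENNReal.tsum_le_tsum fun k => ?_
  rw [lintegral_const_mul' _ _ (ENNReal.pow_ne_top (wt_ne_top k))]
  simp only [gev_zero_left, one_mul, le_refl]

lemma memL2Sobolev_curve (hν : 0 < ν) (hu : ∀ T, MildSol ν T (fourierCoef u₀.toL2) u) (T : ℝ) :
    MemL2Sobolev (3 / 2) T fun t => (curve u₀ u t).toL2 := by
  have h := regModes_Ioi hν hu (isRealSeq_fourierCoef _)
  have h32 : (3 / 2 : ℝ) = (3 : ℕ) / 2 := by norm_num
  have e1 : ∀ t, 0 < t → (Sobolev.ofL2 (3 / 2) (synthLp fun k => u k t)).toL2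
      = synthLp fun k => u k t := by
    intro t ht
    obtain ⟨B, c, hc, hB⟩ := h.decay t ht
    exact Sobolev.toL2_ofL2 (hB.self_of_nhds.seminormSq_ne_top hc (h.real t ht) h32)
  have e2 : ∀ t, 0 < t → fourierCoef (Sobolev.ofL2 (3 / 2) (synthLp fun k => u k t)).toL2
      = fun k => u k t := fun t ht => by
    rw [e1 t ht, fourierCoef_synthLp (h.summable_norm ht) (h.real t ht)]
  refine ⟨fun t => Sobolev.ofL2 (3 / 2) (synthLp fun k => u k t),
    memLp_two_of_lintegral (fun t ht => ?_) ?_, ?_⟩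
  · obtain ⟨B, c, hc, hB⟩ := (hu T).exists_expDecay hν (half_pos ht.1)
    have h1 := Sobolev.continuousOn_of_modes h32 (S := Icc (t / 2) T)
      (fun r hr => e2 r ((half_pos ht.1).trans_le hr.1)) (tsum_wt_exp_ne_top 3 B hc)
      (fun r hr k => (hB r hr).enorm_le k)
      fun k => ((hu T).continuousOn k).mono (Icc_subset_Icc_left (half_pos ht.1).le)
    exact (h1.continuousAt (Icc_mem_nhds (half_lt_self ht.1) ht.2)).continuousWithinAt
  · refine lt_of_le_of_lt (setLIntegral_mono' measurableSet_Ioo fun t ht =>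
      (Sobolev.enorm_sq_le h32 _).trans (le_of_eq (by rw [e2 t ht.1]))) ?_
    rw [lintegral_const_mul' _ _ ENNReal.ofReal_ne_top]
    exact ENNReal.mul_lt_top ENNReal.ofReal_lt_top (lintegral_wt_cube hν (hu T)).lt_top
  · filter_upwards [ae_restrict_mem measurableSet_Ioo] with t ht
    rw [e1 t ht.1, toL2_curve_of_regModes h ht.1]

/-! ### The time derivative and the weak form -/

/-- The time derivative of a solution as a functional on `H^{1/2}`. -/
def timeDual (ν : ℝ) (u : Mode → ℝ → C3) (t : ℝ) : SobolevDual (1 / 2) :=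
  (innerSL ℝ (synthLp (timeSeq ν fun k => u k t))).comp (Sobolev.toL2CLM (1 / 2))

lemma timeDual_apply (t : ℝ) (Φ : Sobolev (1 / 2)) :
    timeDual ν u t Φ = inner ℝ (synthLp (timeSeq ν fun k => u k t)) Φ.toL2 := rfl

lemma RegModes.summable_timeSeq (hν : 0 ≤ ν) {s : Set ℝ} (h : RegModes ν s u) {t : ℝ} (ht : t ∈ s) :
    Summable fun k => ‖timeSeq ν (fun l => u l t) k‖ := by
  obtain ⟨B, c, hc, hB⟩ := h.decay t ht
  refine Summable.of_nonneg_of_le (fun k => norm_nonneg _)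
    (fun k => hB.self_of_nhds.norm_timeSeq_le hν hc k) ?_
  simpa using summable_timeBound ν B hc 0

lemma continuousOn_timeDual (hν : 0 ≤ ν) (h : RegModes ν (Ioi 0) u) (T : ℝ) :
    ContinuousOn (timeDual ν u) (Ioo 0 T) := by
  intro t ht
  have h1 := h.continuousAt_synth_timeSeq hν isOpen_Ioi ht.1
  have h2 : ContinuousAt (fun τ => synthLp (timeSeq ν fun k => u k τ)) t :=
    (ContinuousMap.toLp (E := E3) 2 (volume : Measure Torus) ℝ).continuous.continuousAt.comp h1
  have h3 : ContinuousAt (fun τ => innerSL ℝ (synthLp (timeSeq ν fun k => u k τ))) t :=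
    (innerSL ℝ (E := L2Field)).continuous.continuousAt.comp h2
  exact (h3.clm_comp continuousAt_const).continuousWithinAt

lemma enorm_timeDual_sq_le (hν : 0 ≤ ν) (h : RegModes ν (Ioi 0) u) {t : ℝ} (ht : 0 < t) :
    ‖timeDual ν u t‖ₑ ^ 2 ≤ ENNReal.ofReal ((2 * Real.pi) ^ 3) ^ 2 *
      ∑' k, (wt k)⁻¹ * ‖timeSeq ν (fun l => u l t) k‖ₑ ^ 2 := by
  set Q := ENNReal.ofReal ((2 * Real.pi) ^ 3) ^ 2 *
      ∑' k, (wt k)⁻¹ * ‖timeSeq ν (fun l => u l t) k‖ₑ ^ 2 with hQ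
  rcases eq_or_ne Q ⊤ with h1 | h1
  · rw [h1]; exact le_top
  have h2 : ‖timeDual ν u t‖ ≤ √Q.toReal := by
    refine ContinuousLinearMap.opNorm_le_bound _ (Real.sqrt_nonneg _) fun Φ => ?_
    have h3 := enorm_inner_synthLp_le (h.summable_timeSeq hν ht) Φ.toL2
    have h4 := Sobolev.tsum_wt_le (n := 1) (by norm_num) Φ
    simp only [pow_one, Nat.sub_self, pow_zero, one_mul] at h4
    have h5 : ‖timeDual ν u t Φ‖ₑ ^ 2 ≤ Q * ‖Φ‖ₑ ^ 2 := by
      rw [timeDual_apply]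
      refine h3.trans ?_
      rw [← mul_assoc, ← hQ]
      gcongr
    have h6 := ENNReal.toReal_mono (by finiteness) h5
    rw [ENNReal.toReal_mul, ENNReal.toReal_pow, ENNReal.toReal_pow, toReal_enorm, toReal_enorm] at h6
    rw [← Real.sqrt_sq (norm_nonneg Φ), ← Real.sqrt_mul ENNReal.toReal_nonneg]
    exact Real.le_sqrt_of_sq_le h6
  rw [← ofReal_norm, ← ENNReal.ofReal_pow (norm_nonneg _), ENNReal.ofReal_le_iff_le_toReal h1]
  calc ‖timeDual ν u t‖ ^ 2 ≤ √Q.toReal ^ 2 := by gcongr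
    _ = _ := Real.sq_sqrt ENNReal.toReal_nonneg

/-- The Laplacian takes L²H^{3/2} to L²H^{-1/2}, as wt^{-1}·wt⁴ = wt³, and the nonlinearity is in
L²H^{-1/2} by the bilinear estimate. -/
lemma memLp_timeDual (hν : 0 < ν) {x : Mode → C3} (hx : IsRealSeq x) (hu : ∀ T, MildSol ν T x u)
    (T : ℝ) : MemLp (timeDual ν u) 2 (volume.restrict (Ioo 0 T)) := by
  have h := regModes_Ioi hν hu hx
  refine memLp_two_of_lintegral (continuousOn_timeDual hν.le h T) ?_
  have h1 : ∀ t, ∑' k, (wt k)⁻¹ * ‖timeSeq ν (fun l => u l t) k‖ₑ ^ 2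
      ≤ 2 * (ENNReal.ofReal ν ^ 2 * (∑' k, wt k ^ 3 * ‖u k t‖ₑ ^ 2)
        + ∑' k, (wt k)⁻¹ * ‖nonlin u k t‖ₑ ^ 2) := by
    intro t
    rw [← ENNReal.tsum_mul_left, ← ENNReal.tsum_add, ← ENNReal.tsum_mul_left]
    refine ENNReal.tsum_le_tsum fun k => ?_
    have h2 : ‖timeSeq ν (fun l => u l t) k‖ₑ
        ≤ ENNReal.ofReal ν * wt k ^ 2 * ‖u k t‖ₑ + ‖nonlin u k t‖ₑ := by
      refine enorm_sub_le.trans (add_le_add ?_ le_rfl)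
      rw [enorm_neg, enorm_smul, Real.enorm_of_nonneg (heatRate_nonneg hν.le k), heatRate,
        ENNReal.ofReal_mul hν.le]
      gcongr
      rw [wt_sq]
      exact le_add_self
    calc (wt k)⁻¹ * ‖timeSeq ν (fun l => u l t) k‖ₑ ^ 2
        ≤ (wt k)⁻¹ * (2 * ((ENNReal.ofReal ν * wt k ^ 2 * ‖u k t‖ₑ) ^ 2 + ‖nonlin u k t‖ₑ ^ 2)) := by
          gcongr
          exact (pow_le_pow_left' h2 2).trans (add_sq_le_two_mul _ _)
      _ = 2 * (ENNReal.ofReal ν ^ 2 * (((wt k)⁻¹ * wt k) * wt k ^ 3 * ‖u k t‖ₑ ^ 2)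
            + (wt k)⁻¹ * ‖nonlin u k t‖ₑ ^ 2) := by ring
      _ = _ := by rw [wt_inv_mul, one_mul]
  have h2 : ∫⁻ t in Ioo 0 T, ∑' k, (wt k)⁻¹ * ‖nonlin u k t‖ₑ ^ 2 ≠ ⊤ := by
    refine ne_top_of_le_ne_top (hu T).fNorm_ne_top ((lintegral_mono_set Ioo_subset_Ioc_self).trans ?_)
    rw [lintegral_tsum fun k => (((hu T).meas.nonlin k).enorm.pow_const 2).const_mul _, fNorm]
    refine ENNReal.tsum_le_tsum fun k => ?_
    rw [lintegral_const_mul' _ _ (ENNReal.inv_ne_top.2 (wt_ne_zero k))]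
    simp only [gev_zero_left, one_mul, le_refl]
  have h3 := lintegral_wt_cube hν (hu T)
  have hm : AEMeasurable (fun t => ∑' k, wt k ^ 3 * ‖u k t‖ₑ ^ 2) (volume.restrict (Ioo 0 T)) :=
    AEMeasurable.tsum fun k =>
      ((((hu T).meas k).mono_set Ioo_subset_Ioc_self).enorm.pow_const 2).const_mul _
  refine lt_of_le_of_lt (setLIntegral_mono' measurableSet_Ioo fun t ht =>
    (enorm_timeDual_sq_le hν.le h ht.1).trans (mul_le_mul_right (h1 t) _)) ?_
  rw [lintegral_const_mul' _ _ (by finiteness), lintegral_const_mul' _ _ (by finiteness),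
    lintegral_add_left' (hm.const_mul _), lintegral_const_mul' _ _ (by finiteness)]
  have h4 : ENNReal.ofReal ((2 * Real.pi) ^ 3) ^ 2 ≠ ⊤ := by finiteness
  exact lt_top_iff_ne_top.2 (by finiteness)

lemma hasWeakTimeDeriv_curve (hν : 0 ≤ ν) (h : RegModes ν (Ioi 0) u) (T : ℝ) :
    HasWeakTimeDeriv (1 / 2) T (fun t => (curve u₀ u t).toL2) (timeDual ν u) := by
  intro ψ hψ hc hs Φ
  have hd : ∀ t ∈ Ioo 0 T, HasDerivAt (fun τ => inner ℝ (curve u₀ u τ).toL2 Φ.toL2)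
      (timeDual ν u t Φ) t := by
    intro t ht
    have h1 := h.hasDerivAt_synth hν isOpen_Ioi ht.1
    have h2 := ((innerSL ℝ Φ.toL2).comp
      (ContinuousMap.toLp (E := E3) 2 (volume : Measure Torus) ℝ)).hasFDerivAt.comp_hasDerivAt t h1
    have h3 : HasDerivAt (fun τ => inner ℝ Φ.toL2 (synthLp fun k => u k τ))
        (inner ℝ Φ.toL2 (synthLp (timeSeq ν fun k => u k t))) t := h2
    rw [timeDual_apply, real_inner_comm]
    refine h3.congr_of_eventuallyEq ?_
    filter_upwards [Ioi_mem_nhds ht.1] with τ hτ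
    rw [toL2_curve_of_regModes h hτ, real_inner_comm]
  exact integral_deriv_mul_eq hd
    ((continuousOn_timeDual hν h T).clm_apply continuousOn_const) hψ hc hs

lemma weakForm_of_regModes (h : RegModes ν (Ioi 0) u) {φ : Torus → E3}
    (hφ : IsSmooth φ) {Φ : Sobolev (1 / 2)} (hΦ : (Φ.toL2 : Torus → E3) =ᵐ[volume] φ) {t : ℝ}
    (ht : 0 < t) :
    timeDual ν u t Φ
      + (∫ p, inner ℝ (∑ j, (synthLp (fun k => u k t) p j) •
          (synthLp (derivSeq j fun k => u k t) p)) (φ p))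
      + ν * (∑ j, ∫ p, inner ℝ (synthLp (derivSeq j fun k => u k t) p) (partialDeriv j φ p)) = 0 := by
  set x : Mode → C3 := fun k => u k t with hx
  have hs : ∀ n, Summable fun k => modeNorm k ^ n * ‖x k‖ := h.summable ht
  have hpt : ∀ p, synth (timeSeq ν x) p
      = ν • (∑ j, partialDeriv j (partialDeriv j (synth x)) p)
        - ∑ j, (synth x p j) • partialDeriv j (synth x) p := h.synth_timeSeq ht
  have hφ1 : ContDiff ℝ 1 (lift φ) := by exact_mod_cast contDiff_infty.1 hφ 1
  have cφ := continuous_of_continuous_lift hφ1.continuous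
  have cd : ∀ j, Continuous (partialDeriv j (synth x)) :=
    fun j => continuous_partialDeriv (contDiff_one_lift_synth hs) j
  have cdd : ∀ j, Continuous (partialDeriv j (partialDeriv j (synth x))) := fun j => by
    rw [partialDeriv_synth hs]
    exact continuous_partialDeriv (contDiff_one_lift_synth (summable_derivSeq hs j)) j
  have e1 : timeDual ν u t Φ = ∫ p, inner ℝ (synth (timeSeq ν x) p) (φ p) := by
    rw [timeDual_apply, L2.inner_def, ← integral_inner_synthLp]
    refine integral_congr_ae ?_
    filter_upwards [hΦ] with p hp
    rw [hp]
  have e2 : ∫ p, inner ℝ (∑ j, (synthLp x p j) • (synthLp (derivSeq j x) p)) (φ p)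
      = ∫ p, inner ℝ (∑ j, (synth x p j) • partialDeriv j (synth x) p) (φ p) := by
    refine integral_congr_ae ?_
    filter_upwards [coeFn_synthLp x, ae_all_iff.2 fun j => coeFn_synthLp (derivSeq j x)] with p hp hq
    simp only [hp, hq, fun j => partialDeriv_synth hs j]
  have e3 : ∀ j, ∫ p, inner ℝ (synthLp (derivSeq j x) p) (partialDeriv j φ p)
      = -∫ p, inner ℝ (partialDeriv j (partialDeriv j (synth x)) p) (φ p) := fun j => by
    rw [integral_inner_synthLp, integral_inner_partialDeriv
      (contDiff_one_lift_synth (summable_derivSeq hs j)) hφ1, partialDeriv_synth hs]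
  have i1 : Integrable fun p => inner ℝ (∑ j, (synth x p j) • partialDeriv j (synth x) p) (φ p) := by
    refine integrable_of_continuous (Continuous.inner (continuous_finsetSum _ fun j _ => ?_) cφ)
    exact (((EuclideanSpace.proj (𝕜 := ℝ) j).continuous).comp (synth x).continuous).smul (cd j)
  have i2 : ∀ j, Integrable fun p => inner ℝ (partialDeriv j (partialDeriv j (synth x)) p) (φ p) :=
    fun j => integrable_of_continuous ((cdd j).inner cφ)
  rw [e1, e2]
  simp only [e3, hpt, inner_sub_left, real_inner_smul_left, sum_inner]
  simp only [sum_inner, real_inner_smul_left] at i1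
  rw [integral_sub ((integrable_finsetSum _ fun j _ => i2 j).const_mul ν) i1, integral_const_mul,
    integral_finsetSum _ fun j _ => i2 j, Finset.sum_neg_distrib]
  ring

theorem isGlobalStrongSolution_curve (hν : 0 < ν) (hu : ∀ T, MildSol ν T (fourierCoef u₀.toL2) u) :
    IsGlobalStrongSolution ν (curve u₀ u) := by
  intro T hT
  have h := regModes_Ioi hν hu (isRealSeq_fourierCoef _)
  refine ⟨continuousOn_curve hν hu T, memL2Sobolev_curve hν hu T, timeDual ν u,
    memLp_timeDual hν (isRealSeq_fourierCoef _) hu T, hasWeakTimeDeriv_curve hν.le h T,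
    fun φ hφ Φ hΦ => ?_⟩
  filter_upwards [ae_restrict_mem measurableSet_Ioo] with t ht
  refine ⟨fun j => synthLp (derivSeq j fun k => u k t), fun j => ?_, ?_⟩
  · rw [toL2_curve_of_regModes h ht.1]
    exact hasWeakPartial_synthLp (h.summable ht.1) j
  · rw [toL2_curve_of_regModes h ht.1]
    exact weakForm_of_regModes h hφ hΦ ht.1

end

/-! ### The fundamental lemma of the calculus of variations on an interval -/

lemma deriv_smoothTransition_eq_zero {q : ℝ} (hq : q ∉ Icc (0 : ℝ) 1) :
    deriv Real.smoothTransition q = 0 := by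
  rcases lt_or_ge q 0 with h | h
  · have h1 : Real.smoothTransition =ᶠ[𝓝 q] fun _ => 0 := by
      filter_upwards [Iio_mem_nhds h] with r hr
      exact Real.smoothTransition.zero_of_nonpos (le_of_lt hr)
    rw [h1.deriv_eq]
    simp
  · have h2 : 1 < q := by
      by_contra! h2
      exact hq ⟨h, h2⟩
    have h1 : Real.smoothTransition =ᶠ[𝓝 q] fun _ => 1 := by
      filter_upwards [Ioi_mem_nhds h2] with r hr
      exact Real.smoothTransition.one_of_one_le (le_of_lt hr)
    rw [h1.deriv_eq]
    simp

lemma continuous_deriv_smoothTransition : Continuous (deriv Real.smoothTransition) :=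
  (Real.smoothTransition.contDiff (n := 1)).continuous_deriv (by norm_num)

lemma integrable_deriv_smoothTransition : Integrable (deriv Real.smoothTransition) :=
  continuous_deriv_smoothTransition.integrable_of_hasCompactSupport
    (HasCompactSupport.intro isCompact_Icc fun _ hq => deriv_smoothTransition_eq_zero hq)

lemma hasDerivAt_smoothTransition (q : ℝ) :
    HasDerivAt Real.smoothTransition (deriv Real.smoothTransition q) q :=
  ((Real.smoothTransition.contDiff (n := 1)).differentiable (by norm_num) q).hasDerivAt

lemma integral_deriv_smoothTransition : ∫ q, deriv Real.smoothTransition q = 1 := by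
  rw [integral_of_hasDerivAt_of_tendsto hasDerivAt_smoothTransition
    integrable_deriv_smoothTransition (m := 0) (n := 1), sub_zero]
  · refine tendsto_const_nhds.congr' ?_
    filter_upwards [Iic_mem_atBot 0] with q hq
    exact (Real.smoothTransition.zero_of_nonpos hq).symm
  · refine tendsto_const_nhds.congr' ?_
    filter_upwards [Ici_mem_atTop 1] with q hq
    exact (Real.smoothTransition.one_of_one_le hq).symm

/-- A smooth step of width `ε` at `s`. -/
def step (ε s r : ℝ) : ℝ := Real.smoothTransition (ε⁻¹ * (r - s))

lemma contDiff_step (ε s : ℝ) : ContDiff ℝ ∞ (step ε s) :=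
  Real.smoothTransition.contDiff.comp (contDiff_const.mul (contDiff_id.sub contDiff_const))

lemma hasDerivAt_step (ε s r : ℝ) :
    HasDerivAt (step ε s) (ε⁻¹ * deriv Real.smoothTransition (ε⁻¹ * (r - s))) r := by
  have h1 : HasDerivAt (fun r => ε⁻¹ * (r - s)) (ε⁻¹ * 1) r :=
    ((hasDerivAt_id r).sub_const s).const_mul _
  refine ((hasDerivAt_smoothTransition _).comp r h1).congr_deriv ?_
  ring

lemma tendsto_integral_step {y : ℝ → ℝ} (hy : Continuous y) {C : ℝ} (hC : ∀ r, ‖y r‖ ≤ C) (s : ℝ) :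
    Tendsto (fun ε => ∫ r, deriv (step ε s) r * y r) (𝓝[>] 0) (𝓝 (y s)) := by
  have h1 : ∀ ε > 0, ∫ r, deriv (step ε s) r * y r
      = ∫ q, deriv Real.smoothTransition q * y (s + ε * q) := by
    intro ε hε
    have h2 := Measure.integral_comp_mul_left (fun w => deriv (step ε s) (s + w) * y (s + w)) ε
    rw [integral_add_left_eq_self (fun r => deriv (step ε s) r * y r)] at h2
    rw [abs_of_pos (inv_pos.2 hε), smul_eq_mul] at h2
    have h3 : ∀ q, deriv (step ε s) (s + ε * q) * y (s + ε * q)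
        = ε⁻¹ * (deriv Real.smoothTransition q * y (s + ε * q)) := by
      intro q
      rw [(hasDerivAt_step ε s _).deriv, add_sub_cancel_left, inv_mul_cancel_left₀ hε.ne', mul_assoc]
    simp only [h3, integral_const_mul] at h2
    exact (mul_left_cancel₀ (inv_pos.2 hε).ne' h2).symm
  have h2 : Tendsto (fun ε => ∫ q, deriv Real.smoothTransition q * y (s + ε * q)) (𝓝[>] 0)
      (𝓝 (∫ q, deriv Real.smoothTransition q * y s)) := by
    refine tendsto_integral_filter_of_dominated_convergence
      (fun q => ‖deriv Real.smoothTransition q‖ * C) (Eventually.of_forall fun ε => ?_)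
      (Eventually.of_forall fun ε => Eventually.of_forall fun q => ?_)
      (integrable_deriv_smoothTransition.norm.mul_const C) (Eventually.of_forall fun q => ?_)
    · exact (continuous_deriv_smoothTransition.mul (hy.comp (by fun_prop))).aestronglyMeasurable
    · rw [norm_mul]
      exact mul_le_mul_of_nonneg_left (hC _) (norm_nonneg _)
    · have h3 : Continuous fun ε : ℝ => y (s + ε * q) := hy.comp (by fun_prop)
      have h4 := h3.tendsto 0
      rw [zero_mul, add_zero] at h4
      exact (h4.mono_left nhdsWithin_le_nhds).const_mul _
  rw [integral_mul_const, integral_deriv_smoothTransition, one_mul] at h2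
  refine h2.congr' ?_
  filter_upwards [self_mem_nhdsWithin] with ε hε
  exact (h1 ε hε).symm

lemma tendsto_step (s r : ℝ) :
    Tendsto (fun ε => step ε s r) (𝓝[>] 0) (𝓝 (if s < r then 1 else 0)) := by
  split_ifs with h
  · refine tendsto_const_nhds.congr' ?_
    filter_upwards [Ioo_mem_nhdsGT (sub_pos.2 h)] with ε hε
    refine (Real.smoothTransition.one_of_one_le ?_).symm
    rw [inv_mul_eq_div, one_le_div hε.1]
    exact hε.2.le
  · refine tendsto_const_nhds.congr' ?_
    filter_upwards [self_mem_nhdsWithin] with ε hε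
    refine (Real.smoothTransition.zero_of_nonpos ?_).symm
    exact mul_nonpos_of_nonneg_of_nonpos (inv_pos.2 hε).le (by linarith)

lemma step_eq_zero {ε s r : ℝ} (hε : 0 < ε) (h : r ≤ s) : step ε s r = 0 :=
  Real.smoothTransition.zero_of_nonpos
    (mul_nonpos_of_nonneg_of_nonpos (inv_pos.2 hε).le (by linarith))

lemma step_eq_one {ε s r : ℝ} (hε : 0 < ε) (h : s + ε ≤ r) : step ε s r = 1 := by
  refine Real.smoothTransition.one_of_one_le ?_
  rw [inv_mul_eq_div, one_le_div hε]
  linarith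

lemma norm_step_le (ε s r : ℝ) : ‖step ε s r‖ ≤ 1 := by
  unfold step
  rw [Real.norm_eq_abs, abs_of_nonneg (Real.smoothTransition.nonneg _)]
  exact Real.smoothTransition.le_one _

/-- `z` is the weak derivative of `y` on `(0,T)`. -/
def IsWeakDeriv (T : ℝ) (y z : ℝ → ℝ) : Prop :=
  ∀ ψ : ℝ → ℝ, ContDiff ℝ ∞ ψ → HasCompactSupport ψ → tsupport ψ ⊆ Ioo 0 T →
    ∫ t in Ioo 0 T, deriv ψ t * y t = -∫ t in Ioo 0 T, ψ t * z t

/-- The test function is a smooth step at `s` minus one at `t`. As the width tends to 0 it tends to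
the indicator of (s, t], and its derivative to the difference of point masses. -/
lemma IsWeakDeriv.sub_eq {T : ℝ} {y z : ℝ → ℝ} (h : IsWeakDeriv T y z)
    (hy : ContinuousOn y (Icc 0 T)) (hz : IntegrableOn z (Ioo 0 T)) {s t : ℝ} (hs : 0 < s)
    (hst : s ≤ t) (ht : t < T) : y t - y s = ∫ r in s..t, z r := by
  have hT : 0 ≤ T := by linarith
  -- A bounded continuous extension, so that the two steps can be treated separately as integrals
  -- over the line.
  set Y : ℝ → ℝ := IccExtend hT ((Icc 0 T).domRestrict y) with hY
  have cY : Continuous Y := (continuousOn_iff_continuous_domRestrict.1 hy).Icc_extend'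
  have eY : ∀ r ∈ Icc 0 T, Y r = y r := fun r hr => IccExtend_of_mem hT _ hr
  obtain ⟨C, hC⟩ := isCompact_Icc.exists_bound_of_continuousOn hy
  have hCY : ∀ r, ‖Y r‖ ≤ C := fun r => hC _ (projIcc 0 T hT r).2
  have key : ∀ ε ∈ Ioo 0 (T - t), (∫ r, deriv (step ε s) r * Y r) - ∫ r, deriv (step ε t) r * Y r
      = -∫ r in Ioo 0 T, (step ε s r - step ε t r) * z r := by
    intro ε hε
    set ψ : ℝ → ℝ := fun r => step ε s r - step ε t r with hψ
    have hsupp : ∀ r ∉ Icc s (t + ε), ψ r = 0 := by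
      intro r hr
      rcases lt_or_ge r s with h1 | h1
      · simp only [hψ]
        rw [step_eq_zero hε.1 h1.le, step_eq_zero hε.1 (h1.le.trans hst), sub_self]
      · have h2 : t + ε < r := by
          by_contra! h2
          exact hr ⟨h1, h2⟩
        simp only [hψ]
        rw [step_eq_one hε.1 (by linarith), step_eq_one hε.1 h2.le, sub_self]
    have hts : tsupport ψ ⊆ Icc s (t + ε) :=
      closure_minimal (Function.support_subset_iff'.2 hsupp) isClosed_Icc
    have hts' : tsupport ψ ⊆ Ioo 0 T := hts.trans fun r hr =>
      ⟨hs.trans_le hr.1, hr.2.trans_lt (by linarith [hε.2])⟩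
    have h1 := h ψ ((contDiff_step ε s).sub (contDiff_step ε t))
      (HasCompactSupport.intro isCompact_Icc hsupp) hts'
    have hd : ∀ r, deriv ψ r = deriv (step ε s) r - deriv (step ε t) r := fun r => by
      rw [(hasDerivAt_step ε s r).deriv, (hasDerivAt_step ε t r).deriv]
      exact ((hasDerivAt_step ε s r).sub (hasDerivAt_step ε t r)).deriv
    have hd0 : ∀ r ∉ Ioo 0 T, deriv ψ r = 0 := fun r hr =>
      image_eq_zero_of_notMem_tsupport fun h2 => hr (hts' (tsupport_deriv_subset h2))
    rw [← h1]
    have h2 : ∫ r in Ioo 0 T, deriv ψ r * y r = ∫ r, deriv ψ r * Y r := by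
      rw [← setIntegral_eq_integral_of_forall_compl_eq_zero (μ := volume) (s := Ioo (0 : ℝ) T)
        (f := fun r => deriv ψ r * Y r) (fun r hr => by rw [hd0 r hr, zero_mul])]
      refine setIntegral_congr_fun measurableSet_Ioo fun r hr => ?_
      simp only [eY r ⟨hr.1.le, hr.2.le⟩]
    have hint : ∀ s, Integrable fun r => deriv (step ε s) r * Y r := by
      intro s
      have c1 : Continuous (deriv (step ε s)) := (contDiff_step ε s).continuous_deriv (by simp)
      refine (c1.mul cY).integrable_of_hasCompactSupport
        (HasCompactSupport.intro (isCompact_Icc (a := s) (b := s + ε)) fun r hr => ?_)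
      change deriv (step ε s) r * Y r = 0
      rw [(hasDerivAt_step ε s r).deriv, deriv_smoothTransition_eq_zero, mul_zero, zero_mul]
      intro h3
      refine hr ⟨?_, ?_⟩
      · have := nonneg_of_mul_nonneg_right h3.1 (inv_pos.2 hε.1)
        linarith
      · have := h3.2
        rw [inv_mul_le_iff₀ hε.1] at this
        linarith
    rw [h2, ← integral_sub (hint s) (hint t)]
    simp only [hd, sub_mul]
  have lim1 := (tendsto_integral_step cY hCY s).sub (tendsto_integral_step cY hCY t)
  have lim2 : Tendsto (fun ε => -∫ r in Ioo 0 T, (step ε s r - step ε t r) * z r) (𝓝[>] 0)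
      (𝓝 (-∫ r in Ioo 0 T, ((if s < r then 1 else 0) - (if t < r then 1 else 0)) * z r)) := by
    refine (tendsto_integral_filter_of_dominated_convergence (fun r => (1 + 1) * ‖z r‖)
      (Eventually.of_forall fun ε => ?_) (Eventually.of_forall fun ε => Eventually.of_forall fun r => ?_)
      (hz.norm.const_mul _) (Eventually.of_forall fun r => ?_)).neg
    · exact (((contDiff_step ε s).continuous.sub
        (contDiff_step ε t).continuous).aestronglyMeasurable).mul hz.1
    · rw [norm_mul]
      refine mul_le_mul_of_nonneg_right ((norm_sub_le _ _).trans ?_) (norm_nonneg _)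
      exact add_le_add (norm_step_le _ _ _) (norm_step_le _ _ _)
    · exact ((tendsto_step s r).sub (tendsto_step t r)).mul_const _
  have e1 : ∫ r in Ioo 0 T, ((if s < r then 1 else 0) - (if t < r then 1 else 0)) * z r
      = ∫ r in s..t, z r := by
    have h1 : ∀ r, ((if s < r then 1 else 0) - (if t < r then 1 else 0)) * z r
        = (Ioc s t).indicator z r := by
      intro r
      simp only [indicator, mem_Ioc]
      split_ifs <;> first | linarith | grind
    simp only [h1]
    rw [intervalIntegral.integral_of_le hst, setIntegral_indicator measurableSet_Ioc,
      inter_eq_right.2 (show Ioc s t ⊆ Ioo 0 T from fun r hr => ⟨hs.trans hr.1, hr.2.trans_lt ht⟩)]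
  have h3 := tendsto_nhds_unique (lim1.congr' (by
    filter_upwards [Ioo_mem_nhdsGT (sub_pos.2 ht)] with ε hε
    exact key ε hε)) lim2
  rw [e1, eY s ⟨hs.le, by linarith⟩, eY t ⟨by linarith, ht.le⟩] at h3
  linarith

lemma IsWeakDeriv.eq_add_integral {T : ℝ} {y z : ℝ → ℝ} (h : IsWeakDeriv T y z)
    (hy : ContinuousOn y (Icc 0 T)) (hz : IntegrableOn z (Ioo 0 T)) {t : ℝ} (ht : t ∈ Icc 0 T) :
    y t = y 0 + ∫ r in (0 : ℝ)..t, z r := by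
  rcases eq_or_lt_of_le (ht.1.trans ht.2) with hT | hT
  · have h0 : t = 0 := le_antisymm (hT ▸ ht.2) ht.1
    simp [h0]
  have hzi : IntervalIntegrable z volume 0 T := by
    rw [intervalIntegrable_iff_integrableOn_Ioo_of_le hT.le]
    exact hz
  have hzi' : IntegrableOn z (uIcc 0 T) := by
    rw [uIcc_of_le hT.le, integrableOn_Icc_iff_integrableOn_Ioo]
    exact hz
  have hc : ContinuousOn (fun t => y t - ∫ r in (0 : ℝ)..t, z r) (Icc 0 T) := by
    refine hy.sub ?_
    have := intervalIntegral.continuousOn_primitive_interval hzi'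
    rwa [uIcc_of_le hT.le] at this
  have hsub : ∀ t ∈ Icc 0 T, IntervalIntegrable z volume 0 t := fun t ht =>
    hzi.mono_set (by rw [uIcc_of_le hT.le, uIcc_of_le ht.1]; exact Icc_subset_Icc_right ht.2)
  have hconst : EqOn (fun t => y t - ∫ r in (0 : ℝ)..t, z r)
      (fun _ => y (T / 2) - ∫ r in (0 : ℝ)..(T / 2), z r) (Ioo 0 T) := by
    intro t ht
    have i1 := hsub t ⟨ht.1.le, ht.2.le⟩
    have i2 := hsub (T / 2) ⟨by linarith, by linarith⟩
    rcases le_total t (T / 2) with h1 | h1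
    · have h2 := h.sub_eq hy hz ht.1 h1 (by linarith)
      have h3 := intervalIntegral.integral_add_adjacent_intervals i1 (i1.symm.trans i2)
      simp only
      linarith
    · have h2 := h.sub_eq hy hz (by linarith) h1 ht.2
      have h3 := intervalIntegral.integral_add_adjacent_intervals i2 (i2.symm.trans i1)
      simp only
      linarith
  have hall := hconst.of_subset_closure hc continuousOn_const Ioo_subset_Icc_self
    (by rw [closure_Ioo hT.ne])
  have h1 := hall ht
  have h2 := hall (left_mem_Icc.2 hT.le)
  simp only [intervalIntegral.integral_same, sub_zero] at h1 h2
  linarith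

/-! ### Fourier coefficients of strong solutions -/

/-- The real part of the inner product with `c`. -/
def reInner (c : C3) : C3 →L[ℝ] ℝ := Complex.reCLM.comp ((innerSL ℂ c).restrictScalars ℝ)

lemma reInner_apply (c x : C3) : reInner c x = (inner ℂ x c).re := by
  change (inner ℂ c x).re = _
  rw [← inner_conj_symm, Complex.conj_re]

lemma eq_of_reInner {x y : C3} (h : ∀ c, reInner c x = reInner c y) : x = y := by
  have h1 := h (x - y)
  rw [← sub_eq_zero, ← map_sub, reInner_apply] at h1
  have h2 : (inner ℂ (x - y) (x - y)).re = ‖x - y‖ ^ 2 := inner_self_eq_norm_sq (𝕜 := ℂ) (x - y)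
  rw [h2] at h1
  exact sub_eq_zero.1 (norm_eq_zero.1 (pow_eq_zero_iff two_ne_zero |>.1 h1))

lemma reInner_I_mul_smul (r : ℝ) (c x : C3) :
    reInner ((Complex.I * (r : ℂ)) • c) x = -reInner c ((Complex.I * (r : ℂ)) • x) := by
  simp only [reInner_apply, inner_smul_left, inner_smul_right, map_mul, Complex.conj_I,
    Complex.conj_ofReal, ← Complex.neg_re]
  congr 1
  ring

lemma integral_inner_reMode_eq (f : L2Field) (k : Mode) (c : C3) :
    ∫ p, inner ℝ (f p) (reMode k c p) = (2 * Real.pi) ^ 3 * reInner c (fourierCoef f k) := by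
  rw [reInner_apply, integral_inner_reMode_L2]

/-- The evaluation of a Fourier coefficient as a continuous linear map. -/
def fourierCLM (k : Mode) : L2Field →L[ℝ] C3 :=
  LinearMap.mkContinuous
    { toFun := fun f => fourierCoef f k
      map_add' := fun f g => fourierCoef_add f g k
      map_smul' := fun c f => fourierCoef_smul c f k } 1 fun f => by
    rw [one_mul, ← enorm_le_iff_norm_le]
    refine (ENNReal.pow_right_strictMono two_ne_zero).le_iff_le.1 ?_
    change ‖fourierCoef f k‖ₑ ^ 2 ≤ ‖f‖ₑ ^ 2
    rw [parseval]
    have hπ : 1 ≤ ENNReal.ofReal ((2 * Real.pi) ^ 3) := by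
      rw [ENNReal.one_le_ofReal]
      exact one_le_pow₀ (by linarith [Real.pi_gt_three])
    exact (ENNReal.le_tsum k).trans (le_mul_of_one_le_left zero_le hπ)

/-- Plane waves are admissible test functions, and `c` ranges over all vectors, so real parts of
inner products determine the coefficient. -/
lemma HasWeakPartial.fourierCoef_eq {j : Fin 3} {f D : L2Field} (h : HasWeakPartial j f D) :
    fourierCoef D = derivSeq j (fourierCoef f) := by
  funext k
  refine eq_of_reInner fun c => ?_
  have h1 := h _ (isSmooth_reMode k c)
  rw [partialDeriv_reMode, integral_inner_reMode_eq, integral_inner_reMode_eq] at h1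
  have h2 := reInner_I_mul_smul (k j) c (fourierCoef f k)
  rw [Complex.ofReal_intCast] at h2
  rw [h2, mul_neg, neg_inj] at h1
  exact (mul_left_cancel₀ (pow_pos Real.two_pi_pos 3).ne' h1).symm

lemma hasWeakPartial_toLp {F : C(Torus, E3)} (hF : ContDiff ℝ 1 (lift F)) {j : Fin 3} {G : C(Torus, E3)}
    (hG : partialDeriv j F = G) :
    HasWeakPartial j (ContinuousMap.toLp 2 volume ℝ F) (ContinuousMap.toLp 2 volume ℝ G) := by
  intro φ hφ
  have hφ1 : ContDiff ℝ 1 (lift φ) := by exact_mod_cast contDiff_infty.1 hφ 1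
  have h1 := integral_inner_partialDeriv hF hφ1 j
  have h2 : ∀ (H : C(Torus, E3)) (χ : Torus → E3),
      ∫ p, inner ℝ ((ContinuousMap.toLp 2 volume ℝ H : L2Field) p) (χ p) = ∫ p, inner ℝ (H p) (χ p) := by
    intro H χ
    refine integral_congr_ae ?_
    filter_upwards [ContinuousMap.coeFn_toLp (p := 2) (𝕜 := ℝ) (volume : Measure Torus) H] with p hp
    rw [hp]
  rw [h2, h2, h1, hG]

lemma seminormSq_half_ne_top {f : L2Field} {D : Fin 3 → L2Field} (h : ∀ j, HasWeakPartial j f (D j)) :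
    seminormSq (1 / 2) f ≠ ⊤ := by
  rw [seminormSq_eq (n := 1) (by norm_num)]
  have h1 : ∀ g : L2Field, ∑' k, ‖fourierCoef g k‖ₑ ^ 2 ≠ ⊤ := by
    intro g hg
    have := parseval g
    rw [hg, ENNReal.mul_top (ENNReal.ofReal_pos.2 (pow_pos Real.two_pi_pos 3)).ne'] at this
    exact absurd this (by finiteness)
  have h2 : ∑' k, (‖fourierCoef f k‖ₑ ^ 2 + ∑ j, ‖fourierCoef (D j) k‖ₑ ^ 2) ≠ ⊤ := by
    rw [ENNReal.tsum_add, Summable.tsum_finsetSum fun _ _ => ENNReal.summable]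
    exact ENNReal.add_ne_top.2 ⟨h1 f, ENNReal.sum_ne_top.2 fun j _ => h1 (D j)⟩
  refine ne_top_of_le_ne_top h2 (ENNReal.tsum_le_tsum fun k => ?_)
  simp only [fun j => (h j).fourierCoef_eq, enorm_derivSeq_sq, ← Finset.sum_mul]
  rw [← ENNReal.ofReal_sum_of_nonneg fun j _ => sq_nonneg _, ← modeNorm_sq, pow_one]
  have h3 : modeNorm k ≤ 1 + modeNorm k ^ 2 := by nlinarith [modeNorm_nonneg k, sq_nonneg (modeNorm k - 1)]
  calc _ ≤ ENNReal.ofReal (1 + modeNorm k ^ 2) * ‖fourierCoef f k‖ₑ ^ 2 := by gcongr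
    _ = _ := by rw [ENNReal.ofReal_add zero_le_one (sq_nonneg _), ENNReal.ofReal_one, add_mul, one_mul]

/-- The field `reMode k c` as an element of `H^{1/2}`. -/
def testMode (k : Mode) (c : C3) : Sobolev (1 / 2) :=
  Sobolev.ofL2 (1 / 2) (ContinuousMap.toLp 2 volume ℝ (reMode k c))

lemma toL2_testMode (k : Mode) (c : C3) :
    (testMode k c).toL2 = ContinuousMap.toLp 2 volume ℝ (reMode k c) := by
  refine Sobolev.toL2_ofL2 (seminormSq_half_ne_top fun j => hasWeakPartial_toLp
    (G := reMode k ((Complex.I * (k j : ℂ)) • c)) ?_ (partialDeriv_reMode j k c))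
  exact (contDiff_infty.1 (isSmooth_reMode k c) 1)

lemma coeFn_testMode (k : Mode) (c : C3) : ((testMode k c).toL2 : Torus → E3) =ᵐ[volume] reMode k c := by
  rw [toL2_testMode]
  exact ContinuousMap.coeFn_toLp (volume : Measure Torus) _

lemma inner_testMode (f : L2Field) (k : Mode) (c : C3) :
    inner ℝ f (testMode k c).toL2 = (2 * Real.pi) ^ 3 * reInner c (fourierCoef f k) := by
  rw [← integral_inner_reMode_eq, L2.inner_def]
  refine integral_congr_ae ?_
  filter_upwards [coeFn_testMode k c] with p hp
  rw [hp]

lemma integrable_smul_L2 (f D : L2Field) (j : Fin 3) : Integrable fun p => (f p j) • (D p) := by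
  have h1 : MemLp (fun p => f p j) 2 (volume : Measure Torus) :=
    (EuclideanSpace.proj (𝕜 := ℝ) j).comp_memLp' (Lp.memLp f)
  exact memLp_one_iff_integrable.1 (MemLp.smul (p := 2) (q := 2) (r := 1) (Lp.memLp D) h1)

lemma hasSum_convTerm {f : L2Field} {D : Fin 3 → L2Field} (h : ∀ j, HasWeakPartial j f (D j)) (k : Mode) :
    HasSum (fun l => convTerm (k - l) (fourierCoef f l) (fourierCoef f (k - l)))
      (WithLp.toLp 2 fun i => ∑ j, (((2 * Real.pi) ^ 3 : ℝ) : ℂ)⁻¹ *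
        ∫ p, expMode (-k) p * (((f p j : ℝ) : ℂ) * ((D j p i : ℝ) : ℂ)) : C3) := by
  have h1 : ∀ i, HasSum (fun l => (convTerm (k - l) (fourierCoef f l) (fourierCoef f (k - l))) i)
      (∑ j, (((2 * Real.pi) ^ 3 : ℝ) : ℂ)⁻¹ *
        ∫ p, expMode (-k) p * (((f p j : ℝ) : ℂ) * ((D j p i : ℝ) : ℂ))) := by
    intro i
    refine (hasSum_sum fun j (_ : j ∈ Finset.univ) => hasSum_fourierCoef_mul f (D j) j i k).congr_fun ?_
    intro l
    simp only [(h _).fourierCoef_eq, derivSeq, convTerm, PiLp.smul_apply, smul_eq_mul, Finset.mul_sum,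
      Finset.sum_mul]
    refine Finset.sum_congr rfl fun j _ => ?_
    ring
  exact (Pi.hasSum.2 h1).mapL
    ((PiLp.continuousLinearEquiv 2 ℂ (fun _ : Fin 3 => ℂ)).symm : (Fin 3 → ℂ) →L[ℂ] C3)

/-- The product of two L² functions is only integrable, but its Fourier coefficients are still
convergent convolutions; this links the weak form to `burgersNL` without any smoothness. -/
lemma integral_inner_advection {f : L2Field} {D : Fin 3 → L2Field} (h : ∀ j, HasWeakPartial j f (D j))
    (k : Mode) (c : C3) :
    ∫ p, inner ℝ (∑ j, (f p j) • (D j p)) (reMode k c p)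
      = (2 * Real.pi) ^ 3 * reInner c (burgersNL (fourierCoef f) k) := by
  have hi : ∀ j i, Integrable fun p => expMode k p * (((f p j : ℝ) : ℂ) * ((D j p i : ℝ) : ℂ)) := by
    intro j i
    have h1 := ((EuclideanSpace.proj (𝕜 := ℝ) i).integrable_comp (integrable_smul_L2 f (D j) j)).ofReal (𝕜 := ℂ)
    refine (h1.bdd_mul (c := 1) (continuous_expMode k).aestronglyMeasurable
      (Eventually.of_forall fun x => (norm_expMode k x).le)).congr (Eventually.of_forall fun p => ?_)
    simp
  rw [integral_inner_reMode (integrable_finsetSum _ fun j _ => integrable_smul_L2 f (D j) j),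
    burgersNL, (hasSum_convTerm h k).tsum_eq, reInner_apply, PiLp.inner_apply,
    ← Complex.re_ofReal_mul, Finset.mul_sum]
  congr 1
  refine Finset.sum_congr rfl fun i _ => ?_
  have h0 : (((2 * Real.pi) ^ 3 : ℝ) : ℂ) ≠ 0 := by
    exact_mod_cast (pow_pos Real.two_pi_pos 3).ne'
  have h1 : ∀ p, expMode k p * (((∑ j, (f p j) • (D j p)) i : ℝ) : ℂ)
      = ∑ j, expMode k p * (((f p j : ℝ) : ℂ) * ((D j p i : ℝ) : ℂ)) := fun p => by
    simp [Finset.mul_sum]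
  simp only [h1]
  rw [integral_finsetSum _ fun j _ => hi j i, RCLike.inner_apply, ← Finset.mul_sum, map_mul, map_inv₀,
    Complex.conj_ofReal, map_sum]
  have h2 : ∀ j, conj (∫ p, expMode (-k) p * (((f p j : ℝ) : ℂ) * ((D j p i : ℝ) : ℂ)))
      = ∫ p, expMode k p * (((f p j : ℝ) : ℂ) * ((D j p i : ℝ) : ℂ)) := by
    intro j
    rw [← integral_conj]
    refine integral_congr_ae (Eventually.of_forall fun p => ?_)
    simp only [map_mul, Complex.conj_ofReal, ← expMode_neg, neg_neg]
  simp only [h2]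
  field_simp

lemma sum_integral_inner_partialDeriv {f : L2Field} {D : Fin 3 → L2Field}
    (h : ∀ j, HasWeakPartial j f (D j)) (k : Mode) (c : C3) :
    ∑ j, ∫ p, inner ℝ (D j p) (partialDeriv j (reMode k c) p)
      = (2 * Real.pi) ^ 3 * (modeNorm k ^ 2 * reInner c (fourierCoef f k)) := by
  have h1 : ∀ j, ∫ p, inner ℝ (D j p) (partialDeriv j (reMode k c) p)
      = (2 * Real.pi) ^ 3 * ((k j : ℝ) ^ 2 * reInner c (fourierCoef f k)) := by
    intro j
    have h2 := reInner_I_mul_smul (k j) c (fourierCoef (D j) k)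
    rw [Complex.ofReal_intCast] at h2
    rw [partialDeriv_reMode, integral_inner_reMode_eq, h2, (h j).fourierCoef_eq, derivSeq, smul_smul]
    have h3 : Complex.I * (k j : ℂ) * (Complex.I * (k j : ℂ)) = ((-(k j : ℝ) ^ 2 : ℝ) : ℂ) := by
      push_cast
      linear_combination (k j : ℂ) ^ 2 * Complex.I_sq
    rw [h3, Complex.coe_smul, map_smul, smul_eq_mul]
    ring
  rw [Finset.sum_congr rfl fun j _ => h1 j, ← Finset.mul_sum, ← Finset.sum_mul, modeNorm_sq]

/-- The integrating factor is moved onto the test function, where it is smooth. -/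
lemma IsWeakDeriv.exp_mul {T c : ℝ} {y n : ℝ → ℝ} (h : IsWeakDeriv T y fun t => -(n t + c * y t))
    (hy : ContinuousOn y (Icc 0 T)) (hn : IntegrableOn n (Ioo 0 T)) :
    IsWeakDeriv T (fun t => Real.exp (c * t) * y t) fun t => -(Real.exp (c * t) * n t) := by
  intro ψ hψ hcs hts
  have hE : ContDiff ℝ ∞ fun t : ℝ => Real.exp (c * t) := by fun_prop
  have hd : ∀ t, deriv (fun t => ψ t * Real.exp (c * t)) t
      = deriv ψ t * Real.exp (c * t) + ψ t * (c * Real.exp (c * t)) := by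
    intro t
    have h1 : HasDerivAt (fun t : ℝ => Real.exp (c * t)) (Real.exp (c * t) * (c * 1)) t :=
      ((hasDerivAt_id t).const_mul c).exp
    refine ((((hψ.differentiable (by simp)) t).hasDerivAt.mul h1).deriv).trans ?_
    ring
  have h1 := h (fun t => ψ t * Real.exp (c * t)) (hψ.mul hE) hcs.mul_right
    ((tsupport_mul_subset_left).trans hts)
  have cE : Continuous fun t : ℝ => Real.exp (c * t) := by fun_prop
  have cψ := hψ.continuous
  have cψ' : Continuous (deriv ψ) := hψ.continuous_deriv (by simp)
  have cint : ∀ {g : ℝ → ℝ}, Continuous g → IntegrableOn (fun t => g t * y t) (Ioo 0 T) := fun hg =>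
    ((hg.continuousOn.mul hy).integrableOn_compact isCompact_Icc).mono_set Ioo_subset_Icc_self
  have i1 : IntegrableOn (fun t => deriv ψ t * Real.exp (c * t) * y t) (Ioo 0 T) := cint (cψ'.mul cE)
  have i2 : IntegrableOn (fun t => ψ t * (c * Real.exp (c * t)) * y t) (Ioo 0 T) :=
    cint (cψ.mul (cE.const_mul c))
  obtain ⟨B, hB⟩ := isCompact_Icc.exists_bound_of_continuousOn (s := Icc 0 T) (cψ.mul cE).continuousOn
  have i3 : IntegrableOn (fun t => ψ t * Real.exp (c * t) * n t) (Ioo 0 T) := by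
    refine Integrable.bdd_mul hn (c := B) (cψ.mul cE).aestronglyMeasurable ?_
    filter_upwards [ae_restrict_mem measurableSet_Ioo] with t ht
    exact hB t ⟨ht.1.le, ht.2.le⟩
  have e1 : ∫ t in Ioo 0 T, deriv (fun t => ψ t * Real.exp (c * t)) t * y t
      = (∫ t in Ioo 0 T, deriv ψ t * Real.exp (c * t) * y t)
        + ∫ t in Ioo 0 T, ψ t * (c * Real.exp (c * t)) * y t := by
    rw [← integral_add i1 i2]
    simp only [hd, add_mul]
  have e2 : ∫ t in Ioo 0 T, ψ t * Real.exp (c * t) * -(n t + c * y t)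
      = -((∫ t in Ioo 0 T, ψ t * Real.exp (c * t) * n t)
        + ∫ t in Ioo 0 T, ψ t * (c * Real.exp (c * t)) * y t) := by
    rw [← integral_add i3 i2, ← integral_neg]
    congr 1
    funext t
    ring
  rw [e1, e2] at h1
  simp only [mul_neg, integral_neg, ← mul_assoc] at h1 ⊢
  linarith

/-! ### Strong solutions are mild solutions -/

variable {ν T : ℝ} {v : ℝ → Sobolev (1 / 2)}

/-- The Fourier coefficients of a curve in `H^{1/2}`. -/
def modes (v : ℝ → Sobolev (1 / 2)) (k : Mode) (t : ℝ) : C3 := fourierCoef (v t).toL2 k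

lemma continuousOn_modes {S : Set ℝ} (hc : ContinuousOn v S) (k : Mode) : ContinuousOn (modes v k) S :=
  ((fourierCLM k).comp (Sobolev.toL2CLM (1 / 2))).continuous.comp_continuousOn hc

lemma modesMeas_modes (hc : ContinuousOn v (Icc 0 T)) : ModesMeas T (modes v) := fun k =>
  ((continuousOn_modes hc k).mono Ioc_subset_Icc_self).aestronglyMeasurable measurableSet_Ioc

lemma lintegral_wt_cube_modes (hw : MemL2Sobolev (3 / 2) T fun t => (v t).toL2) :
    ∫⁻ t in Ioo 0 T, ∑' k, wt k ^ 3 * ‖modes v k t‖ₑ ^ 2 ≠ ⊤ := by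
  obtain ⟨w, hw, hwv⟩ := hw
  have h1 : ∫⁻ t in Ioo 0 T, ‖w t‖ₑ ^ 2 < ⊤ := by
    have := hw.2
    rw [eLpNorm_lt_top_iff_lintegral_rpow_enorm_lt_top (by norm_num) (by norm_num)] at this
    simpa using this
  have h2 : ∫⁻ t in Ioo 0 T, ∑' k, wt k ^ 3 * ‖modes v k t‖ₑ ^ 2
      ≤ ∫⁻ t in Ioo 0 T, 2 ^ 2 * ‖w t‖ₑ ^ 2 := by
    refine lintegral_mono_ae ?_
    filter_upwards [hwv] with t ht
    simp only [modes, ← ht]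
    exact Sobolev.tsum_wt_le (n := 3) (by norm_num) (w t)
  refine ne_top_of_le_ne_top ?_ h2
  rw [lintegral_const_mul' _ _ (by finiteness)]
  finiteness

/-- At fixed time the H^{-1/2} norm of the advection is O(‖u‖₁²), and ‖u‖₁² ≤ ‖u‖_{1/2}‖u‖_{3/2}. So
C⁰H^{1/2} ∩ L²H^{3/2} suffices for the forcing to be in L²H^{-1/2}. -/
lemma tsum_inv_wt_nonlin_le (a : Mode → ℝ → C3) (t : ℝ) :
    ∑' k, (wt k)⁻¹ * ‖nonlin a k t‖ₑ ^ 2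
      ≤ 108 * ((∑' k, wt k ^ 1 * ‖a k t‖ₑ ^ 2) * ∑' k, wt k ^ 3 * ‖a k t‖ₑ ^ 2) := by
  have h1 : ∀ k, ‖nonlin a k t‖ₑ
      ≤ conv (fun l => (wt l)⁻¹ * (wt l * ‖a l t‖ₑ)) (fun l => wt l * ‖a l t‖ₑ) k := by
    intro k
    refine (enorm_nonlin_le a k t).trans (ENNReal.tsum_le_tsum fun l => ?_)
    simp only
    rw [← mul_assoc (wt l)⁻¹, wt_inv_mul, one_mul]
    gcongr
    exact modeNormE_le_wt _
  have h2 : (∑' k, (wt k * ‖a k t‖ₑ) ^ 2) ^ 2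
      ≤ (∑' k, wt k ^ 1 * ‖a k t‖ₑ ^ 2) * ∑' k, wt k ^ 3 * ‖a k t‖ₑ ^ 2 := by
    have hr : ∀ (k : Mode) (n : ℕ), ((wt k ^ n) ^ (1 / 2 : ℝ)) ^ 2 = wt k ^ n := fun k n => by
      rw [← ENNReal.rpow_natCast (_ ^ (1 / 2 : ℝ)), ← ENNReal.rpow_mul]
      norm_num
    have h3 := tsum_mul_sq_le (fun k => (wt k ^ 1) ^ (1 / 2 : ℝ) * ‖a k t‖ₑ)
      (fun k => (wt k ^ 3) ^ (1 / 2 : ℝ) * ‖a k t‖ₑ)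
    simp only [mul_pow, hr] at h3
    refine le_trans (le_of_eq ?_) h3
    congr 2
    funext k
    have h4 : (wt k ^ 1) ^ (1 / 2 : ℝ) * (wt k ^ 3) ^ (1 / 2 : ℝ) = wt k ^ 2 := by
      rw [← ENNReal.mul_rpow_of_nonneg _ _ (by norm_num), ← pow_add, ← ENNReal.rpow_natCast,
        ← ENNReal.rpow_mul]
      norm_num
    rw [mul_pow, ← h4]
    ring
  calc _ ≤ ∑' k, (wt k)⁻¹ *
        (conv (fun l => (wt l)⁻¹ * (wt l * ‖a l t‖ₑ)) (fun l => wt l * ‖a l t‖ₑ) k) ^ 2 := by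
        gcongr with k
        exact h1 k
    _ ≤ 108 * ((∑' k, (wt k * ‖a k t‖ₑ) ^ 2) * ∑' k, (wt k * ‖a k t‖ₑ) ^ 2) := tsum_conv_sq_le _ _
    _ ≤ _ := by
        rw [← sq]
        gcongr

lemma fNorm_nonlin_modes_ne_top (hc : ContinuousOn v (Icc 0 T))
    (hw : MemL2Sobolev (3 / 2) T fun t => (v t).toL2) : fNorm T 0 (nonlin (modes v)) ≠ ⊤ := by
  have hm := (modesMeas_modes hc).nonlin
  obtain ⟨C, hC⟩ := isCompact_Icc.exists_bound_of_continuousOn hc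
  have h1 : ∀ t ∈ Icc 0 T, ∑' k, wt k ^ 1 * ‖modes v k t‖ₑ ^ 2 ≤ ENNReal.ofReal C ^ 2 := by
    intro t ht
    refine (Sobolev.tsum_wt_le (n := 1) (by norm_num) (v t)).trans ?_
    rw [Nat.sub_self, pow_zero, one_mul]
    gcongr
    rw [← ofReal_norm]
    exact ENNReal.ofReal_le_ofReal (hC t ht)
  have e1 : fNorm T 0 (nonlin (modes v))
      = ∫⁻ t in Ioo 0 T, ∑' k, (wt k)⁻¹ * ‖nonlin (modes v) k t‖ₑ ^ 2 := by
    rw [setLIntegral_congr (Ioo_ae_eq_Ioc (μ := volume)), fNorm,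
      lintegral_tsum fun k => ((hm k).enorm.pow_const 2).const_mul _]
    congr 1
    funext k
    rw [lintegral_const_mul' _ _ (ENNReal.inv_ne_top.2 (wt_ne_zero k))]
    simp only [gev_zero_left, one_mul]
  rw [e1]
  have h2 : ∫⁻ t in Ioo 0 T, ∑' k, (wt k)⁻¹ * ‖nonlin (modes v) k t‖ₑ ^ 2
      ≤ ∫⁻ t in Ioo 0 T, 108 * ENNReal.ofReal C ^ 2 * ∑' k, wt k ^ 3 * ‖modes v k t‖ₑ ^ 2 := by
    refine setLIntegral_mono' measurableSet_Ioo fun t ht => (tsum_inv_wt_nonlin_le _ t).trans ?_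
    rw [← mul_assoc]
    gcongr
    exact h1 t ⟨ht.1.le, ht.2.le⟩
  refine ne_top_of_le_ne_top ?_ h2
  have h3 := lintegral_wt_cube_modes hw
  rw [lintegral_const_mul' _ _ (by finiteness)]
  finiteness

lemma IsStrongSolutionOn.isWeakDeriv (h : IsStrongSolutionOn ν T v) (k : Mode) (c : C3) :
    IsWeakDeriv T (fun t => reInner c (modes v k t))
      fun t => -(reInner c (nonlin (modes v) k t) + heatRate ν k * reInner c (modes v k t)) := by
  obtain ⟨-, -, g, -, hwt, heq⟩ := h
  intro ψ hψ hcs hts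
  have h1 := hwt ψ hψ hcs hts (testMode k c)
  have h2 : ∫ t in Ioo 0 T, ψ t * g t (testMode k c)
      = ∫ t in Ioo 0 T, (2 * Real.pi) ^ 3 * (ψ t *
        -(reInner c (nonlin (modes v) k t) + heatRate ν k * reInner c (modes v k t))) := by
    refine integral_congr_ae ?_
    filter_upwards [heq _ (isSmooth_reMode k c) _ (coeFn_testMode k c)] with t ht
    obtain ⟨D, hD, h3⟩ := ht
    rw [integral_inner_advection hD, sum_integral_inner_partialDeriv hD] at h3
    change _ + _ * reInner c (nonlin (modes v) k t) + ν * (_ * (_ * reInner c (modes v k t))) = 0 at h3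
    rw [heatRate]
    linear_combination ψ t * h3
  have h4 : ∀ t, deriv ψ t * inner ℝ (v t).toL2 (testMode k c).toL2
      = (2 * Real.pi) ^ 3 * (deriv ψ t * reInner c (modes v k t)) := fun t => by
    rw [inner_testMode, modes]
    ring
  simp only [h4] at h1
  rw [h2, integral_const_mul, integral_const_mul, ← mul_neg] at h1
  exact mul_left_cancel₀ (pow_pos Real.two_pi_pos 3).ne' h1

/-- Each scalar mode solves a weak linear ODE with integrable forcing, which integrates to the
Duhamel formula. Plain continuity in H^{1/2} does not give a supremum inside the sum over modes; the
formula does, by maximal regularity, and interpolation then gives the L̃⁴ bound required for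
uniqueness. -/
theorem IsStrongSolutionOn.mildSol (hν : 0 < ν) (h : IsStrongSolutionOn ν T v) :
    MildSol ν T (fourierCoef (v 0).toL2) (modes v) := by
  have hc := h.1
  have hm := modesMeas_modes hc
  have hf := fNorm_nonlin_modes_ne_top hc h.2.1
  have hi := integrableOn_of_fNorm hm.nonlin hf
  have init : ∑' k, wt k * ‖fourierCoef (v 0).toL2 k‖ₑ ^ 2 ≠ ⊤ := by
    have h1 := Sobolev.tsum_wt_le (n := 1) (by norm_num) (v 0)
    simp only [pow_one] at h1
    exact ne_top_of_le_ne_top (by finiteness) h1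
  have eqn : ∀ k, ∀ t ∈ Icc 0 T, modes v k t
      = heatFlow ν (fourierCoef (v 0).toL2) k t - duhamel ν (nonlin (modes v)) k t := by
    intro k t ht
    refine eq_of_exp_smul (eq_of_reInner fun c => ?_)
    have i1 : IntegrableOn (fun t => reInner c (nonlin (modes v) k t)) (Ioo 0 T) :=
      (reInner c).integrable_comp ((hi k).mono_set Ioo_subset_Ioc_self)
    have c1 : ContinuousOn (fun t => reInner c (modes v k t)) (Icc 0 T) :=
      (reInner c).continuous.comp_continuousOn (continuousOn_modes hc k)
    have cE : Continuous fun t : ℝ => Real.exp (heatRate ν k * t) := by fun_prop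
    have i2 : IntegrableOn (fun t => -(Real.exp (heatRate ν k * t) * reInner c (nonlin (modes v) k t)))
        (Ioo 0 T) := by
      obtain ⟨B, hB⟩ := isCompact_Icc.exists_bound_of_continuousOn (s := Icc 0 T) cE.continuousOn
      refine (Integrable.bdd_mul i1 (c := B) cE.aestronglyMeasurable ?_).neg
      filter_upwards [ae_restrict_mem measurableSet_Ioo] with t ht
      exact hB t ⟨ht.1.le, ht.2.le⟩
    have h1 := ((h.isWeakDeriv k c).exp_mul c1 i1).eq_add_integral (cE.continuousOn.mul c1) i2 ht
    rw [map_sub, ← (reInner c).intervalIntegral_comp_comm (intervalIntegrable_exp_smul ht (hi k) _)]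
    simp only [map_smul, smul_eq_mul]
    rw [h1, intervalIntegral.integral_neg, mul_zero, Real.exp_zero, one_mul, ← sub_eq_add_neg]
    rfl
  refine ⟨init, ?_, hm, eqn⟩
  have e0 := sNorm_le_of_eq (σ := 0) eqn
  have e1 := hNorm_le_of_eq (σ := 0) (modesMeas_heatFlow ν T _) eqn
  have b1 := sNorm_heatFlow_le (T := T) (σ := 0) hν zero_le_one (fourierCoef (v 0).toL2)
  have b2 := hNorm_heatFlow_le (T := T) (σ := 0) hν zero_le_one (fourierCoef (v 0).toL2)
  have b3 := sNorm_duhamel_le (σ := 0) hν zero_le_one hm.nonlin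
  have b4 := hNorm_duhamel_le (σ := 0) hν zero_le_one hm.nonlin
  have hk : kerConst ν T ≠ ⊤ := kerConst_ne_top ν T
  have hr : regConst ν T ≠ ⊤ := regConst_ne_top ν T
  have f1 := ne_top_of_le_ne_top (by finiteness) b1
  have f2 := ne_top_of_le_ne_top (by finiteness) b2
  have f3 := ne_top_of_le_ne_top (by finiteness) b3
  have f4 := ne_top_of_le_ne_top (by finiteness) b4
  have g1 := ne_top_of_le_ne_top (by finiteness) e0
  have g2 := ne_top_of_le_ne_top (by finiteness) e1
  exact ne_top_of_le_ne_top (by finiteness) (zNorm_le_sNorm_add_hNorm T 0 _)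

end Burgers

end

/-! ### The main theorem -/

theorem mainTheorem1 (ν : ℝ) (hν : 0 < ν) (u₀ : Burgers.Sobolev (1 / 2)) :
    ∃ u : ℝ → Burgers.Sobolev (1 / 2),
      Burgers.IsGlobalStrongSolution ν u ∧ u 0 = u₀ ∧
      (∀ v : ℝ → Burgers.Sobolev (1 / 2),
        Burgers.IsGlobalStrongSolution ν v → v 0 = u₀ → ∀ t : ℝ, 0 ≤ t → v t = u t) ∧
      ∫⁻ t in Ioi (0 : ℝ), Burgers.seminormSq (3 / 2) (u t).toL2 < ⊤ ∧
      ∃ U : ℝ → C(Burgers.Torus, Burgers.E3),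
        (∀ t : ℝ, 0 < t → ((u t).toL2 : Burgers.Torus → Burgers.E3) =ᵐ[volume] U t) ∧
        Burgers.IsClassicalSolution ν U := by
  have hr := Burgers.isRealSeq_fourierCoef u₀.toL2
  have hx : ∑' k, Burgers.wt k * ‖Burgers.fourierCoef u₀.toL2 k‖ₑ ^ 2 ≠ ⊤ := by
    have h1 := Burgers.Sobolev.tsum_wt_le (n := 1) (by norm_num) u₀
    simp only [pow_one] at h1
    exact ne_top_of_le_ne_top (by finiteness) h1
  obtain ⟨u, hu⟩ := Burgers.exists_mildSol hν hx hr
  have hreg := Burgers.regModes_Ioi hν hu hr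
  refine ⟨Burgers.curve u₀ u, Burgers.isGlobalStrongSolution_curve hν hu, if_neg (lt_irrefl 0),
    ?_, ?_, fun t => Burgers.synth fun k => u k t, ?_, hreg.isClassicalSolution hν.le⟩
  -- Any competitor is a mild solution with the same datum, so its Fourier coefficients agree with
  -- those of the constructed solution.
  · intro v hv h0 t ht
    apply Burgers.Sobolev.toL2_injective
    apply Burgers.fourierCoef_injective
    rw [Burgers.fourierCoef_curve hν hu ht]
    funext k
    have h1 := (hv (t + 1) (by linarith)).mildSol hν
    rw [h0] at h1
    exact h1.unique hν (hu (t + 1)) t ⟨ht, by linarith⟩ k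
  · refine lt_of_eq_of_lt (setLIntegral_congr_fun measurableSet_Ioi fun t ht => ?_)
      (Burgers.lintegral_modeNorm_cube_lt_top hν hu hr)
    rw [Burgers.seminormSq_eq (n := 3) (by norm_num), Burgers.fourierCoef_curve hν hu (le_of_lt ht)]
  · intro t ht
    rw [Burgers.toL2_curve_of_regModes hreg ht]
    exact Burgers.coeFn_synthLp _
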